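/- **Spectral parameters.** Let $i\mathfrak a^*=\{\mu\in\mathbb C^3:\Re\mu_j=0,\ \mu_1+\mu_2+\mu_3=0\}$, on which the Weyl group $W=S_3$ acts by permuting coordinates; the Weyl chamber walls are the fixed points of the elements $w\ne1$. Put $\nu_1=\frac{\mu_1-\mu_2}3$, $\nu_2=\frac{\mu_2-\mu_3}3$, $\nu_3=\frac{\mu_3-\mu_1}3$, $\operatorname{spec}(\mu)=\prod_{j=1}^3 3\nu_j\tan(\tfrac{3\pi}2\nu_j)$, $\psi(\mu)=\exp(3(\nu_1^2+\nu_2^2+\nu_3^2))$. **Test functions.** Let $\Omega\subseteq\Omega'\subseteq i\mathfrak a^*$ be compact sets disjoint from the walls, $\Omega$ Weyl-group invariant, and let $\mu_0\in\Omega$, $0<\varepsilon<\frac12$, and an integer $A\ge0$ be fixed. For $T>1$ put $$h_T^{0}(\mu)=\Bigl(\prod_{0\le n\le A}\prod_{j=1}^3\frac{\nu_j^2-\frac19(1+2n)^2}{T^2}\Bigr)^2\Bigl(\sum_{w\in W}\psi\Bigl(\frac{w(\mu)-T\mu_0}{T^{1-\varepsilon}}\Bigr)\Bigr)^2 .$$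 Let $(h_T)_{T>1}$ be a family of smooth, Weyl-group invariant functions on $i\mathfrak a^*$ such that $h_T$ is supported in $T\Omega'$; such that all derivatives of order $j$ of $h_T$ are $\ll_j T^{j(\varepsilon-1)}$, for every $j\ge0$; and such that $h_T-h_T^{0}\ll_N T^{-N}$ on $i\mathfrak a^*$ for every $N\ge 0$. **Kernels.** Put $$G(s,\mu)=\frac1{\Gamma(s_1+s_2)}\prod_{j=1}^3\Gamma(s_1-\mu_j)\Gamma(s_2+\mu_j),$$ $$\tilde G^{\pm}(s,\mu)=\frac{\pi^{-3s}}{12288\,\pi^{7/2}}\Bigl(\prod_{j=1}^3\frac{\Gamma(\frac12(s-\mu_j))}{\Gamma(\frac12(1-s+\mu_j))}\pm i\prod_{j=1}^3\frac{\Gamma(\frac12(1+s-\mu_j))}{\Gamma(\frac12(2-s+\mu_j))}\Bigr),$$ $$S^{++}=\frac1{24\pi^2}\prod_{j=1}^3\cos(\tfrac32\pi\nu_j),\qquad S^{+-}=-\frac1{32\pi^2}\frac{\cos(\frac32\pi\nu_2)\sin(\pi(s_1-\mu_1))\sin(\pi(s_2+\mu_2))\sin(\pi(s_2+\mu_3))}{\sin(\frac32\pi\nu_1)\sin(\frac32\pi\nu_3)\sin(\pi(s_1+s_2))},$$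 $$S^{-+}=-\frac1{32\pi^2}\frac{\cos(\frac32\pi\nu_1)\sin(\pi(s_1-\mu_1))\sin(\pi(s_1-\mu_2))\sin(\pi(s_2+\mu_3))}{\sin(\frac32\pi\nu_2)\sin(\frac32\pi\nu_3)\sin(\pi(s_1+s_2))},$$ $$S^{--}=\frac1{32\pi^2}\frac{\cos(\frac32\pi\nu_3)\sin(\pi(s_1-\mu_2))\sin(\pi(s_2+\mu_2))}{\sin(\frac32\pi\nu_2)\sin(\frac32\pi\nu_1)}.$$ For non-zero real $y_1,y_2$ with signs $\alpha_1,\alpha_2$, and for non-zero real $y$ with sign $\alpha$, let $$K_{w_6}(y_1,y_2;\mu)=\iint|4\pi^2y_1|^{-s_1}|4\pi^2y_2|^{-s_2}G(s,\mu)S^{\alpha_1,\alpha_2}(s,\mu)\frac{ds_1\,ds_2}{(2\pi i)^2},\qquad K_{w_4}(y;\mu)=\int|y|^{-s}\tilde G^{\alpha}(s,\mu)\frac{ds}{2\pi i}.$$ The paths run from $-i\infty$ to $i\infty$ by the Barnes convention. For $\mu\in i\mathfrak a^*$ the $s$-path is the line $\Re s=\frac1{12}$. The $s_1$- and $s_2$-paths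 both follow $\Re s=\frac18$ for $|\Im s|\le\|\mu\|_\infty+\frac78$ and $\Re s=-\frac18$ for $|\Im s|\ge\|\mu\|_\infty+\frac98$, joined by line segments. **Weight functions.** With $d\mu=d\mu_1\,d\mu_2$ put $$\Phi_{w_6}(y_1,y_2)=\int_{\Re\mu=0}h_T(\mu)K_{w_6}(y_1,y_2;\mu)\operatorname{spec}(\mu)\,d\mu,\qquad \Phi_{w_4}(y)=\int_{\Re\mu=0}h_T(\mu)K_{w_4}(y;\mu)\operatorname{spec}(\mu)\,d\mu .$$ **Proposition.** The integrals defining $K_{w_6}(y_1,y_2;\mu)$ (for $\mu\in i\mathfrak a^*$ off the walls) and $K_{w_4}(y;\mu)$ (for $\mu\in i\mathfrak a^*$) converge absolutely, as do the integrals defining $\Phi_{w_6}$ and $\Phi_{w_4}$ at the points below, and for every $\epsilon>0$ and all $T>1$: (a) For $y\in(T^{-100},T^{100})^2$ and $\alpha\in\{\pm1\}^2$, $\Phi_{w_6}(\alpha_1y_1,\alpha_2y_2)\ll T^{3+\epsilon}$. (b) For $y\in(T^{-100},T^{100})$ and $\alpha\in\{\pm1\}$, $\Phi_{w_4}(\alpha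 y)\ll T^{3+\epsilon}\,(y^{1/6}+y^{-1/6})$. The implied constants depend only on $\epsilon$, on the fixed data $\Omega,\Omega',\mu_0,A,\varepsilon$, and on the family $(h_T)$; not on $T$, $y$ or $\alpha$. -/

import Mathlib

open MeasureTheory
open scoped ContDiff

noncomputable section

namespace GL3Kuznetsov

/-! ### Spectral parameters

A spectral parameter is written in the coordinates `μ = (μ₁, μ₂, μ₃)` with `μ₁ + μ₂ + μ₃ = 0`
(indexed by `Fin 3`, so `μ 0 = μ₁`, and so on).  The Weyl group `S₃` acts by permuting coordinates,
that is, by `μ ↦ μ ∘ w`. -/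

/-- The real plane `i𝔞*` of the parameters `μ` with `Re μ = 0` and `μ₁ + μ₂ + μ₃ = 0`. -/
def iaStar : Set (Fin 3 → ℂ) := {μ | (∀ j, (μ j).re = 0) ∧ ∑ j, μ j = 0}

/-- The Weyl chamber walls: the parameters fixed by some `w ≠ 1`. -/
def walls : Set (Fin 3 → ℂ) := {μ | ∃ w : Equiv.Perm (Fin 3), w ≠ 1 ∧ μ ∘ w = μ}

/-- The coordinates `ν`, the inverse of `μ₁ = ν₁ - ν₃`, `μ₂ = ν₂ - ν₁`, `μ₃ = ν₃ - ν₂` with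
`ν₁ + ν₂ + ν₃ = 0`. -/
def nu (μ : Fin 3 → ℂ) : Fin 3 → ℂ := ![(μ 0 - μ 1) / 3, (μ 1 - μ 2) / 3, (μ 2 - μ 0) / 3]

/-- The parametrization of `i𝔞*` by `(μ₁, μ₂) = (i t₁, i t₂)`. -/
def imagParam (t : ℝ × ℝ) : Fin 3 → ℂ :=
  ![Complex.I * t.1, Complex.I * t.2, -(Complex.I * (t.1 + t.2))]

/-- The spectral density `spec = ∏ⱼ 3 νⱼ tan(3π νⱼ / 2)`. -/
def spec (μ : Fin 3 → ℂ) : ℂ :=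
  ∏ j, (3 * nu μ j * Complex.tan (3 * Real.pi / 2 * nu μ j))

/-! ### The test functions -/

/-- `ψ = exp(3 (ν₁² + ν₂² + ν₃²))`. -/
def psi (μ : Fin 3 → ℂ) : ℂ := Complex.exp (3 * ∑ j, nu μ j ^ 2)

/-- `P = ∏_{0 ≤ n ≤ A} ∏ⱼ (νⱼ² - (1 + 2n)² / 9) / T²`. -/
def polyP (A : ℕ) (T : ℝ) (μ : Fin 3 → ℂ) : ℂ :=
  ∏ n ∈ Finset.range (A + 1), ∏ j, (nu μ j ^ 2 - (1 + 2 * (n : ℂ)) ^ 2 / 9) / (T : ℂ) ^ 2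

/-- The explicit test function
`P(μ)² (∑_w ψ((w(μ) - T μ₀) / T^{1-ε}))²`. -/
def gaussianTest (A : ℕ) (ε : ℝ) (μ₀ : Fin 3 → ℂ) (T : ℝ) (μ : Fin 3 → ℂ) : ℂ :=
  polyP A T μ ^ 2 *
    (∑ w : Equiv.Perm (Fin 3),
      psi (fun j => (μ (w j) - (T : ℂ) * μ₀ j) / ((T ^ (1 - ε) : ℝ) : ℂ))) ^ 2

/-- A family `h = (h_T)_{T > 1}` of functions on `i𝔞*` which replaces the family `gaussianTest`:
each `h_T` is smooth, Weyl group invariant and supported in the compact set `T Ω'`; all derivatives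
of order `j` are `≪ T^{j(ε-1)}`; and `h_T` agrees with `gaussianTest` up to a negligible error,
i.e. up to `≪ T^{-N}` for every `N`.  Only the values on `i𝔞*` matter. -/
structure IsTestFamily (Ω' : Set (Fin 3 → ℂ)) (A : ℕ) (ε : ℝ) (μ₀ : Fin 3 → ℂ)
    (h : ℝ → (Fin 3 → ℂ) → ℂ) : Prop where
  smooth : ∀ T : ℝ, 1 < T → ContDiff ℝ ∞ (fun t : ℝ × ℝ => h T (imagParam t))
  weyl_invariant : ∀ T : ℝ, 1 < T → ∀ μ ∈ iaStar, ∀ w : Equiv.Perm (Fin 3), h T (μ ∘ w) = h T μ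
  support : ∀ T : ℝ, 1 < T → ∀ μ ∈ iaStar, h T μ ≠ 0 → ∃ μ' ∈ Ω', μ = (T : ℂ) • μ'
  deriv_bound : ∀ j : ℕ, ∃ C : ℝ, ∀ T : ℝ, 1 < T → ∀ t : ℝ × ℝ,
    ‖iteratedFDeriv ℝ j (fun t : ℝ × ℝ => h T (imagParam t)) t‖ ≤ C * T ^ ((j : ℝ) * (ε - 1))
  negligible_error : ∀ N : ℕ, ∃ C : ℝ, ∀ T : ℝ, 1 < T → ∀ μ ∈ iaStar,
    ‖h T μ - gaussianTest A ε μ₀ T μ‖ ≤ C * T ^ (-(N : ℝ))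

/-! ### The long element kernel -/

/-- `G(s, μ) = Γ(s₁ + s₂)⁻¹ ∏ⱼ Γ(s₁ - μⱼ) Γ(s₂ + μⱼ)`. -/
def G (s₁ s₂ : ℂ) (μ : Fin 3 → ℂ) : ℂ :=
  1 / Complex.Gamma (s₁ + s₂) * ∏ j, (Complex.Gamma (s₁ - μ j) * Complex.Gamma (s₂ + μ j))

/-- `sin(π z)`. -/
def sinPi (z : ℂ) : ℂ := Complex.sin (Real.pi * z)

/-- `cos(3π z / 2)`. -/
def cosT (z : ℂ) : ℂ := Complex.cos (3 / 2 * Real.pi * z)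

/-- `sin(3π z / 2)`. -/
def sinT (z : ℂ) : ℂ := Complex.sin (3 / 2 * Real.pi * z)

/-- `S^{++}`. -/
def Spp (μ : Fin 3 → ℂ) : ℂ := 1 / (24 * (Real.pi : ℂ) ^ 2) * ∏ j, cosT (nu μ j)

/-- `S^{+-}`. -/
def Spm (s₁ s₂ : ℂ) (μ : Fin 3 → ℂ) : ℂ :=
  -(1 / (32 * (Real.pi : ℂ) ^ 2)) *
    (cosT (nu μ 1) * sinPi (s₁ - μ 0) * sinPi (s₂ + μ 1) * sinPi (s₂ + μ 2)) /
    (sinT (nu μ 0) * sinT (nu μ 2) * sinPi (s₁ + s₂))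

/-- `S^{-+}`. -/
def Smp (s₁ s₂ : ℂ) (μ : Fin 3 → ℂ) : ℂ :=
  -(1 / (32 * (Real.pi : ℂ) ^ 2)) *
    (cosT (nu μ 0) * sinPi (s₁ - μ 0) * sinPi (s₁ - μ 1) * sinPi (s₂ + μ 2)) /
    (sinT (nu μ 1) * sinT (nu μ 2) * sinPi (s₁ + s₂))

/-- `S^{--}`. -/
def Smm (s₁ s₂ : ℂ) (μ : Fin 3 → ℂ) : ℂ :=
  1 / (32 * (Real.pi : ℂ) ^ 2) *
    (cosT (nu μ 2) * sinPi (s₁ - μ 1) * sinPi (s₂ + μ 1)) /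
    (sinT (nu μ 1) * sinT (nu μ 0))

/-- `S^{α₁, α₂}` with `α₁ = sgn y₁`, `α₂ = sgn y₂`, for `y₁, y₂ ≠ 0`. -/
def S (y₁ y₂ : ℝ) (s₁ s₂ : ℂ) (μ : Fin 3 → ℂ) : ℂ :=
  if 0 < y₁ then (if 0 < y₂ then Spp μ else Spm s₁ s₂ μ)
  else (if 0 < y₂ then Smp s₁ s₂ μ else Smm s₁ s₂ μ)

/-- A path of integration from `-i∞` to `i∞` which follows the Barnes convention, for `μ ∈ i𝔞*`:
it runs along `Re s = 1/8` for `|Im s| ≤ ‖μ‖ + 7/8`, and along `Re s = -1/8` for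
`|Im s| ≥ ‖μ‖ + 9/8`, with straight segments in between.  If both `s₁` and `s₂` are on it, then the
poles of `Γ(s₁ - μⱼ)` and `Γ(s₂ + μⱼ)` are to the left, those of `Γ(1 - s₁ - s₂)` (which come from
`1 / (Γ(s₁ + s₂) sin(π (s₁ + s₂)))`) are to the right, and the unbounded portions lie to the left of
the line `Re s = 0`, which makes the double integral below absolutely convergent. -/
def barnesPath (μ : Fin 3 → ℂ) (t : ℝ) : ℂ :=
  ((max (-(1 / 8)) (min (1 / 8) (1 + ‖μ‖ - |t|)) : ℝ) : ℂ) + t * Complex.I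

/-- The Mellin-Barnes integrand of `kernelW6`, pulled back to `ℝ²` along the paths of
integration, including the factor `1 / (2πi)²`. -/
def kernelW6Integrand (y₁ y₂ : ℝ) (μ : Fin 3 → ℂ) (t : ℝ × ℝ) : ℂ :=
  ((|4 * Real.pi ^ 2 * y₁| : ℝ) : ℂ) ^ (-barnesPath μ t.1) *
    ((|4 * Real.pi ^ 2 * y₂| : ℝ) : ℂ) ^ (-barnesPath μ t.2) *
    G (barnesPath μ t.1) (barnesPath μ t.2) μ *
    S y₁ y₂ (barnesPath μ t.1) (barnesPath μ t.2) μ *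
    (deriv (barnesPath μ) t.1 * deriv (barnesPath μ) t.2) /
    (2 * Real.pi * Complex.I) ^ 2

/-- `K_{w₆}^{sgn y₁, sgn y₂}((y₁, y₂); μ)`. -/
def kernelW6 (y₁ y₂ : ℝ) (μ : Fin 3 → ℂ) : ℂ := ∫ t : ℝ × ℝ, kernelW6Integrand y₁ y₂ μ t

/-! ### The kernel for `w₄` -/

/-- `G̃^α(s, μ)` for a sign `α = ±1`. -/
def Gtilde (α : ℝ) (s : ℂ) (μ : Fin 3 → ℂ) : ℂ :=
  (Real.pi : ℂ) ^ (-(3 * s)) / (12288 * (Real.pi : ℂ) ^ (7 / 2 : ℂ)) *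
    ((∏ j, Complex.Gamma (1 / 2 * (s - μ j)) / Complex.Gamma (1 / 2 * (1 - s + μ j))) +
      (α : ℂ) * Complex.I *
        ∏ j, Complex.Gamma (1 / 2 * (1 + s - μ j)) / Complex.Gamma (1 / 2 * (2 - s + μ j)))

/-- The Mellin-Barnes integrand of `kernelW4` on the line `s = 1/12 + it`, including the factor
`ds / (2πi) = dt / (2π)`.  For `μ ∈ i𝔞*` all poles in `s` are to the left of this line, and the
integral converges absolutely because `0 < 1/12 < 1/6`. -/
def kernelW4Integrand (y : ℝ) (μ : Fin 3 → ℂ) (t : ℝ) : ℂ :=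
  ((|y| : ℝ) : ℂ) ^ (-(1 / 12 + t * Complex.I)) *
    Gtilde (Real.sign y) (1 / 12 + t * Complex.I) μ / (2 * Real.pi)

/-- `K_{w₄}(y; μ)`. -/
def kernelW4 (y : ℝ) (μ : Fin 3 → ℂ) : ℂ := ∫ t : ℝ, kernelW4Integrand y μ t

/-! ### The weight functions

Here `dμ = dμ₁ dμ₂`, so that `dμ = i² dt₁ dt₂` in the coordinates of `imagParam`. -/

/-- The integrand of `phiW6`. -/
def phiW6Integrand (h : (Fin 3 → ℂ) → ℂ) (y₁ y₂ : ℝ) (t : ℝ × ℝ) : ℂ :=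
  h (imagParam t) * kernelW6 y₁ y₂ (imagParam t) * spec (imagParam t) * Complex.I ^ 2

/-- `Φ_{w₆}(y₁, y₂)`, the integral of `h(μ) K_{w₆}(y; μ) spec(μ)` over `Re μ = 0`. -/
def phiW6 (h : (Fin 3 → ℂ) → ℂ) (y₁ y₂ : ℝ) : ℂ := ∫ t : ℝ × ℝ, phiW6Integrand h y₁ y₂ t

/-- The integrand of `phiW4`. -/
def phiW4Integrand (h : (Fin 3 → ℂ) → ℂ) (y : ℝ) (t : ℝ × ℝ) : ℂ :=
  h (imagParam t) * kernelW4 y (imagParam t) * spec (imagParam t) * Complex.I ^ 2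

/-- `Φ_{w₄}(y)`, the integral of `h(μ) K_{w₄}(y; μ) spec(μ)` over `Re μ = 0`. -/
def phiW4 (h : (Fin 3 → ℂ) → ℂ) (y : ℝ) : ℂ := ∫ t : ℝ × ℝ, phiW4Integrand h y t

end GL3Kuznetsov

end

noncomputable section

open MeasureTheory Filter Topology Set
open scoped ContDiff FourierTransform

namespace GL3Kuznetsov

/-! ### Stirling's upper bound for the Gamma function -/

lemma norm_exp_stirling (z : ℂ) :
    ‖Complex.exp (z + (1 / 2 - z) * Complex.log z)‖ =
      Real.exp (z.re + (1 / 2 - z.re) * Real.log ‖z‖ + z.im * z.arg) := by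
  rw [Complex.norm_exp]
  congr 1
  simp [Complex.add_re, Complex.mul_re, Complex.log_re, Complex.log_im]
  ring

lemma im_mul_arg_nonneg (z : ℂ) : 0 ≤ z.im * z.arg := by
  rcases le_or_gt 0 z.im with h | h
  · exact mul_nonneg h (Complex.arg_nonneg_iff.2 h)
  · exact mul_nonneg_of_nonpos_of_nonpos h.le (Complex.arg_neg_iff.2 h).le

lemma im_mul_arg_le {z : ℂ} (hz : 0 < z.re) : z.im * z.arg ≤ Real.pi / 2 * |z.im| := by
  have h := Complex.abs_arg_le_pi_div_two_iff.2 hz.le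
  calc z.im * z.arg ≤ |z.im * z.arg| := le_abs_self _
    _ = |z.arg| * |z.im| := by rw [abs_mul, mul_comm]
    _ ≤ _ := by gcongr

lemma le_im_mul_arg {z : ℂ} (hz : 0 < z.re) :
    Real.pi / 2 * |z.im| - z.re ≤ z.im * z.arg := by
  rcases eq_or_ne z.im 0 with h0 | h0
  · rw [h0]; simp [hz.le]
  have key : z.im * z.arg = |z.im| * |z.arg| := by
    rw [← abs_mul, abs_of_nonneg (im_mul_arg_nonneg z)]
  have hlt : |z.arg| < Real.pi / 2 := Complex.abs_arg_lt_pi_div_two_iff.2 (Or.inl hz)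
  have harg0 : z.arg ≠ 0 := by
    intro h
    rw [Complex.arg_eq_zero_iff] at h
    exact h0 h.2
  have hpos : 0 < |z.arg| := abs_pos.2 harg0
  have htan : Real.tan |z.arg| = |z.im| / z.re := by
    have h1 := Complex.tan_arg z
    rcases le_or_gt 0 z.im with h | h
    · rw [abs_of_nonneg (Complex.arg_nonneg_iff.2 h), abs_of_nonneg h, h1]
    · rw [abs_of_neg (Complex.arg_neg_iff.2 h), abs_of_neg h, Real.tan_neg, h1, neg_div]
  have h2 : Real.pi / 2 - |z.arg| ≤ z.re / |z.im| := by
    have := (Real.lt_tan (x := Real.pi / 2 - |z.arg|) (by linarith) (by linarith)).le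
    rwa [Real.tan_pi_div_two_sub, htan, inv_div] at this
  have h3 : (Real.pi / 2 - |z.arg|) * |z.im| ≤ z.re := by
    rwa [le_div_iff₀ (abs_pos.2 h0)] at h2
  rw [key]; nlinarith

lemma norm_Gamma_le_Gamma_re {z : ℂ} (hz : 0 < z.re) : ‖Complex.Gamma z‖ ≤ Real.Gamma z.re := by
  rw [Complex.Gamma_eq_integral hz, Complex.GammaIntegral, Real.Gamma_eq_integral hz]
  refine (norm_integral_le_integral_norm _).trans (le_of_eq ?_)
  refine setIntegral_congr_fun measurableSet_Ioi fun x hx => ?_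
  simp only [mem_Ioi] at hx
  simp only [norm_mul, Complex.norm_real, Real.norm_eq_abs, Real.abs_exp]
  rw [Complex.norm_cpow_eq_rpow_re_of_pos hx]
  simp

lemma norm_Gamma_half {z : ℂ} (hz : z.re = 1 / 2) :
    ‖Complex.Gamma z‖ ≤ 3 * Real.exp (-(Real.pi / 2 * |z.im|)) := by
  have hzc : 1 - z = (starRingEnd ℂ) z := by
    apply Complex.ext
    · simp [hz]; norm_num
    · simp
  have h1 := Complex.Gamma_mul_Gamma_one_sub z
  rw [hzc, Complex.Gamma_conj, Complex.mul_conj] at h1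
  have h2 : Complex.sin (Real.pi * z) = (Real.cosh (Real.pi * z.im) : ℝ) := by
    have : (Real.pi : ℂ) * z = (Real.pi * z.im : ℝ) * Complex.I + Real.pi / 2 := by
      apply Complex.ext
      · simp [hz]; ring
      · simp
    rw [this, Complex.sin_add_pi_div_two, Complex.cos_mul_I, Complex.ofReal_cosh]
  rw [h2, ← Complex.ofReal_div, Complex.ofReal_inj] at h1
  have h3 : Real.exp (Real.pi * |z.im|) / 2 ≤ Real.cosh (Real.pi * z.im) := by
    have : Real.cosh (Real.pi * z.im) = Real.cosh (Real.pi * |z.im|) := by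
      rw [← Real.cosh_abs, abs_mul, abs_of_pos Real.pi_pos]
    rw [this, Real.cosh_eq]
    have := Real.exp_pos (-(Real.pi * |z.im|))
    linarith
  have h4 : ‖Complex.Gamma z‖ ^ 2 ≤ (3 * Real.exp (-(Real.pi / 2 * |z.im|))) ^ 2 := by
    rw [← Complex.normSq_eq_norm_sq, h1, mul_pow, ← Real.exp_nat_mul]
    rw [div_le_iff₀ (Real.cosh_pos _)]
    have e1 : Real.exp ((2 : ℕ) * -(Real.pi / 2 * |z.im|)) * Real.exp (Real.pi * |z.im|) = 1 := by
      rw [← Real.exp_add, ← Real.exp_zero]; congr 1; push_cast; ring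
    have e0 := Real.exp_pos ((2 : ℕ) * -(Real.pi / 2 * |z.im|))
    have := mul_le_mul_of_nonneg_left h3 e0.le
    nlinarith [Real.pi_lt_four]
  exact (sq_le_sq₀ (norm_nonneg _) (by positivity)).1 h4

lemma norm_stirling_quotient_le {z : ℂ} (h1 : 1 / 2 ≤ z.re) (h2 : z.re ≤ 3 / 2) :
    ‖Complex.Gamma z * Complex.exp (z + (1 / 2 - z) * Complex.log z)‖ ≤ 3 * Real.exp (3 / 2) := by
  have hslit : ∀ w : ℂ, 0 < w.re → w ∈ Complex.slitPlane := fun w hw => Or.inl hw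
  have hdiff : ∀ w : ℂ, 0 < w.re → DifferentiableAt ℂ
      (fun z => Complex.Gamma z * Complex.exp (z + (1 / 2 - z) * Complex.log z)) w := by
    intro w hw
    have hG : DifferentiableAt ℂ Complex.Gamma w := by
      apply Complex.differentiableAt_Gamma
      intro m h
      rw [h] at hw
      simp at hw
      exact absurd hw (not_lt.2 (Nat.cast_nonneg m))
    have hl : DifferentiableAt ℂ Complex.log w := Complex.differentiableAt_log (hslit w hw)
    fun_prop
  refine PhragmenLindelof.vertical_strip (a := 1 / 2) (b := 3 / 2)
    (f := fun z => Complex.Gamma z * Complex.exp (z + (1 / 2 - z) * Complex.log z)) ?_ ?_ ?_ ?_ h1 h2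
  · apply DifferentiableOn.diffContOnCl
    intro w hw
    have : w ∈ Complex.re ⁻¹' Icc (1 / 2) (3 / 2) := by
      have h := closure_mono (preimage_mono (f := Complex.re) Ioo_subset_Icc_self) hw
      rwa [(isClosed_Icc.preimage Complex.continuous_re).closure_eq] at h
    have hw0 : 0 < w.re := by have := this.1; linarith
    exact (hdiff w hw0).differentiableWithinAt
  · obtain ⟨M, hM⟩ : ∃ M, ∀ x ∈ Icc (1 / 2 : ℝ) (3 / 2), ‖Real.Gamma x‖ ≤ M := by
      apply IsCompact.exists_bound_of_continuousOn isCompact_Icc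
      intro x hx
      exact (Real.differentiableAt_Gamma fun m h => by
        have := hx.1; rw [h] at this
        have h' : (0 : ℝ) ≤ m := Nat.cast_nonneg m
        linarith).continuousAt.continuousWithinAt
    refine ⟨1, ?_, Real.pi / 2 + 0, ?_⟩
    · rw [lt_div_iff₀ (by norm_num)]; linarith [Real.pi_gt_three]
    · apply Asymptotics.IsBigO.of_bound (M * Real.exp (3 / 2 + Real.log 2))
      rw [eventually_inf_principal]
      refine Eventually.of_forall fun w hw => ?_
      have hw0 : 0 < w.re := by have := hw.1; linarith
      have hb1 : ‖Complex.Gamma w‖ ≤ M :=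
        (norm_Gamma_le_Gamma_re hw0).trans ((le_abs_self _).trans (hM _ ⟨hw.1.le, hw.2.le⟩))
      have hM0 : 0 ≤ M := (norm_nonneg _).trans hb1
      rw [norm_mul, norm_exp_stirling, Real.norm_eq_abs, Real.abs_exp, mul_assoc, ← Real.exp_add]
      refine mul_le_mul hb1 (Real.exp_le_exp.2 ?_) (Real.exp_pos _).le hM0
      have hb2 := im_mul_arg_le hw0
      have hb3 : |w.im| ≤ Real.exp (1 * |w.im|) := by
        have := Real.add_one_le_exp (1 * |w.im|); linarith
      have hnorm : 1 / 2 ≤ ‖w‖ := by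
        have := Complex.re_le_norm w; have := hw.1; linarith
      have hlog : -Real.log 2 ≤ Real.log ‖w‖ := by
        rw [← Real.log_inv]; exact Real.log_le_log (by norm_num) (by linarith)
      have hl2 : 0 ≤ Real.log 2 := Real.log_nonneg (by norm_num)
      have hb4 : (1 / 2 - w.re) * Real.log ‖w‖ ≤ Real.log 2 := by
        have a1 := hw.1; have a2 := hw.2
        nlinarith
      have hb5 : Real.pi / 2 * |w.im| ≤ (Real.pi / 2 + 0) * Real.exp (1 * |w.im|) := by
        rw [add_zero]; gcongr
      have := hw.2
      linarith
  · intro w hw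
    have hw0 : 0 < w.re := by rw [hw]; norm_num
    rw [norm_mul, norm_exp_stirling]
    have hb := im_mul_arg_le hw0
    calc _ ≤ 3 * Real.exp (-(Real.pi / 2 * |w.im|)) *
          Real.exp (3 / 2 + Real.pi / 2 * |w.im|) := by
          refine mul_le_mul (norm_Gamma_half hw) (Real.exp_le_exp.2 ?_) (Real.exp_pos _).le
            (by positivity)
          rw [hw]; norm_num; linarith
      _ = _ := by rw [mul_assoc, ← Real.exp_add]; congr 2; ring
  · intro w hw
    have hw0 : 0 < w.re := by rw [hw]; norm_num
    have hne : w - 1 ≠ 0 := by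
      intro h
      have := congrArg Complex.re h
      simp [hw] at this; norm_num at this
    have hG : Complex.Gamma w = (w - 1) * Complex.Gamma (w - 1) := by
      rw [← Complex.Gamma_add_one _ hne, sub_add_cancel]
    have hn : ‖w - 1‖ ≤ ‖w‖ := by
      apply (sq_le_sq₀ (norm_nonneg _) (norm_nonneg _)).1
      rw [← Complex.normSq_eq_norm_sq, ← Complex.normSq_eq_norm_sq, Complex.normSq_apply,
        Complex.normSq_apply]
      simp [hw]; norm_num
    have hwn : 0 < ‖w‖ := by rw [norm_pos_iff]; rintro rfl; simp at hw0
    rw [norm_mul, norm_exp_stirling, hG, norm_mul]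
    have hb := im_mul_arg_le hw0
    have hh : ‖Complex.Gamma (w - 1)‖ ≤ 3 * Real.exp (-(Real.pi / 2 * |w.im|)) := by
      have := norm_Gamma_half (z := w - 1) (by simp [hw]; norm_num)
      simpa using this
    calc _ ≤ (‖w‖ * (3 * Real.exp (-(Real.pi / 2 * |w.im|)))) *
          Real.exp (3 / 2 - Real.log ‖w‖ + Real.pi / 2 * |w.im|) := by
          refine mul_le_mul (mul_le_mul hn hh (norm_nonneg _) hwn.le) (Real.exp_le_exp.2 ?_)
            (Real.exp_pos _).le (by positivity)
          rw [hw]; ring_nf; linarith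
      _ = 3 * (‖w‖ * Real.exp (-Real.log ‖w‖)) * (Real.exp (-(Real.pi / 2 * |w.im|)) *
          Real.exp (3 / 2 + Real.pi / 2 * |w.im|)) := by
          rw [show 3 / 2 - Real.log ‖w‖ + Real.pi / 2 * |w.im| =
            -Real.log ‖w‖ + (3 / 2 + Real.pi / 2 * |w.im|) by ring, Real.exp_add]; ring
      _ = _ := by
          rw [Real.exp_neg, Real.exp_log hwn, mul_inv_cancel₀ hwn.ne', ← Real.exp_add]
          simp

lemma norm_Gamma_le_strip {z : ℂ} (h1 : 1 / 2 ≤ z.re) (h2 : z.re ≤ 3 / 2) :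
    ‖Complex.Gamma z‖ ≤ 3 * Real.exp 3 * (‖z‖ ^ (z.re - 1 / 2) *
      Real.exp (-(Real.pi / 2 * |z.im|))) := by
  have h := norm_stirling_quotient_le h1 h2
  have h0 : 0 < z.re := by linarith
  have hz : 0 < ‖z‖ := by rw [norm_pos_iff]; rintro rfl; simp at h0
  rw [norm_mul, norm_exp_stirling] at h
  rw [Real.rpow_def_of_pos hz]
  have hb := le_im_mul_arg h0
  have h3 := (le_div_iff₀ (Real.exp_pos _)).2 h
  refine h3.trans ?_
  rw [div_eq_mul_inv, ← Real.exp_neg, mul_assoc, mul_assoc, ← Real.exp_add, ← Real.exp_add,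
    ← Real.exp_add]
  gcongr
  · norm_num
  · linarith

lemma rpow_compare {x y K a : ℝ} (hx : 0 < x) (hy : 0 < y) (hK : 1 ≤ K) (h1 : x ≤ K * y)
    (h2 : y ≤ K * x) (ha : |a| ≤ 1) : x ^ a ≤ K * y ^ a := by
  have hK0 : 0 < K := by linarith
  obtain ⟨ha1, ha2⟩ := abs_le.1 ha
  rcases le_or_gt 0 a with h | h
  · calc x ^ a ≤ (K * y) ^ a := Real.rpow_le_rpow hx.le h1 h
      _ = K ^ a * y ^ a := Real.mul_rpow hK0.le hy.le
      _ ≤ K ^ (1 : ℝ) * y ^ a := by gcongr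
      _ = _ := by rw [Real.rpow_one]
  · have : K⁻¹ * y ≤ x := by rw [inv_mul_le_iff₀ hK0]; exact h2
    calc x ^ a ≤ (K⁻¹ * y) ^ a := Real.rpow_le_rpow_of_nonpos (by positivity) this h.le
      _ = K ^ (-a) * y ^ a := by
        rw [Real.mul_rpow (by positivity) hy.le, Real.inv_rpow hK0.le, Real.rpow_neg hK0.le]
      _ ≤ K ^ (1 : ℝ) * y ^ a := by gcongr; linarith
      _ = _ := by rw [Real.rpow_one]

/-- Stirling's bound in the strip `-1/8 ≤ Re z ≤ 5/4`, away from the pole at `0`. -/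
theorem exists_norm_Gamma_le : ∃ C : ℝ, 1 ≤ C ∧ ∀ z : ℂ, -(1 / 8) ≤ z.re → z.re ≤ 5 / 4 →
    (1 / 12 ≤ z.re ∨ 7 / 8 ≤ |z.im|) →
    ‖Complex.Gamma z‖ ≤ C * ((1 + |z.im|) ^ (z.re - 1 / 2) *
      Real.exp (-(Real.pi / 2 * |z.im|))) := by
  have hE : 1 ≤ 3 * Real.exp 3 := by have := Real.add_one_le_exp 3; linarith
  refine ⟨3 * Real.exp 3 * 1000, by linarith, fun z h1 h2 h3 => ?_⟩
  have him := abs_nonneg z.im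
  have hzup : ‖z‖ ≤ |z.re| + |z.im| := Complex.norm_le_abs_re_add_abs_im z
  have hre : |z.re| ≤ 5 / 4 := abs_le.2 ⟨by linarith, h2⟩
  have hzim : |z.im| ≤ ‖z‖ := Complex.abs_im_le_norm z
  have hzre : |z.re| ≤ ‖z‖ := Complex.abs_re_le_norm z
  have hlow : 1 + |z.im| ≤ 13 * ‖z‖ := by
    rcases h3 with h | h
    · have := le_abs_self z.re; linarith
    · linarith
  have hzpos : 0 < ‖z‖ := by linarith
  rcases le_or_gt (1 / 2) z.re with h | h
  · refine (norm_Gamma_le_strip h (by linarith)).trans ?_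
    have := rpow_compare (a := z.re - 1 / 2) (K := 13) hzpos (by linarith : 0 < 1 + |z.im|)
      (by norm_num) (by linarith) hlow (by rw [abs_le]; constructor <;> linarith)
    calc _ ≤ 3 * Real.exp 3 * (13 * (1 + |z.im|) ^ (z.re - 1 / 2) *
          Real.exp (-(Real.pi / 2 * |z.im|))) := by gcongr
      _ ≤ _ := by
        have : 0 ≤ 3 * Real.exp 3 * ((1 + |z.im|) ^ (z.re - 1 / 2) *
          Real.exp (-(Real.pi / 2 * |z.im|))) := by positivity
        nlinarith
  · have hz0 : z ≠ 0 := norm_pos_iff.1 hzpos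
    have hG : Complex.Gamma z = Complex.Gamma (z + 1) / z := by
      rw [Complex.Gamma_add_one _ hz0]; field_simp
    have hs := norm_Gamma_le_strip (z := z + 1)
      (by simp only [Complex.add_re, Complex.one_re]; linarith)
      (by simp only [Complex.add_re, Complex.one_re]; linarith)
    simp only [Complex.add_re, Complex.one_re, Complex.add_im, Complex.one_im, add_zero] at hs
    have hz1 : ‖z + 1‖ ≤ 4 * (1 + |z.im|) := by
      have := norm_add_le z 1; rw [norm_one] at this; linarith
    have hz1' : 1 + |z.im| ≤ 3 * ‖z + 1‖ := by
      have a := Complex.abs_im_le_norm (z + 1)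
      have b := Complex.re_le_norm (z + 1)
      simp only [Complex.add_re, Complex.one_re, Complex.add_im, Complex.one_im, add_zero] at a b
      linarith
    have hc := rpow_compare (a := z.re + 1 - 1 / 2) (K := 4) (x := ‖z + 1‖) (y := 1 + |z.im|)
      (by linarith) (by linarith)
      (by norm_num) hz1 (by linarith) (by rw [abs_le]; constructor <;> linarith)
    rw [hG, norm_div, div_le_iff₀ hzpos]
    have hpow : (1 + |z.im|) ^ (z.re + 1 - 1 / 2) = (1 + |z.im|) ^ (z.re - 1 / 2) * (1 + |z.im|) := by
      rw [show z.re + 1 - 1 / 2 = (z.re - 1 / 2) + 1 by ring, Real.rpow_add (by linarith),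
        Real.rpow_one]
    calc _ ≤ 3 * Real.exp 3 * (4 * ((1 + |z.im|) ^ (z.re - 1 / 2) * (13 * ‖z‖)) *
          Real.exp (-(Real.pi / 2 * |z.im|))) := by
            refine hs.trans ?_
            gcongr
            refine hc.trans ?_
            rw [hpow]
            gcongr
      _ ≤ _ := by
        have : 0 ≤ 3 * Real.exp 3 * ((1 + |z.im|) ^ (z.re - 1 / 2) *
          Real.exp (-(Real.pi / 2 * |z.im|))) * ‖z‖ := by positivity
        nlinarith

/-! ### Rotated Gamma functions -/

/-- `exp(-e^{-ia} e^v)`. -/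
def rotExp (a v : ℝ) : ℂ := Complex.exp (-(Complex.exp (-(a * Complex.I)) * Real.exp v))

/-- `Γ(z) e^{iaz}`. -/
def rGamma (a : ℝ) (z : ℂ) : ℂ := Complex.Gamma z * Complex.exp (a * Complex.I * z)

lemma re_exp_neg_mul_I (a : ℝ) : (Complex.exp (-(a * Complex.I))).re = Real.cos a := by
  rw [← neg_mul, ← Complex.ofReal_neg, Complex.exp_ofReal_mul_I_re, Real.cos_neg]

lemma norm_exp_neg_mul_I (a : ℝ) : ‖Complex.exp (-(a * Complex.I))‖ = 1 := by
  rw [← neg_mul, ← Complex.ofReal_neg, Complex.norm_exp_ofReal_mul_I]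

lemma norm_rotExp (a v : ℝ) : ‖rotExp a v‖ = Real.exp (-(Real.cos a * Real.exp v)) := by
  rw [rotExp, Complex.norm_exp, Complex.neg_re, Complex.re_mul_ofReal, re_exp_neg_mul_I]

lemma norm_rotExp_le_one {a : ℝ} (ha : |a| ≤ Real.pi / 2) (v : ℝ) : ‖rotExp a v‖ ≤ 1 := by
  rw [norm_rotExp, Real.exp_le_one_iff, neg_nonpos]
  exact mul_nonneg (Real.cos_nonneg_of_mem_Icc (abs_le.1 ha)) (Real.exp_pos _).le

lemma continuous_rotExp_right (a : ℝ) : Continuous (rotExp a) := by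
  unfold rotExp; fun_prop

lemma norm_rGamma (a : ℝ) (z : ℂ) :
    ‖rGamma a z‖ = ‖Complex.Gamma z‖ * Real.exp (-(a * z.im)) := by
  rw [rGamma, norm_mul, Complex.norm_exp]
  congr 2
  simp [Complex.mul_re]

lemma integrable_exp_neg_mul_abs {s : ℝ} (hs : 0 < s) :
    Integrable (fun v : ℝ => Real.exp (-(s * |v|))) := by
  have h := (exp_neg_integrableOn_Ioi 0 hs)
  have h' : IntegrableOn (fun v : ℝ => Real.exp (-(s * |v|))) (Ioi 0) := by
    refine h.congr_fun (fun x hx => ?_) measurableSet_Ioi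
    simp only [abs_of_pos (mem_Ioi.1 hx), neg_mul]
  have h2 : IntegrableOn (fun v : ℝ => Real.exp (-(s * |v|))) (Iic 0) := by
    refine (integrableOn_exp_mul_Iic hs 0).congr_fun (fun x hx => ?_) measurableSet_Iic
    simp only [abs_of_nonpos (mem_Iic.1 hx)]
    congr 1; ring
  have := h2.union h'
  rwa [Iic_union_Ioi, integrableOn_univ] at this

/-- `e^{σv} exp(-c e^v)` decays exponentially in both directions. -/
lemma exists_exp_mul_exp_neg_le {σ c : ℝ} (hc : 0 < c) :
    ∃ C, 0 ≤ C ∧ ∀ c' v : ℝ, c ≤ c' → Real.exp (σ * v) * Real.exp (-(c' * Real.exp v)) ≤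
      C * Real.exp (-(σ * |v|)) := by
  obtain ⟨k, hk⟩ := exists_nat_ge (2 * σ)
  refine ⟨1 + k.factorial / c ^ k, by positivity, fun c' v hc' => ?_⟩
  have hC0 : 0 ≤ (k.factorial : ℝ) / c ^ k := by positivity
  rcases le_or_gt v 0 with h | h
  · have e1 : Real.exp (-(c' * Real.exp v)) ≤ 1 := by
      rw [Real.exp_le_one_iff, neg_nonpos]
      exact mul_nonneg (hc.le.trans hc') (Real.exp_pos _).le
    rw [abs_of_nonpos h, mul_neg, neg_neg]
    have := (Real.exp_pos (σ * v))
    nlinarith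
  · have e1 : Real.exp (-(c' * Real.exp v)) ≤ k.factorial / c ^ k * Real.exp (-(k * v)) := by
      have h1 : Real.exp (-(c' * Real.exp v)) ≤ Real.exp (-(c * Real.exp v)) := by gcongr
      refine h1.trans ?_
      have h2 := Real.pow_div_factorial_le_exp (c * Real.exp v) (by positivity) k
      rw [Real.exp_neg, Real.exp_neg, ← div_eq_mul_inv, div_div, mul_comm (c ^ k), Real.exp_nat_mul,
        inv_le_comm₀ (Real.exp_pos _) (by positivity), inv_div, ← mul_pow, mul_comm (Real.exp v)]
      exact h2
    rw [abs_of_pos h]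
    calc _ ≤ Real.exp (σ * v) * (k.factorial / c ^ k * Real.exp (-(k * v))) := by gcongr
      _ = k.factorial / c ^ k * Real.exp (σ * v - k * v) := by
        rw [sub_eq_add_neg, Real.exp_add]; ring
      _ ≤ k.factorial / c ^ k * Real.exp (-(σ * v)) := by
        gcongr; nlinarith [mul_nonneg (sub_nonneg.2 hk) h.le]
      _ ≤ _ := by
        gcongr; linarith

lemma norm_exp_mul_rotExp (a : ℝ) (z : ℂ) (v : ℝ) :
    ‖Complex.exp (z * v) * rotExp a v‖ =
      Real.exp (z.re * v) * Real.exp (-(Real.cos a * Real.exp v)) := by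
  rw [norm_mul, norm_rotExp, Complex.norm_exp, Complex.re_mul_ofReal]

lemma cos_pos_of_abs_lt {a : ℝ} (ha : |a| < Real.pi / 2) : 0 < Real.cos a :=
  Real.cos_pos_of_mem_Ioo (abs_lt.1 ha)

lemma integrable_exp_mul_rotExp {a : ℝ} (ha : |a| < Real.pi / 2) {z : ℂ} (hz : 0 < z.re) :
    Integrable (fun v : ℝ => Complex.exp (z * v) * rotExp a v) := by
  obtain ⟨C, hC0, hC⟩ := exists_exp_mul_exp_neg_le (σ := z.re) (cos_pos_of_abs_lt ha)
  refine ((integrable_exp_neg_mul_abs hz).const_mul C).mono' ?_ (Eventually.of_forall fun v => ?_)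
  · have := continuous_rotExp_right a
    exact Continuous.aestronglyMeasurable (by fun_prop)
  · rw [norm_exp_mul_rotExp]; exact hC _ v le_rfl

lemma integral_Ioi_eq_integral_exp (g : ℝ → ℂ) :
    ∫ x in Ioi (0 : ℝ), g x = ∫ v : ℝ, (Real.exp v : ℂ) * g (Real.exp v) := by
  have h := integral_image_eq_integral_abs_deriv_smul (s := univ) (f := Real.exp)
    (f' := Real.exp) MeasurableSet.univ (fun x _ => (Real.hasDerivAt_exp x).hasDerivWithinAt)
    Real.exp_injective.injOn g
  rw [image_univ, Real.range_exp, setIntegral_univ] at h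
  simpa [abs_of_pos (Real.exp_pos _)] using h

lemma integral_exp_mul_rotExp_zero {z : ℂ} (hz : 0 < z.re) :
    ∫ v : ℝ, Complex.exp (z * v) * rotExp 0 v = Complex.Gamma z := by
  rw [Complex.Gamma_eq_integral hz, Complex.GammaIntegral, integral_Ioi_eq_integral_exp]
  refine integral_congr_ae (Eventually.of_forall fun v => ?_)
  have h1 : ((Real.exp v : ℝ) : ℂ) ^ (z - 1) = Complex.exp ((z - 1) * v) := by
    rw [Complex.cpow_def_of_ne_zero (by exact_mod_cast (Real.exp_pos v).ne'),
      ← Complex.ofReal_log (Real.exp_pos v).le, Real.log_exp, mul_comm]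
  simp only [rotExp, h1]
  rw [Complex.ofReal_exp (-Real.exp v)]
  push_cast
  simp only [zero_mul, neg_zero, Complex.exp_zero, one_mul]
  rw [← Complex.exp_add, ← Complex.exp_add, ← Complex.exp_add]
  congr 1; ring

/-- The rotated Gamma integral. -/
theorem integral_exp_mul_rotExp {a : ℝ} (ha : |a| < Real.pi / 2) {z : ℂ} (hz : 0 < z.re) :
    ∫ v : ℝ, Complex.exp (z * v) * rotExp a v = rGamma a z := by
  set F' : ℝ → ℝ → ℂ := fun a v => Complex.exp (z * v) *
    (rotExp a v * (Complex.I * Complex.exp (-(a * Complex.I)) * Real.exp v)) with hF'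
  have hF'eq : ∀ a v, F' a v = Complex.I * Complex.exp (-(a * Complex.I)) *
      (Complex.exp ((z + 1) * v) * rotExp a v) := by
    intro a v
    simp only [hF']
    rw [add_mul, one_mul, Complex.exp_add, Complex.ofReal_exp]; ring
  have hz1 : 0 < (z + 1).re := by simp; linarith
  have hder : ∀ a v : ℝ, HasDerivAt (fun a : ℝ => Complex.exp (z * v) * rotExp a v) (F' a v) a := by
    intro a v
    have h0 : HasDerivAt (fun a : ℝ => (a : ℂ)) 1 a := Complex.ofRealCLM.hasDerivAt
    have h := ((((h0.mul_const Complex.I).fun_neg).cexp.mul_const ((Real.exp v : ℝ) : ℂ)).fun_neg.cexp).const_mul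
      (Complex.exp (z * v))
    convert! h using 1
    simp only [hF', rotExp]; ring
  have hG : ∀ a, |a| < Real.pi / 2 → HasDerivAt (fun a : ℝ => ∫ v : ℝ, Complex.exp (z * v) * rotExp a v)
      (∫ v : ℝ, F' a v) a := by
    intro a ha
    obtain ⟨b, hab, hb⟩ := exists_between ha
    have hb0 : 0 < b := (abs_nonneg a).trans_lt hab
    have hcb : 0 < Real.cos b := cos_pos_of_abs_lt (by rwa [abs_of_pos hb0])
    obtain ⟨C, hC0, hC⟩ := exists_exp_mul_exp_neg_le (σ := (z + 1).re) hcb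
    refine (hasDerivAt_integral_of_dominated_loc_of_deriv_le (s := {x | |x| < b})
      (bound := fun v => C * Real.exp (-((z + 1).re * |v|))) ?_ ?_ ?_ ?_ ?_ ?_ ?_).2
    · exact (isOpen_lt continuous_abs continuous_const).mem_nhds hab
    · refine Eventually.of_forall fun x => ?_
      have := continuous_rotExp_right x
      exact Continuous.aestronglyMeasurable (by fun_prop)
    · exact integrable_exp_mul_rotExp ha hz
    · have := continuous_rotExp_right a
      simp only [hF']
      exact Continuous.aestronglyMeasurable (by fun_prop)
    · refine Eventually.of_forall fun v x hx => ?_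
      rw [hF'eq, norm_mul, norm_mul, Complex.norm_I, norm_exp_neg_mul_I, one_mul, one_mul,
        norm_exp_mul_rotExp]
      refine hC _ v ?_
      rw [← Real.cos_abs x]
      exact Real.cos_le_cos_of_nonneg_of_le_pi (abs_nonneg x) (by linarith [Real.pi_pos]) (le_of_lt hx)
    · exact (integrable_exp_neg_mul_abs hz1).const_mul C
    · exact Eventually.of_forall fun v x _ => hder x v
  have hibp : ∀ a, |a| < Real.pi / 2 → ∫ v : ℝ, F' a v =
      Complex.I * z * ∫ v : ℝ, Complex.exp (z * v) * rotExp a v := by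
    intro a ha
    have hd : ∀ v : ℝ, HasDerivAt (fun v : ℝ => Complex.exp (z * v) * rotExp a v)
        (z * (Complex.exp (z * v) * rotExp a v) -
          Complex.exp (-(a * Complex.I)) * (Complex.exp ((z + 1) * v) * rotExp a v)) v := by
      intro v
      have h0 : HasDerivAt (fun v : ℝ => (v : ℂ)) 1 v := Complex.ofRealCLM.hasDerivAt
      have h1 : HasDerivAt (fun v : ℝ => ((Real.exp v : ℝ) : ℂ)) (Real.exp v : ℝ) v :=
        (Real.hasDerivAt_exp v).ofReal_comp
      have h2 := ((h0.const_mul z).cexp).fun_mul ((h1.const_mul (Complex.exp (-(a * Complex.I)))).fun_neg.cexp)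
      convert! h2 using 1
      simp only [rotExp]
      rw [add_mul, one_mul, Complex.exp_add, Complex.ofReal_exp]; ring
    have hi1 := integrable_exp_mul_rotExp ha hz
    have hi2 := integrable_exp_mul_rotExp ha hz1
    have h := integral_eq_zero_of_hasDerivAt_of_integrable hd
      ((hi1.const_mul z).sub (hi2.const_mul _)) hi1
    rw [integral_sub (hi1.const_mul z) (hi2.const_mul _), integral_const_mul, integral_const_mul,
      sub_eq_zero] at h
    simp_rw [hF'eq]
    rw [integral_const_mul, mul_assoc, ← h]; ring
  have hH : ∀ x ∈ Ioo (-(Real.pi / 2)) (Real.pi / 2), HasDerivAt (fun a : ℝ =>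
      (∫ v : ℝ, Complex.exp (z * v) * rotExp a v) * Complex.exp (-(a * Complex.I * z))) 0 x := by
    intro x hx
    have hx' : |x| < Real.pi / 2 := abs_lt.2 hx
    have h0 : HasDerivAt (fun a : ℝ => (a : ℂ)) 1 x := Complex.ofRealCLM.hasDerivAt
    have h := (hG x hx').fun_mul ((((h0.mul_const Complex.I).mul_const z).fun_neg).cexp)
    convert! h using 1
    rw [hibp x hx']; ring
  have hconst := IsOpen.is_const_of_deriv_eq_zero isOpen_Ioo
    (isPreconnected_Ioo (a := -(Real.pi / 2)) (b := Real.pi / 2))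
    (fun x hx => (hH x hx).differentiableAt.differentiableWithinAt)
    (fun x hx => (hH x hx).deriv) (abs_lt.1 ha) (show (0 : ℝ) ∈ _ from
      ⟨by linarith [Real.pi_pos], by linarith [Real.pi_pos]⟩)
  rw [integral_exp_mul_rotExp_zero hz] at hconst
  rw [rGamma]
  simp only [Complex.ofReal_zero, zero_mul, neg_zero, Complex.exp_zero, mul_one] at hconst
  rw [← hconst, mul_assoc, ← Complex.exp_add]
  simp

/-- The constant in Stirling's bound. -/
def stirlingConst : ℝ := exists_norm_Gamma_le.choose

lemma one_le_stirlingConst : 1 ≤ stirlingConst := exists_norm_Gamma_le.choose_spec.1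

lemma norm_Gamma_le_stirling {z : ℂ} (h1 : -(1 / 8) ≤ z.re) (h2 : z.re ≤ 5 / 4)
    (h3 : 1 / 12 ≤ z.re ∨ 7 / 8 ≤ |z.im|) :
    ‖Complex.Gamma z‖ ≤ stirlingConst * ((1 + |z.im|) ^ (z.re - 1 / 2) *
      Real.exp (-(Real.pi / 2 * |z.im|))) := exists_norm_Gamma_le.choose_spec.2 z h1 h2 h3

lemma norm_rGamma_le {a : ℝ} {z : ℂ} (h1 : -(1 / 8) ≤ z.re) (h2 : z.re ≤ 5 / 4)
    (h3 : 1 / 12 ≤ z.re ∨ 7 / 8 ≤ |z.im|) :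
    ‖rGamma a z‖ ≤ stirlingConst * ((1 + |z.im|) ^ (z.re - 1 / 2) *
      Real.exp (-((Real.pi / 2 - |a|) * |z.im|))) := by
  have hC := one_le_stirlingConst
  rw [norm_rGamma]
  calc _ ≤ (stirlingConst * ((1 + |z.im|) ^ (z.re - 1 / 2) *
      Real.exp (-(Real.pi / 2 * |z.im|)))) * Real.exp (|a| * |z.im|) := by
        refine mul_le_mul (norm_Gamma_le_stirling h1 h2 h3) (Real.exp_le_exp.2 ?_)
          (Real.exp_pos _).le (by positivity)
        rw [← abs_mul]; exact neg_le_abs _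
    _ = _ := by
        rw [mul_assoc, mul_assoc, ← Real.exp_add]; congr 3; ring

lemma measurable_Gamma : Measurable Complex.Gamma := by
  have h : Measurable (fun z => (Complex.Gamma z)⁻¹⁻¹) :=
    (Complex.differentiable_one_div_Gamma.continuous.measurable).inv
  simpa using h

lemma measurable_rGamma (a : ℝ) : Measurable (rGamma a) := by
  unfold rGamma
  exact measurable_Gamma.mul (by fun_prop)

lemma norm_rGamma_line_le {a : ℝ} {z : ℂ} (h1 : 1 / 12 ≤ z.re) (h2 : z.re ≤ 1 / 2) :
    ‖rGamma a z‖ ≤ stirlingConst * Real.exp (-((Real.pi / 2 - |a|) * |z.im|)) := by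
  have hC := one_le_stirlingConst
  refine (norm_rGamma_le (by linarith) (by linarith) (Or.inl h1)).trans ?_
  have : (1 + |z.im|) ^ (z.re - 1 / 2) ≤ 1 :=
    Real.rpow_le_one_of_one_le_of_nonpos (by linarith [abs_nonneg z.im]) (by linarith)
  gcongr
  exact mul_le_of_le_one_left (Real.exp_pos _).le this

lemma integrable_exp_neg_mul_abs_add {s : ℝ} (hs : 0 < s) (c : ℝ) :
    Integrable (fun v : ℝ => Real.exp (-(s * |v + c|))) :=
  (integrable_exp_neg_mul_abs hs).comp_add_right c

lemma integrable_rGamma_line {a σ : ℝ} (ha : |a| < Real.pi / 2) (h1 : 1 / 12 ≤ σ) (h2 : σ ≤ 1 / 2)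
    {β : ℂ} (hβ : β.re = 0) :
    Integrable (fun t : ℝ => rGamma a (σ + t * Complex.I + β)) := by
  have hs : 0 < Real.pi / 2 - |a| := by linarith
  refine ((integrable_exp_neg_mul_abs_add hs β.im).const_mul stirlingConst).mono' ?_
    (Eventually.of_forall fun t => ?_)
  · exact ((measurable_rGamma a).comp (by fun_prop)).aestronglyMeasurable
  · have := norm_rGamma_line_le (a := a) (z := σ + t * Complex.I + β) (by simpa [hβ] using h1)
      (by simpa [hβ] using h2)
    simpa using this

/-- The inverse Mellin transform of the rotated Gamma function. -/
theorem integral_rGamma_line {a σ : ℝ} (ha : |a| < Real.pi / 2) (h1 : 1 / 12 ≤ σ)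
    (h2 : σ ≤ 1 / 2) (v : ℝ) :
    ∫ t : ℝ, rGamma a (σ + t * Complex.I) * Complex.exp (-((σ + t * Complex.I) * v)) =
      2 * Real.pi * rotExp a v := by
  have hσ : 0 < σ := by linarith
  have hpi := Real.pi_pos
  set f : ℝ → ℂ := fun u => Complex.exp (σ * u) * rotExp a u with hf
  have hfi : Integrable f := integrable_exp_mul_rotExp ha (z := σ) (by simpa using hσ)
  have hfc : Continuous f := by
    have := continuous_rotExp_right a
    fun_prop
  have hF : 𝓕 f = fun w : ℝ => rGamma a (σ + (-(2 * Real.pi) * w : ℝ) * Complex.I) := by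
    ext w
    rw [Real.fourier_real_eq_integral_exp_smul, ← integral_exp_mul_rotExp ha (by simpa using hσ)]
    refine integral_congr_ae (Eventually.of_forall fun u => ?_)
    simp only [hf, smul_eq_mul]
    rw [← mul_assoc, ← Complex.exp_add]
    congr 2
    push_cast; ring
  have hline : Integrable (fun t : ℝ => rGamma a (σ + t * Complex.I)) := by
    simpa using integrable_rGamma_line (β := 0) ha h1 h2 (by simp)
  have hFi : Integrable (𝓕 f) := by
    rw [hF]
    exact hline.comp_mul_left' (R := -(2 * Real.pi)) (by linarith [Real.pi_pos])
  have hinv := congrFun (hfc.fourierInv_fourier_eq hfi hFi) v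
  rw [Real.fourierInv_eq', hF] at hinv
  have hsub := Measure.integral_comp_mul_left
    (fun t : ℝ => rGamma a (σ + t * Complex.I) * Complex.exp (-(t * Complex.I * v))) (-(2 * Real.pi))
  have e1 : ∫ w : ℝ, Complex.exp ((2 * Real.pi * inner ℝ w v : ℝ) * Complex.I) •
      rGamma a (σ + (-(2 * Real.pi) * w : ℝ) * Complex.I) =
      ∫ w : ℝ, rGamma a (σ + (-(2 * Real.pi) * w : ℝ) * Complex.I) *
        Complex.exp (-((-(2 * Real.pi) * w : ℝ) * Complex.I * v)) := by
    refine integral_congr_ae (Eventually.of_forall fun w => ?_)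
    simp only [smul_eq_mul]
    rw [mul_comm]
    congr 2
    simp
    ring
  rw [e1, hsub] at hinv
  have e2 : ∫ t : ℝ, rGamma a (σ + t * Complex.I) * Complex.exp (-((σ + t * Complex.I) * v)) =
      Complex.exp (-(σ * v)) *
        ∫ t : ℝ, rGamma a (σ + t * Complex.I) * Complex.exp (-(t * Complex.I * v)) := by
    rw [← integral_const_mul]
    refine integral_congr_ae (Eventually.of_forall fun w => ?_)
    simp only
    rw [add_mul, neg_add, Complex.exp_add]; ring
  have e3 : ∫ t : ℝ, rGamma a (σ + t * Complex.I) * Complex.exp (-(t * Complex.I * v)) =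
      2 * Real.pi * f v := by
    rw [← hinv, abs_inv, abs_neg, abs_of_pos (by positivity)]
    rw [Complex.real_smul]
    push_cast
    rw [← mul_assoc, mul_inv_cancel₀ (by exact_mod_cast (by positivity : (2 * Real.pi) ≠ 0)), one_mul]
  rw [e2, e3, hf]
  simp only
  rw [show Complex.exp (-(σ * v)) * (2 * Real.pi * (Complex.exp (σ * v) * rotExp a v)) =
    2 * Real.pi * ((Complex.exp (-(σ * v)) * Complex.exp (σ * v)) * rotExp a v) by ring,
    ← Complex.exp_add, neg_add_cancel, Complex.exp_zero, one_mul]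

/-! ### The Bessel-type integrals -/

/-- The inverse Mellin transform of a product of two rotated Gamma functions. -/
def besselB (a b : ℝ) (α β : ℂ) (X : ℝ) : ℂ :=
  ∫ v : ℝ, rotExp a v * rotExp b (X - v) * Complex.exp (α * v + β * (X - v))

lemma norm_exp_of_re_eq_zero {α β : ℂ} (hα : α.re = 0) (hβ : β.re = 0) (v w : ℝ) :
    ‖Complex.exp (α * v + β * (w - v))‖ = 1 := by
  rw [Complex.norm_exp, Complex.add_re, ← Complex.ofReal_sub, Complex.re_mul_ofReal,
    Complex.re_mul_ofReal, hα, hβ]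
  simp

lemma norm_besselB_integrand {α β : ℂ} (hα : α.re = 0) (hβ : β.re = 0) (a b X v : ℝ) :
    ‖rotExp a v * rotExp b (X - v) * Complex.exp (α * v + β * (X - v))‖ =
      ‖rotExp a v‖ * ‖rotExp b (X - v)‖ := by
  rw [norm_mul, norm_mul, norm_exp_of_re_eq_zero hα hβ, mul_one]

lemma exists_norm_rotExp_mul_le {a b : ℝ} (ha : |a| < Real.pi / 2) (hb : |b| < Real.pi / 2)
    {σ : ℝ} (hσ : 0 < σ) :
    ∃ C, 0 ≤ C ∧ ∀ X v : ℝ, ‖rotExp a v‖ * ‖rotExp b (X - v)‖ ≤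
      C * Real.exp (-(σ * X)) * Real.exp (-(σ * |v|)) := by
  obtain ⟨C, hC0, hC⟩ := exists_exp_mul_exp_neg_le (σ := σ) (cos_pos_of_abs_lt ha)
  obtain ⟨C', hC0', hC'⟩ := exists_exp_mul_exp_neg_le (σ := σ) (cos_pos_of_abs_lt hb)
  refine ⟨C * C', by positivity, fun X v => ?_⟩
  have h1 := hC _ v le_rfl
  have h2 := (hC' _ (X - v) le_rfl).trans (mul_le_of_le_one_right hC0' (by
    rw [Real.exp_le_one_iff, neg_nonpos]; positivity))
  rw [norm_rotExp, norm_rotExp]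
  have := mul_le_mul h1 h2 (by positivity) (by positivity)
  have e : Real.exp (σ * v) * Real.exp (σ * (X - v)) * Real.exp (-(σ * X)) = 1 := by
    rw [← Real.exp_add, ← Real.exp_add, ← Real.exp_zero]; congr 1; ring
  calc _ = (Real.exp (σ * v) * Real.exp (-(Real.cos a * Real.exp v)) *
      (Real.exp (σ * (X - v)) * Real.exp (-(Real.cos b * Real.exp (X - v))))) *
      Real.exp (-(σ * X)) := by
        rw [show ∀ x y z w u : ℝ, x * y * (z * w) * u = (x * z * u) * (y * w) by intros; ring,
          e, one_mul]
    _ ≤ _ := by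
        rw [show C * C' * Real.exp (-(σ * X)) * Real.exp (-(σ * |v|)) =
          C * Real.exp (-(σ * |v|)) * C' * Real.exp (-(σ * X)) by ring]
        gcongr

lemma continuous_besselB_integrand (a b : ℝ) :
    Continuous (fun p : (ℂ × ℂ × ℝ) × ℝ => rotExp a p.2 * rotExp b (p.1.2.2 - p.2) *
      Complex.exp (p.1.1 * p.2 + p.1.2.1 * (p.1.2.2 - p.2))) := by
  unfold rotExp; fun_prop

lemma stronglyMeasurable_besselB (a b : ℝ) :
    StronglyMeasurable (fun p : ℂ × ℂ × ℝ => besselB a b p.1 p.2.1 p.2.2) :=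
  (continuous_besselB_integrand a b).stronglyMeasurable.integral_prod_right

lemma integrable_besselB_integrand {a b : ℝ} (ha : |a| < Real.pi / 2) (hb : |b| < Real.pi / 2)
    {α β : ℂ} (hα : α.re = 0) (hβ : β.re = 0) (X : ℝ) :
    Integrable (fun v : ℝ =>
      rotExp a v * rotExp b (X - v) * Complex.exp (α * v + β * (X - v))) := by
  obtain ⟨C, -, hC⟩ := exists_norm_rotExp_mul_le ha hb one_pos
  refine ((integrable_exp_neg_mul_abs one_pos).const_mul (C * Real.exp (-(1 * X)))).mono'
    ?_ (Eventually.of_forall fun v => ?_)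
  · have h1 := continuous_rotExp_right a
    have h2 := continuous_rotExp_right b
    exact Continuous.aestronglyMeasurable (by fun_prop)
  · rw [norm_besselB_integrand hα hβ]; exact hC X v

lemma exists_norm_besselB_le {a b : ℝ} (ha : |a| < Real.pi / 2) (hb : |b| < Real.pi / 2)
    {σ : ℝ} (hσ : 0 < σ) :
    ∃ C, 0 ≤ C ∧ ∀ (α β : ℂ) (X : ℝ), α.re = 0 → β.re = 0 →
      ‖besselB a b α β X‖ ≤ C * Real.exp (-(σ * X)) := by
  obtain ⟨C, hC0, hC⟩ := exists_norm_rotExp_mul_le ha hb hσ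
  refine ⟨C * ∫ v : ℝ, Real.exp (-(σ * |v|)), mul_nonneg hC0
    (integral_nonneg fun v => (Real.exp_pos _).le), fun α β X hα hβ => ?_⟩
  calc ‖besselB a b α β X‖ ≤ ∫ v : ℝ, C * Real.exp (-(σ * X)) * Real.exp (-(σ * |v|)) := by
        refine norm_integral_le_of_norm_le ((integrable_exp_neg_mul_abs hσ).const_mul _)
          (Eventually.of_forall fun v => ?_)
        rw [norm_besselB_integrand hα hβ]; exact hC X v
    _ = _ := by rw [integral_const_mul]; ring

/-- The Mellin–Barnes representation of `besselB`. -/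
theorem integral_rGamma_mul_rGamma {a b σ : ℝ} (ha : |a| < Real.pi / 2) (hb : |b| < Real.pi / 2)
    (h1 : 1 / 12 ≤ σ) (h2 : σ ≤ 1 / 2) {α β : ℂ} (hα : α.re = 0) (hβ : β.re = 0) (X : ℝ) :
    ∫ t : ℝ, Complex.exp (-((σ + t * Complex.I) * X)) * rGamma a (σ + t * Complex.I + α) *
      rGamma b (σ + t * Complex.I + β) = 2 * Real.pi * besselB a b α β X := by
  have hσ : 0 < σ := by linarith
  have hre : ∀ t : ℝ, 0 < ((σ : ℂ) + t * Complex.I + α).re := fun t => by simpa [hα] using hσ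
  have hβI : β = β.im * Complex.I := by apply Complex.ext <;> simp [hβ]
  set F : ℝ → ℝ → ℂ := fun t v => Complex.exp (-((σ + t * Complex.I) * X)) *
    (Complex.exp ((σ + t * Complex.I + α) * v) * rotExp a v) * rGamma b (σ + t * Complex.I + β)
    with hF
  have hstep : ∀ t : ℝ, Complex.exp (-((σ + t * Complex.I) * X)) *
      rGamma a (σ + t * Complex.I + α) * rGamma b (σ + t * Complex.I + β) = ∫ v : ℝ, F t v := by
    intro t
    rw [← integral_exp_mul_rotExp ha (hre t), ← integral_const_mul, ← integral_mul_const]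
  simp_rw [hstep]
  have hFi : Integrable (Function.uncurry F) (volume.prod volume) := by
    have hi := (integrable_rGamma_line hb h1 h2 hβ).norm.mul_prod
      ((integrable_exp_mul_rotExp ha (z := (σ : ℂ)) (by simpa using hσ)).norm.const_mul
        (Real.exp (-(σ * X))))
    refine hi.mono' ?_ (Eventually.of_forall fun p => ?_)
    · refine AEStronglyMeasurable.mul ?_ ?_
      · have h1 := continuous_rotExp_right a
        exact Continuous.aestronglyMeasurable (by fun_prop)
      · exact ((measurable_rGamma b).comp (by fun_prop)).aestronglyMeasurable
    · simp only [Function.uncurry, hF, norm_mul, Complex.norm_exp]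
      apply le_of_eq
      simp [hα]
      ring
  rw [integral_integral_swap hFi, besselB, ← integral_const_mul]
  refine integral_congr_ae (Eventually.of_forall fun v => ?_)
  simp only
  have hline := integral_rGamma_line hb h1 h2 (X - v)
  have htr := integral_add_right_eq_self (μ := volume) (fun t : ℝ => rGamma b (σ + t * Complex.I) *
    Complex.exp (-((σ + t * Complex.I) * ((X - v : ℝ) : ℂ)))) β.im
  rw [hline] at htr
  have e : ∀ t : ℝ, F t v = rotExp a v * Complex.exp (α * v + β * (X - v)) *
      (rGamma b (σ + ((t + β.im : ℝ) : ℂ) * Complex.I) *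
        Complex.exp (-((σ + ((t + β.im : ℝ) : ℂ) * Complex.I) * ((X - v : ℝ) : ℂ)))) := by
    intro t
    simp only [hF]
    have e1 : (σ : ℂ) + ((t + β.im : ℝ) : ℂ) * Complex.I = σ + t * Complex.I + β := by
      conv_rhs => rw [hβI]
      push_cast; ring
    rw [e1]
    have e2 : Complex.exp (-((σ + t * Complex.I) * X)) *
        Complex.exp ((σ + t * Complex.I + α) * v) = Complex.exp (α * v + β * (X - v)) *
        Complex.exp (-((σ + t * Complex.I + β) * ((X - v : ℝ) : ℂ))) := by
      rw [← Complex.exp_add, ← Complex.exp_add]; congr 1; push_cast; ring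
    linear_combination (rotExp a v * rGamma b (σ + t * Complex.I + β)) * e2
  simp_rw [e]
  rw [integral_const_mul, htr]
  ring

/-- The truncated Bessel-type integral. -/
def besselTrunc (a b : ℝ) (α β : ℂ) (X V : ℝ) : ℂ :=
  ∫ v in Ioc (X - V) V, rotExp a v * rotExp b (X - v) * Complex.exp (α * v + β * (X - v))

lemma norm_besselTail_le {a b : ℝ} (ha : |a| < Real.pi / 2) (hb : |b| < Real.pi / 2)
    {α β : ℂ} (hα : α.re = 0) (hβ : β.re = 0) (X V : ℝ) :
    ‖∫ v in Ioi V, rotExp a v * rotExp b (X - v) * Complex.exp (α * v + β * (X - v))‖ ≤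
      Real.exp (-V) * (2 + ‖α - β‖ + Real.exp (X - V)) := by
  set w₁ := Complex.exp (-(a * Complex.I)) with hw₁
  set w₂ := Complex.exp (-(b * Complex.I)) with hw₂
  set g : ℝ → ℂ := fun v =>
    rotExp a v * rotExp b (X - v) * Complex.exp (α * v + β * (X - v)) with hg
  have hgi : Integrable g := integrable_besselB_integrand ha hb hα hβ X
  have hgn : ∀ v, ‖g v‖ ≤ 1 := fun v => by
    simp only [hg]
    rw [norm_besselB_integrand hα hβ]
    exact mul_le_one₀ (norm_rotExp_le_one ha.le v) (norm_nonneg _) (norm_rotExp_le_one hb.le _)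
  set r : ℝ → ℂ := fun v => (Real.exp (-v) : ℂ) * g v *
    (-1 + w₂ * Real.exp (X - v) + (α - β)) with hr
  have hd : ∀ v : ℝ, HasDerivAt (fun v : ℝ => ((Real.exp (-v) : ℝ) : ℂ) * g v)
      (r v - w₁ * g v) v := by
    intro v
    have h0 : HasDerivAt (fun v : ℝ => (v : ℂ)) 1 v := Complex.ofRealCLM.hasDerivAt
    have he : HasDerivAt (fun v : ℝ => ((Real.exp (-v) : ℝ) : ℂ)) ((-Real.exp (-v) : ℝ) : ℂ) v := by
      have := ((hasDerivAt_id v).fun_neg.exp).ofReal_comp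
      simpa using this
    have h1 : HasDerivAt (fun v : ℝ => ((Real.exp v : ℝ) : ℂ)) (Real.exp v : ℝ) v :=
      (Real.hasDerivAt_exp v).ofReal_comp
    have h2 : HasDerivAt (fun v : ℝ => ((Real.exp (X - v) : ℝ) : ℂ))
        ((-Real.exp (X - v) : ℝ) : ℂ) v := by
      have := (((hasDerivAt_id v).const_sub X).exp).ofReal_comp
      simpa using this
    have hA := ((h1.const_mul w₁).fun_neg.cexp)
    have hB := ((h2.const_mul w₂).fun_neg.cexp)
    have hC := ((h0.const_mul α).fun_add ((h0.const_sub (X : ℂ)).const_mul β)).cexp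
    have := he.fun_mul ((hA.fun_mul hB).fun_mul hC)
    convert! this using 1
    simp only [hr, hg, rotExp]
    rw [← hw₁, ← hw₂]
    have hee : ((Real.exp v : ℝ) : ℂ) * ((Real.exp (-v) : ℝ) : ℂ) = 1 := by
      rw [← Complex.ofReal_mul, ← Real.exp_add]; simp
    push_cast at hee ⊢
    linear_combination (w₁ * Complex.exp (-(w₁ * Complex.exp (v : ℂ))) *
      Complex.exp (-(w₂ * Complex.exp (X - v : ℂ))) *
      Complex.exp (α * v + β * (X - v))) * hee
  have hrb : ∀ v ∈ Ioi V, ‖r v‖ ≤ (1 + ‖α - β‖ + Real.exp (X - V)) * Real.exp (-v) := by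
    intro v hv
    simp only [hr, norm_mul, Complex.norm_real, Real.norm_eq_abs, Real.abs_exp]
    have h3 : ‖-1 + w₂ * ((Real.exp (X - v) : ℝ) : ℂ) + (α - β)‖ ≤
        1 + ‖α - β‖ + Real.exp (X - V) := by
      refine (norm_add₃_le).trans ?_
      rw [norm_neg, norm_one, norm_mul, hw₂, norm_exp_neg_mul_I, one_mul, Complex.norm_real,
        Real.norm_eq_abs, Real.abs_exp]
      have : Real.exp (X - v) ≤ Real.exp (X - V) :=
        Real.exp_le_exp.2 (by linarith [mem_Ioi.1 hv])
      linarith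
    calc _ ≤ Real.exp (-v) * 1 * (1 + ‖α - β‖ + Real.exp (X - V)) := by
          gcongr; exact hgn v
      _ = _ := by ring
  have hei : IntegrableOn (fun v : ℝ => Real.exp (-v)) (Ioi V) := by
    simpa using exp_neg_integrableOn_Ioi V one_pos
  have hri : IntegrableOn r (Ioi V) := by
    refine (hei.const_mul _).mono' ?_ ((ae_restrict_iff' measurableSet_Ioi).2
      (Eventually.of_forall hrb))
    have h1 := continuous_rotExp_right a
    have h2 := continuous_rotExp_right b
    exact Continuous.aestronglyMeasurable (by simp only [hr, hg]; fun_prop)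
  have hlim : Tendsto (fun v : ℝ => ((Real.exp (-v) : ℝ) : ℂ) * g v) atTop (𝓝 0) := by
    refine squeeze_zero_norm (a := fun v => Real.exp (-v)) (fun v => ?_) ?_
    · rw [norm_mul, Complex.norm_real, Real.norm_eq_abs, Real.abs_exp]
      exact mul_le_of_le_one_right (Real.exp_pos _).le (hgn v)
    · exact Real.tendsto_exp_neg_atTop_nhds_zero
  have hint := integral_Ioi_of_hasDerivAt_of_tendsto (a := V)
    (hd V).continuousAt.continuousWithinAt (fun v _ => hd v)
    (hri.sub (hgi.integrableOn.const_mul w₁)) hlim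
  rw [integral_sub hri (hgi.integrableOn.const_mul w₁), integral_const_mul, zero_sub] at hint
  have hkey : w₁ * ∫ v in Ioi V, g v = (∫ v in Ioi V, r v) + ((Real.exp (-V) : ℝ) : ℂ) * g V := by
    linear_combination -hint
  have hn : ‖w₁ * ∫ v in Ioi V, g v‖ = ‖∫ v in Ioi V, g v‖ := by
    rw [norm_mul, hw₁, norm_exp_neg_mul_I, one_mul]
  rw [← hn, hkey]
  refine (norm_add_le _ _).trans ?_
  have b1 : ‖∫ v in Ioi V, r v‖ ≤ (1 + ‖α - β‖ + Real.exp (X - V)) * Real.exp (-V) := by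
    refine (norm_integral_le_of_norm_le (hei.const_mul _) ((ae_restrict_iff' measurableSet_Ioi).2
      (Eventually.of_forall hrb))).trans (le_of_eq ?_)
    rw [integral_const_mul, integral_exp_neg_Ioi]
  have b2 : ‖((Real.exp (-V) : ℝ) : ℂ) * g V‖ ≤ Real.exp (-V) := by
    rw [norm_mul, Complex.norm_real, Real.norm_eq_abs, Real.abs_exp]
    exact mul_le_of_le_one_right (Real.exp_pos _).le (hgn V)
  linarith

lemma norm_besselB_sub_besselTrunc_le {a b : ℝ} (ha : |a| < Real.pi / 2) (hb : |b| < Real.pi / 2)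
    {α β : ℂ} (hα : α.re = 0) (hβ : β.re = 0) {X V : ℝ} (hV : X - V ≤ V) :
    ‖besselB a b α β X - besselTrunc a b α β X V‖ ≤
      2 * (Real.exp (-V) * (2 + ‖α - β‖ + Real.exp (X - V))) := by
  have hgi := integrable_besselB_integrand ha hb hα hβ X
  have e1 : besselB a b α β X = (∫ v in Iic (X - V), rotExp a v * rotExp b (X - v) *
      Complex.exp (α * v + β * (X - v))) + (besselTrunc a b α β X V +
      ∫ v in Ioi V, rotExp a v * rotExp b (X - v) * Complex.exp (α * v + β * (X - v))) := by
    rw [besselTrunc, ← setIntegral_union (Ioc_disjoint_Ioi le_rfl) measurableSet_Ioi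
      hgi.integrableOn hgi.integrableOn, Ioc_union_Ioi_eq_Ioi hV,
      intervalIntegral.integral_Iic_add_Ioi hgi.integrableOn hgi.integrableOn, besselB]
  have e2 : ∫ v in Iic (X - V), rotExp a v * rotExp b (X - v) *
      Complex.exp (α * v + β * (X - v)) = ∫ v in Ioi V, rotExp b v * rotExp a (X - v) *
      Complex.exp (β * v + α * (X - v)) := by
    have h1 := integral_sub_left_eq_self (μ := volume) ((Iic (X - V)).indicator fun v : ℝ =>
      rotExp a v * rotExp b (X - v) * Complex.exp (α * v + β * (X - v))) X
    rw [integral_indicator measurableSet_Iic] at h1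
    rw [← h1, ← integral_Ici_eq_integral_Ioi, ← integral_indicator measurableSet_Ici]
    refine integral_congr_ae (Eventually.of_forall fun v => ?_)
    simp only [indicator, mem_Iic, mem_Ici]
    by_cases h : V ≤ v
    · rw [if_pos h, if_pos (by linarith)]
      rw [sub_sub_cancel]
      push_cast
      rw [mul_comm (rotExp a _), sub_sub_cancel, add_comm (α * _)]
    · rw [if_neg h, if_neg (by intro h'; exact h (by linarith))]
  have t1 := norm_besselTail_le ha hb hα hβ X V
  have t2 := norm_besselTail_le hb ha hβ hα X V
  rw [norm_sub_rev β α] at t2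
  rw [e1, e2]
  rw [show ∀ x y z : ℂ, x + (y + z) - y = x + z by intros; ring]
  refine (norm_add_le _ _).trans ?_
  linarith

lemma norm_besselTrunc_le {a b : ℝ} (ha : |a| ≤ Real.pi / 2) (hb : |b| ≤ Real.pi / 2)
    {α β : ℂ} (hα : α.re = 0) (hβ : β.re = 0) {X V : ℝ} (hV : X - V ≤ V) :
    ‖besselTrunc a b α β X V‖ ≤ 2 * V - X := by
  have := norm_setIntegral_le_of_norm_le_const (μ := volume) (s := Ioc (X - V) V) (C := 1)
    (f := fun v : ℝ => rotExp a v * rotExp b (X - v) * Complex.exp (α * v + β * (X - v)))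
    (by simp) (fun v _ => by
      rw [norm_besselB_integrand hα hβ]
      exact mul_le_one₀ (norm_rotExp_le_one ha v) (norm_nonneg _) (norm_rotExp_le_one hb _))
  rw [Real.volume_real_Ioc_of_le hV] at this
  rw [besselTrunc]
  linarith

/-! ### Beta integrals -/

/-- One of `p + q`, `q`, `p`. -/
def betaW (J : Fin 3) (p q : ℂ) : ℂ := ![p + q, q, p] J

/-- `Γ(p) Γ(q) Γ(1 - p - q) sin(πw) / π` with `w` one of `p + q`, `q`, `p`. -/
def betaJ (J : Fin 3) (p q : ℂ) : ℂ :=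
  Complex.Gamma p * Complex.Gamma q * Complex.Gamma (1 - p - q) * sinPi (betaW J p q) / Real.pi

/-- The range of integration in the integral representation of `betaJ`. -/
def betaSet (J : Fin 3) : Set ℝ := ![univ, Iio 0, Ioi 0] J

/-- The base of the power in the integral representation of `betaJ`. -/
def betaD (J : Fin 3) (x : ℝ) : ℝ := ![1 + Real.exp x, 1 - Real.exp x, Real.exp x - 1] J

lemma measurableSet_betaSet (J : Fin 3) : MeasurableSet (betaSet J) := by
  fin_cases J
  · exact MeasurableSet.univ
  · exact measurableSet_Iio
  · exact measurableSet_Ioi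

lemma measurable_betaD (J : Fin 3) : Measurable (betaD J) := by
  fin_cases J
  · exact (Real.measurable_exp).const_add 1
  · exact (Real.measurable_exp).const_sub 1
  · exact (Real.measurable_exp).sub_const 1

lemma betaD_pos {J : Fin 3} {x : ℝ} (hx : x ∈ betaSet J) : 0 < betaD J x := by
  fin_cases J
  · show 0 < 1 + Real.exp x
    positivity
  · show 0 < 1 - Real.exp x
    have : Real.exp x < 1 := Real.exp_lt_one_iff.2 hx
    linarith
  · show 0 < Real.exp x - 1
    have : 1 < Real.exp x := Real.one_lt_exp_iff.2 hx
    linarith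

/-- The integrand of the Beta integral. -/
def betaKer (J : Fin 3) (p q : ℂ) (x : ℝ) : ℂ :=
  Complex.exp (p * x - (p + q) * Real.log (betaD J x))

lemma norm_betaKer (J : Fin 3) (p q : ℂ) (x : ℝ) :
    ‖betaKer J p q x‖ = Real.exp (p.re * x - (p.re + q.re) * Real.log (betaD J x)) := by
  rw [betaKer, Complex.norm_exp, Complex.sub_re, Complex.re_mul_ofReal, Complex.re_mul_ofReal,
    Complex.add_re]

lemma Gamma_mul_sinPi {z : ℂ} (hz : Complex.Gamma (1 - z) ≠ 0) (hs : sinPi z ≠ 0) :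
    Complex.Gamma z * sinPi z / Real.pi = 1 / Complex.Gamma (1 - z) := by
  have h := Complex.Gamma_mul_Gamma_one_sub z
  rw [sinPi] at hs
  rw [eq_div_iff hs] at h
  have hpi : (Real.pi : ℂ) ≠ 0 := by exact_mod_cast Real.pi_ne_zero
  rw [div_eq_div_iff hpi hz]
  rw [sinPi]; linear_combination h

lemma sinPi_ne_zero {z : ℂ} (h0 : 0 < z.re) (h1 : z.re < 1) : sinPi z ≠ 0 := by
  rw [sinPi, Complex.sin_ne_zero_iff]
  intro k hk
  have hpi : (Real.pi : ℂ) ≠ 0 := by exact_mod_cast Real.pi_ne_zero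
  have hz : z = (k : ℂ) := by
    apply mul_left_cancel₀ hpi; rw [hk]; ring
  rw [hz] at h0 h1
  simp only [Complex.intCast_re] at h0 h1
  have a : (0 : ℤ) < k := by exact_mod_cast h0
  have b : k < 1 := by exact_mod_cast h1
  omega

lemma Gamma_mul_sinPi' {z : ℂ} (h0 : 0 < z.re) (h1 : z.re < 1) :
    Complex.Gamma z * sinPi z / Real.pi = 1 / Complex.Gamma (1 - z) :=
  Gamma_mul_sinPi (Complex.Gamma_ne_zero_of_re_pos (by simpa using h1)) (sinPi_ne_zero h0 h1)

lemma betaIntegral_eq_setIntegral (p q : ℂ) :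
    Complex.betaIntegral p q = ∫ x in Ioo (0 : ℝ) 1, (x : ℂ) ^ (p - 1) * (1 - (x : ℂ)) ^ (q - 1) := by
  rw [Complex.betaIntegral, intervalIntegral.integral_of_le zero_le_one, integral_Ioc_eq_integral_Ioo]

lemma integrableOn_beta {p q : ℂ} (hp : 0 < p.re) (hq : 0 < q.re) :
    IntegrableOn (fun x : ℝ => (x : ℂ) ^ (p - 1) * (1 - (x : ℂ)) ^ (q - 1)) (Ioo 0 1) := by
  have h := Complex.betaIntegral_convergent hp hq
  rw [intervalIntegrable_iff_integrableOn_Ioo_of_le zero_le_one] at h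
  exact h

lemma ofReal_cpow_eq_exp {x : ℝ} (hx : 0 < x) (z : ℂ) :
    (x : ℂ) ^ z = Complex.exp (z * Real.log x) := by
  rw [Complex.cpow_def_of_ne_zero (by exact_mod_cast hx.ne'), ← Complex.ofReal_log hx.le, mul_comm]

lemma beta_exp_substitution {p q : ℂ} (hp : 0 < p.re) (hpq : p.re + q.re < 1) :
    IntegrableOn (betaKer 1 p q) (Iio 0) ∧
      ∫ x in Iio (0 : ℝ), betaKer 1 p q x = Complex.betaIntegral p (1 - p - q) := by
  have him : Real.exp '' Iio 0 = Ioo 0 1 := by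
    ext y
    simp only [mem_image, mem_Iio, mem_Ioo]
    constructor
    · rintro ⟨x, hx, rfl⟩; exact ⟨Real.exp_pos x, Real.exp_lt_one_iff.2 hx⟩
    · rintro ⟨h0, h1⟩
      exact ⟨Real.log y, Real.log_neg h0 h1, Real.exp_log h0⟩
  have hd : ∀ x ∈ Iio (0 : ℝ), HasDerivWithinAt Real.exp (Real.exp x) (Iio 0) x :=
    fun x _ => (Real.hasDerivAt_exp x).hasDerivWithinAt
  have hinj : InjOn Real.exp (Iio 0) := Real.exp_injective.injOn
  have hcongr : ∀ x ∈ Iio (0 : ℝ), |Real.exp x| • (((Real.exp x : ℝ) : ℂ) ^ (p - 1) *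
      (1 - ((Real.exp x : ℝ) : ℂ)) ^ (1 - p - q - 1)) = betaKer 1 p q x := by
    intro x hx
    have hD : 0 < 1 - Real.exp x := betaD_pos (J := 1) hx
    rw [abs_of_pos (Real.exp_pos x), Complex.real_smul, ofReal_cpow_eq_exp (Real.exp_pos x),
      ← Complex.ofReal_one, ← Complex.ofReal_sub, ofReal_cpow_eq_exp hD, Real.log_exp,
      Complex.ofReal_exp, ← Complex.exp_add, ← Complex.exp_add, betaKer]
    congr 1
    simp only [betaD, Matrix.cons_val_one, Matrix.cons_val_zero]
    push_cast
    ring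
  constructor
  · have h := (integrableOn_image_iff_integrableOn_abs_deriv_smul measurableSet_Iio hd hinj
      (fun x : ℝ => (x : ℂ) ^ (p - 1) * (1 - (x : ℂ)) ^ (1 - p - q - 1))).1
      (by rw [him]; exact integrableOn_beta hp (by simp; linarith))
    exact h.congr_fun hcongr measurableSet_Iio
  · rw [betaIntegral_eq_setIntegral, ← him,
      integral_image_eq_integral_abs_deriv_smul measurableSet_Iio hd hinj]
    exact (setIntegral_congr_fun measurableSet_Iio hcongr).symm

lemma beta_reflect_substitution {p q : ℂ} (hq : 0 < q.re) (hpq : p.re + q.re < 1) :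
    IntegrableOn (betaKer 2 p q) (Ioi 0) ∧
      ∫ x in Ioi (0 : ℝ), betaKer 2 p q x = Complex.betaIntegral q (1 - p - q) := by
  obtain ⟨h1, h2⟩ := beta_exp_substitution (p := q) (q := p) hq (by linarith)
  have hcongr : ∀ x ∈ Ioi (0 : ℝ), betaKer 1 q p (-x) = betaKer 2 p q x := by
    intro x hx
    have hx' : 1 < Real.exp x := Real.one_lt_exp_iff.2 hx
    have : Real.log (1 - Real.exp (-x)) = Real.log (Real.exp x - 1) - x := by
      rw [show 1 - Real.exp (-x) = (Real.exp x - 1) * Real.exp (-x) by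
        rw [sub_mul, ← Real.exp_add]; simp, Real.log_mul (by linarith) (Real.exp_pos _).ne',
        Real.log_exp]; ring
    rw [betaKer, betaKer]
    congr 1
    simp only [betaD, Matrix.cons_val_one, Matrix.cons_val]
    rw [this]; push_cast; ring
  constructor
  · have h3 : IntegrableOn (fun x => betaKer 1 q p (-x)) (Ioi 0) := by
      have := (integrableOn_Iic_iff_integrableOn_Iio (by simp)).2 h1
      exact (integrableOn_Ici_iff_integrableOn_Ioi (by simp)).1 (by simpa using (show IntegrableOn (betaKer 1 q p) (Iic (-0)) by simpa using this).comp_neg_Ici)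
    exact h3.congr_fun hcongr measurableSet_Ioi
  · rw [← setIntegral_congr_fun measurableSet_Ioi hcongr, integral_comp_neg_Ioi, neg_zero,
      integral_Iic_eq_integral_Iio, h2]
    congr 1; ring

lemma beta_logistic_substitution {p q : ℂ} (hp : 0 < p.re) (hq : 0 < q.re) :
    Integrable (betaKer 0 p q) ∧ ∫ x : ℝ, betaKer 0 p q x = Complex.betaIntegral p q := by
  set f : ℝ → ℝ := fun x => Real.exp x / (1 + Real.exp x) with hf
  have hpos : ∀ x : ℝ, 0 < 1 + Real.exp x := fun x => by positivity
  have h1f : ∀ x, 1 - f x = 1 / (1 + Real.exp x) := fun x => by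
    have := hpos x
    simp only [hf]; field_simp; ring
  have him : f '' univ = Ioo 0 1 := by
    ext y
    simp only [mem_image, mem_univ, true_and, mem_Ioo]
    constructor
    · rintro ⟨x, rfl⟩
      have := hpos x
      exact ⟨by positivity, by simp only [hf]; rw [div_lt_one this]; linarith⟩
    · rintro ⟨h0, h1⟩
      have h2 : 0 < 1 - y := by linarith
      refine ⟨Real.log (y / (1 - y)), ?_⟩
      simp only [hf]
      rw [Real.exp_log (by positivity)]
      field_simp
      ring
  have hd : ∀ x ∈ (univ : Set ℝ), HasDerivWithinAt f (Real.exp x / (1 + Real.exp x) ^ 2) univ x := by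
    intro x _
    have h := (Real.hasDerivAt_exp x).div ((Real.hasDerivAt_exp x).const_add 1) (hpos x).ne'
    rw [hasDerivWithinAt_univ]
    convert! h using 1
    ring
  have hinj : InjOn f univ := by
    intro x _ y _ h
    have h' : 1 - f x = 1 - f y := by rw [h]
    rw [h1f, h1f, one_div, one_div, inv_inj] at h'
    exact Real.exp_injective (by linarith)
  have hcongr : ∀ x ∈ (univ : Set ℝ), |Real.exp x / (1 + Real.exp x) ^ 2| • ((f x : ℂ) ^ (p - 1) *
      (1 - (f x : ℂ)) ^ (q - 1)) = betaKer 0 p q x := by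
    intro x _
    have hD := hpos x
    have hfx : 0 < f x := by simp only [hf]; positivity
    have hl : Real.log (f x) = x - Real.log (1 + Real.exp x) := by
      simp only [hf]; rw [Real.log_div (Real.exp_pos x).ne' hD.ne', Real.log_exp]
    have hl2 : Real.log (1 - f x) = - Real.log (1 + Real.exp x) := by
      rw [h1f, one_div, Real.log_inv]
    have hj : Real.exp x / (1 + Real.exp x) ^ 2 = Real.exp (x - 2 * Real.log (1 + Real.exp x)) := by
      rw [Real.exp_sub, two_mul, Real.exp_add, Real.exp_log hD, sq]
    rw [abs_of_pos (by positivity), Complex.real_smul, ofReal_cpow_eq_exp hfx,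
      ← Complex.ofReal_one, ← Complex.ofReal_sub, ofReal_cpow_eq_exp (by rw [h1f]; positivity), hl, hl2,
      hj, Complex.ofReal_exp, ← Complex.exp_add, ← Complex.exp_add, betaKer]
    congr 1
    simp only [betaD, Matrix.cons_val_zero]
    push_cast
    ring
  constructor
  · have h := (integrableOn_image_iff_integrableOn_abs_deriv_smul MeasurableSet.univ hd hinj
      (fun x : ℝ => (x : ℂ) ^ (p - 1) * (1 - (x : ℂ)) ^ (q - 1))).1
      (by rw [him]; exact integrableOn_beta hp hq)
    exact integrableOn_univ.1 (h.congr_fun hcongr MeasurableSet.univ)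
  · rw [betaIntegral_eq_setIntegral, ← him,
      integral_image_eq_integral_abs_deriv_smul MeasurableSet.univ hd hinj,
      setIntegral_congr_fun MeasurableSet.univ hcongr, setIntegral_univ]

lemma integrableOn_betaKer (J : Fin 3) {p q : ℂ} (hp : 0 < p.re) (hq : 0 < q.re)
    (hpq : p.re + q.re < 1) : IntegrableOn (betaKer J p q) (betaSet J) := by
  fin_cases J
  · exact (beta_logistic_substitution hp hq).1.integrableOn
  · exact (beta_exp_substitution hp hpq).1
  · exact (beta_reflect_substitution hq hpq).1

/-- The Beta integrals. -/
theorem betaJ_eq_integral (J : Fin 3) {p q : ℂ} (hp : 0 < p.re) (hq : 0 < q.re)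
    (hpq : p.re + q.re < 1) : betaJ J p q = ∫ x in betaSet J, betaKer J p q x := by
  have hr : 0 < (1 - p - q).re := by simp; linarith
  fin_cases J
  · show betaJ 0 p q = ∫ x in univ, betaKer 0 p q x
    have h := Gamma_mul_sinPi' (z := p + q) (by simp; linarith) (by simpa using hpq)
    have hb := Complex.Gamma_mul_Gamma_eq_betaIntegral hp hq
    have hs := Complex.Gamma_mul_Gamma_one_sub (p + q)
    have hne := Complex.Gamma_ne_zero_of_re_pos (s := p + q) (by simp; linarith)
    have hsn := sinPi_ne_zero (z := p + q) (by simp; linarith) (by simpa using hpq)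
    have hpi : (Real.pi : ℂ) ≠ 0 := by exact_mod_cast Real.pi_ne_zero
    rw [sinPi] at hsn
    rw [eq_div_iff hsn] at hs
    rw [setIntegral_univ, (beta_logistic_substitution hp hq).2]
    simp only [betaJ, betaW, Matrix.cons_val_zero]
    rw [hb, div_eq_iff hpi, sub_sub, sinPi]
    linear_combination Complex.betaIntegral p q * hs
  · show betaJ 1 p q = ∫ x in Iio (0 : ℝ), betaKer 1 p q x
    have h := Gamma_mul_sinPi' hq (by linarith)
    have hb := Complex.Gamma_mul_Gamma_eq_betaIntegral hp hr
    have hne := Complex.Gamma_ne_zero_of_re_pos (s := 1 - q) (by simp; linarith)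
    rw [(beta_exp_substitution hp hpq).2]
    rw [show p + (1 - p - q) = 1 - q by ring] at hb
    simp only [betaJ, betaW, Matrix.cons_val_one, Matrix.cons_val_zero]
    rw [eq_div_iff hne] at h
    linear_combination Complex.Gamma q * sinPi q / Real.pi * hb + Complex.betaIntegral p (1 - p - q) * h
  · show betaJ 2 p q = ∫ x in Ioi (0 : ℝ), betaKer 2 p q x
    have h := Gamma_mul_sinPi' hp (by linarith)
    have hb := Complex.Gamma_mul_Gamma_eq_betaIntegral hq hr
    have hne := Complex.Gamma_ne_zero_of_re_pos (s := 1 - p) (by simp; linarith)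
    rw [(beta_reflect_substitution hq hpq).2]
    rw [show q + (1 - p - q) = 1 - p by ring] at hb
    simp only [betaJ, betaW, Matrix.cons_val]
    rw [eq_div_iff hne] at h
    linear_combination Complex.Gamma p * sinPi p / Real.pi * hb + Complex.betaIntegral q (1 - p - q) * h

/-! ### The Barnes path -/

/-- The real part of `barnesPath`. -/
def barnesRe (μ : Fin 3 → ℂ) (t : ℝ) : ℝ := max (-(1 / 8)) (min (1 / 8) (1 + ‖μ‖ - |t|))

lemma barnesPath_eq (μ : Fin 3 → ℂ) (t : ℝ) : barnesPath μ t = barnesRe μ t + t * Complex.I := rfl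

@[simp] lemma barnesPath_re (μ : Fin 3 → ℂ) (t : ℝ) : (barnesPath μ t).re = barnesRe μ t := by
  simp [barnesPath_eq]

@[simp] lemma barnesPath_im (μ : Fin 3 → ℂ) (t : ℝ) : (barnesPath μ t).im = t := by
  simp [barnesPath_eq]

lemma neg_le_barnesRe (μ : Fin 3 → ℂ) (t : ℝ) : -(1 / 8) ≤ barnesRe μ t := le_max_left _ _

lemma barnesRe_le (μ : Fin 3 → ℂ) (t : ℝ) : barnesRe μ t ≤ 1 / 8 :=
  max_le (by norm_num) (min_le_left _ _)

lemma barnesRe_eq_of_le {μ : Fin 3 → ℂ} {t : ℝ} (h : |t| ≤ ‖μ‖ + 7 / 8) : barnesRe μ t = 1 / 8 := by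
  rw [barnesRe, min_eq_left (by linarith), max_eq_right (by norm_num)]

lemma barnesRe_eq_of_ge {μ : Fin 3 → ℂ} {t : ℝ} (h : ‖μ‖ + 9 / 8 ≤ |t|) :
    barnesRe μ t = -(1 / 8) := by
  rw [barnesRe, min_eq_right (by linarith), max_eq_left (by linarith)]

lemma barnesRe_eq_mid {μ : Fin 3 → ℂ} {t : ℝ} (h : ‖μ‖ + 7 / 8 ≤ |t|) (h' : |t| ≤ ‖μ‖ + 9 / 8) :
    barnesRe μ t = 1 + ‖μ‖ - |t| := by
  rw [barnesRe, min_eq_right (by linarith), max_eq_right (by linarith)]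

lemma barnesRe_eq_or (μ : Fin 3 → ℂ) (t : ℝ) : barnesRe μ t = 1 / 8 ∨ ‖μ‖ + 7 / 8 ≤ |t| := by
  rcases le_total |t| (‖μ‖ + 7 / 8) with h | h
  · exact Or.inl (barnesRe_eq_of_le h)
  · exact Or.inr h

lemma barnesRe_eq_neg_or (μ : Fin 3 → ℂ) (t : ℝ) :
    barnesRe μ t = -(1 / 8) ∨ |t| ≤ ‖μ‖ + 9 / 8 := by
  rcases le_total |t| (‖μ‖ + 9 / 8) with h | h
  · exact Or.inr h
  · exact Or.inl (barnesRe_eq_of_ge h)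

lemma continuous_barnesPath : Continuous (fun p : (Fin 3 → ℂ) × ℝ => barnesPath p.1 p.2) := by
  unfold barnesPath; fun_prop

lemma continuous_barnesPath_right (μ : Fin 3 → ℂ) : Continuous (barnesPath μ) := by
  unfold barnesPath; fun_prop

lemma lipschitzWith_barnesPath (μ : Fin 3 → ℂ) : LipschitzWith 2 (barnesPath μ) := by
  refine LipschitzWith.of_dist_le_mul fun s t => ?_
  have h1 : |barnesRe μ s - barnesRe μ t| ≤ |s - t| := by
    calc _ ≤ |min (1 / 8) (1 + ‖μ‖ - |s|) - min (1 / 8) (1 + ‖μ‖ - |t|)| := by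
          have := abs_max_sub_max_le_abs (min (1 / 8) (1 + ‖μ‖ - |s|)) (min (1 / 8) (1 + ‖μ‖ - |t|))
            (-(1 / 8))
          rwa [max_comm, max_comm (min (1 / 8) (1 + ‖μ‖ - |t|))] at this
      _ ≤ |(1 + ‖μ‖ - |s|) - (1 + ‖μ‖ - |t|)| := by
          have := abs_min_sub_min_le_max (1 / 8 : ℝ) (1 + ‖μ‖ - |s|) (1 / 8) (1 + ‖μ‖ - |t|)
          simpa using this
      _ = abs (|t| - |s|) := by congr 1; ring
      _ ≤ |t - s| := abs_abs_sub_abs_le_abs_sub _ _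
      _ = |s - t| := abs_sub_comm _ _
  rw [dist_eq_norm, dist_eq_norm, Real.norm_eq_abs, barnesPath_eq, barnesPath_eq]
  have : (barnesRe μ s : ℂ) + s * Complex.I - (barnesRe μ t + t * Complex.I) =
      ((barnesRe μ s - barnesRe μ t : ℝ) : ℂ) + ((s - t : ℝ) : ℂ) * Complex.I := by
    push_cast; ring
  rw [this]
  refine (norm_add_le _ _).trans ?_
  rw [norm_mul, Complex.norm_I, Complex.norm_real, Complex.norm_real, Real.norm_eq_abs,
    Real.norm_eq_abs]
  have : ((2 : NNReal) : ℝ) = 2 := rfl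
  rw [this]; linarith

lemma norm_deriv_barnesPath_le (μ : Fin 3 → ℂ) (t : ℝ) : ‖deriv (barnesPath μ) t‖ ≤ 2 := by
  simpa using norm_deriv_le_of_lipschitz (lipschitzWith_barnesPath μ) (x₀ := t)

lemma measurable_deriv_barnesPath :
    Measurable (fun p : (Fin 3 → ℂ) × ℝ => deriv (barnesPath p.1) p.2) :=
  measurable_deriv_with_param (f := barnesPath) continuous_barnesPath

lemma hasDerivAt_barnesPath {μ : Fin 3 → ℂ} {t : ℝ} (h1 : |t| ≠ ‖μ‖ + 7 / 8)
    (h2 : |t| ≠ ‖μ‖ + 9 / 8) : HasDerivAt (barnesPath μ) (deriv (barnesPath μ) t) t := by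
  refine DifferentiableAt.hasDerivAt ?_
  have hlin : DifferentiableAt ℝ (fun t : ℝ => (t : ℂ) * Complex.I) t :=
    (Complex.ofRealCLM.differentiableAt).mul_const _
  rcases lt_or_gt_of_ne h1 with h | h
  · have : barnesPath μ =ᶠ[𝓝 t] fun t => ((1 / 8 : ℝ) : ℂ) + t * Complex.I := by
      filter_upwards [continuous_abs.continuousAt.eventually_lt_const h] with x hx
      rw [barnesPath_eq, barnesRe_eq_of_le hx.le]
    rw [this.differentiableAt_iff]; exact hlin.const_add _
  rcases lt_or_gt_of_ne h2 with h' | h'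
  · have hμ := norm_nonneg μ
    have h0 : t ≠ 0 := by
      rintro rfl; simp at h; linarith
    have : barnesPath μ =ᶠ[𝓝 t] fun t => ((1 + ‖μ‖ - |t| : ℝ) : ℂ) + t * Complex.I := by
      filter_upwards [continuous_abs.continuousAt.eventually_lt_const h',
        continuous_abs.continuousAt.eventually_const_lt h] with x hx hx'
      rw [barnesPath_eq, barnesRe_eq_mid hx'.le hx.le]
    rw [this.differentiableAt_iff]
    refine DifferentiableAt.add ?_ hlin
    exact Complex.ofRealCLM.differentiableAt.comp t ((differentiableAt_abs h0).const_sub _)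
  · have : barnesPath μ =ᶠ[𝓝 t] fun t => ((-(1 / 8) : ℝ) : ℂ) + t * Complex.I := by
      filter_upwards [continuous_abs.continuousAt.eventually_const_lt h'] with x hx
      rw [barnesPath_eq, barnesRe_eq_of_ge hx.le]
    rw [this.differentiableAt_iff]; exact hlin.const_add _

lemma deriv_barnesPath_of_lt {μ : Fin 3 → ℂ} {t : ℝ} (h : |t| < ‖μ‖ + 7 / 8) :
    deriv (barnesPath μ) t = Complex.I := by
  have : barnesPath μ =ᶠ[𝓝 t] fun t => ((1 / 8 : ℝ) : ℂ) + t * Complex.I := by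
    filter_upwards [continuous_abs.continuousAt.eventually_lt_const h] with x hx
    rw [barnesPath_eq, barnesRe_eq_of_le hx.le]
  rw [this.deriv_eq]
  have h2 : HasDerivAt (fun t : ℝ => ((1 / 8 : ℝ) : ℂ) + t * Complex.I) (1 * Complex.I) t :=
    ((Complex.ofRealCLM.hasDerivAt (x := t)).mul_const Complex.I).const_add _
  simpa using h2.deriv

lemma barnesPath_of_le {μ : Fin 3 → ℂ} {t : ℝ} (h : |t| ≤ ‖μ‖ + 7 / 8) :
    barnesPath μ t = 1 / 8 + t * Complex.I := by
  rw [barnesPath_eq, barnesRe_eq_of_le h]; norm_num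

section Shift

variable {μ : Fin 3 → ℂ} {F : ℂ → ℂ} {g : ℝ → ℝ}

lemma integral_Ioi_barnesPath_sub_eq_zero {e : ℝ} (he : |e| = 1)
    (hF : ∀ s : ℂ, |s.re| < 1 / 4 → ‖μ‖ < e * s.im → DifferentiableAt ℂ F s)
    (hg : Tendsto g atTop (𝓝 0))
    (hFg : ∀ s : ℂ, |s.re| ≤ 1 / 8 → ‖μ‖ + 7 / 8 ≤ e * s.im → ‖F s‖ ≤ g (e * s.im))
    (hint : Integrable (fun t => F (barnesPath μ t) * deriv (barnesPath μ) t -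
      F (1 / 8 + t * Complex.I) * Complex.I)) :
    ∫ t in Ioi (0 : ℝ), (F (barnesPath μ (e * t)) * deriv (barnesPath μ) (e * t) -
      F (1 / 8 + (e * t : ℝ) * Complex.I) * Complex.I) = 0 := by
  have he2 : e * e = 1 := by
    have := abs_mul_abs_self e
    rw [he] at this; linarith
  have he0 : e ≠ 0 := by rintro rfl; simp at he
  have hμ := norm_nonneg μ
  set U : Set ℂ := {s | |s.re| < 1 / 4 ∧ ‖μ‖ < e * s.im} with hU
  have hUo : IsOpen U := by
    exact (isOpen_lt (Complex.continuous_re.abs) continuous_const).inter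
      (isOpen_lt continuous_const (continuous_const.mul Complex.continuous_im))
  have hUc : Convex ℝ U := by
    intro x hx y hy a b ha hb hab
    obtain ⟨hx1, hx2⟩ := hx
    obtain ⟨hy1, hy2⟩ := hy
    rw [abs_lt] at hx1 hy1
    have hb' : b = 1 - a := by linarith
    subst hb'
    have key : ∀ u v w : ℝ, u < w → v < w → a * u + (1 - a) * v < w := by
      intro u v w hu hv
      rcases ha.eq_or_lt with h | h
      · rw [← h]; linarith
      · nlinarith [mul_lt_mul_of_pos_left hu h, mul_le_mul_of_nonneg_left hv.le hb]
    refine ⟨abs_lt.2 ⟨?_, ?_⟩, ?_⟩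
    · have := key (-x.re) (-y.re) (1 / 4) (by linarith) (by linarith)
      simp; linarith
    · have := key x.re y.re (1 / 4) hx1.2 hy1.2
      simp; linarith
    · have := key (-(e * x.im)) (-(e * y.im)) (-‖μ‖) (by linarith) (by linarith)
      simp; linarith
  obtain ⟨P, hP⟩ := hUc.exists_forall_hasDerivWithinAt
    (fun s hs => (hF s hs.1 hs.2).differentiableWithinAt : DifferentiableOn ℂ F U)
  have hP' : ∀ s ∈ U, HasDerivAt P (F s) s := fun s hs => (hP s hs).hasDerivAt (hUo.mem_nhds hs)
  set f : ℝ → ℂ := fun t => F (barnesPath μ (e * t)) * deriv (barnesPath μ) (e * t) -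
      F (1 / 8 + (e * t : ℝ) * Complex.I) * Complex.I with hf
  have hfi : Integrable f := by
    have := hint.comp_mul_left' he0
    simpa [hf] using this
  set D : ℝ → ℂ := fun t => e * (P (barnesPath μ (e * t)) - P (1 / 8 + (e * t : ℝ) * Complex.I)) with hD
  have habs : ∀ t : ℝ, 0 ≤ t → |e * t| = t := fun t ht => by rw [abs_mul, he, one_mul, abs_of_nonneg ht]
  have hmem1 : ∀ t, ‖μ‖ < t → barnesPath μ (e * t) ∈ U := by
    intro t ht
    refine ⟨?_, ?_⟩
    · rw [barnesPath_re, abs_lt]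
      constructor <;> linarith [neg_le_barnesRe μ (e * t), barnesRe_le μ (e * t)]
    · rw [barnesPath_im, ← mul_assoc, he2, one_mul]; exact ht
  have hmem2 : ∀ t : ℝ, ‖μ‖ < t → (1 / 8 + (e * t : ℝ) * Complex.I : ℂ) ∈ U := by
    intro t ht
    refine ⟨?_, ?_⟩
    · norm_num
    · simp [← mul_assoc, he2]; exact ht
  have hline : ∀ t : ℝ, HasDerivAt (fun t : ℝ => (1 / 8 + (e * t : ℝ) * Complex.I : ℂ)) (e * Complex.I) t := by
    intro t
    have : HasDerivAt (fun t : ℝ => e * t) e t := by simpa using (hasDerivAt_id t).const_mul e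
    exact (this.ofReal_comp.mul_const Complex.I).const_add _
  have hDd : ∀ t, ‖μ‖ < t → t ≠ ‖μ‖ + 7 / 8 → t ≠ ‖μ‖ + 9 / 8 → HasDerivAt D (f t) t := by
    intro t ht h1 h2
    have ht0 : 0 ≤ t := by linarith
    have hb := hasDerivAt_barnesPath (μ := μ) (t := e * t) (by rwa [habs t ht0]) (by rwa [habs t ht0])
    have hm : HasDerivAt (fun t : ℝ => e * t) e t := by simpa using (hasDerivAt_id t).const_mul e
    have hb2 := hb.scomp t hm
    have h3 := (hP' _ (hmem1 t ht)).comp_of_eq t hb2 rfl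
    have h4 := (hP' _ (hmem2 t ht)).comp t (hline t)
    have h5 := (h3.sub h4).const_mul (e : ℂ)
    have he2' : (e : ℂ) * e = 1 := by exact_mod_cast he2
    convert! h5 using 1
    simp only [hf, Complex.real_smul]
    linear_combination (-(F (barnesPath μ (e * t)) * deriv (barnesPath μ) (e * t)) +
      F (1 / 8 + (e * t : ℝ) * Complex.I) * Complex.I) * he2'
  have hDc : ∀ t, ‖μ‖ < t → ContinuousAt D t := by
    intro t ht
    have h3 : ContinuousAt (fun t => P (barnesPath μ (e * t))) t :=
      ContinuousAt.comp (hP' _ (hmem1 t ht)).continuousAt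
        ((continuous_barnesPath_right μ).comp (continuous_const.mul continuous_id)).continuousAt
    have h4 : ContinuousAt (fun t : ℝ => P (1 / 8 + (e * t : ℝ) * Complex.I)) t :=
      ContinuousAt.comp (f := fun t : ℝ => (1 / 8 + (e * t : ℝ) * Complex.I : ℂ))
        (hP' _ (hmem2 t ht)).continuousAt (hline t).continuousAt
    exact (h3.sub h4).const_mul _
  have hDlim : Tendsto D atTop (𝓝 0) := by
    rw [tendsto_zero_iff_norm_tendsto_zero]
    refine squeeze_zero' (Eventually.of_forall fun t => norm_nonneg _) ?_ hg
    filter_upwards [eventually_ge_atTop (‖μ‖ + 9 / 8)] with t ht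
    have ht0 : 0 ≤ t := by linarith
    have hseg : ∀ s ∈ segment ℝ (1 / 8 + (e * t : ℝ) * Complex.I : ℂ) (barnesPath μ (e * t)),
        |s.re| ≤ 1 / 8 ∧ e * s.im = t := by
      rintro s ⟨a, b, ha, hb, hab, rfl⟩
      have hr : barnesRe μ (e * t) = -(1 / 8) := barnesRe_eq_of_ge (by rw [habs t ht0]; exact ht)
      constructor
      · have : (a • (1 / 8 + (e * t : ℝ) * Complex.I : ℂ) + b • barnesPath μ (e * t)).re =
            a * (1 / 8) + b * (-(1 / 8)) := by
          simp [hr]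
        rw [this, abs_le]
        constructor <;> linarith
      · have : (a • (1 / 8 + (e * t : ℝ) * Complex.I : ℂ) + b • barnesPath μ (e * t)).im =
            (a + b) * (e * t) := by
          simp; ring
        rw [this, hab, one_mul, ← mul_assoc, he2, one_mul]
    have hb := Convex.norm_image_sub_le_of_norm_hasDerivWithin_le (𝕜 := ℂ) (f := P) (f' := F) (C := g t)
      (s := segment ℝ (1 / 8 + (e * t : ℝ) * Complex.I : ℂ) (barnesPath μ (e * t)))
      (fun s hs => (hP' s ⟨lt_of_le_of_lt (hseg s hs).1 (by norm_num),
        by rw [(hseg s hs).2]; linarith⟩).hasDerivWithinAt)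
      (fun s hs => by
        have := hFg s (hseg s hs).1 (by rw [(hseg s hs).2]; linarith)
        rwa [(hseg s hs).2] at this)
      (convex_segment _ _) (left_mem_segment ℝ _ _) (right_mem_segment ℝ _ _)
    have hn : ‖barnesPath μ (e * t) - (1 / 8 + (e * t : ℝ) * Complex.I : ℂ)‖ ≤ 1 := by
      have : barnesPath μ (e * t) - (1 / 8 + (e * t : ℝ) * Complex.I : ℂ) = ((-(1/4) : ℝ) : ℂ) := by
        rw [barnesPath_eq, barnesRe_eq_of_ge (by rw [habs t ht0]; exact ht)]; push_cast; ring
      rw [this, Complex.norm_real]; norm_num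
    have hg0 : 0 ≤ g t := by
      have := hFg (1 / 8 + (e * t : ℝ) * Complex.I) (by norm_num) (by
        simp [← mul_assoc, he2]; linarith)
      have h2 := (norm_nonneg _).trans this
      simpa [← mul_assoc, he2] using h2
    have : ‖D t‖ = ‖P (barnesPath μ (e * t)) - P (1 / 8 + (e * t : ℝ) * Complex.I)‖ := by
      rw [hD, norm_mul, Complex.norm_real, Real.norm_eq_abs, he, one_mul]
    rw [this]
    exact hb.trans (mul_le_of_le_one_right hg0 hn)
  have hA : ∫ t in Ioc 0 (‖μ‖ + 7 / 8), f t = 0 := by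
    rw [integral_Ioc_eq_integral_Ioo]
    refine setIntegral_eq_zero_of_forall_eq_zero fun t ht => ?_
    have h1 : |e * t| < ‖μ‖ + 7 / 8 := by rw [habs t ht.1.le]; exact ht.2
    simp only [hf]
    rw [deriv_barnesPath_of_lt h1, barnesPath_of_le h1.le, sub_self]
  have hD0 : D (‖μ‖ + 7 / 8) = 0 := by
    have h1 : |e * (‖μ‖ + 7 / 8)| ≤ ‖μ‖ + 7 / 8 := by rw [habs _ (by positivity)]
    simp only [hD]
    rw [barnesPath_of_le h1, sub_self, mul_zero]
  have hB : ∫ t in Ioc (‖μ‖ + 7 / 8) (‖μ‖ + 9 / 8), f t = D (‖μ‖ + 9 / 8) := by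
    rw [← intervalIntegral.integral_of_le (by linarith)]
    rw [intervalIntegral.integral_eq_sub_of_hasDerivAt_of_le (by linarith) (f := D), hD0, sub_zero]
    · exact fun t ht => (hDc t (by linarith [ht.1])).continuousWithinAt
    · exact fun t ht => hDd t (by linarith [ht.1]) ht.1.ne' ht.2.ne
    · exact hfi.intervalIntegrable
  have hC : ∫ t in Ioi (‖μ‖ + 9 / 8), f t = 0 - D (‖μ‖ + 9 / 8) := by
    refine integral_Ioi_of_hasDerivAt_of_tendsto (hDc _ (by linarith)).continuousWithinAt
      (fun t ht => hDd t ?_ ?_ ?_) hfi.integrableOn hDlim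
    · linarith [mem_Ioi.1 ht]
    · have := mem_Ioi.1 ht
      intro h; linarith
    · exact (mem_Ioi.1 ht).ne'
  rw [← Ioc_union_Ioi_eq_Ioi (a := (0 : ℝ)) (b := ‖μ‖ + 7 / 8) (by positivity),
    setIntegral_union (Set.Ioc_disjoint_Ioi le_rfl) measurableSet_Ioi hfi.integrableOn hfi.integrableOn, hA,
    ← Ioc_union_Ioi_eq_Ioi (a := ‖μ‖ + 7 / 8) (b := ‖μ‖ + 9 / 8) (by linarith),
    setIntegral_union (Set.Ioc_disjoint_Ioi le_rfl) measurableSet_Ioi hfi.integrableOn hfi.integrableOn, hB, hC]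
  ring

/-- Shifting the Barnes path to the line `Re s = 1 / 8`. -/
theorem integral_barnesPath_eq
    (hF : ∀ s : ℂ, |s.re| < 1 / 4 → ‖μ‖ < |s.im| → DifferentiableAt ℂ F s)
    (hg : Tendsto g atTop (𝓝 0))
    (hFg : ∀ s : ℂ, |s.re| ≤ 1 / 8 → ‖μ‖ + 7 / 8 ≤ |s.im| → ‖F s‖ ≤ g |s.im|)
    (h1 : Integrable (fun t => F (barnesPath μ t) * deriv (barnesPath μ) t))
    (h2 : Integrable (fun t : ℝ => F (1 / 8 + t * Complex.I))) :
    ∫ t, F (barnesPath μ t) * deriv (barnesPath μ) t =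
      ∫ t : ℝ, F (1 / 8 + t * Complex.I) * Complex.I := by
  have hint : Integrable (fun t => F (barnesPath μ t) * deriv (barnesPath μ) t -
      F (1 / 8 + t * Complex.I) * Complex.I) := h1.sub (h2.mul_const Complex.I)
  have hμ := norm_nonneg μ
  rw [← sub_eq_zero, ← integral_sub h1 (h2.mul_const _),
    ← intervalIntegral.integral_Iic_add_Ioi (b := 0) hint.integrableOn hint.integrableOn]
  have hp := integral_Ioi_barnesPath_sub_eq_zero (μ := μ) (F := F) (g := g) (e := 1) (by norm_num)
    (fun s hs hs' => hF s hs (by rw [one_mul] at hs'; exact hs'.trans_le (le_abs_self _))) hg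
    (fun s hs hs' => by
      rw [one_mul] at hs' ⊢
      have := hFg s hs (hs'.trans (le_abs_self _))
      rwa [abs_of_nonneg (by linarith)] at this) hint
  have hn := integral_Ioi_barnesPath_sub_eq_zero (μ := μ) (F := F) (g := g) (e := -1) (by norm_num)
    (fun s hs hs' => hF s hs (by rw [neg_one_mul] at hs'; exact hs'.trans_le (neg_le_abs _))) hg
    (fun s hs hs' => by
      rw [neg_one_mul] at hs' ⊢
      have := hFg s hs (hs'.trans (neg_le_abs _))
      rwa [abs_of_nonpos (by linarith)] at this) hint
  simp only [one_mul, neg_one_mul] at hp hn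
  rw [hp, add_zero, ← neg_zero, ← integral_comp_neg_Ioi (0 : ℝ) (fun t : ℝ => F (barnesPath μ t) * deriv (barnesPath μ) t -
      F (1 / 8 + t * Complex.I) * Complex.I), hn]

end Shift

/-! ### The building blocks of the long element kernel -/

/-- A product of rotated Gamma functions and a beta function. -/
def termFn (a : Fin 4 → ℝ) (J : Fin 3) (σ : Equiv.Perm (Fin 3)) (μ : Fin 3 → ℂ) (s₁ s₂ : ℂ) : ℂ :=
  rGamma (a 0) (s₁ - μ (σ 0)) * rGamma (a 1) (s₁ - μ (σ 1)) *
    (rGamma (a 2) (s₂ + μ (σ 0)) * rGamma (a 3) (s₂ + μ (σ 1))) *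
    betaJ J (s₁ - μ (σ 2)) (s₂ + μ (σ 2))

/-- The Mellin-Barnes integrand of `termFn`, pulled back along the paths. -/
def termIntegrand (a : Fin 4 → ℝ) (J : Fin 3) (σ : Equiv.Perm (Fin 3)) (Y₁ Y₂ : ℝ) (μ : Fin 3 → ℂ)
    (t : ℝ × ℝ) : ℂ :=
  Complex.exp (-(barnesPath μ t.1 * Y₁)) * Complex.exp (-(barnesPath μ t.2 * Y₂)) *
    termFn a J σ μ (barnesPath μ t.1) (barnesPath μ t.2) *
    (deriv (barnesPath μ) t.1 * deriv (barnesPath μ) t.2) / (2 * Real.pi * Complex.I) ^ 2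

/-- The Mellin-Barnes integral of `termFn`. -/
def termKernel (a : Fin 4 → ℝ) (J : Fin 3) (σ : Equiv.Perm (Fin 3)) (Y₁ Y₂ : ℝ) (μ : Fin 3 → ℂ) : ℂ :=
  ∫ t : ℝ × ℝ, termIntegrand a J σ Y₁ Y₂ μ t

lemma norm_sinPi_le (z : ℂ) : ‖sinPi z‖ ≤ Real.exp (Real.pi * |z.im|) := by
  have h : ∀ w : ℂ, ‖Complex.exp (w * Complex.I)‖ ≤ Real.exp |w.im| := by
    intro w
    rw [Complex.norm_exp]
    apply Real.exp_le_exp.2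
    simp only [Complex.mul_re, Complex.I_re, Complex.I_im, mul_zero, mul_one, zero_sub]
    exact neg_le_abs _
  have h1 := h (-(Real.pi * z))
  have h2 := h (Real.pi * z)
  have him : |(Real.pi * z : ℂ).im| = Real.pi * |z.im| := by
    rw [Complex.im_ofReal_mul, abs_mul, abs_of_pos Real.pi_pos]
  rw [Complex.neg_im, abs_neg, him] at h1
  rw [him] at h2
  rw [sinPi, Complex.sin, norm_div, norm_mul, Complex.norm_I, mul_one]
  have : ‖(2 : ℂ)‖ = 2 := by norm_num
  rw [this]
  have := norm_sub_le (Complex.exp (-(Real.pi * z) * Complex.I)) (Complex.exp (Real.pi * z * Complex.I))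
  linarith

lemma measurable_sinPi : Measurable sinPi := by unfold sinPi; fun_prop

lemma abs_betaW_im_le (J : Fin 3) (p q : ℂ) :
    2 * |(betaW J p q).im| ≤ |p.im| + |q.im| + |p.im + q.im| := by
  have h1 := abs_add_le p.im q.im
  have h2 := abs_sub (p.im + q.im) p.im
  have h3 := abs_sub (p.im + q.im) q.im
  fin_cases J
  · show 2 * |(p + q).im| ≤ _
    rw [Complex.add_im]; linarith
  · show 2 * |q.im| ≤ _
    rw [add_sub_cancel_left] at h2; linarith
  · show 2 * |p.im| ≤ _
    rw [add_sub_cancel_right] at h3; linarith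

lemma norm_betaJ_le (J : Fin 3) {p q : ℂ} (hp1 : -(1 / 8) ≤ p.re) (hp2 : p.re ≤ 1 / 8)
    (hp3 : p.re = 1 / 8 ∨ 7 / 8 ≤ |p.im|) (hq1 : -(1 / 8) ≤ q.re) (hq2 : q.re ≤ 1 / 8)
    (hq3 : q.re = 1 / 8 ∨ 7 / 8 ≤ |q.im|) :
    ‖betaJ J p q‖ ≤ stirlingConst ^ 3 * ((1 + |p.im|) ^ (p.re - 1 / 2) * (1 + |q.im|) ^ (q.re - 1 / 2) *
      (1 + |p.im + q.im|) ^ (3 / 4 : ℝ)) := by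
  have hC := one_le_stirlingConst
  have g1 := norm_Gamma_le_stirling hp1 (by linarith) (hp3.imp_left fun h => by rw [h]; norm_num)
  have g2 := norm_Gamma_le_stirling hq1 (by linarith) (hq3.imp_left fun h => by rw [h]; norm_num)
  have hre : (1 - p - q).re = 1 - p.re - q.re := by simp
  have him : |(1 - p - q).im| = |p.im + q.im| := by
    rw [← abs_neg]; congr 1; simp; ring
  have g3 := norm_Gamma_le_stirling (z := 1 - p - q) (by rw [hre]; linarith) (by rw [hre]; linarith)
    (Or.inl (by rw [hre]; linarith))
  have g4 := norm_sinPi_le (betaW J p q)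
  have g5 := abs_betaW_im_le J p q
  rw [hre, him] at g3
  have g3' : ‖Complex.Gamma (1 - p - q)‖ ≤ stirlingConst * ((1 + |p.im + q.im|) ^ (3 / 4 : ℝ) *
      Real.exp (-(Real.pi / 2 * |p.im + q.im|))) := by
    refine g3.trans ?_
    gcongr
    · linarith [abs_nonneg (p.im + q.im)]
    · linarith
  rw [betaJ, norm_div, norm_mul, norm_mul, norm_mul, Complex.norm_real, Real.norm_eq_abs,
    abs_of_pos Real.pi_pos]
  refine (div_le_self (by positivity) (by linarith [Real.pi_gt_three])).trans ?_
  have hexp : Real.exp (-(Real.pi / 2 * |p.im|)) * Real.exp (-(Real.pi / 2 * |q.im|)) *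
      Real.exp (-(Real.pi / 2 * |p.im + q.im|)) * Real.exp (Real.pi * |(betaW J p q).im|) ≤ 1 := by
    rw [← Real.exp_add, ← Real.exp_add, ← Real.exp_add, Real.exp_le_one_iff]
    nlinarith [Real.pi_pos]
  calc _ ≤ (stirlingConst * ((1 + |p.im|) ^ (p.re - 1 / 2) * Real.exp (-(Real.pi / 2 * |p.im|)))) *
      (stirlingConst * ((1 + |q.im|) ^ (q.re - 1 / 2) * Real.exp (-(Real.pi / 2 * |q.im|)))) *
      (stirlingConst * ((1 + |p.im + q.im|) ^ (3 / 4 : ℝ) *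
      Real.exp (-(Real.pi / 2 * |p.im + q.im|)))) * Real.exp (Real.pi * |(betaW J p q).im|) := by
        gcongr
    _ = stirlingConst ^ 3 * ((1 + |p.im|) ^ (p.re - 1 / 2) * (1 + |q.im|) ^ (q.re - 1 / 2) *
      (1 + |p.im + q.im|) ^ (3 / 4 : ℝ)) * (Real.exp (-(Real.pi / 2 * |p.im|)) * Real.exp (-(Real.pi / 2 * |q.im|)) *
      Real.exp (-(Real.pi / 2 * |p.im + q.im|)) * Real.exp (Real.pi * |(betaW J p q).im|)) := by ring
    _ ≤ _ := mul_le_of_le_one_right (by positivity) hexp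

lemma measurable_betaW (J : Fin 3) : Measurable (fun x : ℂ × ℂ => betaW J x.1 x.2) := by
  fin_cases J
  · exact measurable_fst.add measurable_snd
  · exact measurable_snd
  · exact measurable_fst

lemma measurable_betaJ (J : Fin 3) : Measurable (fun x : ℂ × ℂ => betaJ J x.1 x.2) := by
  unfold betaJ
  refine Measurable.div_const ?_ _
  refine (((measurable_Gamma.comp measurable_fst).mul (measurable_Gamma.comp measurable_snd)).mul
    (measurable_Gamma.comp ?_)).mul (measurable_sinPi.comp (measurable_betaW J))
  fun_prop

lemma measurable_termFn (a : Fin 4 → ℝ) (J : Fin 3) (σ : Equiv.Perm (Fin 3)) :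
    Measurable (fun x : (Fin 3 → ℂ) × ℂ × ℂ => termFn a J σ x.1 x.2.1 x.2.2) := by
  unfold termFn
  refine ((((measurable_rGamma _).comp ?_).mul ((measurable_rGamma _).comp ?_)).mul
    (((measurable_rGamma _).comp ?_).mul ((measurable_rGamma _).comp ?_))).mul
    ((measurable_betaJ J).comp (f := fun x : (Fin 3 → ℂ) × ℂ × ℂ => (x.2.1 - x.1 (σ 2), x.2.2 + x.1 (σ 2))) ?_) <;>
  fun_prop

lemma measurable_termIntegrand (a : Fin 4 → ℝ) (J : Fin 3) (σ : Equiv.Perm (Fin 3)) (Y₁ Y₂ : ℝ) :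
    Measurable (fun x : (Fin 3 → ℂ) × ℝ × ℝ => termIntegrand a J σ Y₁ Y₂ x.1 x.2) := by
  have e1 : Measurable (fun x : (Fin 3 → ℂ) × ℝ × ℝ => (x.1, x.2.1)) := by fun_prop
  have e2 : Measurable (fun x : (Fin 3 → ℂ) × ℝ × ℝ => (x.1, x.2.2)) := by fun_prop
  have hb := continuous_barnesPath.measurable
  have h1 := hb.comp e1
  have h2 := hb.comp e2
  have h3 := measurable_deriv_barnesPath.comp e1
  have h4 := measurable_deriv_barnesPath.comp e2
  have h5 : Measurable (fun x : (Fin 3 → ℂ) × ℝ × ℝ =>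
      (x.1, barnesPath x.1 x.2.1, barnesPath x.1 x.2.2)) := measurable_fst.prodMk (h1.prodMk h2)
  have h6 := (measurable_termFn a J σ).comp h5
  simp only [Function.comp_def] at h1 h2 h3 h4 h6
  have h7 : Measurable (fun x : (Fin 3 → ℂ) × ℝ × ℝ =>
      Complex.exp (-(barnesPath x.1 x.2.1 * Y₁)) * Complex.exp (-(barnesPath x.1 x.2.2 * Y₂))) := by
    fun_prop
  exact ((h7.mul h6).mul (h3.mul h4)).div_const _

/-- The decay of a `termFn` in one of its two variables. -/
def termWeight (κ : ℝ) (τ₀ τ₁ τ₂ ρ t : ℝ) : ℝ :=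
  (1 + |t - τ₀|) ^ (ρ - 1 / 2) * (1 + |t - τ₁|) ^ (ρ - 1 / 2) * (1 + |t - τ₂|) ^ (ρ - 1 / 2) *
    Real.exp (-(κ * |t - τ₀|)) * (1 + |t|) ^ (3 / 4 : ℝ)

lemma termWeight_nonneg (κ τ₀ τ₁ τ₂ ρ t : ℝ) : 0 ≤ termWeight κ τ₀ τ₁ τ₂ ρ t := by
  unfold termWeight; positivity

lemma abs_im_le_norm (μ : Fin 3 → ℂ) (j : Fin 3) : |(μ j).im| ≤ ‖μ‖ :=
  (Complex.abs_im_le_norm _).trans (norm_le_pi_norm μ j)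

/-- The points near the path of integration which are at a distance from the poles. -/
def nearPath (μ : Fin 3 → ℂ) : Set ℂ :=
  {s | |s.re| ≤ 1 / 8 ∧ (s.re = 1 / 8 ∨ ‖μ‖ + 7 / 8 ≤ |s.im|)}

lemma barnesPath_mem_nearPath (μ : Fin 3 → ℂ) (t : ℝ) : barnesPath μ t ∈ nearPath μ := by
  refine ⟨?_, ?_⟩
  · rw [barnesPath_re, abs_le]; exact ⟨neg_le_barnesRe μ t, barnesRe_le μ t⟩
  · rw [barnesPath_re, barnesPath_im]; exact barnesRe_eq_or μ t

lemma line_mem_nearPath (μ : Fin 3 → ℂ) (t : ℝ) : (1 / 8 + t * Complex.I : ℂ) ∈ nearPath μ := by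
  constructor <;> norm_num

lemma nearPath_aux {μ : Fin 3 → ℂ} {s c : ℂ} (hs : s ∈ nearPath μ) (hc : c.re = 0)
    (hc' : |c.im| ≤ ‖μ‖) :
    -(1 / 8) ≤ (s + c).re ∧ (s + c).re ≤ 1 / 8 ∧ ((s + c).re = 1 / 8 ∨ 7 / 8 ≤ |(s + c).im|) := by
  obtain ⟨h1, h2⟩ := hs
  rw [abs_le] at h1
  rw [Complex.add_re, hc, add_zero, Complex.add_im]
  refine ⟨h1.1, h1.2, h2.imp_right fun h => ?_⟩
  have := abs_sub (s.im + c.im) c.im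
  rw [add_sub_cancel_right] at this
  linarith

lemma norm_termFn_le {a : Fin 4 → ℝ} (ha : ∀ j, |a j| ≤ Real.pi / 2) (J : Fin 3)
    (σ : Equiv.Perm (Fin 3)) {μ : Fin 3 → ℂ} (hμ : μ ∈ iaStar) {s₁ s₂ : ℂ} (h1 : s₁ ∈ nearPath μ)
    (h2 : s₂ ∈ nearPath μ) :
    ‖termFn a J σ μ s₁ s₂‖ ≤ stirlingConst ^ 7 *
      (termWeight (Real.pi / 2 - |a 0|) (μ (σ 0)).im (μ (σ 1)).im (μ (σ 2)).im s₁.re s₁.im *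
      termWeight (Real.pi / 2 - |a 2|) (-(μ (σ 0)).im) (-(μ (σ 1)).im) (-(μ (σ 2)).im) s₂.re s₂.im) := by
  have hC := one_le_stirlingConst
  have key : ∀ (b : ℝ) (s c : ℂ), s ∈ nearPath μ → c.re = 0 → |c.im| ≤ ‖μ‖ →
      ‖rGamma b (s + c)‖ ≤ stirlingConst * ((1 + |s.im + c.im|) ^ (s.re - 1 / 2) *
      Real.exp (-((Real.pi / 2 - |b|) * |s.im + c.im|))) := by
    intro b s c hs hc hc'
    obtain ⟨k1, k2, k3⟩ := nearPath_aux hs hc hc'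
    have := norm_rGamma_le (a := b) k1 (by linarith) (k3.imp_left fun h => by rw [h]; norm_num)
    simpa [hc] using this
  have key' : ∀ (b : ℝ) (s c : ℂ), |b| ≤ Real.pi / 2 → s ∈ nearPath μ → c.re = 0 → |c.im| ≤ ‖μ‖ →
      ‖rGamma b (s + c)‖ ≤ stirlingConst * ((1 + |s.im + c.im|) ^ (s.re - 1 / 2)) := by
    intro b s c hb hs hc hc'
    refine (key b s c hs hc hc').trans ?_
    gcongr
    refine mul_le_of_le_one_right (by positivity) (Real.exp_le_one_iff.2 ?_)
    have := mul_nonneg (sub_nonneg.2 hb) (abs_nonneg (s.im + c.im))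
    linarith
  have hn : ∀ j, (-μ j).re = 0 ∧ |(-μ j).im| ≤ ‖μ‖ := fun j =>
    ⟨by simp [hμ.1 j], by simpa using abs_im_le_norm μ j⟩
  have hn' : ∀ j, (μ j).re = 0 ∧ |(μ j).im| ≤ ‖μ‖ := fun j => ⟨hμ.1 j, abs_im_le_norm μ j⟩
  have k0 := key (a 0) s₁ (-μ (σ 0)) h1 (hn _).1 (hn _).2
  have k1 := key' (a 1) s₁ (-μ (σ 1)) (ha _) h1 (hn _).1 (hn _).2
  have k2 := key (a 2) s₂ (μ (σ 0)) h2 (hn' _).1 (hn' _).2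
  have k3 := key' (a 3) s₂ (μ (σ 1)) (ha _) h2 (hn' _).1 (hn' _).2
  obtain ⟨p1, p2, p3⟩ := nearPath_aux h1 (hn (σ 2)).1 (hn (σ 2)).2
  obtain ⟨q1, q2, q3⟩ := nearPath_aux h2 (hn' (σ 2)).1 (hn' (σ 2)).2
  have kb := norm_betaJ_le J p1 p2 p3 q1 q2 q3
  simp only [Complex.add_re, Complex.add_im, Complex.neg_re, Complex.neg_im, hμ.1, neg_zero,
    add_zero] at k0 k1 k2 k3 kb
  have hsum : (1 + |s₁.im + -(μ (σ 2)).im + (s₂.im + (μ (σ 2)).im)|) ^ (3 / 4 : ℝ) ≤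
      (1 + |s₁.im|) ^ (3 / 4 : ℝ) * (1 + |s₂.im|) ^ (3 / 4 : ℝ) := by
    rw [← Real.mul_rpow (by positivity) (by positivity)]
    refine Real.rpow_le_rpow (by positivity) ?_ (by norm_num)
    have : s₁.im + -(μ (σ 2)).im + (s₂.im + (μ (σ 2)).im) = s₁.im + s₂.im := by ring
    rw [this]
    nlinarith [abs_add_le s₁.im s₂.im, abs_nonneg s₁.im, abs_nonneg s₂.im,
      mul_nonneg (abs_nonneg s₁.im) (abs_nonneg s₂.im)]
  rw [termFn]
  simp only [sub_eq_add_neg, norm_mul] at *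
  calc _ ≤ (stirlingConst * ((1 + |s₁.im + -(μ (σ 0)).im|) ^ (s₁.re + -(1 / 2)) *
      Real.exp (-((Real.pi / 2 + -|a 0|) * |s₁.im + -(μ (σ 0)).im|)))) *
      (stirlingConst * ((1 + |s₁.im + -(μ (σ 1)).im|) ^ (s₁.re + -(1 / 2)))) *
      ((stirlingConst * ((1 + |s₂.im + (μ (σ 0)).im|) ^ (s₂.re + -(1 / 2)) *
      Real.exp (-((Real.pi / 2 + -|a 2|) * |s₂.im + (μ (σ 0)).im|)))) *
      (stirlingConst * ((1 + |s₂.im + (μ (σ 1)).im|) ^ (s₂.re + -(1 / 2))))) *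
      (stirlingConst ^ 3 * ((1 + |s₁.im + -(μ (σ 2)).im|) ^ (s₁.re + -(1 / 2)) *
        (1 + |s₂.im + (μ (σ 2)).im|) ^ (s₂.re + -(1 / 2)) *
      ((1 + |s₁.im|) ^ (3 / 4 : ℝ) * (1 + |s₂.im|) ^ (3 / 4 : ℝ)))) := by
        gcongr
        refine kb.trans ?_
        gcongr
    _ = _ := by simp only [termWeight, sub_eq_add_neg, neg_neg]; ring

lemma pathFactor_le {μ : Fin 3 → ℂ} {τ : ℝ} (hτ : |τ| ≤ ‖μ‖) (t : ℝ) :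
    (1 + |t - τ|) ^ (barnesRe μ t - 1 / 2) ≤ 3 * (1 + ‖μ‖) * (1 + |t|) ^ (-(5 / 8) : ℝ) := by
  have hμ := norm_nonneg μ
  have hpos : 0 < (1 + |t|) ^ (5 / 8 : ℝ) := by positivity
  rw [Real.rpow_neg (by positivity), ← div_eq_mul_inv, le_div_iff₀ hpos]
  have hsub : (1 + ‖μ‖) ^ (5 / 8 : ℝ) ≤ 1 + ‖μ‖ := by
    have := Real.rpow_le_rpow_of_exponent_le (x := 1 + ‖μ‖) (y := 5 / 8) (z := 1) (by linarith) (by norm_num)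
    simpa using this
  rcases barnesRe_eq_neg_or μ t with h | h
  · have : (barnesRe μ t - 1 / 2) = -(5 / 8) := by rw [h]; norm_num
    rw [this, Real.rpow_neg (by positivity), inv_mul_le_iff₀ (by positivity)]
    calc (1 + |t|) ^ (5 / 8 : ℝ) ≤ ((1 + |t - τ|) * (1 + ‖μ‖)) ^ (5 / 8 : ℝ) := by
          refine Real.rpow_le_rpow (by positivity) ?_ (by norm_num)
          have := abs_add_le (t - τ) τ
          rw [sub_add_cancel] at this
          nlinarith [abs_nonneg (t - τ)]
      _ = (1 + |t - τ|) ^ (5 / 8 : ℝ) * (1 + ‖μ‖) ^ (5 / 8 : ℝ) :=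
          Real.mul_rpow (by positivity) (by positivity)
      _ ≤ (1 + |t - τ|) ^ (5 / 8 : ℝ) * (3 * (1 + ‖μ‖)) := by
          gcongr; linarith
  · have h1 : (1 + |t - τ|) ^ (barnesRe μ t - 1 / 2) ≤ 1 :=
      Real.rpow_le_one_of_one_le_of_nonpos (by linarith [abs_nonneg (t - τ)])
        (by linarith [barnesRe_le μ t])
    have h2 : (1 + |t|) ^ (5 / 8 : ℝ) ≤ 3 * (1 + ‖μ‖) := by
      have := Real.rpow_le_rpow_of_exponent_le (x := 1 + |t|) (y := 5 / 8) (z := 1)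
        (by linarith [abs_nonneg t]) (by norm_num)
      rw [Real.rpow_one] at this
      linarith
    calc _ ≤ 1 * (3 * (1 + ‖μ‖)) := mul_le_mul h1 h2 hpos.le zero_le_one
      _ = _ := one_mul _

lemma termWeight_path_le {κ : ℝ} (hκ : 0 ≤ κ) {μ : Fin 3 → ℂ} {τ₀ τ₁ τ₂ : ℝ} (h0 : |τ₀| ≤ ‖μ‖)
    (h1 : |τ₁| ≤ ‖μ‖) (h2 : |τ₂| ≤ ‖μ‖) (t : ℝ) :
    termWeight κ τ₀ τ₁ τ₂ (barnesRe μ t) t ≤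
      27 * (1 + ‖μ‖) ^ 3 * (1 + |t|) ^ (-(9 / 8) : ℝ) := by
  have he : Real.exp (-(κ * |t - τ₀|)) ≤ 1 := by
    rw [Real.exp_le_one_iff]; have := mul_nonneg hκ (abs_nonneg (t - τ₀)); linarith
  calc _ ≤ (3 * (1 + ‖μ‖) * (1 + |t|) ^ (-(5 / 8) : ℝ)) * (3 * (1 + ‖μ‖) * (1 + |t|) ^ (-(5 / 8) : ℝ)) *
      (3 * (1 + ‖μ‖) * (1 + |t|) ^ (-(5 / 8) : ℝ)) * 1 * (1 + |t|) ^ (3 / 4 : ℝ) := by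
        unfold termWeight
        gcongr
        · exact pathFactor_le h0 t
        · exact pathFactor_le h1 t
        · exact pathFactor_le h2 t
    _ = 27 * (1 + ‖μ‖) ^ 3 * ((1 + |t|) ^ (-(5 / 8) : ℝ) * (1 + |t|) ^ (-(5 / 8) : ℝ) *
      (1 + |t|) ^ (-(5 / 8) : ℝ) * (1 + |t|) ^ (3 / 4 : ℝ)) := by ring
    _ = _ := by
      rw [← Real.rpow_add (by positivity), ← Real.rpow_add (by positivity),
        ← Real.rpow_add (by positivity)]
      norm_num

lemma termWeight_le {κ τ₀ τ₁ τ₂ ρ t : ℝ} (hρ : ρ ≤ 1 / 8) :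
    termWeight κ τ₀ τ₁ τ₂ ρ t ≤ (1 + |t|) * Real.exp (-(κ * |t - τ₀|)) := by
  have h : ∀ τ, (1 + |t - τ|) ^ (ρ - 1 / 2) ≤ 1 := fun τ =>
    Real.rpow_le_one_of_one_le_of_nonpos (by linarith [abs_nonneg (t - τ)]) (by linarith)
  have h2 : (1 + |t|) ^ (3 / 4 : ℝ) ≤ 1 + |t| := by
    have := Real.rpow_le_rpow_of_exponent_le (x := 1 + |t|) (y := 3 / 4) (z := 1)
        (by linarith [abs_nonneg t]) (by norm_num)
    rwa [Real.rpow_one] at this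
  calc _ ≤ 1 * 1 * 1 * Real.exp (-(κ * |t - τ₀|)) * (1 + |t|) := by
        unfold termWeight
        gcongr
        · exact h _
        · exact h _
        · exact h _
    _ = _ := by ring

/-- Shifting both Barnes paths to the line `Re s = 1 / 8`. -/
theorem integral_barnesPath_prod_eq {μ : Fin 3 → ℂ} {F : ℂ → ℂ → ℂ} {C κ : ℝ} (hκ : 0 < κ)
    (hm : Measurable (fun x : ℂ × ℂ => F x.1 x.2))
    (hF1 : ∀ s₂ ∈ nearPath μ, ∀ s : ℂ, |s.re| < 1 / 4 → ‖μ‖ < |s.im| →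
      DifferentiableAt ℂ (fun s => F s s₂) s)
    (hF2 : ∀ s₁ ∈ nearPath μ, ∀ s : ℂ, |s.re| < 1 / 4 → ‖μ‖ < |s.im| →
      DifferentiableAt ℂ (fun s => F s₁ s) s)
    (hC : ∀ s₁ ∈ nearPath μ, ∀ s₂ ∈ nearPath μ,
      ‖F s₁ s₂‖ ≤ C * (Real.exp (-(κ * |s₁.im|)) * Real.exp (-(κ * |s₂.im|)))) :
    ∫ t : ℝ × ℝ, F (barnesPath μ t.1) (barnesPath μ t.2) *
      (deriv (barnesPath μ) t.1 * deriv (barnesPath μ) t.2) =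
    -∫ t : ℝ × ℝ, F (1 / 8 + t.1 * Complex.I) (1 / 8 + t.2 * Complex.I) := by
  set b := barnesPath μ with hb
  set l : ℝ → ℂ := fun t => 1 / 8 + t * Complex.I with hl
  have hbm : Measurable b := (continuous_barnesPath_right μ).measurable
  have hlm : Measurable l := by simp only [hl]; fun_prop
  have hdm : Measurable (deriv b) := measurable_deriv b
  have hbim : ∀ t, (b t).im = t := fun t => barnesPath_im μ t
  have hlim : ∀ t, (l t).im = t := fun t => by simp [hl]
  have hbn : ∀ t, b t ∈ nearPath μ := barnesPath_mem_nearPath μ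
  have hln : ∀ t, l t ∈ nearPath μ := line_mem_nearPath μ
  have hC0 : 0 ≤ C := by
    have h := (norm_nonneg _).trans (hC (l 0) (hln 0) (l 0) (hln 0))
    rw [hlim] at h
    simpa using h
  have hexp := integrable_exp_neg_mul_abs hκ
  -- one-variable integrability
  have one : ∀ (f : ℝ → ℂ) (M : ℝ), Measurable f → (∀ t, ‖f t‖ ≤ M * Real.exp (-(κ * |t|))) →
      Integrable f := fun f M hf h =>
    (hexp.const_mul M).mono' hf.aestronglyMeasurable (Eventually.of_forall h)
  have two : ∀ (f : ℝ × ℝ → ℂ) (M : ℝ), Measurable f →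
      (∀ t, ‖f t‖ ≤ M * (Real.exp (-(κ * |t.1|)) * Real.exp (-(κ * |t.2|)))) →
      Integrable f := fun f M hf h =>
    ((hexp.mul_prod hexp).const_mul M).mono' hf.aestronglyMeasurable (Eventually.of_forall h)
  have hg : ∀ M : ℝ, Tendsto (fun t : ℝ => M * Real.exp (-(κ * t))) atTop (𝓝 0) := by
    intro M
    have h1 : Tendsto (fun t : ℝ => Real.exp (-(κ * t))) atTop (𝓝 0) :=
      Real.tendsto_exp_neg_atTop_nhds_zero.comp (tendsto_id.const_mul_atTop hκ)
    simpa using h1.const_mul M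
  have hle1 : ∀ t : ℝ, Real.exp (-(κ * |t|)) ≤ 1 := fun t => by
    rw [Real.exp_le_one_iff]; have := mul_nonneg hκ.le (abs_nonneg t); linarith
  have hd2 : ∀ t, ‖deriv b t‖ ≤ 2 := norm_deriv_barnesPath_le μ
  have hmem : ∀ s : ℂ, |s.re| ≤ 1 / 8 → ‖μ‖ + 7 / 8 ≤ |s.im| → s ∈ nearPath μ :=
    fun s h h' => ⟨h, Or.inr h'⟩
  -- first shift
  have s1 : ∀ t₂, ∫ t₁, F (b t₁) (b t₂) * deriv b t₁ = ∫ t₁, F (l t₁) (b t₂) * Complex.I := by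
    intro t₂
    refine integral_barnesPath_eq (F := fun s => F s (b t₂)) (hF1 _ (hbn t₂)) (hg C)
      (fun s h h' => ?_) ?_ ?_
    · refine (hC s (hmem s h h') _ (hbn t₂)).trans ?_
      rw [hbim]
      exact mul_le_mul_of_nonneg_left (mul_le_of_le_one_right (Real.exp_pos _).le (hle1 _)) hC0
    · refine one _ (C * 2) ((hm.comp (hbm.prodMk measurable_const)).mul hdm) fun t => ?_
      rw [norm_mul]
      have := hC _ (hbn t) _ (hbn t₂)
      rw [hbim, hbim] at this
      calc _ ≤ (C * (Real.exp (-(κ * |t|)) * 1)) * 2 := by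
            refine mul_le_mul (this.trans ?_) (hd2 t) (norm_nonneg _) (by positivity)
            have := hle1 t₂
            gcongr
        _ = _ := by ring
    · refine one _ C (hm.comp (hlm.prodMk measurable_const)) fun t => ?_
      have := hC _ (hln t) _ (hbn t₂)
      rw [hbim, hlim] at this
      refine this.trans ?_
      exact mul_le_mul_of_nonneg_left (mul_le_of_le_one_right (Real.exp_pos _).le (hle1 _)) hC0
  have s2 : ∀ t₁, ∫ t₂, F (l t₁) (b t₂) * deriv b t₂ = ∫ t₂, F (l t₁) (l t₂) * Complex.I := by
    intro t₁
    refine integral_barnesPath_eq (F := fun s => F (l t₁) s) (hF2 _ (hln t₁)) (hg C)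
      (fun s h h' => ?_) ?_ ?_
    · refine (hC _ (hln t₁) s (hmem s h h')).trans ?_
      rw [hlim]
      exact mul_le_mul_of_nonneg_left (mul_le_of_le_one_left (Real.exp_pos _).le (hle1 _)) hC0
    · refine one _ (C * 2) ((hm.comp (measurable_const.prodMk hbm)).mul hdm) fun t => ?_
      rw [norm_mul]
      have := hC _ (hln t₁) _ (hbn t)
      rw [hbim, hlim] at this
      calc _ ≤ (C * (1 * Real.exp (-(κ * |t|)))) * 2 := by
            refine mul_le_mul (this.trans ?_) (hd2 t) (norm_nonneg _) (by positivity)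
            have := hle1 t₁
            gcongr
        _ = _ := by ring
    · refine one _ C (hm.comp (measurable_const.prodMk hlm)) fun t => ?_
      have := hC _ (hln t₁) _ (hln t)
      rw [hlim, hlim] at this
      refine this.trans ?_
      exact mul_le_mul_of_nonneg_left (mul_le_of_le_one_left (Real.exp_pos _).le (hle1 _)) hC0
  have hm1 : Measurable (fun t : ℝ × ℝ => F (b t.1) (b t.2)) :=
    hm.comp ((hbm.comp measurable_fst).prodMk (hbm.comp measurable_snd))
  have hm2 : Measurable (fun t : ℝ × ℝ => F (l t.1) (b t.2)) :=
    hm.comp ((hlm.comp measurable_fst).prodMk (hbm.comp measurable_snd))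
  have hm3 : Measurable (fun t : ℝ × ℝ => F (l t.1) (l t.2)) :=
    hm.comp ((hlm.comp measurable_fst).prodMk (hlm.comp measurable_snd))
  have i1 : Integrable (fun t : ℝ × ℝ => F (b t.1) (b t.2) * (deriv b t.1 * deriv b t.2)) := by
    refine two _ (C * (2 * 2)) (hm1.mul ((hdm.comp measurable_fst).mul (hdm.comp measurable_snd)))
      fun t => ?_
    have := hC _ (hbn t.1) _ (hbn t.2)
    rw [hbim, hbim] at this
    rw [norm_mul, norm_mul]
    calc _ ≤ (C * (Real.exp (-(κ * |t.1|)) * Real.exp (-(κ * |t.2|)))) * (2 * 2) := by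
          gcongr
          · exact hd2 _
          · exact hd2 _
      _ = _ := by ring
  have i2 : Integrable (fun t : ℝ × ℝ => F (l t.1) (b t.2) * Complex.I * deriv b t.2) := by
    refine two _ (C * 2) ((hm2.mul_const _).mul (hdm.comp measurable_snd)) fun t => ?_
    have := hC _ (hln t.1) _ (hbn t.2)
    rw [hbim, hlim] at this
    rw [norm_mul, norm_mul, Complex.norm_I, mul_one]
    calc _ ≤ (C * (Real.exp (-(κ * |t.1|)) * Real.exp (-(κ * |t.2|)))) * 2 := by
          gcongr
          exact hd2 _
      _ = _ := by ring
  have i3 : Integrable (fun t : ℝ × ℝ => F (l t.1) (l t.2)) := by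
    refine two _ C hm3 fun t => ?_
    have := hC _ (hln t.1) _ (hln t.2)
    rwa [hlim, hlim] at this
  calc _ = ∫ t₂, ∫ t₁, F (b t₁) (b t₂) * (deriv b t₁ * deriv b t₂) := integral_prod_symm _ i1
    _ = ∫ t₂, ∫ t₁, F (l t₁) (b t₂) * Complex.I * deriv b t₂ := by
        congr 1; ext t₂
        simp only [← mul_assoc]
        rw [integral_mul_const, s1 t₂, ← integral_mul_const]
    _ = ∫ t : ℝ × ℝ, F (l t.1) (b t.2) * Complex.I * deriv b t.2 := (integral_prod_symm _ i2).symm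
    _ = ∫ t₁, ∫ t₂, F (l t₁) (b t₂) * Complex.I * deriv b t₂ := integral_prod _ i2
    _ = ∫ t₁, ∫ t₂, -F (l t₁) (l t₂) := by
        congr 1; ext t₁
        have : ∀ t₂, F (l t₁) (b t₂) * Complex.I * deriv b t₂ =
          F (l t₁) (b t₂) * deriv b t₂ * Complex.I := fun t₂ => by ring
        simp only [this]
        rw [integral_mul_const, s2 t₁, ← integral_mul_const]
        congr 1; ext t₂
        rw [mul_assoc, Complex.I_mul_I]; ring
    _ = ∫ t : ℝ × ℝ, -F (l t.1) (l t.2) := (integral_prod _ i3.neg).symm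
    _ = _ := integral_neg _

lemma exists_norm_termFn_le {a : Fin 4 → ℝ} (ha : ∀ j, |a j| < Real.pi / 2) (J : Fin 3)
    (σ : Equiv.Perm (Fin 3)) {μ : Fin 3 → ℂ} (hμ : μ ∈ iaStar) :
    ∃ C κ : ℝ, 0 < κ ∧ ∀ s₁ ∈ nearPath μ, ∀ s₂ ∈ nearPath μ,
      ‖termFn a J σ μ s₁ s₂‖ ≤ C * (Real.exp (-(κ * |s₁.im|)) * Real.exp (-(κ * |s₂.im|))) := by
  have hC := one_le_stirlingConst
  obtain ⟨κ, hκ0, hκ1, hκ2⟩ : ∃ κ : ℝ, 0 < κ ∧ 2 * κ ≤ Real.pi / 2 - |a 0| ∧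
      2 * κ ≤ Real.pi / 2 - |a 2| := by
    refine ⟨min (Real.pi / 2 - |a 0|) (Real.pi / 2 - |a 2|) / 2, ?_, ?_, ?_⟩
    · have := ha 0; have := ha 2
      exact half_pos (lt_min (by linarith) (by linarith))
    · rw [mul_div_cancel₀ _ two_ne_zero]; exact min_le_left _ _
    · rw [mul_div_cancel₀ _ two_ne_zero]; exact min_le_right _ _
  have key : ∀ K τ t : ℝ, 2 * κ ≤ K → |τ| ≤ ‖μ‖ → (1 + |t|) * Real.exp (-(K * |t - τ|)) ≤
      ((1 + 1 / κ) * Real.exp (2 * κ * ‖μ‖)) * Real.exp (-(κ * |t|)) := by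
    intro K τ t hK hτ
    have h1 : 1 + |t| ≤ (1 + 1 / κ) * Real.exp (κ * |t|) := by
      have := Real.add_one_le_exp (κ * |t|)
      calc 1 + |t| ≤ (1 + 1 / κ) * (κ * |t| + 1) := by
            have e : (1 + 1 / κ) * (κ * |t| + 1) = 1 + |t| + (κ * |t| + 1 / κ) := by field_simp; ring
            rw [e]
            have : 0 ≤ κ * |t| + 1 / κ := by positivity
            linarith
        _ ≤ _ := by gcongr
    have h2 : Real.exp (-(K * |t - τ|)) ≤ Real.exp (2 * κ * ‖μ‖ - 2 * κ * |t|) := by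
      apply Real.exp_le_exp.2
      have := abs_sub_abs_le_abs_sub t τ
      nlinarith [mul_le_mul_of_nonneg_right hK (abs_nonneg (t - τ))]
    calc _ ≤ ((1 + 1 / κ) * Real.exp (κ * |t|)) * Real.exp (2 * κ * ‖μ‖ - 2 * κ * |t|) := by gcongr
      _ = _ := by
        rw [mul_assoc (1 + 1 / κ), mul_assoc (1 + 1 / κ), ← Real.exp_add, ← Real.exp_add]
        congr 2; ring
  refine ⟨stirlingConst ^ 7 * (((1 + 1 / κ) * Real.exp (2 * κ * ‖μ‖)) *
    ((1 + 1 / κ) * Real.exp (2 * κ * ‖μ‖))), κ, hκ0, fun s₁ h1 s₂ h2 => ?_⟩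
  refine (norm_termFn_le (fun j => (ha j).le) J σ hμ h1 h2).trans ?_
  have k1 := (termWeight_le (κ := Real.pi / 2 - |a 0|) (τ₀ := (μ (σ 0)).im) (τ₁ := (μ (σ 1)).im) (τ₂ := (μ (σ 2)).im)
    (t := s₁.im) (abs_le.1 h1.1).2).trans (key _ _ _ hκ1 (abs_im_le_norm μ _))
  have k2 := (termWeight_le (κ := Real.pi / 2 - |a 2|) (τ₀ := -(μ (σ 0)).im) (τ₁ := -(μ (σ 1)).im) (τ₂ := -(μ (σ 2)).im)
    (t := s₂.im) (abs_le.1 h2.1).2).trans (key _ _ _ hκ2 (by rw [abs_neg]; exact abs_im_le_norm μ _))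
  calc _ ≤ stirlingConst ^ 7 * ((((1 + 1 / κ) * Real.exp (2 * κ * ‖μ‖)) * Real.exp (-(κ * |s₁.im|))) *
      (((1 + 1 / κ) * Real.exp (2 * κ * ‖μ‖)) * Real.exp (-(κ * |s₂.im|)))) := by
        gcongr
        exact termWeight_nonneg _ _ _ _ _ _
    _ = _ := by ring

lemma differentiableAt_Gamma_of_im {z : ℂ} (hz : z.im ≠ 0) : DifferentiableAt ℂ Complex.Gamma z := by
  refine Complex.differentiableAt_Gamma z fun m h => hz ?_
  rw [h]; simp

lemma differentiableAt_rGamma {a : ℝ} {z : ℂ} (hz : z.im ≠ 0) : DifferentiableAt ℂ (rGamma a) z :=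
  (differentiableAt_Gamma_of_im hz).mul (by fun_prop)

lemma differentiableAt_betaJ (J : Fin 3) {p q : ℂ → ℂ} {s : ℂ} (hp : DifferentiableAt ℂ p s)
    (hq : DifferentiableAt ℂ q s) (hp' : DifferentiableAt ℂ (fun s => Complex.Gamma (p s)) s)
    (hq' : DifferentiableAt ℂ (fun s => Complex.Gamma (q s)) s) (h : (p s).re + (q s).re < 1) :
    DifferentiableAt ℂ (fun s => betaJ J (p s) (q s)) s := by
  have h1 : DifferentiableAt ℂ (fun s => Complex.Gamma (1 - p s - q s)) s := by
    have : DifferentiableAt ℂ Complex.Gamma (1 - p s - q s) := by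
      refine Complex.differentiableAt_Gamma _ fun m hm => ?_
      have := congrArg Complex.re hm
      simp at this
      have h0 : (0 : ℝ) ≤ m := Nat.cast_nonneg m
      linarith
    exact this.comp s ((hp.const_sub 1).sub hq)
  have h2 : DifferentiableAt ℂ (fun s => sinPi (betaW J (p s) (q s))) s := by
    have : DifferentiableAt ℂ (fun s => betaW J (p s) (q s)) s := by
      fin_cases J
      · exact hp.add hq
      · exact hq
      · exact hp
    exact (this.const_mul (Real.pi : ℂ)).csin
  exact (((hp'.mul hq').mul h1).mul h2).div_const _

lemma sub_im_ne_zero {μ : Fin 3 → ℂ} {s : ℂ} (h : ‖μ‖ < |s.im|) (j : Fin 3) : (s - μ j).im ≠ 0 := by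
  intro h0
  rw [Complex.sub_im, sub_eq_zero] at h0
  rw [h0] at h
  exact absurd (abs_im_le_norm μ j) (not_le.2 h)

lemma add_im_ne_zero {μ : Fin 3 → ℂ} {s : ℂ} (h : ‖μ‖ < |s.im|) (j : Fin 3) : (s + μ j).im ≠ 0 := by
  intro h0
  rw [Complex.add_im, add_eq_zero_iff_eq_neg] at h0
  rw [h0, abs_neg] at h
  exact absurd (abs_im_le_norm μ j) (not_le.2 h)

lemma differentiableAt_termFn_left (a : Fin 4 → ℝ) (J : Fin 3) (σ : Equiv.Perm (Fin 3)) {μ : Fin 3 → ℂ}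
    (hμ : μ ∈ iaStar) {s₂ s : ℂ} (h2 : s₂ ∈ nearPath μ) (hs : |s.re| < 1 / 4) (hs' : ‖μ‖ < |s.im|) :
    DifferentiableAt ℂ (fun s => termFn a J σ μ s s₂) s := by
  have hr : ∀ (b : ℝ) (j : Fin 3), DifferentiableAt ℂ (fun s => rGamma b (s - μ j)) s := fun b j =>
    (differentiableAt_rGamma (sub_im_ne_zero hs' j)).comp s (differentiableAt_id.sub_const _)
  have hG : DifferentiableAt ℂ (fun s => Complex.Gamma (s - μ (σ 2))) s :=
    (differentiableAt_Gamma_of_im (sub_im_ne_zero hs' _)).comp s (differentiableAt_id.sub_const _)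
  have hre : (s - μ (σ 2)).re + (s₂ + μ (σ 2)).re < 1 := by
    have h3 := (abs_le.1 h2.1).2
    have h4 := (abs_lt.1 hs).2
    simp [hμ.1]; linarith
  exact (((hr _ _).mul (hr _ _)).mul_const _).mul (differentiableAt_betaJ J (p := fun s => s - μ (σ 2))
    (q := fun _ => s₂ + μ (σ 2)) (differentiableAt_id.sub_const _)
    (differentiableAt_const _) hG (differentiableAt_const _) hre)

lemma differentiableAt_termFn_right (a : Fin 4 → ℝ) (J : Fin 3) (σ : Equiv.Perm (Fin 3)) {μ : Fin 3 → ℂ}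
    (hμ : μ ∈ iaStar) {s₁ s : ℂ} (h1 : s₁ ∈ nearPath μ) (hs : |s.re| < 1 / 4) (hs' : ‖μ‖ < |s.im|) :
    DifferentiableAt ℂ (fun s => termFn a J σ μ s₁ s) s := by
  have hr : ∀ (b : ℝ) (j : Fin 3), DifferentiableAt ℂ (fun s => rGamma b (s + μ j)) s := fun b j =>
    (differentiableAt_rGamma (add_im_ne_zero hs' j)).comp s (differentiableAt_id.add_const _)
  have hG : DifferentiableAt ℂ (fun s => Complex.Gamma (s + μ (σ 2))) s :=
    (differentiableAt_Gamma_of_im (add_im_ne_zero hs' _)).comp s (differentiableAt_id.add_const _)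
  have hre : (s₁ - μ (σ 2)).re + (s + μ (σ 2)).re < 1 := by
    have h3 := (abs_le.1 h1.1).2
    have h4 := (abs_lt.1 hs).2
    simp [hμ.1]; linarith
  exact (((hr _ _).mul (hr _ _)).const_mul _).mul (differentiableAt_betaJ J (p := fun _ => s₁ - μ (σ 2))
    (q := fun s => s + μ (σ 2)) (differentiableAt_const _) (differentiableAt_id.add_const _)
    (differentiableAt_const _) hG hre)

lemma norm_exp_neg_mul_le {μ : Fin 3 → ℂ} {s : ℂ} (hs : s ∈ nearPath μ) (Y : ℝ) :
    ‖Complex.exp (-(s * Y))‖ ≤ Real.exp (|Y| / 8) := by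
  rw [Complex.norm_exp, Complex.neg_re, Complex.re_mul_ofReal]
  apply Real.exp_le_exp.2
  calc -(s.re * Y) ≤ |s.re * Y| := neg_le_abs _
    _ = |s.re| * |Y| := abs_mul _ _
    _ ≤ 1 / 8 * |Y| := by gcongr; exact hs.1
    _ = _ := by ring

/-- The regularized kernel as an integral over the line `Re s = 1 / 8`. -/
lemma termKernel_eq_line {a : Fin 4 → ℝ} (ha : ∀ j, |a j| < Real.pi / 2) (J : Fin 3)
    (σ : Equiv.Perm (Fin 3)) (Y₁ Y₂ : ℝ) {μ : Fin 3 → ℂ} (hμ : μ ∈ iaStar) :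
    termKernel a J σ Y₁ Y₂ μ = (1 / (2 * Real.pi) ^ 2) * ∫ t : ℝ × ℝ,
      Complex.exp (-((1 / 8 + t.1 * Complex.I) * Y₁)) * Complex.exp (-((1 / 8 + t.2 * Complex.I) * Y₂)) *
      termFn a J σ μ (1 / 8 + t.1 * Complex.I) (1 / 8 + t.2 * Complex.I) := by
  obtain ⟨C, κ, hκ, hb⟩ := exists_norm_termFn_le ha J σ hμ
  have h := integral_barnesPath_prod_eq (μ := μ)
    (F := fun s₁ s₂ => Complex.exp (-(s₁ * Y₁)) * Complex.exp (-(s₂ * Y₂)) * termFn a J σ μ s₁ s₂)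
    (C := Real.exp (|Y₁| / 8) * Real.exp (|Y₂| / 8) * C) hκ ?_ ?_ ?_ ?_
  · rw [termKernel]
    simp only [termIntegrand]
    rw [integral_div, h]
    have hpi : (Real.pi : ℂ) ≠ 0 := by exact_mod_cast Real.pi_ne_zero
    have hI : (2 * Real.pi * Complex.I : ℂ) ^ 2 = -(2 * Real.pi) ^ 2 := by
      rw [mul_pow, Complex.I_sq]; ring
    rw [hI, neg_div_neg_eq, div_eq_inv_mul, one_div ((2 * Real.pi : ℂ) ^ 2)]
  · have e : Measurable (fun x : ℂ × ℂ => (μ, x.1, x.2)) := by fun_prop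
    have h1 := (measurable_termFn a J σ).comp e
    simp only [Function.comp_def] at h1
    have h2 : Measurable (fun x : ℂ × ℂ => Complex.exp (-(x.1 * Y₁)) * Complex.exp (-(x.2 * Y₂))) := by
      fun_prop
    exact h2.mul h1
  · intro s₂ h2 s hs hs'
    exact (DifferentiableAt.mul (by fun_prop) (by fun_prop)).mul
      (differentiableAt_termFn_left a J σ hμ h2 hs hs')
  · intro s₂ h2 s hs hs'
    exact (DifferentiableAt.mul (by fun_prop) (by fun_prop)).mul
      (differentiableAt_termFn_right a J σ hμ h2 hs hs')
  · intro s₁ h1 s₂ h2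
    rw [norm_mul, norm_mul, mul_assoc (_ * _)]
    gcongr
    · exact norm_exp_neg_mul_le h1 _
    · exact norm_exp_neg_mul_le h2 _
    · exact hb s₁ h1 s₂ h2

/-- The regularized kernel as an integral of Bessel integrals. -/
theorem termKernel_eq_integral_besselB {a : Fin 4 → ℝ} (ha : ∀ j, |a j| < Real.pi / 2) (J : Fin 3)
    (σ : Equiv.Perm (Fin 3)) (Y₁ Y₂ : ℝ) {μ : Fin 3 → ℂ} (hμ : μ ∈ iaStar) :
    termKernel a J σ Y₁ Y₂ μ = ∫ x in betaSet J, Complex.exp (-(μ (σ 2) * x)) *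
      (besselB (a 0) (a 1) (-μ (σ 0)) (-μ (σ 1)) (Y₁ + Real.log (betaD J x) - x) *
      besselB (a 2) (a 3) (μ (σ 0)) (μ (σ 1)) (Y₂ + Real.log (betaD J x))) := by
  set l : ℝ → ℂ := fun t => 1 / 8 + t * Complex.I with hl
  set A : ℝ → ℂ := fun t => Complex.exp (-(l t * Y₁)) * (rGamma (a 0) (l t - μ (σ 0)) *
    rGamma (a 1) (l t - μ (σ 1))) with hA
  set B : ℝ → ℂ := fun t => Complex.exp (-(l t * Y₂)) * (rGamma (a 2) (l t + μ (σ 0)) *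
    rGamma (a 3) (l t + μ (σ 1))) with hB
  have hlre : ∀ t, (l t).re = 1 / 8 := fun t => by simp [hl]
  have hm := measurableSet_betaSet J
  have hpi : (Real.pi : ℂ) ≠ 0 := by exact_mod_cast Real.pi_ne_zero
  have hlm : Measurable l := by simp only [hl]; fun_prop
  -- integrability of the two factors
  have hint : ∀ (a₀ a₁ Y : ℝ) (α β : ℂ), |a₀| < Real.pi / 2 → |a₁| < Real.pi / 2 → α.re = 0 → β.re = 0 →
      Integrable (fun t => Complex.exp (-(l t * Y)) * (rGamma a₀ (l t + α) * rGamma a₁ (l t + β))) := by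
    intro a₀ a₁ Y α β h0 h1 hα hβ
    have i0 := integrable_rGamma_line (σ := 1 / 8) h0 (by norm_num) (by norm_num) hα
    refine ((i0.norm.const_mul (Real.exp (|Y| / 8) * stirlingConst))).mono'
      (Measurable.aestronglyMeasurable ?_) (Eventually.of_forall fun t => ?_)
    · have := (measurable_rGamma a₀).comp (hlm.add_const α)
      have := (measurable_rGamma a₁).comp (hlm.add_const β)
      simp only [Function.comp_def] at *
      fun_prop
    · have e1 := norm_exp_neg_mul_le (line_mem_nearPath 0 t) Y
      have e2 := norm_rGamma_line_le (a := a₁) (z := l t + β) (by rw [Complex.add_re, hlre, hβ]; norm_num)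
        (by rw [Complex.add_re, hlre, hβ]; norm_num)
      have e3 : Real.exp (-((Real.pi / 2 - |a₁|) * |(l t + β).im|)) ≤ 1 := by
        rw [Real.exp_le_one_iff]
        have := mul_nonneg (sub_nonneg.2 h1.le) (abs_nonneg (l t + β).im)
        linarith
      have hC := one_le_stirlingConst
      have e4 : ‖rGamma a₁ (l t + β)‖ ≤ stirlingConst :=
        e2.trans (mul_le_of_le_one_right (by linarith) e3)
      have e5 : (((1 / 8 : ℝ) : ℂ) + t * Complex.I + α) = l t + α := by simp [hl]
      rw [e5, norm_mul, norm_mul]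
      calc _ ≤ Real.exp (|Y| / 8) * (‖rGamma a₀ (l t + α)‖ * stirlingConst) := by gcongr
        _ = _ := by ring
  have hAi : Integrable A := by
    have := hint (a 0) (a 1) Y₁ (-μ (σ 0)) (-μ (σ 1)) (ha 0) (ha 1) (by simp [hμ.1]) (by simp [hμ.1])
    simpa only [hA, sub_eq_add_neg] using this
  have hBi : Integrable B := hint (a 2) (a 3) Y₂ (μ (σ 0)) (μ (σ 1)) (ha 2) (ha 3) (hμ.1 _) (hμ.1 _)
  set f : (ℝ × ℝ) → ℝ → ℂ := fun t x => A t.1 * B t.2 * betaKer J (l t.1 - μ (σ 2)) (l t.2 + μ (σ 2)) x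
    with hf
  have hker : ∀ t : ℝ × ℝ, termFn a J σ μ (l t.1) (l t.2) * (Complex.exp (-(l t.1 * Y₁)) *
      Complex.exp (-(l t.2 * Y₂))) = ∫ x in betaSet J, f t x := by
    intro t
    simp only [hf]
    rw [integral_const_mul, ← betaJ_eq_integral J, termFn]
    · simp only [hA, hB]; ring
    · simp [hlre, hμ.1]
    · simp [hlre, hμ.1]
    · simp [hlre, hμ.1]; norm_num
  have hfi : Integrable (Function.uncurry f) ((volume : Measure (ℝ × ℝ)).prod (volume.restrict (betaSet J))) := by
    have k0 := integrableOn_betaKer J (p := 1 / 8) (q := 1 / 8) (by norm_num) (by norm_num) (by norm_num)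
    have k1 := ((hAi.mul_prod hBi).mul_prod k0)
    refine k1.mono ?_ (Eventually.of_forall fun z => ?_)
    · have m1 := (hAi.mul_prod hBi).aestronglyMeasurable.comp_fst (ν := volume.restrict (betaSet J))
      refine m1.mul (Measurable.aestronglyMeasurable ?_)
      have := measurable_betaD J
      unfold betaKer
      fun_prop
    · simp only [hf, Function.uncurry, norm_mul, norm_betaKer, Complex.sub_re, Complex.add_re, hlre,
        hμ.1, sub_zero, add_zero]
      norm_num
  rw [termKernel_eq_line ha J σ Y₁ Y₂ hμ]
  have e1 : ∫ t : ℝ × ℝ, Complex.exp (-((1 / 8 + t.1 * Complex.I) * Y₁)) *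
      Complex.exp (-((1 / 8 + t.2 * Complex.I) * Y₂)) *
      termFn a J σ μ (1 / 8 + t.1 * Complex.I) (1 / 8 + t.2 * Complex.I) =
      ∫ t : ℝ × ℝ, ∫ x in betaSet J, f t x := by
    congr 1; ext t; rw [← hker t]; simp only [hl]; ring
  rw [e1, integral_integral_swap hfi, ← integral_const_mul]
  refine setIntegral_congr_fun hm fun x hx => ?_
  have hD := betaD_pos hx
  set L := Real.log (betaD J x) with hL
  have b1 := integral_rGamma_mul_rGamma (σ := 1 / 8) (ha 0) (ha 1) (by norm_num) (by norm_num)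
    (α := -μ (σ 0)) (β := -μ (σ 1)) (by simp [hμ.1]) (by simp [hμ.1]) (Y₁ + L - x)
  have b2 := integral_rGamma_mul_rGamma (σ := 1 / 8) (ha 2) (ha 3) (by norm_num) (by norm_num)
    (α := μ (σ 0)) (β := μ (σ 1)) (hμ.1 _) (hμ.1 _) (Y₂ + L)
  have e2 : ∫ t : ℝ × ℝ, f t x = Complex.exp (-(μ (σ 2) * x)) * ((2 * Real.pi *
      besselB (a 0) (a 1) (-μ (σ 0)) (-μ (σ 1)) (Y₁ + L - x)) * (2 * Real.pi *
      besselB (a 2) (a 3) (μ (σ 0)) (μ (σ 1)) (Y₂ + L))) := by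
    rw [← b1, ← b2, ← integral_prod_mul, ← integral_const_mul]
    congr 1; ext t
    simp only [hf, hA, hB, betaKer, ← hL]
    have el : ∀ t : ℝ, (((1 / 8 : ℝ) : ℂ) + t * Complex.I) = l t := fun t => by simp [hl]
    have ee : Complex.exp ((l t.1 - μ (σ 2)) * x - (l t.1 - μ (σ 2) + (l t.2 + μ (σ 2))) * L) =
        Complex.exp (-(μ (σ 2) * x)) * Complex.exp (l t.1 * x - l t.1 * L) * Complex.exp (-(l t.2 * L)) := by
      rw [← Complex.exp_add, ← Complex.exp_add]; congr 1; ring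
    have e3 : Complex.exp (-(l t.1 * ((Y₁ + L - x : ℝ) : ℂ))) =
        Complex.exp (-(l t.1 * Y₁)) * Complex.exp (l t.1 * x - l t.1 * L) := by
      rw [← Complex.exp_add]; congr 1; push_cast; ring
    have e4 : Complex.exp (-(l t.2 * ((Y₂ + L : ℝ) : ℂ))) =
        Complex.exp (-(l t.2 * Y₂)) * Complex.exp (-(l t.2 * L)) := by
      rw [← Complex.exp_add]; congr 1; push_cast; ring
    rw [el, el, ee, e3, e4]
    simp only [sub_eq_add_neg]
    ring
  show (1 / (2 * Real.pi) ^ 2 : ℂ) * ∫ t : ℝ × ℝ, f t x = _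
  rw [e2]
  field_simp

lemma integrable_one_add_abs_rpow {r : ℝ} (hr : 1 < r) :
    Integrable (fun t : ℝ => (1 + |t|) ^ (-r)) := by
  have := integrable_one_add_norm (E := ℝ) (μ := volume) (r := r) (by simpa using hr)
  simpa using this

/-- The majorant of `termIntegrand` in the variables of integration. -/
def pathMajorant (t : ℝ × ℝ) : ℝ := (1 + |t.1|) ^ (-(9 / 8) : ℝ) * (1 + |t.2|) ^ (-(9 / 8) : ℝ)

lemma integrable_pathMajorant : Integrable pathMajorant := by
  have h := integrable_one_add_abs_rpow (r := 9 / 8) (by norm_num)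
  exact h.mul_prod h

lemma norm_termIntegrand_le {a : Fin 4 → ℝ} (ha : ∀ j, |a j| ≤ Real.pi / 2) (J : Fin 3)
    (σ : Equiv.Perm (Fin 3)) (Y₁ Y₂ : ℝ) {μ : Fin 3 → ℂ} (hμ : μ ∈ iaStar) (t : ℝ × ℝ) :
    ‖termIntegrand a J σ Y₁ Y₂ μ t‖ ≤
      (2916 * stirlingConst ^ 7 * Real.exp (|Y₁| / 8) * Real.exp (|Y₂| / 8) * (1 + ‖μ‖) ^ 6) *
        pathMajorant t := by
  have hC := one_le_stirlingConst
  have h1 := norm_termFn_le ha J σ hμ (barnesPath_mem_nearPath μ t.1) (barnesPath_mem_nearPath μ t.2)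
  have e : ∀ j, |(μ j).im| ≤ ‖μ‖ := abs_im_le_norm μ
  have e' : ∀ j, |-(μ j).im| ≤ ‖μ‖ := fun j => by rw [abs_neg]; exact e j
  have w1 := termWeight_path_le (sub_nonneg.2 (ha 0)) (e (σ 0)) (e (σ 1)) (e (σ 2)) t.1
  have w2 := termWeight_path_le (sub_nonneg.2 (ha 2)) (e' (σ 0)) (e' (σ 1)) (e' (σ 2)) t.2
  simp only [barnesPath_re, barnesPath_im] at h1
  have hden : (1 : ℝ) ≤ ‖(2 * Real.pi * Complex.I : ℂ) ^ 2‖ := by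
    rw [norm_pow, norm_mul, norm_mul, Complex.norm_I, Complex.norm_real, Real.norm_eq_abs,
      abs_of_pos Real.pi_pos]
    have : ‖(2 : ℂ)‖ = 2 := by norm_num
    rw [this]
    nlinarith [Real.pi_gt_three]
  rw [termIntegrand, norm_div]
  refine (div_le_self (norm_nonneg _) hden).trans ?_
  rw [norm_mul, norm_mul, norm_mul, norm_mul]
  have hw := termWeight_nonneg (Real.pi / 2 - |a 2|) (-(μ (σ 0)).im) (-(μ (σ 1)).im) (-(μ (σ 2)).im)
    (barnesRe μ t.2) t.2
  calc _ ≤ Real.exp (|Y₁| / 8) * Real.exp (|Y₂| / 8) * (stirlingConst ^ 7 *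
      ((27 * (1 + ‖μ‖) ^ 3 * (1 + |t.1|) ^ (-(9 / 8) : ℝ)) *
        (27 * (1 + ‖μ‖) ^ 3 * (1 + |t.2|) ^ (-(9 / 8) : ℝ)))) * (2 * 2) := by
        gcongr
        · exact norm_exp_neg_mul_le (barnesPath_mem_nearPath μ t.1) _
        · exact norm_exp_neg_mul_le (barnesPath_mem_nearPath μ t.2) _
        · refine h1.trans ?_
          gcongr
        · exact norm_deriv_barnesPath_le μ _
        · exact norm_deriv_barnesPath_le μ _
    _ = _ := by unfold pathMajorant; ring

lemma measurable_termIntegrand_right (a : Fin 4 → ℝ) (J : Fin 3) (σ : Equiv.Perm (Fin 3)) (Y₁ Y₂ : ℝ)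
    (μ : Fin 3 → ℂ) : Measurable (termIntegrand a J σ Y₁ Y₂ μ) := by
  have e : Measurable (fun x : ℝ × ℝ => (μ, x)) := by fun_prop
  have h := (measurable_termIntegrand a J σ Y₁ Y₂).comp e
  simpa only [Function.comp_def] using h

lemma integrable_termIntegrand {a : Fin 4 → ℝ} (ha : ∀ j, |a j| ≤ Real.pi / 2) (J : Fin 3)
    (σ : Equiv.Perm (Fin 3)) (Y₁ Y₂ : ℝ) {μ : Fin 3 → ℂ} (hμ : μ ∈ iaStar) :
    Integrable (termIntegrand a J σ Y₁ Y₂ μ) :=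
  (integrable_pathMajorant.const_mul _).mono'
    (measurable_termIntegrand_right a J σ Y₁ Y₂ μ).aestronglyMeasurable
    (Eventually.of_forall fun t => norm_termIntegrand_le ha J σ Y₁ Y₂ hμ t)

/-- The constant in the trivial bound for `termKernel`. -/
def termConst : ℝ := 2916 * stirlingConst ^ 7 * ∫ t, pathMajorant t

lemma termConst_nonneg : 0 ≤ termConst := by
  have hC := one_le_stirlingConst
  refine mul_nonneg (by positivity) (integral_nonneg fun t => ?_)
  unfold pathMajorant
  exact mul_nonneg (Real.rpow_nonneg (by positivity) _) (Real.rpow_nonneg (by positivity) _)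

lemma norm_termKernel_le {a : Fin 4 → ℝ} (ha : ∀ j, |a j| ≤ Real.pi / 2) (J : Fin 3)
    (σ : Equiv.Perm (Fin 3)) (Y₁ Y₂ : ℝ) {μ : Fin 3 → ℂ} (hμ : μ ∈ iaStar) :
    ‖termKernel a J σ Y₁ Y₂ μ‖ ≤
      termConst * Real.exp (|Y₁| / 8) * Real.exp (|Y₂| / 8) * (1 + ‖μ‖) ^ 6 := by
  refine (norm_integral_le_of_norm_le (integrable_pathMajorant.const_mul _)
    (Eventually.of_forall fun t => norm_termIntegrand_le ha J σ Y₁ Y₂ hμ t)).trans_eq ?_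
  rw [integral_const_mul, termConst]; ring

lemma continuous_imagParam : Continuous imagParam := by
  refine continuous_pi fun j => ?_
  fin_cases j <;> simp [imagParam] <;> fun_prop

lemma imagParam_mem_iaStar (t : ℝ × ℝ) : imagParam t ∈ iaStar := by
  refine ⟨fun j => ?_, ?_⟩
  · fin_cases j <;> simp [imagParam]
  · simp [Fin.sum_univ_three, imagParam]; ring

lemma stronglyMeasurable_termKernel (a : Fin 4 → ℝ) (J : Fin 3) (σ : Equiv.Perm (Fin 3)) (Y₁ Y₂ : ℝ) :
    StronglyMeasurable (fun t : ℝ × ℝ => termKernel a J σ Y₁ Y₂ (imagParam t)) := by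
  have e : Measurable (fun x : (ℝ × ℝ) × (ℝ × ℝ) => (imagParam x.1, x.2)) :=
    (continuous_imagParam.measurable.comp measurable_fst).prodMk measurable_snd
  have h := ((measurable_termIntegrand a J σ Y₁ Y₂).comp e).stronglyMeasurable
  exact h.integral_prod_right' (ν := volume)

lemma continuous_rGamma_left (z : ℂ) : Continuous (fun a : ℝ => rGamma a z) := by
  unfold rGamma; fun_prop

lemma tendsto_termFn {ι : Type*} {l : Filter ι} {a : ι → Fin 4 → ℝ} {a₀ : Fin 4 → ℝ}
    (ha : ∀ j, Tendsto (fun i => a i j) l (𝓝 (a₀ j))) (J : Fin 3) (σ : Equiv.Perm (Fin 3))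
    (μ : Fin 3 → ℂ) (s₁ s₂ : ℂ) :
    Tendsto (fun i => termFn (a i) J σ μ s₁ s₂) l (𝓝 (termFn a₀ J σ μ s₁ s₂)) := by
  have h : ∀ (j : Fin 4) (z : ℂ), Tendsto (fun i => rGamma (a i j) z) l (𝓝 (rGamma (a₀ j) z)) :=
    fun j z => (continuous_rGamma_left z).continuousAt.tendsto.comp (ha j)
  exact (((h 0 _).mul (h 1 _)).mul ((h 2 _).mul (h 3 _))).mul tendsto_const_nhds

lemma tendsto_termKernel {ι : Type*} {l : Filter ι} [l.IsCountablyGenerated] {a : ι → Fin 4 → ℝ}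
    {a₀ : Fin 4 → ℝ} (ha : ∀ j, Tendsto (fun i => a i j) l (𝓝 (a₀ j)))
    (ha' : ∀ i j, |a i j| ≤ Real.pi / 2) (J : Fin 3) (σ : Equiv.Perm (Fin 3)) (Y₁ Y₂ : ℝ)
    {μ : Fin 3 → ℂ} (hμ : μ ∈ iaStar) :
    Tendsto (fun i => termKernel (a i) J σ Y₁ Y₂ μ) l (𝓝 (termKernel a₀ J σ Y₁ Y₂ μ)) := by
  refine tendsto_integral_filter_of_dominated_convergence _
    (Eventually.of_forall fun i =>
      (measurable_termIntegrand_right (a i) J σ Y₁ Y₂ μ).aestronglyMeasurable)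
    (Eventually.of_forall fun i => Eventually.of_forall fun t =>
      norm_termIntegrand_le (ha' i) J σ Y₁ Y₂ hμ t)
    (integrable_pathMajorant.const_mul _) (Eventually.of_forall fun t => ?_)
  exact (((tendsto_termFn ha J σ μ _ _).const_mul _).mul_const _).div_const _

/-- Integrals against `termKernel` over a compact range of spectral parameters. -/
lemma integrable_mul_termKernel {a : Fin 4 → ℝ} (ha : ∀ j, |a j| ≤ Real.pi / 2) (J : Fin 3)
    (σ : Equiv.Perm (Fin 3)) (Y₁ Y₂ : ℝ) {f : ℝ × ℝ → ℂ} (hf : Integrable f) {K : ℝ}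
    (hK : ∀ t, f t ≠ 0 → ‖imagParam t‖ ≤ K) :
    Integrable (fun t => f t * termKernel a J σ Y₁ Y₂ (imagParam t)) ∧
    ∀ t, ‖f t * termKernel a J σ Y₁ Y₂ (imagParam t)‖ ≤
      termConst * Real.exp (|Y₁| / 8) * Real.exp (|Y₂| / 8) * (1 + K) ^ 6 * ‖f t‖ := by
  have hT := termConst_nonneg
  have hb : ∀ t, ‖f t * termKernel a J σ Y₁ Y₂ (imagParam t)‖ ≤
      termConst * Real.exp (|Y₁| / 8) * Real.exp (|Y₂| / 8) * (1 + K) ^ 6 * ‖f t‖ := by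
    intro t
    by_cases h0 : f t = 0
    · simp [h0]
    · rw [norm_mul, mul_comm]
      refine mul_le_mul_of_nonneg_right ((norm_termKernel_le ha J σ Y₁ Y₂
        (imagParam_mem_iaStar t)).trans ?_) (norm_nonneg _)
      have := hK t h0
      gcongr
  refine ⟨(hf.norm.const_mul _).mono' ?_ (Eventually.of_forall hb), hb⟩
  exact hf.aestronglyMeasurable.mul (stronglyMeasurable_termKernel a J σ Y₁ Y₂).aestronglyMeasurable

lemma tendsto_integral_mul_termKernel {ι : Type*} {l : Filter ι} [l.IsCountablyGenerated]
    {a : ι → Fin 4 → ℝ} {a₀ : Fin 4 → ℝ} (ha : ∀ j, Tendsto (fun i => a i j) l (𝓝 (a₀ j)))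
    (ha' : ∀ i j, |a i j| ≤ Real.pi / 2) (J : Fin 3) (σ : Equiv.Perm (Fin 3)) (Y₁ Y₂ : ℝ)
    {f : ℝ × ℝ → ℂ} (hf : Integrable f) {K : ℝ} (hK : ∀ t, f t ≠ 0 → ‖imagParam t‖ ≤ K) :
    Tendsto (fun i => ∫ t, f t * termKernel (a i) J σ Y₁ Y₂ (imagParam t)) l
      (𝓝 (∫ t, f t * termKernel a₀ J σ Y₁ Y₂ (imagParam t))) := by
  refine tendsto_integral_filter_of_dominated_convergence _
    (Eventually.of_forall fun i => (integrable_mul_termKernel (ha' i) J σ Y₁ Y₂ hf hK).1.aestronglyMeasurable)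
    (Eventually.of_forall fun i => Eventually.of_forall fun t =>
      (integrable_mul_termKernel (ha' i) J σ Y₁ Y₂ hf hK).2 t)
    (hf.norm.const_mul _) (Eventually.of_forall fun t => ?_)
  exact (tendsto_termKernel ha ha' J σ Y₁ Y₂ (imagParam_mem_iaStar t)).const_mul _

/-! ### Weights -/

/-- An integrable singularity which majorizes the logarithm near `0`. -/
def logMajorant (y : ℝ) : ℝ := (Ioo (-1) 1).indicator (fun y => 2 * |y| ^ (-(1 / 2) : ℝ)) y

lemma logMajorant_nonneg (y : ℝ) : 0 ≤ logMajorant y := by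
  unfold logMajorant
  exact indicator_nonneg (fun y _ => by positivity) y

lemma integrable_logMajorant : Integrable logMajorant := by
  have h0 : IntegrableOn (fun y : ℝ => y ^ (-(1 / 2) : ℝ)) (Ioo 0 1) := by
    have := intervalIntegral.intervalIntegrable_rpow' (a := 0) (b := 1) (r := -(1 / 2)) (by norm_num)
    rwa [intervalIntegrable_iff_integrableOn_Ioo_of_le zero_le_one] at this
  have h1 : Integrable ((Ioo (0 : ℝ) 1).indicator (fun y : ℝ => y ^ (-(1 / 2) : ℝ))) :=
    (integrable_indicator_iff measurableSet_Ioo).2 h0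
  have h2 := (h1.const_mul 2).add (h1.comp_neg.const_mul 2)
  refine h2.congr ?_
  have hz : ∀ᵐ y : ℝ, y ≠ 0 := by simp [ae_iff]
  filter_upwards [hz] with y hy
  simp only [Pi.add_apply, logMajorant, indicator, mem_Ioo]
  rcases lt_or_gt_of_ne hy with h | h
  · rw [if_neg (by rintro ⟨h1, -⟩; linarith), abs_of_neg h]
    by_cases h' : -1 < y
    · rw [if_pos ⟨by linarith, by linarith⟩, if_pos ⟨h', by linarith⟩]; ring
    · rw [if_neg (by rintro ⟨-, h1⟩; linarith), if_neg (by rintro ⟨h1, -⟩; linarith)]; ring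
  · rw [if_neg (c := 0 < -y ∧ -y < 1) (by rintro ⟨h1, -⟩; linarith), abs_of_pos h]
    by_cases h' : y < 1
    · rw [if_pos ⟨h, h'⟩, if_pos ⟨by linarith, h'⟩]; ring
    · rw [if_neg (by rintro ⟨-, h1⟩; linarith), if_neg (by rintro ⟨-, h1⟩; linarith)]; ring

lemma neg_log_le_logMajorant {y : ℝ} (hy : 0 < y) : -Real.log y ≤ logMajorant y := by
  by_cases h : y < 1
  · rw [logMajorant, indicator_of_mem (show y ∈ Ioo (-1) 1 from ⟨by linarith, h⟩), abs_of_pos hy]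
    have := Real.log_le_sub_one_of_pos (x := y ^ (-(1 / 2) : ℝ)) (by positivity)
    rw [Real.log_rpow hy] at this
    linarith
  · have := Real.log_nonneg (not_lt.1 h)
    linarith [logMajorant_nonneg y]

lemma abs_log_betaD_le {J : Fin 3} {x R : ℝ} (hx : x ∈ betaSet J) (hx0 : x ≠ 0) (hR : 1 ≤ R) :
    |Real.log (betaD J x)| ≤ 1 + |x| + Real.log R + logMajorant (R * |x|) := by
  have hR0 := Real.log_nonneg hR
  have hm := logMajorant_nonneg (R * |x|)
  have hxp : 0 < |x| := abs_pos.2 hx0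
  have hlow : Real.log |x| - |x| ≤ Real.log (betaD J x) →
      -(1 + |x| + Real.log R + logMajorant (R * |x|)) ≤ Real.log (betaD J x) := by
    intro h
    have := neg_log_le_logMajorant (y := R * |x|) (by positivity)
    rw [Real.log_mul (by positivity) hxp.ne'] at this
    linarith
  have hD := betaD_pos hx
  have e1 := Real.add_one_le_exp |x|
  rw [abs_le]
  fin_cases J
  · have hd : betaD 0 x = 1 + Real.exp x := rfl
    show -_ ≤ Real.log (betaD 0 x) ∧ Real.log (betaD 0 x) ≤ _
    rw [hd]
    have hp : 0 ≤ Real.log (1 + Real.exp x) := Real.log_nonneg (by linarith [Real.exp_pos x])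
    refine ⟨by linarith, ?_⟩
    have : 1 + Real.exp x ≤ Real.exp (1 + |x|) := by
      rw [Real.exp_add]
      have h1 : Real.exp x ≤ Real.exp |x| := Real.exp_le_exp.2 (le_abs_self x)
      have h2 := Real.add_one_le_exp (1 : ℝ)
      nlinarith
    have := Real.log_le_log (by positivity) this
    rw [Real.log_exp] at this
    linarith
  · have hx' : x < 0 := hx
    have hd : betaD 1 x = 1 - Real.exp x := rfl
    have hD' : 0 < betaD 1 x := hD
    show -_ ≤ Real.log (betaD 1 x) ∧ Real.log (betaD 1 x) ≤ _
    refine ⟨hlow ?_, ?_⟩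
    · show _ ≤ Real.log (betaD 1 x)
      have hq : Real.log (|x| / Real.exp |x|) = Real.log |x| - |x| := by
        rw [Real.log_div hxp.ne' (Real.exp_pos _).ne', Real.log_exp]
      rw [← hq]
      refine Real.log_le_log (by positivity) ?_
      rw [div_le_iff₀ (Real.exp_pos _), hd, abs_of_neg hx', sub_mul, ← Real.exp_add]
      rw [abs_of_neg hx'] at e1
      simp; linarith
    · have : Real.log (betaD 1 x) ≤ 0 := Real.log_nonpos hD'.le (by rw [hd]; linarith [Real.exp_pos x])
      linarith
  · have hx' : 0 < x := hx
    have hd : betaD 2 x = Real.exp x - 1 := rfl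
    have hD' : 0 < betaD 2 x := hD
    show -_ ≤ Real.log (betaD 2 x) ∧ Real.log (betaD 2 x) ≤ _
    refine ⟨hlow ?_, ?_⟩
    · have : Real.log |x| ≤ Real.log (betaD 2 x) := by
        refine Real.log_le_log hxp ?_
        rw [hd]; rw [abs_of_pos hx'] at e1 ⊢; linarith
      show _ ≤ Real.log (betaD 2 x)
      linarith
    · have : Real.log (betaD 2 x) ≤ Real.log (Real.exp x) := by
        refine Real.log_le_log hD' (by rw [hd]; linarith)
      rw [Real.log_exp] at this
      linarith [le_abs_self x]

/-- A weight which bounds the length of the ranges of the Bessel-type integrals. -/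
def betaWeight (J : Fin 3) (x : ℝ) : ℝ := 1 + |x| + |Real.log (betaD J x)|

lemma one_le_betaWeight (J : Fin 3) (x : ℝ) : 1 ≤ betaWeight J x := by
  unfold betaWeight; linarith [abs_nonneg x, abs_nonneg (Real.log (betaD J x))]

lemma measurable_betaWeight (J : Fin 3) : Measurable (betaWeight J) := by
  have := measurable_betaD J
  unfold betaWeight
  fun_prop

lemma betaWeight_le {J : Fin 3} {x R : ℝ} (hx : x ∈ betaSet J) (hx0 : x ≠ 0) (hR : 1 ≤ R) :
    betaWeight J x ≤ 2 * (1 + |x|) + Real.log R + logMajorant (R * |x|) := by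
  have := abs_log_betaD_le hx hx0 hR
  unfold betaWeight; linarith

lemma logMajorant_mul_abs (R x : ℝ) : logMajorant (R * |x|) = logMajorant (R * x) := by
  rcases abs_cases x with ⟨h, -⟩ | ⟨h, -⟩
  · rw [h]
  · rw [h]
    simp only [logMajorant, indicator, mem_Ioo, mul_neg, abs_neg]
    congr 1
    simp only [eq_iff_iff]
    constructor <;> rintro ⟨h1, h2⟩ <;> constructor <;> linarith

/-- The constant in `setIntegral_betaWeight_le`. -/
def weightConst : ℝ := 4 * (∫ x : ℝ, (1 + |x|) ^ (-2 : ℝ)) + (∫ x, logMajorant x) +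
  (∫ x : ℝ, (2 * (1 + |x|) + logMajorant |x|) * Real.exp (-|x|))

lemma weightInt_nonneg : 0 ≤ ∫ x : ℝ, (1 + |x|) ^ (-2 : ℝ) :=
  integral_nonneg fun x => by positivity

lemma logInt_nonneg : 0 ≤ ∫ x, logMajorant x := integral_nonneg logMajorant_nonneg

lemma expInt_nonneg : 0 ≤ ∫ x : ℝ, (2 * (1 + |x|) + logMajorant |x|) * Real.exp (-|x|) :=
  integral_nonneg fun x => by have := logMajorant_nonneg |x|; positivity

lemma weightConst_nonneg : 0 ≤ weightConst := by
  unfold weightConst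
  linarith [weightInt_nonneg, logInt_nonneg, expInt_nonneg]

/-- The weight is integrable against a bump of width `1 / R`. -/
lemma setIntegral_betaWeight_le (J : Fin 3) {R L c : ℝ} (hR : 1 ≤ R) (hL : 0 ≤ L) (hc : |c| ≤ 2 * L)
    (hRL : Real.log R ≤ L) :
    IntegrableOn (fun x => betaWeight J x * ((1 + R * |c + 3 * x| / 2) ^ 4)⁻¹) (betaSet J) ∧
    ∫ x in betaSet J, betaWeight J x * ((1 + R * |c + 3 * x| / 2) ^ 4)⁻¹ ≤
      4 * weightConst * (1 + L) / R := by
  have hR0 : 0 < R := by linarith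
  set g : ℝ → ℝ := fun x => 5 * (1 + L) * (1 + |3 * R / 2 * (x + c / 3)|) ^ (-2 : ℝ) +
    logMajorant (R * x) with hg
  have i1 : Integrable (fun x : ℝ => (1 + |x|) ^ (-2 : ℝ)) := integrable_one_add_abs_rpow (by norm_num)
  have i2 : Integrable (fun x : ℝ => (1 + |3 * R / 2 * (x + c / 3)|) ^ (-2 : ℝ)) :=
    (i1.comp_mul_left' (R := 3 * R / 2) (by positivity)).comp_add_right (c / 3)
  have i3 : Integrable (fun x : ℝ => logMajorant (R * x)) :=
    integrable_logMajorant.comp_mul_left' hR0.ne'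
  have hgi : Integrable g := (i2.const_mul _).add i3
  have hg0 : ∀ x, 0 ≤ g x := fun x => by
    have := logMajorant_nonneg (R * x); simp only [hg]; positivity
  have hle : ∀ x ∈ betaSet J, x ≠ 0 → betaWeight J x * ((1 + R * |c + 3 * x| / 2) ^ 4)⁻¹ ≤ g x := by
    intro x hx hx0
    set q := 1 + R * |c + 3 * x| / 2 with hq
    have hk : 0 ≤ |c + 3 * x| := abs_nonneg _
    have hq1 : 1 ≤ q := by have : 0 ≤ R * |c + 3 * x| / 2 := by positivity
                           linarith
    have e1 : 1 + |3 * R / 2 * (x + c / 3)| = q := by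
      have : 3 * R / 2 * (x + c / 3) = R / 2 * (c + 3 * x) := by ring
      rw [this, abs_mul, abs_of_pos (by positivity : 0 < R / 2), hq]; ring
    have e2 : q ^ (-2 : ℝ) = (q ^ 2)⁻¹ := by
      rw [Real.rpow_neg (by positivity)]; norm_num
    simp only [hg]
    rw [e1, e2]
    have hw := betaWeight_le hx hx0 hR
    rw [logMajorant_mul_abs] at hw
    have hm := logMajorant_nonneg (R * x)
    have hx1 : |x| ≤ L + |c + 3 * x| / 3 := by
      have : x = (c + 3 * x) / 3 - c / 3 := by ring
      calc |x| = |(c + 3 * x) / 3 - c / 3| := by rw [← this]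
        _ ≤ |(c + 3 * x) / 3| + |c / 3| := abs_sub _ _
        _ ≤ _ := by rw [abs_div, abs_div, abs_of_pos (by norm_num : (0:ℝ) < 3)]; linarith
    have hx2 : |c + 3 * x| ≤ 2 * (q - 1) := by
      rw [hq]; nlinarith
    have hx3 : 2 * (1 + |x|) + Real.log R ≤ 5 * (1 + L) * q := by nlinarith
    have hq4 : 0 < q ^ 4 := by positivity
    calc _ ≤ (5 * (1 + L) * q + logMajorant (R * x)) * (q ^ 4)⁻¹ := by gcongr; linarith
      _ = 5 * (1 + L) * (q * (q ^ 4)⁻¹) + logMajorant (R * x) * (q ^ 4)⁻¹ := by ring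
      _ ≤ 5 * (1 + L) * (q ^ 2)⁻¹ + logMajorant (R * x) * 1 := by
        gcongr
        · rw [← div_eq_mul_inv, div_le_iff₀ hq4, inv_mul_eq_div, le_div_iff₀ (by positivity)]
          nlinarith [pow_le_pow_right₀ hq1 (show 3 ≤ 4 by norm_num)]
        · exact inv_le_one_of_one_le₀ (one_le_pow₀ hq1)
      _ = _ := by ring
  have hz : ∀ᵐ x ∂(volume.restrict (betaSet J)), x ∈ betaSet J ∧ x ≠ 0 := by
    have h1 := ae_restrict_mem (μ := volume) (measurableSet_betaSet J)
    have h2 : ∀ᵐ x ∂(volume.restrict (betaSet J)), x ≠ 0 := ae_restrict_of_ae (by simp [ae_iff])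
    filter_upwards [h1, h2] with x h h' using ⟨h, h'⟩
  have hpos : ∀ x, 0 ≤ betaWeight J x * ((1 + R * |c + 3 * x| / 2) ^ 4)⁻¹ := fun x => by
    have := one_le_betaWeight J x; positivity
  have hint : IntegrableOn (fun x => betaWeight J x * ((1 + R * |c + 3 * x| / 2) ^ 4)⁻¹) (betaSet J) := by
    refine (hgi.integrableOn (s := betaSet J)).mono' ?_ ?_
    · have := measurable_betaWeight J
      exact Measurable.aestronglyMeasurable (by fun_prop)
    · filter_upwards [hz] with x hx
      rw [Real.norm_of_nonneg (hpos x)]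
      exact hle x hx.1 hx.2
  refine ⟨hint, ?_⟩
  calc _ ≤ ∫ x in betaSet J, g x := by
        refine setIntegral_mono_ae_restrict hint hgi.integrableOn ?_
        filter_upwards [hz] with x hx using hle x hx.1 hx.2
    _ ≤ ∫ x, g x := setIntegral_le_integral hgi (Eventually.of_forall hg0)
    _ = 5 * (1 + L) * ((3 * R / 2)⁻¹ * ∫ x : ℝ, (1 + |x|) ^ (-2 : ℝ)) + R⁻¹ * ∫ x, logMajorant x := by
        rw [integral_add (i2.const_mul _) i3, integral_const_mul]
        congr 2
        · rw [integral_add_right_eq_self (fun x : ℝ => (1 + |3 * R / 2 * x|) ^ (-2 : ℝ)) (c / 3),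
            Measure.integral_comp_mul_left (fun x : ℝ => (1 + |x|) ^ (-2 : ℝ)) (3 * R / 2),
            abs_of_pos (by positivity), smul_eq_mul]
        · rw [Measure.integral_comp_mul_left logMajorant R, abs_of_pos (by positivity), smul_eq_mul]
    _ ≤ _ := by
        unfold weightConst
        have h1 := weightInt_nonneg
        have h2 := logInt_nonneg
        have h3 := expInt_nonneg
        set p := ∫ x : ℝ, (1 + |x|) ^ (-2 : ℝ)
        set l := ∫ x, logMajorant x
        set e := ∫ x : ℝ, (2 * (1 + |x|) + logMajorant |x|) * Real.exp (-|x|)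
        rw [le_div_iff₀ hR0]
        have : (5 * (1 + L) * ((3 * R / 2)⁻¹ * p) + R⁻¹ * l) * R = 10 / 3 * (1 + L) * p + l := by
          field_simp; ring
        rw [this]
        nlinarith [mul_nonneg hL h1, mul_nonneg hL h2, mul_nonneg hL h3]

lemma setIntegral_betaWeight_exp_le (J : Fin 3) :
    IntegrableOn (fun x => betaWeight J x * Real.exp (-|x|)) (betaSet J) ∧
    ∫ x in betaSet J, betaWeight J x * Real.exp (-|x|) ≤ weightConst := by
  set g : ℝ → ℝ := fun x => (2 * (1 + |x|) + logMajorant |x|) * Real.exp (-|x|) with hg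
  have hm : Measurable logMajorant := by
    unfold logMajorant
    exact Measurable.indicator (by fun_prop) measurableSet_Ioo
  have hgi : Integrable g := by
    have i1 : Integrable (fun x : ℝ => (1 + |x|) * Real.exp (-|x|)) := by
      have := (integrable_exp_neg_mul_abs (s := 1 / 2) (by norm_num)).const_mul 2
      refine this.mono' (by fun_prop) (Eventually.of_forall fun x => ?_)
      rw [Real.norm_of_nonneg (by positivity)]
      have h1 := Real.add_one_le_exp (1 / 2 * |x|)
      have h2 : Real.exp (-|x|) = Real.exp (-(1 / 2 * |x|)) * Real.exp (-(1 / 2 * |x|)) := by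
        rw [← Real.exp_add]; ring_nf
      have h3 : Real.exp (1 / 2 * |x|) * Real.exp (-(1 / 2 * |x|)) = 1 := by
        rw [← Real.exp_add]; simp
      have h4 := Real.exp_pos (-(1 / 2 * |x|))
      have h5 : (1 + |x|) * Real.exp (-(1 / 2 * |x|)) ≤ 2 := by
        calc _ ≤ (2 * Real.exp (1 / 2 * |x|)) * Real.exp (-(1 / 2 * |x|)) := by
              gcongr; linarith [abs_nonneg x]
          _ = 2 := by rw [mul_assoc, h3, mul_one]
      rw [h2, ← mul_assoc]
      gcongr
    have i2 : Integrable (fun x : ℝ => logMajorant |x| * Real.exp (-|x|)) := by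
      have e : ∀ x : ℝ, logMajorant |x| = logMajorant x := fun x => by
        simpa using logMajorant_mul_abs 1 x
      simp only [e]
      refine integrable_logMajorant.mono' (by fun_prop) (Eventually.of_forall fun x => ?_)
      have := logMajorant_nonneg x
      rw [Real.norm_of_nonneg (by positivity)]
      exact mul_le_of_le_one_right this (Real.exp_le_one_iff.2 (by simp))
    refine ((i1.const_mul 2).add i2).congr (Eventually.of_forall fun x => ?_)
    simp only [hg, Pi.add_apply]; ring
  have hg0 : ∀ x, 0 ≤ g x := fun x => by
    have := logMajorant_nonneg |x|; simp only [hg]; positivity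
  have hle : ∀ x ∈ betaSet J, x ≠ 0 → betaWeight J x * Real.exp (-|x|) ≤ g x := by
    intro x hx hx0
    have := betaWeight_le hx hx0 le_rfl
    rw [Real.log_one, one_mul, add_zero] at this
    simp only [hg]
    gcongr
  have hz : ∀ᵐ x ∂(volume.restrict (betaSet J)), x ∈ betaSet J ∧ x ≠ 0 := by
    have h1 := ae_restrict_mem (μ := volume) (measurableSet_betaSet J)
    have h2 : ∀ᵐ x ∂(volume.restrict (betaSet J)), x ≠ 0 := ae_restrict_of_ae (by simp [ae_iff])
    filter_upwards [h1, h2] with x h h' using ⟨h, h'⟩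
  have hint : IntegrableOn (fun x => betaWeight J x * Real.exp (-|x|)) (betaSet J) := by
    refine (hgi.integrableOn (s := betaSet J)).mono' ?_ ?_
    · have := measurable_betaWeight J
      exact Measurable.aestronglyMeasurable (by fun_prop)
    · filter_upwards [hz] with x hx
      have := one_le_betaWeight J x
      rw [Real.norm_of_nonneg (by positivity)]
      exact hle x hx.1 hx.2
  refine ⟨hint, ?_⟩
  calc _ ≤ ∫ x in betaSet J, g x := by
        refine setIntegral_mono_ae_restrict hint hgi.integrableOn ?_
        filter_upwards [hz] with x hx using hle x hx.1 hx.2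
    _ ≤ ∫ x, g x := setIntegral_le_integral hgi (Eventually.of_forall hg0)
    _ ≤ weightConst := by
        unfold weightConst
        linarith [weightInt_nonneg, logInt_nonneg]

/-- The Fourier transform of a function on `i𝔞*`. -/
def planeFourier (f : ℝ × ℝ → ℂ) (c : Fin 3 → ℝ) : ℂ :=
  ∫ t, f t * Complex.exp (∑ j, imagParam t j * c j)

/-- Decay of the Fourier transform in all directions in which two coordinates differ. -/
def FourierDecay (f : ℝ × ℝ → ℂ) (R M : ℝ) : Prop :=
  ∀ c : Fin 3 → ℝ, ∀ i j, i ≠ j → ‖planeFourier f c‖ * (1 + R * |c i - c j|) ^ 8 ≤ M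

lemma FourierDecay.nonneg {f : ℝ × ℝ → ℂ} {R M : ℝ} (h : FourierDecay f R M) : 0 ≤ M :=
  le_trans (by positivity) (h 0 0 1 (by decide))

/-- Combining the decay in two directions. -/
lemma FourierDecay.le_mul {f : ℝ × ℝ → ℂ} {R M : ℝ} (h : FourierDecay f R M) (hR : 0 ≤ R)
    {c : Fin 3 → ℝ} {i k m : Fin 3} (hik : i ≠ k) (hkm : k ≠ m) (him : i ≠ m) :
    ‖planeFourier f c‖ ≤ M * ((1 + R * |c i - c k|) ^ 4)⁻¹ *
      ((1 + R * |c i + c k - 2 * c m| / 2) ^ 4)⁻¹ := by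
  have hM := h.nonneg
  set P := 1 + R * |c i - c k| with hP
  set Q := 1 + R * |c i + c k - 2 * c m| / 2 with hQ
  have hP1 : 1 ≤ P := by have : 0 ≤ R * |c i - c k| := by positivity
                         linarith
  have hQ1 : 1 ≤ Q := by have : 0 ≤ R * |c i + c k - 2 * c m| / 2 := by positivity
                         linarith
  have h1 : ‖planeFourier f c‖ * P ^ 8 ≤ M := h c i k hik
  have h2 : ‖planeFourier f c‖ * Q ^ 8 ≤ M := by
    have hab : |c i + c k - 2 * c m| ≤ |c i - c m| + |c k - c m| := by
      have : c i + c k - 2 * c m = (c i - c m) + (c k - c m) := by ring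
      rw [this]; exact abs_add_le _ _
    rcases le_total |c i - c m| |c k - c m| with hl | hl
    · refine le_trans ?_ (h c k m hkm)
      gcongr
      rw [hQ]
      nlinarith
    · refine le_trans ?_ (h c i m him)
      gcongr
      rw [hQ]
      nlinarith
  rw [mul_assoc, ← mul_inv, ← div_eq_mul_inv, le_div_iff₀ (by positivity)]
  rcases le_total P Q with hPQ | hPQ
  · refine le_trans ?_ h2
    gcongr
    calc P ^ 4 * Q ^ 4 ≤ Q ^ 4 * Q ^ 4 := by gcongr
      _ = Q ^ 8 := by ring
  · refine le_trans ?_ h1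
    gcongr
    calc P ^ 4 * Q ^ 4 ≤ P ^ 4 * P ^ 4 := by gcongr
      _ = P ^ 8 := by ring

/-- The constant in `integral_bump_le`. -/
def bumpConst : ℝ := ∫ x : ℝ, (1 + |x|) ^ (-4 : ℝ)

lemma bumpConst_nonneg : 0 ≤ bumpConst := integral_nonneg fun x => by positivity

lemma bump_eq {y : ℝ} (hy : 0 ≤ y) : ((1 + y) ^ 4)⁻¹ = (1 + y) ^ (-4 : ℝ) := by
  rw [Real.rpow_neg (by positivity)]; norm_num

lemma integral_bump {R : ℝ} (hR : 0 < R) (c : ℝ) :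
    Integrable (fun v : ℝ => ((1 + R * |c + 2 * v|) ^ 4)⁻¹) ∧
    ∫ v : ℝ, ((1 + R * |c + 2 * v|) ^ 4)⁻¹ = bumpConst / (2 * R) := by
  have e : (fun v : ℝ => ((1 + R * |c + 2 * v|) ^ 4)⁻¹) =
      fun v => (1 + |2 * R * (v + c / 2)|) ^ (-4 : ℝ) := by
    ext v
    have : |2 * R * (v + c / 2)| = R * |c + 2 * v| := by
      have : 2 * R * (v + c / 2) = R * (c + 2 * v) := by ring
      rw [this, abs_mul, abs_of_pos hR]
    rw [this, bump_eq (by positivity)]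
  have i1 : Integrable (fun x : ℝ => (1 + |x|) ^ (-4 : ℝ)) := integrable_one_add_abs_rpow (by norm_num)
  rw [e]
  refine ⟨(i1.comp_mul_left' (by positivity)).comp_add_right (c / 2), ?_⟩
  rw [integral_add_right_eq_self (fun x : ℝ => (1 + |2 * R * x|) ^ (-4 : ℝ)) (c / 2),
    Measure.integral_comp_mul_left (fun x : ℝ => (1 + |x|) ^ (-4 : ℝ)) (2 * R),
    abs_of_pos (by positivity), smul_eq_mul, bumpConst]
  ring

section Fixed

variable {a : Fin 4 → ℝ} {σ : Equiv.Perm (Fin 3)} {f : ℝ × ℝ → ℂ} {R M K : ℝ}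

lemma perm_ne (σ : Equiv.Perm (Fin 3)) {i j : Fin 3} (h : i ≠ j) : σ i ≠ σ j := σ.injective.ne h

/-- The contribution of the truncated Bessel-type integrals at a fixed point of the beta integral. -/
lemma norm_integral_besselTrunc_le (ha : ∀ j, |a j| ≤ Real.pi / 2) (hf : Integrable f) (hR : 0 < R)
    (hF : FourierDecay f R M) (x X₁ X₂ V₁ V₂ : ℝ) (hV₁ : X₁ - V₁ ≤ V₁) :
    Integrable (fun t => f t * (Complex.exp (-(imagParam t (σ 2) * x)) *
      (besselTrunc (a 0) (a 1) (-imagParam t (σ 0)) (-imagParam t (σ 1)) X₁ V₁ *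
      besselTrunc (a 2) (a 3) (imagParam t (σ 0)) (imagParam t (σ 1)) X₂ V₂))) ∧
    ‖∫ t, f t * (Complex.exp (-(imagParam t (σ 2) * x)) *
      (besselTrunc (a 0) (a 1) (-imagParam t (σ 0)) (-imagParam t (σ 1)) X₁ V₁ *
      besselTrunc (a 2) (a 3) (imagParam t (σ 0)) (imagParam t (σ 1)) X₂ V₂))‖ ≤
    (2 * V₁ - X₁) * (M * ((1 + R * |X₂ - X₁ + 2 * x| / 2) ^ 4)⁻¹ * (bumpConst / (2 * R))) := by
  have hM := hF.nonneg
  set ρ₁ := (volume : Measure ℝ).restrict (Ioc (X₁ - V₁) V₁) with hρ₁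
  set ρ₂ := (volume : Measure ℝ).restrict (Ioc (X₂ - V₂) V₂) with hρ₂
  set q : ℝ × ℝ → ℂ := fun v => rotExp (a 0) v.1 * rotExp (a 1) (X₁ - v.1) *
    (rotExp (a 2) v.2 * rotExp (a 3) (X₂ - v.2)) with hq
  have hqc : Continuous q := by
    have h := fun j => continuous_rotExp_right (a j)
    exact (((h 0).comp continuous_fst).mul ((h 1).comp (continuous_const.sub continuous_fst))).mul
      (((h 2).comp continuous_snd).mul ((h 3).comp (continuous_const.sub continuous_snd)))
  have hqn : ∀ v, ‖q v‖ ≤ 1 := by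
    intro v
    have h : ∀ j y, ‖rotExp (a j) y‖ ≤ 1 := fun j y => norm_rotExp_le_one (ha j) y
    simp only [hq, norm_mul]
    exact mul_le_one₀ (mul_le_one₀ (h _ _) (norm_nonneg _) (h _ _)) (by positivity)
      (mul_le_one₀ (h _ _) (norm_nonneg _) (h _ _))
  set c : ℝ × ℝ → Fin 3 → ℝ := fun v j =>
    if j = σ 0 then v.2 - v.1 else if j = σ 1 then X₂ - X₁ - (v.2 - v.1) else -x with hc
  have hc0 : ∀ v, c v (σ 0) = v.2 - v.1 := fun v => by simp [hc]
  have hc1 : ∀ v, c v (σ 1) = X₂ - X₁ - (v.2 - v.1) := fun v => by simp [hc]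
  have hc2 : ∀ v, c v (σ 2) = -x := fun v => by simp [hc]
  set ph : ℝ × ℝ → ℝ × ℝ → ℂ := fun t v => Complex.exp (∑ j, imagParam t j * c v j) with hph
  have hsum : ∀ t v, ∑ j, imagParam t j * c v j = imagParam t (σ 0) * (v.2 - v.1) +
      imagParam t (σ 1) * (X₂ - X₁ - (v.2 - v.1)) + imagParam t (σ 2) * (-x) := by
    intro t v
    rw [← Equiv.sum_comp σ, Fin.sum_univ_three, hc0, hc1, hc2]; push_cast; ring
  have hphn : ∀ t v, ‖ph t v‖ = 1 := by
    intro t v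
    simp only [hph]
    rw [Complex.norm_exp, Complex.re_sum]
    simp [(imagParam_mem_iaStar t).1]
  have hphc : Continuous (fun z : (ℝ × ℝ) × (ℝ × ℝ) => ph z.1 z.2) := by
    simp only [hph, hsum]
    have : ∀ j, Continuous (fun z : (ℝ × ℝ) × (ℝ × ℝ) => imagParam z.1 j) := fun j =>
      (continuous_apply j).comp (continuous_imagParam.comp continuous_fst)
    fun_prop
  have e1 : ∀ t, f t * (Complex.exp (-(imagParam t (σ 2) * x)) *
      (besselTrunc (a 0) (a 1) (-imagParam t (σ 0)) (-imagParam t (σ 1)) X₁ V₁ *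
      besselTrunc (a 2) (a 3) (imagParam t (σ 0)) (imagParam t (σ 1)) X₂ V₂)) =
      ∫ v, f t * (q v * ph t v) ∂(ρ₁.prod ρ₂) := by
    intro t
    rw [besselTrunc, besselTrunc, ← integral_prod_mul, ← integral_const_mul, ← integral_const_mul]
    congr 1; ext v
    simp only [hph, hsum, hq]
    have : Complex.exp (imagParam t (σ 0) * (v.2 - v.1) +
      imagParam t (σ 1) * (X₂ - X₁ - (v.2 - v.1)) + imagParam t (σ 2) * (-x)) =
      Complex.exp (-(imagParam t (σ 2) * x)) *
      (Complex.exp (-imagParam t (σ 0) * v.1 + -imagParam t (σ 1) * (X₁ - v.1)) *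
      Complex.exp (imagParam t (σ 0) * v.2 + imagParam t (σ 1) * (X₂ - v.2))) := by
      rw [← Complex.exp_add, ← Complex.exp_add]; congr 1; ring
    rw [this]; ring
  have hfi : Integrable (Function.uncurry fun t v => f t * (q v * ph t v)) (volume.prod (ρ₁.prod ρ₂)) := by
    have h1 : Integrable (fun z : (ℝ × ℝ) × (ℝ × ℝ) => f z.1) (volume.prod (ρ₁.prod ρ₂)) :=
      hf.comp_fst _
    refine h1.mul_bdd (c := 1) ?_ (Eventually.of_forall fun z => ?_)
    · exact ((hqc.comp continuous_snd).mul hphc).aestronglyMeasurable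
    · rw [norm_mul, hphn, mul_one]; exact hqn _
  simp_rw [e1]
  refine ⟨hfi.integral_prod_left, ?_⟩
  rw [integral_integral_swap hfi]
  have e2 : ∀ v, ∫ t, f t * (q v * ph t v) = q v * planeFourier f (c v) := by
    intro v
    rw [planeFourier, ← integral_const_mul]
    congr 1; ext t; simp only [hph]; ring
  simp_rw [e2]
  obtain ⟨ib, hb⟩ := integral_bump hR (X₁ - X₂)
  set Q := ((1 + R * |X₂ - X₁ + 2 * x| / 2) ^ 4)⁻¹ with hQ
  have hbd : ∀ v, ‖q v * planeFourier f (c v)‖ ≤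
      M * Q * ((1 + R * |(X₁ - X₂) - 2 * v.1 + 2 * v.2|) ^ 4)⁻¹ := by
    intro v
    rw [norm_mul]
    have := hF.le_mul hR.le (c := c v) (perm_ne σ (show (0 : Fin 3) ≠ 1 by decide))
      (perm_ne σ (show (1 : Fin 3) ≠ 2 by decide)) (perm_ne σ (show (0 : Fin 3) ≠ 2 by decide))
    rw [hc0, hc1, hc2] at this
    have r1 : v.2 - v.1 - (X₂ - X₁ - (v.2 - v.1)) = (X₁ - X₂) - 2 * v.1 + 2 * v.2 := by ring
    have r2 : v.2 - v.1 + (X₂ - X₁ - (v.2 - v.1)) - 2 * -x = X₂ - X₁ + 2 * x := by ring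
    rw [r1, r2] at this
    calc _ ≤ 1 * ‖planeFourier f (c v)‖ := by gcongr; exact hqn v
      _ ≤ _ := by rw [one_mul]; refine this.trans_eq ?_; rw [hQ]; ring
  have hinner : ∀ v₁ : ℝ, ∫ v₂, M * Q * ((1 + R * |(X₁ - X₂) - 2 * v₁ + 2 * v₂|) ^ 4)⁻¹ ∂ρ₂ ≤
      M * Q * (bumpConst / (2 * R)) := by
    intro v₁
    obtain ⟨i, hi⟩ := integral_bump hR (X₁ - X₂ - 2 * v₁)
    rw [integral_const_mul, ← hi]
    refine mul_le_mul_of_nonneg_left ?_ (by positivity)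
    exact setIntegral_le_integral i (Eventually.of_forall fun v => by positivity)
  have hcont : Continuous (fun v : ℝ × ℝ => M * Q * ((1 + R * |(X₁ - X₂) - 2 * v.1 + 2 * v.2|) ^ 4)⁻¹) := by
    refine continuous_const.mul (Continuous.inv₀ (by fun_prop) fun v => ?_)
    positivity
  have hgi : Integrable (fun v : ℝ × ℝ => M * Q * ((1 + R * |(X₁ - X₂) - 2 * v.1 + 2 * v.2|) ^ 4)⁻¹)
      (ρ₁.prod ρ₂) := by
    refine Integrable.of_bound hcont.aestronglyMeasurable (C := M * Q) (Eventually.of_forall fun v => ?_)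
    rw [Real.norm_of_nonneg (by positivity)]
    refine mul_le_of_le_one_right (by positivity) (inv_le_one_of_one_le₀ (one_le_pow₀ ?_))
    have : 0 ≤ R * |(X₁ - X₂) - 2 * v.1 + 2 * v.2| := by positivity
    linarith
  calc _ ≤ ∫ v, M * Q * ((1 + R * |(X₁ - X₂) - 2 * v.1 + 2 * v.2|) ^ 4)⁻¹ ∂(ρ₁.prod ρ₂) :=
        norm_integral_le_of_norm_le hgi (Eventually.of_forall hbd)
    _ = ∫ v₁, ∫ v₂, M * Q * ((1 + R * |(X₁ - X₂) - 2 * v₁ + 2 * v₂|) ^ 4)⁻¹ ∂ρ₂ ∂ρ₁ := integral_prod _ hgi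
    _ ≤ ∫ v₁, M * Q * (bumpConst / (2 * R)) ∂ρ₁ :=
        integral_mono hgi.integral_prod_left (integrable_const _) hinner
    _ = (2 * V₁ - X₁) * (M * Q * (bumpConst / (2 * R))) := by
        rw [integral_const, smul_eq_mul, hρ₁, measureReal_restrict_apply_univ,
          Real.volume_real_Ioc_of_le hV₁]
        ring

end Fixed

section Fixed

variable {a : Fin 4 → ℝ} {σ : Equiv.Perm (Fin 3)} {f : ℝ × ℝ → ℂ} {R M K : ℝ}

/-- The product of the two Bessel-type integrals, compared with its truncation. -/
lemma norm_besselB_mul_sub_le (ha : ∀ j, |a j| < Real.pi / 2) {μ : Fin 3 → ℂ} (hμ : μ ∈ iaStar)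
    (hK : ‖μ‖ ≤ K) (i k : Fin 3) {X₁ X₂ V₁ V₂ W x ℓ : ℝ} (hV₁ : V₁ = max X₁ 0 + W + |x|)
    (hV₂ : V₂ = max X₂ 0 + W + |x|) (hW : 0 ≤ W) (h1 : 2 * V₁ - X₁ ≤ ℓ) (h2 : 2 * V₂ - X₂ ≤ ℓ)
    (hℓ : 1 ≤ ℓ) :
    ‖besselB (a 0) (a 1) (-μ i) (-μ k) X₁ * besselB (a 2) (a 3) (μ i) (μ k) X₂ -
      besselTrunc (a 0) (a 1) (-μ i) (-μ k) X₁ V₁ * besselTrunc (a 2) (a 3) (μ i) (μ k) X₂ V₂‖ ≤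
    48 * (1 + K) ^ 2 * ℓ * (Real.exp (-W) * Real.exp (-|x|)) := by
  have hK0 : 0 ≤ K := (norm_nonneg μ).trans hK
  have hn : ∀ j, (-μ j).re = 0 := fun j => by simp [hμ.1]
  have hd : ‖-μ i - -μ k‖ ≤ 2 * K := by
    have := norm_sub_le (-μ i) (-μ k)
    rw [norm_neg, norm_neg] at this
    linarith [norm_le_pi_norm μ i, norm_le_pi_norm μ k]
  have hd' : ‖μ i - μ k‖ ≤ 2 * K := by
    linarith [norm_sub_le (μ i) (μ k), norm_le_pi_norm μ i, norm_le_pi_norm μ k]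
  have key : ∀ X V : ℝ, V = max X 0 + W + |x| → X - V ≤ V ∧ Real.exp (-V) ≤ Real.exp (-W) * Real.exp (-|x|) ∧
      Real.exp (X - V) ≤ 1 := by
    intro X V hV
    have hx := abs_nonneg x
    have h1 := le_max_left X 0
    have h2 := le_max_right X 0
    refine ⟨by linarith, ?_, ?_⟩
    · rw [← Real.exp_add]; exact Real.exp_le_exp.2 (by linarith)
    · rw [Real.exp_le_one_iff]; linarith
  obtain ⟨k1, k2, k3⟩ := key X₁ V₁ hV₁
  obtain ⟨l1, l2, l3⟩ := key X₂ V₂ hV₂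
  set E := Real.exp (-W) * Real.exp (-|x|) with hE
  have hE0 : 0 < E := by positivity
  have hE1 : E ≤ 1 := by
    rw [hE, ← Real.exp_add, Real.exp_le_one_iff]; linarith [abs_nonneg x]
  have d1 : ‖besselB (a 0) (a 1) (-μ i) (-μ k) X₁ - besselTrunc (a 0) (a 1) (-μ i) (-μ k) X₁ V₁‖ ≤
      6 * (1 + K) * E := by
    refine (norm_besselB_sub_besselTrunc_le (ha 0) (ha 1) (hn i) (hn k) k1).trans ?_
    calc _ ≤ 2 * (E * (2 + 2 * K + 1)) := by gcongr
      _ ≤ _ := by nlinarith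
  have d2 : ‖besselB (a 2) (a 3) (μ i) (μ k) X₂ - besselTrunc (a 2) (a 3) (μ i) (μ k) X₂ V₂‖ ≤
      6 * (1 + K) * E := by
    refine (norm_besselB_sub_besselTrunc_le (ha 2) (ha 3) (hμ.1 i) (hμ.1 k) l1).trans ?_
    calc _ ≤ 2 * (E * (2 + 2 * K + 1)) := by gcongr
      _ ≤ _ := by nlinarith
  have t1 := (norm_besselTrunc_le (ha 0).le (ha 1).le (hn i) (hn k) k1).trans h1
  have t2 := (norm_besselTrunc_le (ha 2).le (ha 3).le (hμ.1 i) (hμ.1 k) l1).trans h2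
  set B₁ := besselB (a 0) (a 1) (-μ i) (-μ k) X₁
  set B₂ := besselB (a 2) (a 3) (μ i) (μ k) X₂
  set C₁ := besselTrunc (a 0) (a 1) (-μ i) (-μ k) X₁ V₁
  set C₂ := besselTrunc (a 2) (a 3) (μ i) (μ k) X₂ V₂
  have hB2 : ‖B₂‖ ≤ 7 * (1 + K) * ℓ := by
    have : ‖B₂‖ ≤ ‖B₂ - C₂‖ + ‖C₂‖ := by
      have := norm_add_le (B₂ - C₂) C₂
      rwa [sub_add_cancel] at this
    have h6 : 6 * (1 + K) * E ≤ 6 * (1 + K) * ℓ := by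
      gcongr; exact hE1.trans hℓ
    nlinarith
  have : B₁ * B₂ - C₁ * C₂ = (B₁ - C₁) * B₂ + C₁ * (B₂ - C₂) := by ring
  rw [this]
  refine (norm_add_le _ _).trans ?_
  rw [norm_mul, norm_mul]
  have hℓ0 : 0 ≤ ℓ := by linarith
  calc _ ≤ (6 * (1 + K) * E) * (7 * (1 + K) * ℓ) + ℓ * (6 * (1 + K) * E) := by gcongr
    _ ≤ _ := by
      have : 0 ≤ E * ℓ * (1 + K) * K := by positivity
      nlinarith

/-- The integral of `f` against the integrand of `termKernel_eq_integral_besselB`. -/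
lemma norm_integral_besselB_le (ha : ∀ j, |a j| < Real.pi / 2) (hf : Integrable f) (hR : 0 < R)
    (hK : ∀ t, f t ≠ 0 → ‖imagParam t‖ ≤ K)
    (hF : FourierDecay f R M) {L W Y₁ Y₂ : ℝ} (hY₁ : |Y₁| ≤ L) (hY₂ : |Y₂| ≤ L) (hW : 0 ≤ W)
    (J : Fin 3) (x : ℝ) :
    ‖∫ t, f t * (Complex.exp (-(imagParam t (σ 2) * x)) *
      (besselB (a 0) (a 1) (-imagParam t (σ 0)) (-imagParam t (σ 1)) (Y₁ + Real.log (betaD J x) - x) *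
      besselB (a 2) (a 3) (imagParam t (σ 0)) (imagParam t (σ 1)) (Y₂ + Real.log (betaD J x))))‖ ≤
    3 * (1 + L + W) * M * (bumpConst / (2 * R)) *
      (betaWeight J x * ((1 + R * |Y₂ - Y₁ + 3 * x| / 2) ^ 4)⁻¹) +
    144 * (1 + L + W) * (1 + K) ^ 2 * Real.exp (-W) * (∫ t, ‖f t‖) *
      (betaWeight J x * Real.exp (-|x|)) := by
  have hM := hF.nonneg
  set g := Real.log (betaD J x) with hg
  set X₁ := Y₁ + g - x with hX₁
  set X₂ := Y₂ + g with hX₂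
  set V₁ := max X₁ 0 + W + |x| with hV₁
  set V₂ := max X₂ 0 + W + |x| with hV₂
  set ℓ := 3 * (1 + L + W) * betaWeight J x with hℓ
  have hw1 := one_le_betaWeight J x
  have hw : betaWeight J x = 1 + |x| + |g| := rfl
  have hL0 : 0 ≤ L := (abs_nonneg _).trans hY₁
  have hb := bumpConst_nonneg
  have hlen : ∀ X, |X| ≤ L + |g| + |x| → 2 * (max X 0 + W + |x|) - X ≤ ℓ := by
    intro X hX
    have h1 : 2 * max X 0 - X = |X| := by
      rcases le_total X 0 with h | h
      · rw [max_eq_right h, abs_of_nonpos h]; ring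
      · rw [max_eq_left h, abs_of_nonneg h]; ring
    have hx := abs_nonneg x
    have hg := abs_nonneg g
    rw [hℓ, hw]
    nlinarith [mul_nonneg (add_nonneg hL0 hW) (add_nonneg hx hg)]
  have hX1 : |X₁| ≤ L + |g| + |x| := by
    have := abs_add_three Y₁ g (-x)
    rw [abs_neg] at this
    rw [hX₁, sub_eq_add_neg]; linarith
  have hX2 : |X₂| ≤ L + |g| + |x| := by
    have := abs_add_le Y₂ g
    rw [hX₂]; linarith [abs_nonneg x]
  have h1 := hlen X₁ hX1
  have h2 := hlen X₂ hX2
  have hℓ1 : 1 ≤ ℓ := by rw [hℓ]; nlinarith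
  have hV1' : X₁ - V₁ ≤ V₁ := by
    have := le_max_left X₁ 0; have := le_max_right X₁ 0; have := abs_nonneg x
    rw [hV₁]; linarith
  obtain ⟨iT, hT⟩ := norm_integral_besselTrunc_le (σ := σ) (fun j => (ha j).le) hf hR hF x X₁ X₂ V₁ V₂ hV1'
  set A : ℝ × ℝ → ℂ := fun t => f t * (Complex.exp (-(imagParam t (σ 2) * x)) *
      (besselB (a 0) (a 1) (-imagParam t (σ 0)) (-imagParam t (σ 1)) X₁ *
      besselB (a 2) (a 3) (imagParam t (σ 0)) (imagParam t (σ 1)) X₂)) with hA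
  set B : ℝ × ℝ → ℂ := fun t => f t * (Complex.exp (-(imagParam t (σ 2) * x)) *
      (besselTrunc (a 0) (a 1) (-imagParam t (σ 0)) (-imagParam t (σ 1)) X₁ V₁ *
      besselTrunc (a 2) (a 3) (imagParam t (σ 0)) (imagParam t (σ 1)) X₂ V₂)) with hB
  have hAB : ∀ t, ‖A t - B t‖ ≤ (48 * (1 + K) ^ 2 * ℓ * (Real.exp (-W) * Real.exp (-|x|))) * ‖f t‖ := by
    intro t
    by_cases h0 : f t = 0
    · simp [hA, hB, h0]
    · have := norm_besselB_mul_sub_le ha (imagParam_mem_iaStar t) (hK t h0) (σ 0) (σ 1) hV₁ hV₂ hW h1 h2 hℓ1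
      have hre := (imagParam_mem_iaStar t).1 (σ 2)
      have hexp : ‖Complex.exp (-(imagParam t (σ 2) * x))‖ = 1 := by
        rw [Complex.norm_exp]; simp [hre]
      simp only [hA, hB]
      rw [← mul_sub, ← mul_sub, norm_mul, norm_mul, hexp, one_mul, mul_comm]
      gcongr
  have hAm : AEStronglyMeasurable A := by
    have m1 : ∀ j, Measurable (fun t => imagParam t j) := fun j =>
      ((continuous_apply j).comp continuous_imagParam).measurable
    have b1 := (stronglyMeasurable_besselB (a 0) (a 1)).measurable.comp
      ((m1 (σ 0)).neg.prodMk ((m1 (σ 1)).neg.prodMk (measurable_const (a := X₁))))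
    have b2 := (stronglyMeasurable_besselB (a 2) (a 3)).measurable.comp
      ((m1 (σ 0)).prodMk ((m1 (σ 1)).prodMk (measurable_const (a := X₂))))
    have m2 := m1 (σ 2)
    have m3 : Measurable (fun t => Complex.exp (-(imagParam t (σ 2) * x))) := by fun_prop
    exact hf.aestronglyMeasurable.mul (m3.mul (b1.mul b2)).aestronglyMeasurable
  have hDi : Integrable (fun t => A t - B t) :=
    (hf.norm.const_mul _).mono' (hAm.sub iT.aestronglyMeasurable) (Eventually.of_forall hAB)
  have hD : ‖∫ t, (A t - B t)‖ ≤ (48 * (1 + K) ^ 2 * ℓ * (Real.exp (-W) * Real.exp (-|x|))) * ∫ t, ‖f t‖ := by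
    rw [← integral_const_mul]
    exact norm_integral_le_of_norm_le (hf.norm.const_mul _) (Eventually.of_forall hAB)
  have hsplit : ∫ t, A t = (∫ t, B t) + ∫ t, (A t - B t) := by
    rw [← integral_add iT hDi]; congr 1; ext t; ring
  have r : X₂ - X₁ + 2 * x = Y₂ - Y₁ + 3 * x := by rw [hX₁, hX₂]; ring
  rw [r] at hT
  rw [hsplit]
  refine (norm_add_le _ _).trans (add_le_add (hT.trans ?_) (hD.trans_eq ?_))
  · calc _ ≤ ℓ * (M * ((1 + R * |Y₂ - Y₁ + 3 * x| / 2) ^ 4)⁻¹ * (bumpConst / (2 * R))) := by gcongr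
      _ = _ := by rw [hℓ]; ring
  · rw [hℓ]; ring

end Fixed

/-- The constant in the bound for the building blocks. -/
def termBoundConst : ℝ := 6 * bumpConst * weightConst + 144 * weightConst

lemma termBoundConst_nonneg : 0 ≤ termBoundConst := by
  have := bumpConst_nonneg
  have := weightConst_nonneg
  unfold termBoundConst; positivity

/-- The integral of `f` against a regularized building block. -/
lemma norm_integral_mul_termKernel_le_of_lt {a : Fin 4 → ℝ} (ha : ∀ j, |a j| < Real.pi / 2) (J : Fin 3)
    (σ : Equiv.Perm (Fin 3)) {f : ℝ × ℝ → ℂ} {R M K L W Y₁ Y₂ : ℝ} (hf : Integrable f) (hR : 1 ≤ R)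
    (hK : ∀ t, f t ≠ 0 → ‖imagParam t‖ ≤ K) (hK0 : 0 ≤ K) (hF : FourierDecay f R M)
    (hY₁ : |Y₁| ≤ L) (hY₂ : |Y₂| ≤ L) (hW : 0 ≤ W) (hRL : Real.log R ≤ L) :
    ‖∫ t, f t * termKernel a J σ Y₁ Y₂ (imagParam t)‖ ≤ termBoundConst *
      ((1 + L + W) * (1 + L) * M / R ^ 2 + (1 + L + W) * (1 + K) ^ 2 * Real.exp (-W) * ∫ t, ‖f t‖) := by
  have hM := hF.nonneg
  have hR0 : 0 < R := by linarith
  have hL0 : 0 ≤ L := (abs_nonneg _).trans hY₁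
  have hb := bumpConst_nonneg
  have hwc := weightConst_nonneg
  have hf1 : 0 ≤ ∫ t, ‖f t‖ := integral_nonneg fun t => norm_nonneg _
  set H : ℝ × ℝ → ℝ → ℂ := fun t x => f t * (Complex.exp (-(imagParam t (σ 2) * x)) *
      (besselB (a 0) (a 1) (-imagParam t (σ 0)) (-imagParam t (σ 1)) (Y₁ + Real.log (betaD J x) - x) *
      besselB (a 2) (a 3) (imagParam t (σ 0)) (imagParam t (σ 1)) (Y₂ + Real.log (betaD J x)))) with hH
  obtain ⟨C₁, -, hC₁⟩ := exists_norm_besselB_le (ha 0) (ha 1) (σ := 1 / 8) (by norm_num)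
  obtain ⟨C₂, -, hC₂⟩ := exists_norm_besselB_le (ha 2) (ha 3) (σ := 1 / 8) (by norm_num)
  have hre := fun t => (imagParam_mem_iaStar t).1
  have hHi : Integrable (Function.uncurry H) ((volume : Measure (ℝ × ℝ)).prod (volume.restrict (betaSet J))) := by
    have k0 := (integrableOn_betaKer J (p := 1 / 8) (q := 1 / 8) (by norm_num) (by norm_num) (by norm_num)).norm
    have k1 := (hf.norm.mul_prod k0).const_mul (C₁ * C₂ * Real.exp (-(1 / 8 * (Y₁ + Y₂))))
    refine k1.mono' ?_ (Eventually.of_forall fun z => ?_)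
    · have mD := measurable_betaD J
      have m1 : ∀ j, Measurable (fun z : (ℝ × ℝ) × ℝ => imagParam z.1 j) := fun j =>
        ((continuous_apply j).comp (continuous_imagParam.comp continuous_fst)).measurable
      have mx : Measurable (fun z : (ℝ × ℝ) × ℝ => Y₁ + Real.log (betaD J z.2) - z.2) := by fun_prop
      have mx' : Measurable (fun z : (ℝ × ℝ) × ℝ => Y₂ + Real.log (betaD J z.2)) := by fun_prop
      have b1 := (stronglyMeasurable_besselB (a 0) (a 1)).measurable.comp
        ((m1 (σ 0)).neg.prodMk ((m1 (σ 1)).neg.prodMk mx))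
      have b2 := (stronglyMeasurable_besselB (a 2) (a 3)).measurable.comp
        ((m1 (σ 0)).prodMk ((m1 (σ 1)).prodMk mx'))
      have m2 := m1 (σ 2)
      have m3 : Measurable (fun z : (ℝ × ℝ) × ℝ => Complex.exp (-(imagParam z.1 (σ 2) * z.2))) := by
        fun_prop
      exact hf.aestronglyMeasurable.comp_fst.mul (m3.mul (b1.mul b2)).aestronglyMeasurable
    · obtain ⟨t, x⟩ := z
      simp only [Function.uncurry, hH, norm_mul]
      have hexp : ‖Complex.exp (-(imagParam t (σ 2) * x))‖ = 1 := by
        rw [Complex.norm_exp]; simp [hre t (σ 2)]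
      have e1 := hC₁ (-imagParam t (σ 0)) (-imagParam t (σ 1)) (Y₁ + Real.log (betaD J x) - x)
        (by simp [hre t]) (by simp [hre t])
      have e2 := hC₂ (imagParam t (σ 0)) (imagParam t (σ 1)) (Y₂ + Real.log (betaD J x))
        (hre t _) (hre t _)
      rw [hexp, one_mul, norm_betaKer]
      calc _ ≤ ‖f t‖ * ((C₁ * Real.exp (-(1 / 8 * (Y₁ + Real.log (betaD J x) - x)))) *
            (C₂ * Real.exp (-(1 / 8 * (Y₂ + Real.log (betaD J x)))))) :=
            mul_le_mul_of_nonneg_left (mul_le_mul e1 e2 (norm_nonneg _) ((norm_nonneg _).trans e1)) (norm_nonneg _)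
        _ = C₁ * C₂ * ‖f t‖ * (Real.exp (-(1 / 8 * (Y₁ + Real.log (betaD J x) - x))) *
            Real.exp (-(1 / 8 * (Y₂ + Real.log (betaD J x))))) := by ring
        _ = C₁ * C₂ * ‖f t‖ * (Real.exp (-(1 / 8 * (Y₁ + Y₂))) *
            Real.exp (((1 / 8 : ℂ).re) * x - ((1 / 8 : ℂ).re + (1 / 8 : ℂ).re) * Real.log (betaD J x))) := by
            rw [← Real.exp_add, ← Real.exp_add]
            congr 2
            norm_num
            ring
        _ = _ := by ring
  have e1 : ∫ t, f t * termKernel a J σ Y₁ Y₂ (imagParam t) = ∫ x in betaSet J, ∫ t, H t x := by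
    rw [← integral_integral_swap hHi]
    congr 1; ext t
    rw [termKernel_eq_integral_besselB ha J σ Y₁ Y₂ (imagParam_mem_iaStar t), ← integral_const_mul]
  have hc : |Y₂ - Y₁| ≤ 2 * L := by have := abs_sub Y₂ Y₁; linarith
  obtain ⟨i1, w1⟩ := setIntegral_betaWeight_le J hR hL0 hc hRL
  obtain ⟨i2, w2⟩ := setIntegral_betaWeight_exp_le J
  rw [e1]
  refine (norm_integral_le_of_norm_le ((i1.const_mul _).add (i2.const_mul _)) (Eventually.of_forall fun x =>
    norm_integral_besselB_le ha hf hR0 hK hF hY₁ hY₂ hW J x)).trans ?_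
  simp only [Pi.add_apply]
  rw [integral_add (i1.const_mul _) (i2.const_mul _), integral_const_mul, integral_const_mul]
  calc _ ≤ 3 * (1 + L + W) * M * (bumpConst / (2 * R)) * (4 * weightConst * (1 + L) / R) +
      144 * (1 + L + W) * (1 + K) ^ 2 * Real.exp (-W) * (∫ t, ‖f t‖) * weightConst := by gcongr
    _ = 6 * bumpConst * weightConst * ((1 + L + W) * (1 + L) * M / R ^ 2) +
      144 * weightConst * ((1 + L + W) * (1 + K) ^ 2 * Real.exp (-W) * ∫ t, ‖f t‖) := by
        field_simp; ring
    _ ≤ _ := by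
        unfold termBoundConst
        have h1 : 0 ≤ (1 + L + W) * (1 + L) * M / R ^ 2 := by positivity
        have h2 : 0 ≤ (1 + L + W) * (1 + K) ^ 2 * Real.exp (-W) * ∫ t, ‖f t‖ := by positivity
        nlinarith [mul_nonneg (mul_nonneg hb hwc) h2, mul_nonneg hwc h1]

/-- The integral of `f` against a building block. -/
theorem norm_integral_mul_termKernel_le {a : Fin 4 → ℝ} (ha : ∀ j, |a j| ≤ Real.pi / 2) (J : Fin 3)
    (σ : Equiv.Perm (Fin 3)) {f : ℝ × ℝ → ℂ} {R M K L W Y₁ Y₂ : ℝ} (hf : Integrable f) (hR : 1 ≤ R)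
    (hK : ∀ t, f t ≠ 0 → ‖imagParam t‖ ≤ K) (hK0 : 0 ≤ K) (hF : FourierDecay f R M)
    (hY₁ : |Y₁| ≤ L) (hY₂ : |Y₂| ≤ L) (hW : 0 ≤ W) (hRL : Real.log R ≤ L) :
    ‖∫ t, f t * termKernel a J σ Y₁ Y₂ (imagParam t)‖ ≤ termBoundConst *
      ((1 + L + W) * (1 + L) * M / R ^ 2 + (1 + L + W) * (1 + K) ^ 2 * Real.exp (-W) * ∫ t, ‖f t‖) := by
  set b : ℕ → Fin 4 → ℝ := fun n j => (1 - 1 / ((n : ℝ) + 1)) * a j with hb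
  have hc : ∀ n : ℕ, 0 ≤ 1 - 1 / ((n : ℝ) + 1) ∧ 1 - 1 / ((n : ℝ) + 1) < 1 := by
    intro n
    have : 1 / ((n : ℝ) + 1) ≤ 1 := by
      rw [div_le_one (by positivity)]; linarith [(Nat.cast_nonneg n : (0 : ℝ) ≤ n)]
    have h2 : 0 < 1 / ((n : ℝ) + 1) := by positivity
    constructor <;> linarith
  have hblt : ∀ n j, |b n j| < Real.pi / 2 := by
    intro n j
    rw [hb, abs_mul, abs_of_nonneg (hc n).1]
    calc _ ≤ (1 - 1 / ((n : ℝ) + 1)) * (Real.pi / 2) := mul_le_mul_of_nonneg_left (ha j) (hc n).1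
      _ < 1 * (Real.pi / 2) := mul_lt_mul_of_pos_right (hc n).2 (by positivity)
      _ = _ := one_mul _
  have hlim : ∀ j, Tendsto (fun n => b n j) atTop (𝓝 (a j)) := by
    intro j
    have := (tendsto_one_div_add_atTop_nhds_zero_nat (𝕜 := ℝ)).const_sub 1
    simpa [hb] using this.mul_const (a j)
  refine le_of_tendsto (tendsto_integral_mul_termKernel hlim (fun n j => (hblt n j).le) J σ Y₁ Y₂ hf hK).norm
    (Eventually.of_forall fun n => ?_)
  exact norm_integral_mul_termKernel_le_of_lt (hblt n) J σ hf hR hK hK0 hF hY₁ hY₂ hW hRL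

/-! ### Decay of Fourier transforms on the plane of spectral parameters -/

/-- The frequency of `planeFourier` in the coordinates of `imagParam`. -/
def planePhase (c : Fin 3 → ℝ) : ℝ × ℝ →L[ℝ] ℝ :=
  (c 0 - c 2) • ContinuousLinearMap.fst ℝ ℝ ℝ + (c 1 - c 2) • ContinuousLinearMap.snd ℝ ℝ ℝ

lemma planePhase_apply (c : Fin 3 → ℝ) (t : ℝ × ℝ) :
    planePhase c t = (c 0 - c 2) * t.1 + (c 1 - c 2) * t.2 := by
  simp [planePhase]

lemma sum_imagParam_mul (t : ℝ × ℝ) (c : Fin 3 → ℝ) :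
    ∑ j, imagParam t j * c j = (planePhase c t : ℂ) * Complex.I := by
  rw [planePhase_apply, Fin.sum_univ_three]
  simp [imagParam]
  ring

/-- A direction along which the phase detects the difference of two coordinates. -/
lemma exists_planePhase_eq (c : Fin 3 → ℝ) {i j : Fin 3} (hij : i ≠ j) :
    ∃ v : ℝ × ℝ, ‖v‖ ≤ 1 ∧ |planePhase c v| = |c i - c j| := by
  have h02 : ∃ v : ℝ × ℝ, ‖v‖ ≤ 1 ∧ |planePhase c v| = |c 0 - c 2| :=
    ⟨(1, 0), by simp [Prod.norm_def], by simp [planePhase_apply]⟩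
  have h12 : ∃ v : ℝ × ℝ, ‖v‖ ≤ 1 ∧ |planePhase c v| = |c 1 - c 2| :=
    ⟨(0, 1), by simp [Prod.norm_def], by simp [planePhase_apply]⟩
  have h01 : ∃ v : ℝ × ℝ, ‖v‖ ≤ 1 ∧ |planePhase c v| = |c 0 - c 1| :=
    ⟨(1, -1), by simp [Prod.norm_def], by rw [planePhase_apply]; congr 1; ring⟩
  fin_cases i <;> fin_cases j
  · exact absurd rfl hij
  · exact h01
  · exact h02
  · show ∃ v : ℝ × ℝ, ‖v‖ ≤ 1 ∧ |planePhase c v| = |c 1 - c 0|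
    rwa [abs_sub_comm]
  · exact absurd rfl hij
  · exact h12
  · show ∃ v : ℝ × ℝ, ‖v‖ ≤ 1 ∧ |planePhase c v| = |c 2 - c 0|
    rwa [abs_sub_comm]
  · show ∃ v : ℝ × ℝ, ‖v‖ ≤ 1 ∧ |planePhase c v| = |c 2 - c 1|
    rwa [abs_sub_comm]
  · exact absurd rfl hij

lemma norm_planeFourier_le (f : ℝ × ℝ → ℂ) (c : Fin 3 → ℝ) : ‖planeFourier f c‖ ≤ ∫ t, ‖f t‖ := by
  refine (norm_integral_le_integral_norm _).trans_eq ?_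
  congr 1; ext t
  rw [sum_imagParam_mul, norm_mul, Complex.norm_exp_ofReal_mul_I, mul_one]

lemma volume_real_closedBall_prod {r : ℝ} (hr : 0 ≤ r) :
    volume.real (Metric.closedBall (0 : ℝ × ℝ) r) = (2 * r) ^ 2 := by
  have : Metric.closedBall (0 : ℝ × ℝ) r = Metric.closedBall (0 : ℝ) r ×ˢ Metric.closedBall (0 : ℝ) r := by
    rw [closedBall_prod_same]; rfl
  rw [this, measureReal_def, Measure.volume_eq_prod, Measure.prod_prod, Real.volume_closedBall,
    ENNReal.toReal_mul, ENNReal.toReal_ofReal (by positivity)]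
  ring

lemma hasCompactSupport_of_norm_le {F : ℝ × ℝ → ℂ} {r : ℝ} (hr : ∀ t, F t ≠ 0 → ‖t‖ ≤ r) :
    HasCompactSupport F :=
  HasCompactSupport.of_support_subset_isCompact (isCompact_closedBall (0 : ℝ × ℝ) r)
    fun t ht => by simpa using hr t ht

/-- Repeated integration by parts. -/
lemma pow_mul_norm_planeFourier_le {F : ℝ × ℝ → ℂ} (hF : ContDiff ℝ ∞ F) {r D : ℝ} (hr0 : 0 ≤ r)
    (hr : ∀ t, F t ≠ 0 → ‖t‖ ≤ r) {n : ℕ} (hD : ∀ t, ‖t‖ ≤ r → ‖iteratedFDeriv ℝ n F t‖ ≤ D)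
    (c : Fin 3 → ℝ) {i j : Fin 3} (hij : i ≠ j) :
    |c i - c j| ^ n * ‖planeFourier F c‖ ≤ (2 * r) ^ 2 * D := by
  have hcs := hasCompactSupport_of_norm_le hr
  obtain ⟨v, hv, hvc⟩ := exists_planePhase_eq c hij
  set L : ℝ × ℝ →L[ℝ] ℝ →L[ℝ] ℝ := (planePhase c).smulRight (ContinuousLinearMap.id ℝ ℝ) with hL
  set w : ℝ := -(1 / (2 * Real.pi)) with hw
  have hpi := Real.pi_pos
  have hint : ∀ k : ℕ, (k : ℕ∞) ≤ ⊤ → Integrable (iteratedFDeriv ℝ k F) volume := fun k _ =>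
    (hF.continuous_iteratedFDeriv (by exact_mod_cast le_top)).integrable_of_hasCompactSupport
      (hcs.iteratedFDeriv k)
  have key := congrFun (VectorFourier.fourierIntegral_iteratedFDeriv (μ := volume) (N := ⊤) L hF hint
    (n := n) le_top) w
  have hLw : ∀ t, L t w = planePhase c t * w := fun t => by simp [hL]
  have hfour : VectorFourier.fourierIntegral Real.fourierChar volume L.toLinearMap₁₂ F w = planeFourier F c := by
    rw [VectorFourier.fourierIntegral, planeFourier]
    congr 1; ext t
    rw [sum_imagParam_mul, Circle.smul_def, smul_eq_mul, Real.fourierChar_apply, mul_comm]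
    congr 2
    have : (-(L.toLinearMap₁₂ t) w : ℝ) = planePhase c t / (2 * Real.pi) := by
      show -(L t w) = _
      rw [hLw, hw]; ring
    rw [this]
    push_cast
    have : (Real.pi : ℂ) ≠ 0 := by exact_mod_cast hpi.ne'
    field_simp
  have key2 := congrArg (fun A : ContinuousMultilinearMap ℝ (fun _ : Fin n => ℝ × ℝ) ℂ => ‖A fun _ => v‖) key
  simp only [VectorFourier.fourierPowSMulRight_apply, hfour] at key2
  have hR : ‖(-(2 * (Real.pi : ℂ) * Complex.I)) ^ n • (∏ _i : Fin n, (-L.flip) w v) • planeFourier F c‖ =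
      |c i - c j| ^ n * ‖planeFourier F c‖ := by
    have h1 : (-L.flip) w v = planePhase c v / (2 * Real.pi) := by
      show -(L v w) = _
      rw [hLw, hw]; ring
    rw [h1, Finset.prod_const, Finset.card_univ, Fintype.card_fin, norm_smul, norm_smul, norm_pow, norm_pow,
      ← mul_assoc, ← mul_pow]
    congr 2
    rw [norm_neg, norm_mul, norm_mul, Complex.norm_I, Complex.norm_real, Real.norm_eq_abs, Real.norm_eq_abs,
      abs_div, hvc, abs_of_pos hpi, abs_of_pos (by positivity : 0 < 2 * Real.pi)]
    have : ‖(2 : ℂ)‖ = 2 := by norm_num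
    rw [this]
    field_simp
  rw [hR] at key2
  rw [← key2]
  have hD0 : 0 ≤ D := (norm_nonneg _).trans (hD 0 (by simpa using hr0))
  refine (ContinuousMultilinearMap.le_opNorm _ _).trans ?_
  have hprod : ∏ _i : Fin n, ‖v‖ ≤ 1 := Finset.prod_le_one (fun _ _ => norm_nonneg _) (fun _ _ => hv)
  refine (mul_le_of_le_one_right (norm_nonneg _) hprod).trans ?_
  refine (VectorFourier.norm_fourierIntegral_le_integral_norm _ _ _ _ _).trans ?_
  have hz : ∀ t ∉ Metric.closedBall (0 : ℝ × ℝ) r, ‖iteratedFDeriv ℝ n F t‖ = 0 := by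
    intro t ht
    rw [norm_eq_zero]
    by_contra h0
    have h1 := support_iteratedFDeriv_subset (𝕜 := ℝ) (f := F) n h0
    have h2 : tsupport F ⊆ Metric.closedBall (0 : ℝ × ℝ) r :=
      closure_minimal (fun t ht => by simpa using hr t ht) Metric.isClosed_closedBall
    exact ht (h2 h1)
  rw [← setIntegral_eq_integral_of_forall_compl_eq_zero hz]
  have := setIntegral_mono_on (hint n le_top).norm.integrableOn
    (integrableOn_const (C := D) (hs := (isCompact_closedBall (0 : ℝ × ℝ) r).measure_lt_top.ne))
    measurableSet_closedBall
    (fun t ht => hD t (by simpa using ht))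
  refine this.trans_eq ?_
  rw [setIntegral_const, volume_real_closedBall_prod hr0, smul_eq_mul]

/-- Decay of the Fourier transform from a bound for the `L¹` norm and the derivatives. -/
lemma fourierDecay_of_bounds {F : ℝ × ℝ → ℂ} (hF : ContDiff ℝ ∞ F) {r D R M S : ℝ} (hr0 : 0 ≤ r)
    (hr : ∀ t, F t ≠ 0 → ‖t‖ ≤ r) {n : ℕ} (hR : 0 < R)
    (hD : ∀ t, ‖t‖ ≤ r → ‖iteratedFDeriv ℝ (n + 8) F t‖ ≤ D * (R ^ (n + 8))⁻¹) (hS : 1 ≤ S)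
    (hM1 : 2 ^ 8 * S ^ 8 * ∫ t, ‖F t‖ ≤ M) (hM2 : 2 ^ 8 * ((2 * r) ^ 2 * D) ≤ M * S ^ n) :
    FourierDecay F R M := by
  intro c i j hij
  have hp := norm_planeFourier_le F c
  have hk := pow_mul_norm_planeFourier_le hF hr0 hr hD c hij
  set x := |c i - c j| with hx
  have hx0 : 0 ≤ x := abs_nonneg _
  set y := ‖planeFourier F c‖ with hy
  have hy0 : 0 ≤ y := norm_nonneg _
  rcases le_total (R * x) S with h | h
  · calc y * (1 + R * x) ^ 8 ≤ (∫ t, ‖F t‖) * (2 * S) ^ 8 := by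
          gcongr; linarith
      _ = 2 ^ 8 * S ^ 8 * ∫ t, ‖F t‖ := by ring
      _ ≤ M := hM1
  · have h1 : (R * x) ^ (n + 8) * y ≤ (2 * r) ^ 2 * D := by
      have : (R * x) ^ (n + 8) * y = R ^ (n + 8) * (x ^ (n + 8) * y) := by rw [mul_pow]; ring
      rw [this]
      calc _ ≤ R ^ (n + 8) * ((2 * r) ^ 2 * (D * (R ^ (n + 8))⁻¹)) := by gcongr
        _ = _ := by field_simp
    have h2 : S ^ n * (y * (1 + R * x) ^ 8) ≤ 2 ^ 8 * ((2 * r) ^ 2 * D) := by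
      calc _ ≤ (R * x) ^ n * (y * (2 * (R * x)) ^ 8) := by
            gcongr; linarith
        _ = 2 ^ 8 * ((R * x) ^ (n + 8) * y) := by rw [pow_add]; ring
        _ ≤ _ := by gcongr
    have hSn : 0 < S ^ n := by positivity
    have := h2.trans hM2
    rw [mul_comm M] at this
    exact le_of_mul_le_mul_left this hSn

/-! ### Symbols -/

/-- Families of functions whose derivatives of order `j` are `≪ T^{jp}` on balls of radius `BT`. -/
structure IsSymbol (p B : ℝ) (g : ℝ → ℝ × ℝ → ℂ) : Prop where
  smooth : ∀ T : ℝ, 1 < T → ContDiff ℝ ∞ (g T)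
  bound : ∀ j : ℕ, ∃ C : ℝ, 0 ≤ C ∧ ∀ T : ℝ, 1 < T → ∀ t, ‖t‖ ≤ B * T →
    ‖iteratedFDeriv ℝ j (g T) t‖ ≤ C * T ^ ((j : ℝ) * p)

lemma IsSymbol.mul {p B : ℝ} {f g : ℝ → ℝ × ℝ → ℂ} (hf : IsSymbol p B f) (hg : IsSymbol p B g) :
    IsSymbol p B (fun T t => f T t * g T t) := by
  refine ⟨fun T hT => (hf.smooth T hT).mul (hg.smooth T hT), fun j => ?_⟩
  choose C hC0 hC using hf.bound
  choose D hD0 hD using hg.bound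
  refine ⟨∑ i ∈ Finset.range (j + 1), (j.choose i : ℝ) * C i * D (j - i),
    Finset.sum_nonneg fun i _ => mul_nonneg (mul_nonneg (Nat.cast_nonneg _) (hC0 _)) (hD0 _),
    fun T hT t ht => ?_⟩
  have hT0 : 0 < T := by linarith
  refine (norm_iteratedFDeriv_mul_le (hf.smooth T hT) (hg.smooth T hT) t (by exact_mod_cast le_top)).trans ?_
  rw [Finset.sum_mul]
  refine Finset.sum_le_sum fun i hi => ?_
  have hij : i ≤ j := Nat.lt_succ_iff.1 (Finset.mem_range.1 hi)
  have hpow : T ^ ((j : ℝ) * p) = T ^ ((i : ℝ) * p) * T ^ (((j - i : ℕ) : ℝ) * p) := by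
    rw [← Real.rpow_add hT0, Nat.cast_sub hij]; congr 1; ring
  rw [hpow]
  calc _ ≤ (j.choose i : ℝ) * (C i * T ^ ((i : ℝ) * p)) * (D (j - i) * T ^ (((j - i : ℕ) : ℝ) * p)) := by
        have := hC0 i
        gcongr
        · exact hC i T hT t ht
        · exact hD _ T hT t ht
    _ = _ := by ring

lemma norm_iteratedFDeriv_clm_succ_le (ℓ : ℝ × ℝ →L[ℝ] ℂ) (j : ℕ) (t : ℝ × ℝ) :
    ‖iteratedFDeriv ℝ (j + 1) ℓ t‖ ≤ if j = 0 then ‖ℓ‖ else 0 := by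
  rw [← norm_iteratedFDeriv_fderiv]
  have : fderiv ℝ ℓ = fun _ => ℓ := by ext1 x; exact ℓ.fderiv
  rw [this]
  split_ifs with h
  · subst h; simp
  · rw [iteratedFDeriv_const_of_ne h]; simp

lemma isSymbol_clm {p B : ℝ} (hp : -1 ≤ p) (hB : 0 ≤ B) (ℓ : ℝ × ℝ →L[ℝ] ℂ) :
    IsSymbol p B (fun T t => (T⁻¹ : ℝ) • ℓ t) := by
  refine ⟨fun T _ => ℓ.contDiff.const_smul _, fun j => ⟨‖ℓ‖ * (1 + B), by positivity, fun T hT t ht => ?_⟩⟩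
  have hT0 : 0 < T := by linarith
  rw [iteratedFDeriv_const_smul_apply' (ℓ.contDiff.contDiffAt), norm_smul, norm_inv, Real.norm_of_nonneg hT0.le]
  rcases j with _ | j
  · rw [norm_iteratedFDeriv_zero]
    have h1 : ‖ℓ t‖ ≤ ‖ℓ‖ * (B * T) := (ℓ.le_opNorm t).trans (by gcongr)
    have : T⁻¹ * (‖ℓ‖ * (B * T)) = ‖ℓ‖ * B := by field_simp
    have h2 : T⁻¹ * ‖ℓ t‖ ≤ ‖ℓ‖ * B := by rw [← this]; gcongr
    have : (T : ℝ) ^ (((0 : ℕ) : ℝ) * p) = 1 := by simp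
    rw [this]
    nlinarith [norm_nonneg ℓ]
  · refine (mul_le_mul_of_nonneg_left (norm_iteratedFDeriv_clm_succ_le ℓ j t) (by positivity)).trans ?_
    split_ifs with h
    · subst h
      have h1 : T⁻¹ ≤ T ^ (((0 + 1 : ℕ) : ℝ) * p) := by
        rw [← Real.rpow_neg_one]
        exact Real.rpow_le_rpow_of_exponent_le hT.le (by simpa using hp)
      calc T⁻¹ * ‖ℓ‖ = ‖ℓ‖ * T⁻¹ := mul_comm _ _
        _ ≤ ‖ℓ‖ * (1 + B) * T ^ (((0 + 1 : ℕ) : ℝ) * p) := by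
          gcongr
          nlinarith [norm_nonneg ℓ]
    · rw [mul_zero]; positivity

/-! ### Consequences of the conditions on the test functions -/

/-- What is used about a family of test functions. -/
structure TestData (h : ℝ → (Fin 3 → ℂ) → ℂ) (ε B c : ℝ) : Prop where
  eps_pos : 0 < ε
  eps_lt : ε < 1 / 2
  B_pos : 0 < B
  c_pos : 0 < c
  smooth : ∀ T : ℝ, 1 < T → ContDiff ℝ ∞ (fun t : ℝ × ℝ => h T (imagParam t))
  norm_le : ∀ T : ℝ, 1 < T → ∀ t, h T (imagParam t) ≠ 0 → ‖imagParam t‖ ≤ B * T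
  gap : ∀ T : ℝ, 1 < T → ∀ t, h T (imagParam t) ≠ 0 → ∀ i j, i ≠ j →
    c * T ≤ |(imagParam t i).im - (imagParam t j).im|
  deriv_bound : ∀ j : ℕ, ∃ C : ℝ, ∀ T : ℝ, 1 < T → ∀ t : ℝ × ℝ,
    ‖iteratedFDeriv ℝ j (fun t : ℝ × ℝ => h T (imagParam t)) t‖ ≤ C * T ^ ((j : ℝ) * (ε - 1))
  norm_integral : ∃ C : ℝ, 0 ≤ C ∧ ∀ T : ℝ, 1 < T → ∫ t, ‖h T (imagParam t)‖ ≤ C * T ^ (2 - 2 * ε)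

lemma norm_le_norm_imagParam (t : ℝ × ℝ) : ‖t‖ ≤ ‖imagParam t‖ := by
  rw [Prod.norm_def]
  have h0 := norm_le_pi_norm (imagParam t) 0
  have h1 := norm_le_pi_norm (imagParam t) 1
  simp [imagParam] at h0 h1
  exact max_le h0 h1

lemma norm_nu_le (μ : Fin 3 → ℂ) (j : Fin 3) : ‖3 * nu μ j‖ ≤ 2 * ‖μ‖ := by
  have key : ∀ i k, ‖3 * ((μ i - μ k) / 3)‖ ≤ 2 * ‖μ‖ := by
    intro i k
    rw [mul_div_cancel₀ _ (by norm_num : (3 : ℂ) ≠ 0)]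
    linarith [norm_sub_le (μ i) (μ k), norm_le_pi_norm μ i, norm_le_pi_norm μ k]
  fin_cases j
  · exact key 0 1
  · exact key 1 2
  · exact key 2 0

/-- The Weyl chamber on which the coordinates `μ (σ 0)`, `μ (σ 1)`, `μ (σ 2)` have decreasing
imaginary parts. -/
def chamber (σ : Equiv.Perm (Fin 3)) : Set (ℝ × ℝ) :=
  {t | (imagParam t (σ 1)).im < (imagParam t (σ 0)).im ∧
    (imagParam t (σ 2)).im < (imagParam t (σ 1)).im}

lemma continuous_imagParam_im (j : Fin 3) : Continuous (fun t => (imagParam t j).im) :=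
  Complex.continuous_im.comp ((continuous_apply j).comp continuous_imagParam)

lemma isOpen_chamber (σ : Equiv.Perm (Fin 3)) : IsOpen (chamber σ) :=
  (isOpen_lt (continuous_imagParam_im _) (continuous_imagParam_im _)).inter
    (isOpen_lt (continuous_imagParam_im _) (continuous_imagParam_im _))

/-- A function supported off the walls and its restriction to a chamber coincide locally, or the
latter vanishes locally. -/
lemma eventuallyEq_indicator_chamber {F : ℝ × ℝ → ℂ} {γ : ℝ} (hγ : 0 < γ)
    (hF : ∀ t, F t ≠ 0 → ∀ i j, i ≠ j → γ ≤ |(imagParam t i).im - (imagParam t j).im|)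
    (σ : Equiv.Perm (Fin 3)) (t : ℝ × ℝ) :
    (chamber σ).indicator F =ᶠ[𝓝 t] F ∨ (chamber σ).indicator F =ᶠ[𝓝 t] 0 := by
  by_cases h1 : t ∈ chamber σ
  · left
    filter_upwards [(isOpen_chamber σ).mem_nhds h1] with s hs using indicator_of_mem hs F
  · right
    have hne : σ 0 ≠ σ 1 := perm_ne σ (by decide)
    have hne' : σ 1 ≠ σ 2 := perm_ne σ (by decide)
    have hc : ∀ i j, Continuous (fun t => (imagParam t i).im - (imagParam t j).im) := fun i j =>
      (continuous_imagParam_im i).sub (continuous_imagParam_im j)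
    have key : ∀ i j, i ≠ j → (imagParam t i).im ≤ (imagParam t j).im →
        (∀ s ∈ chamber σ, (imagParam s j).im < (imagParam s i).im) →
        (chamber σ).indicator F =ᶠ[𝓝 t] 0 := by
      intro i j hij hle hs
      have : ∀ᶠ s in 𝓝 t, (imagParam s i).im - (imagParam s j).im < γ :=
        (hc i j).continuousAt.eventually_lt_const (by linarith)
      filter_upwards [this] with s hs'
      by_cases h2 : s ∈ chamber σ
      · rw [indicator_of_mem h2]
        by_contra h0
        have h3 := hF s h0 i j hij
        have h4 := hs s h2
        rw [abs_of_pos (by linarith)] at h3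
        linarith
      · rw [indicator_of_notMem h2]; rfl
    simp only [chamber, mem_ofPred_eq, not_and_or, not_lt] at h1
    rcases h1 with h1 | h1
    · exact key _ _ hne h1 fun s hs => hs.1
    · exact key _ _ hne' h1 fun s hs => hs.2

lemma contDiff_indicator_chamber {F : ℝ × ℝ → ℂ} {γ : ℝ} (hγ : 0 < γ)
    (hF : ∀ t, F t ≠ 0 → ∀ i j, i ≠ j → γ ≤ |(imagParam t i).im - (imagParam t j).im|)
    (hs : ContDiff ℝ ∞ F) (σ : Equiv.Perm (Fin 3)) : ContDiff ℝ ∞ ((chamber σ).indicator F) := by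
  rw [contDiff_iff_contDiffAt]
  intro t
  rcases eventuallyEq_indicator_chamber hγ hF σ t with h | h
  · exact hs.contDiffAt.congr_of_eventuallyEq h
  · exact contDiffAt_const.congr_of_eventuallyEq h

lemma norm_iteratedFDeriv_indicator_chamber_le {F : ℝ × ℝ → ℂ} {γ : ℝ} (hγ : 0 < γ)
    (hF : ∀ t, F t ≠ 0 → ∀ i j, i ≠ j → γ ≤ |(imagParam t i).im - (imagParam t j).im|)
    (σ : Equiv.Perm (Fin 3)) (n : ℕ) (t : ℝ × ℝ) :
    ‖iteratedFDeriv ℝ n ((chamber σ).indicator F) t‖ ≤ ‖iteratedFDeriv ℝ n F t‖ := by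
  rcases eventuallyEq_indicator_chamber hγ hF σ t with h | h
  · rw [(h.iteratedFDeriv ℝ n).eq_of_nhds]
  · rw [(h.iteratedFDeriv ℝ n).eq_of_nhds]
    have : iteratedFDeriv ℝ n (0 : ℝ × ℝ → ℂ) t = 0 := by
      have := iteratedFDeriv_fun_zero (𝕜 := ℝ) (E := ℝ × ℝ) (F := ℂ) (n := n)
      exact congrFun this t
    rw [this, norm_zero]; exact norm_nonneg _

/-- The main amplitude on a chamber. -/
def amplitude (h : ℝ → (Fin 3 → ℂ) → ℂ) (σ : Equiv.Perm (Fin 3)) (T : ℝ) : ℝ × ℝ → ℂ :=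
  (chamber σ).indicator fun t => h T (imagParam t) * ∏ j, (3 * nu (imagParam t) j)

lemma exists_nu_clm (j : Fin 3) : ∃ ℓ : ℝ × ℝ →L[ℝ] ℂ, ∀ t, 3 * nu (imagParam t) j = ℓ t := by
  have hl : ∀ i, ∃ ℓ : ℝ × ℝ →L[ℝ] ℂ, ∀ t, imagParam t i = ℓ t := by
    set p : ℝ × ℝ →L[ℝ] ℂ := (Complex.ofRealCLM.comp (ContinuousLinearMap.fst ℝ ℝ ℝ)) with hp
    set q : ℝ × ℝ →L[ℝ] ℂ := (Complex.ofRealCLM.comp (ContinuousLinearMap.snd ℝ ℝ ℝ)) with hq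
    intro i
    fin_cases i
    · exact ⟨Complex.I • p, fun t => by simp [imagParam, hp]⟩
    · exact ⟨Complex.I • q, fun t => by simp [imagParam, hq]⟩
    · exact ⟨-(Complex.I • (p + q)), fun t => by simp [imagParam, hp, hq]; ring⟩
  have key : ∀ i k, ∃ ℓ : ℝ × ℝ →L[ℝ] ℂ, ∀ t, 3 * ((imagParam t i - imagParam t k) / 3) = ℓ t := by
    intro i k
    obtain ⟨ℓ₁, h₁⟩ := hl i
    obtain ⟨ℓ₂, h₂⟩ := hl k
    refine ⟨ℓ₁ - ℓ₂, fun t => ?_⟩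
    rw [mul_div_cancel₀ _ (by norm_num : (3 : ℂ) ≠ 0), h₁, h₂]; rfl
  fin_cases j
  · exact key 0 1
  · exact key 1 2
  · exact key 2 0

section Data

variable {h : ℝ → (Fin 3 → ℂ) → ℂ} {ε B c : ℝ}

lemma TestData.continuous (H : TestData h ε B c) {T : ℝ} (hT : 1 < T) :
    Continuous (fun t => h T (imagParam t)) := (H.smooth T hT).continuous

lemma TestData.integrable (H : TestData h ε B c) {T : ℝ} (hT : 1 < T) :
    Integrable (fun t => h T (imagParam t)) :=
  (H.continuous hT).integrable_of_hasCompactSupport (hasCompactSupport_of_norm_le (r := B * T)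
    fun t ht => (norm_le_norm_imagParam t).trans (H.norm_le T hT t ht))

lemma ne_zero_of_amplitude_ne_zero {σ : Equiv.Perm (Fin 3)} {T : ℝ} {t : ℝ × ℝ}
    (ht : amplitude h σ T t ≠ 0) : h T (imagParam t) ≠ 0 := by
  unfold amplitude at ht
  have := (indicator_apply_ne_zero.1 ht).2
  exact left_ne_zero_of_mul this

lemma TestData.symbol (H : TestData h ε B c) :
    IsSymbol (ε - 1) B (fun T t => h T (imagParam t) * ((T⁻¹ : ℝ) • (3 * nu (imagParam t) 0)) *
      ((T⁻¹ : ℝ) • (3 * nu (imagParam t) 1)) * ((T⁻¹ : ℝ) • (3 * nu (imagParam t) 2))) := by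
  have hh : IsSymbol (ε - 1) B (fun T t => h T (imagParam t)) := by
    refine ⟨H.smooth, fun j => ?_⟩
    obtain ⟨C, hC⟩ := H.deriv_bound j
    refine ⟨max C 0, le_max_right _ _, fun T hT t _ => (hC T hT t).trans ?_⟩
    have hT0 : 0 < T := by linarith
    gcongr
    exact le_max_left _ _
  have hl : ∀ j, IsSymbol (ε - 1) B (fun T t => (T⁻¹ : ℝ) • (3 * nu (imagParam t) j)) := by
    intro j
    obtain ⟨ℓ, hℓ⟩ := exists_nu_clm j
    simp only [hℓ]
    exact isSymbol_clm (by linarith [H.eps_pos]) H.B_pos.le ℓ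
  exact ((hh.mul (hl 0)).mul (hl 1)).mul (hl 2)

lemma TestData.amplitude_eq (T : ℝ) (hT : 1 < T) (σ : Equiv.Perm (Fin 3)) :
    amplitude h σ T = (chamber σ).indicator (fun t => ((T ^ 3 : ℝ) : ℂ) *
      (h T (imagParam t) * ((T⁻¹ : ℝ) • (3 * nu (imagParam t) 0)) *
      ((T⁻¹ : ℝ) • (3 * nu (imagParam t) 1)) * ((T⁻¹ : ℝ) • (3 * nu (imagParam t) 2)))) := by
  unfold amplitude
  congr 1; ext t
  have : (T : ℂ) ≠ 0 := by exact_mod_cast (by linarith : T ≠ 0)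
  rw [Fin.prod_univ_three]
  simp only [Complex.real_smul]
  push_cast
  field_simp

lemma TestData.norm_amplitude_le (H : TestData h ε B c) (σ : Equiv.Perm (Fin 3)) {T : ℝ} (hT : 1 < T)
    (t : ℝ × ℝ) : ‖amplitude h σ T t‖ ≤ (2 * B * T) ^ 3 * ‖h T (imagParam t)‖ := by
  have hB := H.B_pos
  by_cases h0 : amplitude h σ T t = 0
  · rw [h0, norm_zero]; have : 0 < T := by linarith
    positivity
  · have h1 := ne_zero_of_amplitude_ne_zero h0
    have hn := H.norm_le T hT t h1
    unfold amplitude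
    refine (norm_indicator_le_norm_self _ _).trans ?_
    rw [norm_mul, norm_prod, mul_comm]
    gcongr
    calc ∏ j, ‖3 * nu (imagParam t) j‖ ≤ ∏ _j : Fin 3, (2 * B * T) :=
          Finset.prod_le_prod (fun _ _ => norm_nonneg _) fun j _ =>
            (norm_nu_le _ j).trans (by linarith)
      _ = _ := by simp

/-- The properties of the amplitude. -/
theorem TestData.amplitude_spec (H : TestData h ε B c) (σ : Equiv.Perm (Fin 3)) {η : ℝ} (hη : 0 < η) :
    ∃ C : ℝ, 0 ≤ C ∧ ∀ T : ℝ, 1 < T →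
      Integrable (amplitude h σ T) ∧
      (∫ t, ‖amplitude h σ T t‖) ≤ C * T ^ (5 - 2 * ε) ∧
      FourierDecay (amplitude h σ T) (T ^ (1 - ε)) (C * T ^ (5 - 2 * ε + η)) := by
  obtain ⟨C₀, hC₀, hL1⟩ := H.norm_integral
  have hB := H.B_pos
  obtain ⟨n, hn⟩ := exists_nat_gt (8 / η)
  obtain ⟨C₁, hC₁, hsym⟩ := H.symbol.bound (n + 8)
  set C₂ := (2 * B) ^ 3 * C₀ with hC₂
  set C := 2 ^ 8 * C₂ + 2 ^ 8 * (2 * B) ^ 2 * C₁ with hC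
  have hC20 : 0 ≤ C₂ := by positivity
  have hC10 : 0 ≤ 2 ^ 8 * (2 * B) ^ 2 * C₁ := by positivity
  refine ⟨C, by positivity, fun T hT => ?_⟩
  have hT0 : 0 < T := by linarith
  have hsm : ContDiff ℝ ∞ (fun t => ((T ^ 3 : ℝ) : ℂ) *
      (h T (imagParam t) * ((T⁻¹ : ℝ) • (3 * nu (imagParam t) 0)) *
      ((T⁻¹ : ℝ) • (3 * nu (imagParam t) 1)) * ((T⁻¹ : ℝ) • (3 * nu (imagParam t) 2)))) :=
    contDiff_const.mul (H.symbol.smooth T hT)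
  have hgap : ∀ t, ((T ^ 3 : ℝ) : ℂ) *
      (h T (imagParam t) * ((T⁻¹ : ℝ) • (3 * nu (imagParam t) 0)) *
      ((T⁻¹ : ℝ) • (3 * nu (imagParam t) 1)) * ((T⁻¹ : ℝ) • (3 * nu (imagParam t) 2))) ≠ 0 →
      ∀ i j, i ≠ j → c * T ≤ |(imagParam t i).im - (imagParam t j).im| := fun t ht =>
    H.gap T hT t (left_ne_zero_of_mul (left_ne_zero_of_mul (left_ne_zero_of_mul (right_ne_zero_of_mul ht))))
  have hγ : 0 < c * T := mul_pos H.c_pos hT0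
  have hcd : ContDiff ℝ ∞ (amplitude h σ T) := by
    rw [TestData.amplitude_eq T hT]
    exact contDiff_indicator_chamber hγ hgap hsm σ
  have hsupp : ∀ t, amplitude h σ T t ≠ 0 → ‖t‖ ≤ B * T := fun t ht =>
    (norm_le_norm_imagParam t).trans (H.norm_le T hT t (ne_zero_of_amplitude_ne_zero ht))
  have hint : Integrable (amplitude h σ T) :=
    hcd.continuous.integrable_of_hasCompactSupport (hasCompactSupport_of_norm_le hsupp)
  have hnorm : (∫ t, ‖amplitude h σ T t‖) ≤ C₂ * T ^ (5 - 2 * ε) := by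
    calc _ ≤ ∫ t, (2 * B * T) ^ 3 * ‖h T (imagParam t)‖ :=
          integral_mono hint.norm ((H.integrable hT).norm.const_mul _) (H.norm_amplitude_le σ hT)
      _ = (2 * B * T) ^ 3 * ∫ t, ‖h T (imagParam t)‖ := integral_const_mul _ _
      _ ≤ (2 * B * T) ^ 3 * (C₀ * T ^ (2 - 2 * ε)) := by gcongr; exact hL1 T hT
      _ = C₂ * (T ^ (3 : ℝ) * T ^ (2 - 2 * ε)) := by
          rw [hC₂, show (T : ℝ) ^ (3 : ℝ) = T ^ 3 by exact_mod_cast Real.rpow_natCast T 3]; ring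
      _ = _ := by rw [← Real.rpow_add hT0]; congr 2; ring
  have hTp : 0 < T ^ (5 - 2 * ε) := by positivity
  refine ⟨hint, hnorm.trans ?_, ?_⟩
  · gcongr; rw [hC]; linarith
  have hS8 : (T ^ (η / 8)) ^ 8 = T ^ η := by
    rw [← Real.rpow_natCast, ← Real.rpow_mul hT0.le]; congr 1; push_cast; ring
  refine fourierDecay_of_bounds hcd (r := B * T) (D := T ^ 3 * C₁) (n := n) (S := T ^ (η / 8)) (by positivity)
    hsupp (by positivity) ?_ (Real.one_le_rpow hT.le (by positivity)) ?_ ?_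
  · intro t ht
    rw [TestData.amplitude_eq T hT]
    refine (norm_iteratedFDeriv_indicator_chamber_le hγ hgap σ _ t).trans ?_
    have hle : ∀ m : ℕ, (m : WithTop ℕ∞) ≤ ∞ := fun m => by exact_mod_cast le_top
    have e := iteratedFDeriv_const_smul_apply' (𝕜 := ℝ) (i := n + 8) (a := ((T ^ 3 : ℝ) : ℂ)) (x := t)
      ((H.symbol.smooth T hT).contDiffAt.of_le
        (hle (n + 8)))
    simp only [smul_eq_mul] at e
    rw [e, norm_smul, Complex.norm_real, Real.norm_of_nonneg (by positivity)]
    have hr : ((T ^ (1 - ε)) ^ (n + 8))⁻¹ = T ^ (((n + 8 : ℕ) : ℝ) * (ε - 1)) := by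
      rw [← Real.rpow_natCast, ← Real.rpow_mul hT0.le, ← Real.rpow_neg hT0.le]; congr 1; ring
    rw [hr, mul_assoc]
    gcongr
    exact hsym T hT t ht
  · rw [hS8]
    calc _ ≤ 2 ^ 8 * T ^ η * (C₂ * T ^ (5 - 2 * ε)) := by gcongr
      _ = 2 ^ 8 * C₂ * T ^ (5 - 2 * ε + η) := by rw [Real.rpow_add hT0]; ring
      _ ≤ _ := by gcongr; rw [hC]; linarith
  · have hSn : T ≤ (T ^ (η / 8)) ^ n := by
      rw [← Real.rpow_natCast, ← Real.rpow_mul hT0.le]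
      have : 1 ≤ η / 8 * n := by
        rw [div_lt_iff₀ hη] at hn; linarith
      calc T = T ^ (1 : ℝ) := (Real.rpow_one T).symm
        _ ≤ _ := Real.rpow_le_rpow_of_exponent_le hT.le this
    have h4 : T ^ 4 ≤ T ^ (5 - 2 * ε + η) := by
      rw [show (T : ℝ) ^ 4 = T ^ (4 : ℝ) by exact_mod_cast (Real.rpow_natCast T 4).symm]
      exact Real.rpow_le_rpow_of_exponent_le hT.le (by linarith [H.eps_lt])
    calc 2 ^ 8 * ((2 * (B * T)) ^ 2 * (T ^ 3 * C₁)) = (2 ^ 8 * (2 * B) ^ 2 * C₁) * (T ^ 4 * T) := by ring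
      _ ≤ C * (T ^ (5 - 2 * ε + η) * (T ^ (η / 8)) ^ n) := by
        gcongr
        rw [hC]; nlinarith
      _ = _ := by ring

end Data

/-! ### The explicit test function -/

lemma sum_im_of_mem_iaStar {μ : Fin 3 → ℂ} (hμ : μ ∈ iaStar) : (μ 0).im + (μ 1).im + (μ 2).im = 0 := by
  have := congrArg Complex.im hμ.2
  rwa [Fin.sum_univ_three] at this

lemma norm_psi {x : Fin 3 → ℂ} (hx : x ∈ iaStar) :
    ‖psi x‖ = Real.exp (-∑ j, (x j).im ^ 2) := by
  rw [psi, Complex.norm_exp]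
  congr 1
  have hx' : ∀ j, x j = ((x j).im : ℂ) * Complex.I := fun j => by
    apply Complex.ext <;> simp [hx.1 j]
  have hs := sum_im_of_mem_iaStar hx
  set y := fun j => (x j).im with hy
  have e : (3 * ∑ j, nu x j ^ 2 : ℂ) = ((-(1 / 3) * ((y 0 - y 1) ^ 2 + (y 1 - y 2) ^ 2 + (y 2 - y 0) ^ 2) : ℝ) : ℂ) := by
    rw [Fin.sum_univ_three]
    show (3 * (((x 0 - x 1) / 3) ^ 2 + ((x 1 - x 2) / 3) ^ 2 + ((x 2 - x 0) / 3) ^ 2) : ℂ) = _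
    rw [hx' 0, hx' 1, hx' 2]
    push_cast
    have hI := Complex.I_sq
    simp only [hy]
    linear_combination (1 / 3) * (((x 0).im - (x 1).im : ℂ) ^ 2 + ((x 1).im - (x 2).im : ℂ) ^ 2 +
      ((x 2).im - (x 0).im : ℂ) ^ 2) * hI
  rw [e, Complex.ofReal_re, Fin.sum_univ_three]
  have h2 : y 2 = -(y 0 + y 1) := by simp only [hy]; linarith
  show -(1 / 3) * ((y 0 - y 1) ^ 2 + (y 1 - y 2) ^ 2 + (y 2 - y 0) ^ 2) = -(y 0 ^ 2 + y 1 ^ 2 + y 2 ^ 2)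
  rw [h2]; ring

/-- A Gaussian on the plane. -/
def planeGauss (a b R : ℝ) (t : ℝ × ℝ) : ℝ :=
  Real.exp (-(((t.1 - a) / R) ^ 2)) * Real.exp (-(((t.2 - b) / R) ^ 2))

lemma integral_gauss_scaled (a : ℝ) {R : ℝ} (hR : 0 < R) :
    Integrable (fun t : ℝ => Real.exp (-(((t - a) / R) ^ 2))) ∧
    ∫ t : ℝ, Real.exp (-(((t - a) / R) ^ 2)) = R * √Real.pi := by
  have e : (fun t : ℝ => Real.exp (-(((t - a) / R) ^ 2))) =
      fun t => (fun x => Real.exp (-1 * x ^ 2)) (R⁻¹ * (t - a)) := by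
    ext t; simp only; congr 1; rw [div_eq_inv_mul]; ring
  rw [e]
  have i := integrable_exp_neg_mul_sq (b := 1) one_pos
  refine ⟨(i.comp_mul_left' (inv_ne_zero hR.ne')).comp_sub_right a, ?_⟩
  rw [integral_sub_right_eq_self (fun x : ℝ => (fun x => Real.exp (-1 * x ^ 2)) (R⁻¹ * x)) a,
    Measure.integral_comp_mul_left (fun x : ℝ => Real.exp (-1 * x ^ 2)), integral_gaussian, inv_inv,
    abs_of_pos hR, smul_eq_mul, div_one]

lemma integral_planeGauss (a b : ℝ) {R : ℝ} (hR : 0 < R) :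
    Integrable (planeGauss a b R) ∧ ∫ t, planeGauss a b R t = Real.pi * R ^ 2 := by
  obtain ⟨i1, e1⟩ := integral_gauss_scaled a hR
  obtain ⟨i2, e2⟩ := integral_gauss_scaled b hR
  refine ⟨i1.mul_prod i2, ?_⟩
  unfold planeGauss
  rw [Measure.volume_eq_prod, integral_prod_mul (fun t : ℝ => Real.exp (-(((t - a) / R) ^ 2)))
    (fun t : ℝ => Real.exp (-(((t - b) / R) ^ 2))), e1, e2]
  have := Real.mul_self_sqrt Real.pi_pos.le
  linear_combination R ^ 2 * this

lemma norm_psi_shift_le {μ₀ : Fin 3 → ℂ} (hμ₀ : μ₀ ∈ iaStar) {T R : ℝ}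
    (w : Equiv.Perm (Fin 3)) (t : ℝ × ℝ) :
    ‖psi (fun j => (imagParam t (w j) - (T : ℂ) * μ₀ j) / (R : ℂ))‖ ≤
      planeGauss (T * (μ₀ (w.symm 0)).im) (T * (μ₀ (w.symm 1)).im) R t := by
  have ht := imagParam_mem_iaStar t
  have him : ∀ j, ((imagParam t (w j) - (T : ℂ) * μ₀ j) / (R : ℂ)).im =
      ((imagParam t (w j)).im - T * (μ₀ j).im) / R := by
    intro j
    rw [Complex.div_ofReal_im, Complex.sub_im, Complex.im_ofReal_mul]
  have hmem : (fun j => (imagParam t (w j) - (T : ℂ) * μ₀ j) / (R : ℂ)) ∈ iaStar := by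
    refine ⟨fun j => ?_, ?_⟩
    · rw [Complex.div_ofReal_re, Complex.sub_re, Complex.re_ofReal_mul, ht.1, hμ₀.1]; simp
    · rw [← Finset.sum_div, Finset.sum_sub_distrib, ← Finset.mul_sum, hμ₀.2,
        Equiv.sum_comp w (fun j => imagParam t j), ht.2]; simp
  rw [norm_psi hmem, planeGauss, ← Real.exp_add]
  apply Real.exp_le_exp.2
  simp only [him]
  rw [← Equiv.sum_comp w.symm, Fin.sum_univ_three]
  simp only [Equiv.apply_symm_apply]
  have e0 : (imagParam t 0).im = t.1 := by simp [imagParam]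
  have e1 : (imagParam t 1).im = t.2 := by simp [imagParam]
  rw [e0, e1]
  have := sq_nonneg (((imagParam t 2).im - T * (μ₀ (w.symm 2)).im) / R)
  linarith

lemma norm_polyP_le (A : ℕ) {T B : ℝ} (hT : 1 < T) {μ : Fin 3 → ℂ} (hμ : ‖μ‖ ≤ B * T) :
    ‖polyP A T μ‖ ≤ (B ^ 2 + (1 + 2 * A) ^ 2) ^ (3 * (A + 1)) := by
  have hT0 : 0 < T := by linarith
  have hB : 0 ≤ B := by
    have := (norm_nonneg μ).trans hμ
    by_contra h
    nlinarith
  rw [polyP, norm_prod]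
  have hfac : ∀ n ∈ Finset.range (A + 1), ∀ j, ‖(nu μ j ^ 2 - (1 + 2 * (n : ℂ)) ^ 2 / 9) / (T : ℂ) ^ 2‖ ≤
      B ^ 2 + (1 + 2 * A) ^ 2 := by
    intro n hn j
    have hnA : (n : ℝ) ≤ A := by exact_mod_cast Nat.lt_succ_iff.1 (Finset.mem_range.1 hn)
    have hnu : ‖nu μ j‖ ≤ B * T := by
      have := norm_nu_le μ j
      rw [norm_mul] at this
      have h3 : ‖(3 : ℂ)‖ = 3 := by norm_num
      rw [h3] at this
      linarith [norm_nonneg (nu μ j)]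
    have hn2 : ‖(1 + 2 * (n : ℂ)) ^ 2 / 9‖ ≤ (1 + 2 * A) ^ 2 := by
      have : (1 + 2 * (n : ℂ)) ^ 2 / 9 = (((1 + 2 * n) ^ 2 / 9 : ℝ) : ℂ) := by push_cast; ring
      rw [this, Complex.norm_real, Real.norm_of_nonneg (by positivity)]
      refine (div_le_self (by positivity) (by norm_num)).trans ?_
      gcongr
    rw [norm_div, norm_pow, Complex.norm_real, Real.norm_of_nonneg hT0.le, div_le_iff₀ (by positivity)]
    refine (norm_sub_le _ _).trans ?_
    rw [norm_pow]
    have hT2 : 1 ≤ T ^ 2 := one_le_pow₀ hT.le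
    calc ‖nu μ j‖ ^ 2 + _ ≤ (B * T) ^ 2 + (1 + 2 * A) ^ 2 * T ^ 2 := by
          gcongr
          exact hn2.trans (le_mul_of_one_le_right (by positivity) hT2)
      _ = _ := by ring
  calc _ ≤ ∏ n ∈ Finset.range (A + 1), (B ^ 2 + (1 + 2 * (A : ℝ)) ^ 2) ^ 3 := by
        refine Finset.prod_le_prod (fun _ _ => norm_nonneg _) fun n hn => ?_
        rw [norm_prod]
        calc _ ≤ ∏ _j : Fin 3, (B ^ 2 + (1 + 2 * (A : ℝ)) ^ 2) :=
              Finset.prod_le_prod (fun _ _ => norm_nonneg _) fun j _ => hfac n hn j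
          _ = _ := by simp
    _ = _ := by rw [Finset.prod_const, Finset.card_range, ← pow_mul]

lemma norm_gaussianTest_le (A : ℕ) (ε : ℝ) {μ₀ : Fin 3 → ℂ} (hμ₀ : μ₀ ∈ iaStar) {T B : ℝ} (hT : 1 < T)
    {t : ℝ × ℝ} (ht : ‖imagParam t‖ ≤ B * T) :
    ‖gaussianTest A ε μ₀ T (imagParam t)‖ ≤ ((B ^ 2 + (1 + 2 * A) ^ 2) ^ (3 * (A + 1))) ^ 2 * (6 *
      ∑ w : Equiv.Perm (Fin 3), planeGauss (T * (μ₀ (w.symm 0)).im) (T * (μ₀ (w.symm 1)).im) (T ^ (1 - ε)) t) := by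
  have hT0 : 0 < T := by linarith
  rw [gaussianTest, norm_mul, norm_pow, norm_pow]
  have hg1 : ∀ a b R t, planeGauss a b R t ≤ 1 := fun a b R t => by
    unfold planeGauss
    exact mul_le_one₀ (Real.exp_le_one_iff.2 (by have := sq_nonneg ((t.1 - a) / R); linarith))
      (Real.exp_pos _).le (Real.exp_le_one_iff.2 (by have := sq_nonneg ((t.2 - b) / R); linarith))
  have hg0 : ∀ a b R t, 0 ≤ planeGauss a b R t := fun a b R t => by unfold planeGauss; positivity
  set S := ∑ w : Equiv.Perm (Fin 3), planeGauss (T * (μ₀ (w.symm 0)).im) (T * (μ₀ (w.symm 1)).im) (T ^ (1 - ε)) t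
    with hS
  have hS0 : 0 ≤ S := Finset.sum_nonneg fun w _ => hg0 _ _ _ _
  have hS6 : S ≤ 6 := by
    calc S ≤ ∑ _w : Equiv.Perm (Fin 3), (1 : ℝ) := Finset.sum_le_sum fun w _ => hg1 _ _ _ _
      _ = 6 := by simp [Fintype.card_perm]; norm_num [Nat.factorial]
  have hle : ‖∑ w : Equiv.Perm (Fin 3),
      psi (fun j => (imagParam t (w j) - (T : ℂ) * μ₀ j) / ((T ^ (1 - ε) : ℝ) : ℂ))‖ ≤ S :=
    (norm_sum_le _ _).trans (Finset.sum_le_sum fun w _ => norm_psi_shift_le hμ₀ w t)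
  gcongr
  · exact norm_polyP_le A hT ht
  · calc _ ≤ S ^ 2 := by gcongr
      _ ≤ 6 * S := by nlinarith

/-- The data extracted from the hypotheses of the main theorem. -/
theorem exists_testData {Ω' : Set (Fin 3 → ℂ)} (hΩ' : IsCompact Ω') (hΩ'_sub : Ω' ⊆ iaStar)
    (hΩ'_walls : Disjoint Ω' walls) {μ₀ : Fin 3 → ℂ} (hμ₀ : μ₀ ∈ Ω') {A : ℕ} {ε : ℝ} (hε₀ : 0 < ε)
    (hε : ε < 1 / 2) {h : ℝ → (Fin 3 → ℂ) → ℂ} (hh : IsTestFamily Ω' A ε μ₀ h) :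
    ∃ B c : ℝ, TestData h ε B c := by
  obtain ⟨B, hB0, hB⟩ : ∃ B : ℝ, 0 < B ∧ ∀ μ ∈ Ω', ‖μ‖ ≤ B := by
    obtain ⟨B, hB⟩ := hΩ'.isBounded.exists_norm_le
    exact ⟨max B 1, by positivity, fun μ hμ => (hB μ hμ).trans (le_max_left _ _)⟩
  have hpair : ∀ i j : Fin 3, i ≠ j → ∃ c : ℝ, 0 < c ∧ ∀ μ ∈ Ω', c ≤ ‖μ i - μ j‖ := by
    intro i j hij
    obtain ⟨ν, hν, hmin⟩ := hΩ'.exists_isMinOn ⟨μ₀, hμ₀⟩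
      (f := fun μ : Fin 3 → ℂ => ‖μ i - μ j‖) (by fun_prop)
    refine ⟨‖ν i - ν j‖, ?_, fun μ hμ => hmin hμ⟩
    rw [norm_pos_iff, sub_ne_zero]
    intro heq
    refine Set.disjoint_left.1 hΩ'_walls hν ⟨Equiv.swap i j, ?_, ?_⟩
    · rw [Ne, Equiv.swap_eq_one_iff]; exact hij
    · ext k
      simp only [Function.comp_apply]
      rcases eq_or_ne k i with rfl | hk
      · rw [Equiv.swap_apply_left, heq]
      · rcases eq_or_ne k j with rfl | hk'
        · rw [Equiv.swap_apply_right, heq]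
        · rw [Equiv.swap_apply_of_ne_of_ne hk hk']
  obtain ⟨c, hc0, hc⟩ : ∃ c : ℝ, 0 < c ∧ ∀ μ ∈ Ω', ∀ i j : Fin 3, i ≠ j → c ≤ ‖μ i - μ j‖ := by
    obtain ⟨c₁, p₁, q₁⟩ := hpair 0 1 (by decide)
    obtain ⟨c₂, p₂, q₂⟩ := hpair 0 2 (by decide)
    obtain ⟨c₃, p₃, q₃⟩ := hpair 1 2 (by decide)
    refine ⟨min c₁ (min c₂ c₃), by positivity, fun μ hμ i j hij => ?_⟩
    have l1 := min_le_left c₁ (min c₂ c₃)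
    have l2 := (min_le_right c₁ (min c₂ c₃)).trans (min_le_left _ _)
    have l3 := (min_le_right c₁ (min c₂ c₃)).trans (min_le_right _ _)
    have r1 := l1.trans (q₁ μ hμ)
    have r2 := l2.trans (q₂ μ hμ)
    have r3 := l3.trans (q₃ μ hμ)
    fin_cases i <;> fin_cases j
    · exact absurd rfl hij
    · exact r1
    · exact r2
    · rw [norm_sub_rev]; exact r1
    · exact absurd rfl hij
    · exact r3
    · rw [norm_sub_rev]; exact r2
    · rw [norm_sub_rev]; exact r3
    · exact absurd rfl hij
  have hnl : ∀ T : ℝ, 1 < T → ∀ t, h T (imagParam t) ≠ 0 → ‖imagParam t‖ ≤ B * T := by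
    intro T hT t ht
    obtain ⟨μ', hμ', e⟩ := hh.support T hT _ (imagParam_mem_iaStar t) ht
    rw [e, norm_smul, Complex.norm_real, Real.norm_of_nonneg (by linarith), mul_comm]
    have := hB μ' hμ'
    gcongr
  have hint : ∀ T : ℝ, 1 < T → Integrable (fun t => h T (imagParam t)) := fun T hT =>
    (hh.smooth T hT).continuous.integrable_of_hasCompactSupport (hasCompactSupport_of_norm_le (r := B * T)
      fun t ht => (norm_le_norm_imagParam t).trans (hnl T hT t ht))
  refine ⟨B, c, hε₀, hε, hB0, hc0, hh.smooth, hnl, ?_, hh.deriv_bound, ?_⟩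
  · intro T hT t ht i j hij
    have hT0 : 0 < T := by linarith
    obtain ⟨μ', hμ', e⟩ := hh.support T hT _ (imagParam_mem_iaStar t) ht
    have hre : (μ' i - μ' j).re = 0 := by
      rw [Complex.sub_re, (hΩ'_sub hμ').1, (hΩ'_sub hμ').1, sub_zero]
    have hn : ‖μ' i - μ' j‖ = |(μ' i).im - (μ' j).im| := by
      rw [← Complex.sub_im, Complex.abs_im_eq_norm.2 hre]
    have := hc μ' hμ' i j hij
    rw [e]
    simp only [Pi.smul_apply, smul_eq_mul, Complex.im_ofReal_mul]
    rw [← mul_sub, abs_mul, abs_of_pos hT0, ← hn, mul_comm]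
    gcongr
  · obtain ⟨C, hC⟩ := hh.negligible_error 2
    set P := ((B ^ 2 + (1 + 2 * (A : ℝ)) ^ 2) ^ (3 * (A + 1))) ^ 2 with hP
    refine ⟨max C 0 * (2 * B) ^ 2 + P * (36 * Real.pi), by positivity, fun T hT => ?_⟩
    have hT0 : 0 < T := by linarith
    set g : ℝ × ℝ → ℝ := fun t => (Metric.closedBall (0 : ℝ × ℝ) (B * T)).indicator
      (fun _ => max C 0 * T ^ (-2 : ℝ)) t + P * (6 * ∑ w : Equiv.Perm (Fin 3),
        planeGauss (T * (μ₀ (w.symm 0)).im) (T * (μ₀ (w.symm 1)).im) (T ^ (1 - ε)) t) with hg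
    have hR : 0 < T ^ (1 - ε) := by positivity
    have i1 : Integrable ((Metric.closedBall (0 : ℝ × ℝ) (B * T)).indicator
      (fun _ => max C 0 * T ^ (-2 : ℝ))) := by
      rw [integrable_indicator_iff measurableSet_closedBall]
      exact integrableOn_const (hs := (isCompact_closedBall (0 : ℝ × ℝ) _).measure_lt_top.ne)
    have i2 : Integrable (fun t => ∑ w : Equiv.Perm (Fin 3),
        planeGauss (T * (μ₀ (w.symm 0)).im) (T * (μ₀ (w.symm 1)).im) (T ^ (1 - ε)) t) :=
      integrable_finsetSum _ fun w _ => (integral_planeGauss _ _ hR).1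
    have hgi : Integrable g := i1.add ((i2.const_mul 6).const_mul P)
    have hle : ∀ t, ‖h T (imagParam t)‖ ≤ g t := by
      intro t
      have hg2 : 0 ≤ P * (6 * ∑ w : Equiv.Perm (Fin 3),
          planeGauss (T * (μ₀ (w.symm 0)).im) (T * (μ₀ (w.symm 1)).im) (T ^ (1 - ε)) t) := by
        have : 0 ≤ ∑ w : Equiv.Perm (Fin 3),
          planeGauss (T * (μ₀ (w.symm 0)).im) (T * (μ₀ (w.symm 1)).im) (T ^ (1 - ε)) t :=
          Finset.sum_nonneg fun w _ => by unfold planeGauss; positivity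
        positivity
      by_cases h0 : h T (imagParam t) = 0
      · rw [h0, norm_zero]
        exact add_nonneg (indicator_nonneg (fun _ _ => by positivity) _) hg2
      · have hn := hnl T hT t h0
        have hmem : t ∈ Metric.closedBall (0 : ℝ × ℝ) (B * T) := by
          simpa using (norm_le_norm_imagParam t).trans hn
        simp only [hg]
        rw [indicator_of_mem hmem]
        have e1 := hC T hT _ (imagParam_mem_iaStar t)
        have e2 := norm_gaussianTest_le A ε (hΩ'_sub hμ₀) hT hn
        have e3 : ‖h T (imagParam t)‖ ≤ ‖h T (imagParam t) - gaussianTest A ε μ₀ T (imagParam t)‖ +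
            ‖gaussianTest A ε μ₀ T (imagParam t)‖ := by
          have := norm_add_le (h T (imagParam t) - gaussianTest A ε μ₀ T (imagParam t))
            (gaussianTest A ε μ₀ T (imagParam t))
          rwa [sub_add_cancel] at this
        refine e3.trans (add_le_add (e1.trans ?_) e2)
        norm_num
        gcongr
        exact le_max_left _ _
    calc _ ≤ ∫ t, g t := integral_mono (hint T hT).norm hgi hle
      _ = max C 0 * T ^ (-2 : ℝ) * (2 * (B * T)) ^ 2 + P * (6 * (6 * (Real.pi * (T ^ (1 - ε)) ^ 2))) := by
          rw [integral_add i1 ((i2.const_mul 6).const_mul P), integral_indicator measurableSet_closedBall,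
            setIntegral_const, volume_real_closedBall_prod (by positivity), integral_const_mul,
            integral_const_mul, integral_finsetSum _ fun w _ => (integral_planeGauss _ _ hR).1]
          simp only [(integral_planeGauss _ _ hR).2]
          rw [Finset.sum_const, Finset.card_univ, Fintype.card_perm, Fintype.card_fin]
          simp only [smul_eq_mul, nsmul_eq_mul]
          norm_num [Nat.factorial]
          ring
      _ ≤ _ := by
          have e1 : (T ^ (1 - ε)) ^ 2 = T ^ (2 - 2 * ε) := by
            rw [← Real.rpow_natCast, ← Real.rpow_mul hT0.le]; congr 1; push_cast; ring
          have e2 : T ^ (-2 : ℝ) * T ^ 2 = 1 := by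
            rw [show (T : ℝ) ^ 2 = T ^ (2 : ℝ) by exact_mod_cast (Real.rpow_natCast T 2).symm,
              ← Real.rpow_add hT0]; norm_num
          have e3 : 1 ≤ T ^ (2 - 2 * ε) := Real.one_le_rpow hT.le (by linarith)
          rw [e1]
          calc _ = max C 0 * (2 * B) ^ 2 * (T ^ (-2 : ℝ) * T ^ 2) + P * (36 * Real.pi) * T ^ (2 - 2 * ε) := by ring
            _ ≤ max C 0 * (2 * B) ^ 2 * T ^ (2 - 2 * ε) + P * (36 * Real.pi) * T ^ (2 - 2 * ε) := by
              rw [e2]; gcongr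
            _ = _ := by ring

/-! ### Coefficients which converge away from the walls -/

/-- Measurable functions of `α, β ∈ [0, 1)` which converge linearly at `(0, 0)`. -/
def Nice (κ : ℝ → ℝ → ℝ) : Prop :=
  Measurable (fun p : ℝ × ℝ => κ p.1 p.2) ∧
  ∀ q : ℝ, 0 ≤ q → q < 1 → ∃ C : ℝ, 0 ≤ C ∧ ∀ α β : ℝ, 0 ≤ α → α ≤ q → 0 ≤ β → β ≤ q →
    |κ α β - κ 0 0| ≤ C * (α + β)

lemma nice_const (c : ℝ) : Nice fun _ _ => c :=
  ⟨measurable_const, fun q _ _ => ⟨0, le_rfl, fun α β _ _ _ _ => by simp⟩⟩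

lemma nice_left : Nice fun α _ => α :=
  ⟨measurable_fst, fun q _ _ => ⟨1, zero_le_one, fun α β h _ h' _ => by
    rw [sub_zero, abs_of_nonneg h]; linarith⟩⟩

lemma nice_right : Nice fun _ β => β :=
  ⟨measurable_snd, fun q _ _ => ⟨1, zero_le_one, fun α β h _ h' _ => by
    rw [sub_zero, abs_of_nonneg h']; linarith⟩⟩

lemma Nice.add {f g : ℝ → ℝ → ℝ} (hf : Nice f) (hg : Nice g) : Nice fun α β => f α β + g α β := by
  refine ⟨hf.1.add hg.1, fun q h0 h1 => ?_⟩
  obtain ⟨C, hC0, hC⟩ := hf.2 q h0 h1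
  obtain ⟨D, hD0, hD⟩ := hg.2 q h0 h1
  refine ⟨C + D, by positivity, fun α β a1 a2 b1 b2 => ?_⟩
  have := abs_add_le (f α β - f 0 0) (g α β - g 0 0)
  rw [show f α β + g α β - (f 0 0 + g 0 0) = (f α β - f 0 0) + (g α β - g 0 0) by ring]
  linarith [hC α β a1 a2 b1 b2, hD α β a1 a2 b1 b2]

lemma Nice.abs_le {f : ℝ → ℝ → ℝ} (hf : Nice f) {q : ℝ} (h0 : 0 ≤ q) (h1 : q < 1) :
    ∃ C : ℝ, 0 ≤ C ∧ ∀ α β : ℝ, 0 ≤ α → α ≤ q → 0 ≤ β → β ≤ q → |f α β| ≤ C := by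
  obtain ⟨C, hC0, hC⟩ := hf.2 q h0 h1
  refine ⟨C * 2 + |f 0 0|, by positivity, fun α β a1 a2 b1 b2 => ?_⟩
  have := abs_add_le (f α β - f 0 0) (f 0 0)
  rw [sub_add_cancel] at this
  have h2 : C * (α + β) ≤ C * 2 := by gcongr; linarith
  linarith [hC α β a1 a2 b1 b2]

lemma Nice.mul {f g : ℝ → ℝ → ℝ} (hf : Nice f) (hg : Nice g) : Nice fun α β => f α β * g α β := by
  refine ⟨hf.1.mul hg.1, fun q h0 h1 => ?_⟩
  obtain ⟨C, hC0, hC⟩ := hf.2 q h0 h1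
  obtain ⟨D, hD0, hD⟩ := hg.2 q h0 h1
  obtain ⟨E, hE0, hE⟩ := hf.abs_le h0 h1
  refine ⟨C * |g 0 0| + E * D, by positivity, fun α β a1 a2 b1 b2 => ?_⟩
  rw [show f α β * g α β - f 0 0 * g 0 0 = (f α β - f 0 0) * g 0 0 + f α β * (g α β - g 0 0) by ring]
  refine (abs_add_le _ _).trans ?_
  rw [abs_mul, abs_mul]
  have e1 := hC α β a1 a2 b1 b2
  have e2 := hD α β a1 a2 b1 b2
  have e3 := hE α β a1 a2 b1 b2
  calc _ ≤ C * (α + β) * |g 0 0| + E * (D * (α + β)) := by gcongr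
    _ = _ := by ring

lemma Nice.inv {f : ℝ → ℝ → ℝ} (hf : Nice f)
    (h : ∀ q : ℝ, 0 ≤ q → q < 1 → ∃ δ : ℝ, 0 < δ ∧ ∀ α β : ℝ, 0 ≤ α → α ≤ q → 0 ≤ β → β ≤ q → δ ≤ f α β) :
    Nice fun α β => (f α β)⁻¹ := by
  refine ⟨hf.1.inv, fun q h0 h1 => ?_⟩
  obtain ⟨C, hC0, hC⟩ := hf.2 q h0 h1
  obtain ⟨δ, hδ, hl⟩ := h q h0 h1
  refine ⟨C / δ ^ 2, by positivity, fun α β a1 a2 b1 b2 => ?_⟩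
  have p1 := hl α β a1 a2 b1 b2
  have p2 := hl 0 0 le_rfl h0 le_rfl h0
  have q1 : 0 < f α β := by linarith
  have q2 : 0 < f 0 0 := by linarith
  rw [inv_sub_inv q1.ne' q2.ne', abs_div, abs_sub_comm, abs_of_pos (mul_pos q1 q2),
    div_le_iff₀ (mul_pos q1 q2)]
  refine (hC α β a1 a2 b1 b2).trans ?_
  have : δ ^ 2 ≤ f α β * f 0 0 := by rw [sq]; gcongr
  calc C * (α + β) = C / δ ^ 2 * (α + β) * δ ^ 2 := by field_simp
    _ ≤ _ := by gcongr

lemma Nice.neg {f : ℝ → ℝ → ℝ} (hf : Nice f) : Nice fun α β => -f α β := by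
  simpa using (nice_const (-1)).mul hf

lemma Nice.sub {f g : ℝ → ℝ → ℝ} (hf : Nice f) (hg : Nice g) : Nice fun α β => f α β - g α β := by
  simpa [sub_eq_add_neg] using hf.add hg.neg

lemma Nice.inv_one_sub {f : ℝ → ℝ → ℝ} (hf : Nice f)
    (h : ∀ q α β : ℝ, q < 1 → 0 ≤ α → α ≤ q → 0 ≤ β → β ≤ q → f α β ≤ q) :
    Nice fun α β => (1 - f α β)⁻¹ :=
  ((nice_const 1).sub hf).inv fun q _ h1 => ⟨1 - q, by linarith, fun α β a1 a2 b1 b2 => by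
    linarith [h q α β h1 a1 a2 b1 b2]⟩

lemma Nice.inv_one_add {f : ℝ → ℝ → ℝ} (hf : Nice f)
    (h : ∀ α β : ℝ, 0 ≤ α → 0 ≤ β → 0 ≤ f α β) : Nice fun α β => (1 + f α β)⁻¹ :=
  ((nice_const 1).add hf).inv fun q _ _ => ⟨1, one_pos, fun α β a1 _ b1 _ => by
    linarith [h α β a1 b1]⟩

lemma nice_left_mul_right : Nice fun α β => α * β := nice_left.mul nice_right

lemma nice_inv_one_sub_left : Nice fun α _ => (1 - α)⁻¹ := nice_left.inv_one_sub fun _ _ _ _ _ h _ _ => h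

lemma nice_inv_one_sub_right : Nice fun _ β => (1 - β)⁻¹ := nice_right.inv_one_sub fun _ _ _ _ _ _ _ h => h

lemma nice_inv_one_sub_mul : Nice fun α β => (1 - α * β)⁻¹ :=
  nice_left_mul_right.inv_one_sub fun q α β h1 a1 a2 b1 b2 => by nlinarith

lemma nice_inv_one_sub_sq : Nice fun α β => (1 - α ^ 2 * β ^ 2)⁻¹ := by
  have : Nice fun α β => α ^ 2 * β ^ 2 := by
    simpa [sq, mul_comm, mul_assoc, mul_left_comm] using nice_left_mul_right.mul nice_left_mul_right
  refine this.inv_one_sub fun q α β h1 a1 a2 b1 b2 => ?_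
  have h2 : α * β ≤ q := by nlinarith
  have h3 : 0 ≤ α * β := by positivity
  calc α ^ 2 * β ^ 2 = (α * β) * (α * β) := by ring
    _ ≤ q * 1 := mul_le_mul h2 (by linarith) h3 (h3.trans h2)
    _ = q := mul_one q

/-- The normalized coefficients. -/
def coefH (α β : ℝ) : ℝ := -2 * (1 + β) * (1 - α)⁻¹ * (1 - α * β)⁻¹

def coefM (α β : ℝ) : ℝ := 2 * (1 + α * β) * (1 - α)⁻¹ * (1 - β)⁻¹

def coefL (α β : ℝ) : ℝ := -2 * (1 + α) * (1 - α * β)⁻¹ * (1 - β)⁻¹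

def coefR₂ (α β : ℝ) : ℝ := (1 - β * β) * (1 - α ^ 2 * β ^ 2)⁻¹

def coefR₁ (α β : ℝ) : ℝ := (1 - α * α) * (1 - α ^ 2 * β ^ 2)⁻¹

lemma nice_coefH : Nice coefH :=
  (((nice_const (-2)).mul ((nice_const 1).add nice_right)).mul nice_inv_one_sub_left).mul nice_inv_one_sub_mul

lemma nice_coefM : Nice coefM :=
  (((nice_const 2).mul ((nice_const 1).add nice_left_mul_right)).mul nice_inv_one_sub_left).mul
    nice_inv_one_sub_right

lemma nice_coefL : Nice coefL :=
  (((nice_const (-2)).mul ((nice_const 1).add nice_left)).mul nice_inv_one_sub_mul).mul nice_inv_one_sub_right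

lemma nice_coefR₂ : Nice coefR₂ := ((nice_const 1).sub (nice_right.mul nice_right)).mul nice_inv_one_sub_sq

lemma nice_coefR₁ : Nice coefR₁ := ((nice_const 1).sub (nice_left.mul nice_left)).mul nice_inv_one_sub_sq

/-! ### Trigonometric monomials -/

/-- `exp(iπz / 2)`. -/
def qexp (z : ℂ) : ℂ := Complex.exp (Real.pi / 2 * Complex.I * z)

lemma qexp_ne_zero (z : ℂ) : qexp z ≠ 0 := Complex.exp_ne_zero _

lemma qexp_add (z w : ℂ) : qexp (z + w) = qexp z * qexp w := by
  rw [qexp, qexp, qexp, ← Complex.exp_add, mul_add]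

lemma qexp_neg (z : ℂ) : qexp (-z) = (qexp z)⁻¹ := by
  rw [qexp, qexp, ← Complex.exp_neg, mul_neg]

lemma qexp_sub (z w : ℂ) : qexp (z - w) = qexp z / qexp w := by
  rw [sub_eq_add_neg, qexp_add, qexp_neg, div_eq_mul_inv]

lemma qexp_zpow (z : ℂ) (n : ℤ) : qexp z ^ n = Complex.exp (((n * (Real.pi / 2) : ℝ) : ℂ) * Complex.I * z) := by
  rw [qexp, ← Complex.exp_int_mul]
  congr 1; push_cast; ring

lemma sinPi_eq_qexp (z : ℂ) : sinPi z = (qexp z ^ 2 - (qexp z ^ 2)⁻¹) / (2 * Complex.I) := by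
  have h1 : qexp z ^ 2 = Complex.exp (Real.pi * z * Complex.I) := by
    rw [qexp, ← Complex.exp_nat_mul]; congr 1; push_cast; ring
  have h2 : (qexp z ^ 2)⁻¹ = Complex.exp (-(Real.pi * z) * Complex.I) := by
    rw [h1, ← Complex.exp_neg]; congr 1; ring
  rw [h2, h1, sinPi, Complex.sin, div_eq_div_iff two_ne_zero (mul_ne_zero two_ne_zero Complex.I_ne_zero)]
  linear_combination 2 * (Complex.exp (-(Real.pi * z) * Complex.I) -
    Complex.exp (Real.pi * z * Complex.I)) * Complex.I_sq

/-- `sin(πz / 2)`. -/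
def sinHalf (z : ℂ) : ℂ := Complex.sin (Real.pi / 2 * z)

/-- `cos(πz / 2)`. -/
def cosHalf (z : ℂ) : ℂ := Complex.cos (Real.pi / 2 * z)

lemma qexp_eq (z : ℂ) : qexp z = Complex.exp (Real.pi / 2 * z * Complex.I) := by
  rw [qexp]; congr 1; ring

lemma qexp_inv_eq (z : ℂ) : (qexp z)⁻¹ = Complex.exp (-(Real.pi / 2 * z) * Complex.I) := by
  rw [← qexp_neg, qexp]; congr 1; ring

lemma sinHalf_eq (z : ℂ) : sinHalf z = (qexp z - (qexp z)⁻¹) / (2 * Complex.I) := by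
  rw [qexp_inv_eq, qexp_eq, sinHalf, Complex.sin,
    div_eq_div_iff two_ne_zero (mul_ne_zero two_ne_zero Complex.I_ne_zero)]
  linear_combination 2 * (Complex.exp (-(Real.pi / 2 * z) * Complex.I) -
    Complex.exp (Real.pi / 2 * z * Complex.I)) * Complex.I_sq

lemma cosHalf_eq (z : ℂ) : cosHalf z = (qexp z + (qexp z)⁻¹) / 2 := by
  rw [qexp_inv_eq, qexp_eq, cosHalf, Complex.cos]

/-- The trigonometric part of a building block. -/
def trigMono (e : Fin 4 → ℤ) (J : Fin 3) (ρ : Equiv.Perm (Fin 3)) (μ : Fin 3 → ℂ) (s₁ s₂ : ℂ) : ℂ :=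
  qexp (s₁ - μ (ρ 0)) ^ e 0 * qexp (s₁ - μ (ρ 1)) ^ e 1 *
    (qexp (s₂ + μ (ρ 0)) ^ e 2 * qexp (s₂ + μ (ρ 1)) ^ e 3) * sinPi (betaW J (s₁ - μ (ρ 2)) (s₂ + μ (ρ 2)))

/-- The ratios of exponentials attached to a chamber. -/
def ratioA (σ : Equiv.Perm (Fin 3)) (μ : Fin 3 → ℂ) : ℝ :=
  Real.exp (-(Real.pi * ((μ (σ 0)).im - (μ (σ 1)).im)))

def ratioB (σ : Equiv.Perm (Fin 3)) (μ : Fin 3 → ℂ) : ℝ :=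
  Real.exp (-(Real.pi * ((μ (σ 1)).im - (μ (σ 2)).im)))

/-- The open chamber in `i𝔞*`. -/
def openChamber (σ : Equiv.Perm (Fin 3)) : Set (Fin 3 → ℂ) :=
  {μ | μ ∈ iaStar ∧ (μ (σ 1)).im < (μ (σ 0)).im ∧ (μ (σ 2)).im < (μ (σ 1)).im}

lemma qexp_sq_div {x y : ℂ} (hx : x.re = 0) (hy : y.re = 0) :
    qexp x ^ 2 / qexp y ^ 2 = (Real.exp (-(Real.pi * (x.im - y.im))) : ℝ) := by
  have h : ∀ z : ℂ, z.re = 0 → z = z.im * Complex.I := fun z hz => by apply Complex.ext <;> simp [hz]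
  rw [← div_pow, ← qexp_sub, qexp, ← Complex.exp_nat_mul, Complex.ofReal_exp]
  congr 1
  conv_lhs => rw [h x hx, h y hy]
  push_cast
  linear_combination (Real.pi * (x.im - y.im) : ℂ) * Complex.I_sq

lemma ratioA_eq {σ : Equiv.Perm (Fin 3)} {μ : Fin 3 → ℂ} (hμ : μ ∈ iaStar) :
    (ratioA σ μ : ℂ) = qexp (μ (σ 0)) ^ 2 / qexp (μ (σ 1)) ^ 2 := (qexp_sq_div (hμ.1 _) (hμ.1 _)).symm

lemma ratioB_eq {σ : Equiv.Perm (Fin 3)} {μ : Fin 3 → ℂ} (hμ : μ ∈ iaStar) :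
    (ratioB σ μ : ℂ) = qexp (μ (σ 1)) ^ 2 / qexp (μ (σ 2)) ^ 2 := (qexp_sq_div (hμ.1 _) (hμ.1 _)).symm

/-- A term in a trigonometric decomposition. -/
abbrev TrigTerm := (ℝ → ℝ → ℝ) × (Fin 4 → ℤ) × Fin 3 × Equiv.Perm (Fin 3)

/-- Functions which decompose into trigonometric monomials with convergent coefficients. -/
def TrigSum (σ : Equiv.Perm (Fin 3)) (N : (Fin 3 → ℂ) → ℂ → ℂ → ℂ) : Prop :=
  ∃ l : List TrigTerm, (∀ x ∈ l, Nice x.1 ∧ ∀ j, |x.2.1 j| ≤ 1) ∧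
    ∀ μ ∈ openChamber σ, ∀ s₁ s₂, N μ s₁ s₂ =
      (l.map fun x => ((x.1 (ratioA σ μ) (ratioB σ μ) : ℝ) : ℂ) *
        trigMono x.2.1 x.2.2.1 x.2.2.2 μ s₁ s₂).sum

lemma TrigSum.add {σ : Equiv.Perm (Fin 3)} {N N' : (Fin 3 → ℂ) → ℂ → ℂ → ℂ} (h : TrigSum σ N)
    (h' : TrigSum σ N') : TrigSum σ fun μ s₁ s₂ => N μ s₁ s₂ + N' μ s₁ s₂ := by
  obtain ⟨l, h1, h2⟩ := h
  obtain ⟨l', h1', h2'⟩ := h'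
  refine ⟨l ++ l', fun x hx => ?_, fun μ hμ s₁ s₂ => ?_⟩
  · rcases List.mem_append.1 hx with hx | hx
    · exact h1 x hx
    · exact h1' x hx
  · simp only [List.map_append, List.sum_append, h2 μ hμ, h2' μ hμ]

lemma TrigSum.congr {σ : Equiv.Perm (Fin 3)} {N N' : (Fin 3 → ℂ) → ℂ → ℂ → ℂ} (h : TrigSum σ N)
    (e : ∀ μ ∈ openChamber σ, ∀ s₁ s₂, N' μ s₁ s₂ = N μ s₁ s₂) : TrigSum σ N' := by
  obtain ⟨l, h1, h2⟩ := h
  exact ⟨l, h1, fun μ hμ s₁ s₂ => (e μ hμ s₁ s₂).trans (h2 μ hμ s₁ s₂)⟩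

lemma trigSum_single (σ : Equiv.Perm (Fin 3)) {κ : ℝ → ℝ → ℝ} (hκ : Nice κ) (e : Fin 4 → ℤ)
    (he : ∀ j, |e j| ≤ 1) (J : Fin 3) (ρ : Equiv.Perm (Fin 3)) :
    TrigSum σ fun μ s₁ s₂ => ((κ (ratioA σ μ) (ratioB σ μ) : ℝ) : ℂ) * trigMono e J ρ μ s₁ s₂ :=
  ⟨[(κ, e, J, ρ)], by simpa using ⟨hκ, he⟩, fun μ _ s₁ s₂ => by simp⟩

section

/-! ### Decomposition of the trigonometric factors -/

/-- `q² - q⁻²`. -/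
def sqDiff (z : ℂ) : ℂ := qexp z ^ 2 - (qexp z ^ 2)⁻¹

lemma sinPi_eq_sqDiff (z : ℂ) : sinPi z = sqDiff z * (2 * Complex.I)⁻¹ := by
  rw [sinPi_eq_qexp, sqDiff, div_eq_mul_inv]

lemma sinPi_mul_sinPi (z w : ℂ) : sinPi z * sinPi w = -(1 / 4) * (sqDiff z * sqDiff w) := by
  have : ((2 * Complex.I)⁻¹ : ℂ) * (2 * Complex.I)⁻¹ = -(1 / 4) := by
    rw [← mul_inv, show (2 * Complex.I) * (2 * Complex.I) = -4 by linear_combination 4 * Complex.I_sq]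
    norm_num
  rw [sinPi_eq_sqDiff, sinPi_eq_sqDiff, ← this]; ring

/-- The coefficient `cos((b - c)π/2) / (sin((a - b)π/2) sin((a - c)π/2))`. -/
def cotCoef (a b c : ℂ) : ℂ := cosHalf (b - c) / (sinHalf (a - b) * sinHalf (a - c))

lemma cosHalf_neg (z : ℂ) : cosHalf (-z) = cosHalf z := by rw [cosHalf, mul_neg, Complex.cos_neg, cosHalf]

lemma sinHalf_neg (z : ℂ) : sinHalf (-z) = -sinHalf z := by rw [sinHalf, mul_neg, Complex.sin_neg, sinHalf]

lemma cotCoef_comm (a b c : ℂ) : cotCoef a b c = cotCoef a c b := by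
  rw [cotCoef, cotCoef, ← neg_sub c b, cosHalf_neg, mul_comm (sinHalf _)]

lemma cotCoef_eq (a b c : ℂ) : cotCoef a b c =
    -2 * (qexp b / qexp c + qexp c / qexp b) /
      ((qexp a / qexp b - qexp b / qexp a) * (qexp a / qexp c - qexp c / qexp a)) := by
  have h2 : (2 * Complex.I) * (2 * Complex.I) = -4 := by linear_combination 4 * Complex.I_sq
  rw [cotCoef, cosHalf_eq, sinHalf_eq, sinHalf_eq, qexp_sub, qexp_sub, qexp_sub, inv_div, inv_div, inv_div,
    div_mul_div_comm, h2, div_div_eq_mul_div, div_mul_eq_mul_div, div_div,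
    show (qexp b / qexp c + qexp c / qexp b) * -4 = 2 * (-2 * (qexp b / qexp c + qexp c / qexp b)) by ring,
    mul_div_mul_left _ _ two_ne_zero]

lemma ratioA_pos (σ : Equiv.Perm (Fin 3)) (μ : Fin 3 → ℂ) : 0 < ratioA σ μ := Real.exp_pos _

lemma ratioB_pos (σ : Equiv.Perm (Fin 3)) (μ : Fin 3 → ℂ) : 0 < ratioB σ μ := Real.exp_pos _

lemma ratioA_lt_one {σ : Equiv.Perm (Fin 3)} {μ : Fin 3 → ℂ} (hμ : μ ∈ openChamber σ) : ratioA σ μ < 1 :=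
  Real.exp_lt_one_iff.2 (neg_lt_zero.2 (mul_pos Real.pi_pos (sub_pos.2 hμ.2.1)))

lemma ratioB_lt_one {σ : Equiv.Perm (Fin 3)} {μ : Fin 3 → ℂ} (hμ : μ ∈ openChamber σ) : ratioB σ μ < 1 :=
  Real.exp_lt_one_iff.2 (neg_lt_zero.2 (mul_pos Real.pi_pos (sub_pos.2 hμ.2.2)))

/-- The data which describe the algebra on a chamber. -/
lemma chamber_data {σ : Equiv.Perm (Fin 3)} {μ : Fin 3 → ℂ} (hμ : μ ∈ openChamber σ) :
    (ratioA σ μ : ℂ) = qexp (μ (σ 0)) ^ 2 / qexp (μ (σ 1)) ^ 2 ∧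
    (ratioB σ μ : ℂ) = qexp (μ (σ 1)) ^ 2 / qexp (μ (σ 2)) ^ 2 ∧
    qexp (μ (σ 1)) ^ 2 - qexp (μ (σ 0)) ^ 2 ≠ 0 ∧
    qexp (μ (σ 2)) ^ 2 - qexp (μ (σ 1)) ^ 2 ≠ 0 ∧
    qexp (μ (σ 2)) ^ 2 - qexp (μ (σ 0)) ^ 2 ≠ 0 ∧
    qexp (μ (σ 2)) ^ 4 - qexp (μ (σ 0)) ^ 4 ≠ 0 := by
  have hA := ratioA_eq (σ := σ) hμ.1
  have hB := ratioB_eq (σ := σ) hμ.1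
  have a1 := ratioA_lt_one hμ
  have b1 := ratioB_lt_one hμ
  have a0 := ratioA_pos σ μ
  have b0 := ratioB_pos σ μ
  have n0 := qexp_ne_zero (μ (σ 0))
  have n1 := qexp_ne_zero (μ (σ 1))
  have n2 := qexp_ne_zero (μ (σ 2))
  have hC : ((ratioA σ μ * ratioB σ μ : ℝ) : ℂ) = qexp (μ (σ 0)) ^ 2 / qexp (μ (σ 2)) ^ 2 := by
    push_cast; rw [hA, hB]; field_simp
  have c1 : ratioA σ μ * ratioB σ μ < 1 := by nlinarith
  have c0 : 0 < ratioA σ μ * ratioB σ μ := by positivity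
  refine ⟨hA, hB, fun h => ?_, fun h => ?_, fun h => ?_, fun h => ?_⟩
  · rw [← sub_eq_zero.1 h, div_self (pow_ne_zero 2 n1)] at hA
    exact a1.ne (by exact_mod_cast hA)
  · rw [← sub_eq_zero.1 h, div_self (pow_ne_zero 2 n2)] at hB
    exact b1.ne (by exact_mod_cast hB)
  · rw [← sub_eq_zero.1 h, div_self (pow_ne_zero 2 n2)] at hC
    exact c1.ne (by exact_mod_cast hC)
  · have h2 : ((ratioA σ μ * ratioB σ μ : ℝ) : ℂ) ^ 2 = 1 := by
      rw [hC, div_pow, ← pow_mul, ← pow_mul, ← sub_eq_zero.1 h, div_self (pow_ne_zero 4 n2)]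
    have h3 : (ratioA σ μ * ratioB σ μ) ^ 2 = 1 := by exact_mod_cast h2
    nlinarith

lemma TrigSum.const_mul {σ : Equiv.Perm (Fin 3)} {N : (Fin 3 → ℂ) → ℂ → ℂ → ℂ} (h : TrigSum σ N) (c : ℝ) :
    TrigSum σ fun μ s₁ s₂ => (c : ℂ) * N μ s₁ s₂ := by
  obtain ⟨l, h1, h2⟩ := h
  refine ⟨l.map fun x => (fun α β => c * x.1 α β, x.2), fun x hx => ?_, fun μ hμ s₁ s₂ => ?_⟩
  · obtain ⟨y, hy, rfl⟩ := List.mem_map.1 hx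
    exact ⟨(nice_const c).mul (h1 y hy).1, (h1 y hy).2⟩
  · simp only [h2 μ hμ, List.map_map, ← List.sum_map_mul_left, Function.comp_def]
    congr 2
    funext x
    push_cast
    ring

lemma abs_signs_le {a b c d : ℤ} (h : |a| ≤ 1 ∧ |b| ≤ 1 ∧ |c| ≤ 1 ∧ |d| ≤ 1) (j : Fin 4) :
    |(![a, b, c, d] : Fin 4 → ℤ) j| ≤ 1 := by
  fin_cases j
  exacts [h.1, h.2.1, h.2.2.1, h.2.2.2]

variable (σ : Equiv.Perm (Fin 3))

lemma trigSum_mono (a b c d : ℤ) (J : Fin 3) (ρ : Equiv.Perm (Fin 3)) {κ : ℝ → ℝ → ℝ} (hκ : Nice κ)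
    (he : |a| ≤ 1 ∧ |b| ≤ 1 ∧ |c| ≤ 1 ∧ |d| ≤ 1 := by decide) :
    TrigSum σ fun μ s₁ s₂ => ((κ (ratioA σ μ) (ratioB σ μ) : ℝ) : ℂ) * trigMono ![a, b, c, d] J ρ μ s₁ s₂ :=
  trigSum_single σ hκ ![a, b, c, d] (abs_signs_le he) J ρ

lemma cotCoef_H {μ : Fin 3 → ℂ} (hμ : μ ∈ openChamber σ) : cotCoef (μ (σ 0)) (μ (σ 1)) (μ (σ 2)) =
    ((ratioA σ μ * coefH (ratioA σ μ) (ratioB σ μ) : ℝ) : ℂ) := by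
  obtain ⟨hA, hB, d1, d2, d3, -⟩ := chamber_data hμ
  have n0 := qexp_ne_zero (μ (σ 0))
  have n1 := qexp_ne_zero (μ (σ 1))
  have n2 := qexp_ne_zero (μ (σ 2))
  rw [cotCoef_eq, coefH]
  push_cast
  rw [hA, hB]
  generalize qexp (μ (σ 0)) = a at *
  generalize qexp (μ (σ 1)) = b at *
  generalize qexp (μ (σ 2)) = c at *
  have e1 : a / b - b / a = -(b ^ 2 - a ^ 2) / (a * b) := by field_simp; ring
  have e2 : a / c - c / a = -(c ^ 2 - a ^ 2) / (a * c) := by field_simp; ring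
  have e3 : 1 - a ^ 2 / b ^ 2 = (b ^ 2 - a ^ 2) / b ^ 2 := by field_simp
  have e4 : 1 - a ^ 2 / b ^ 2 * (b ^ 2 / c ^ 2) = (c ^ 2 - a ^ 2) / c ^ 2 := by field_simp
  rw [e1, e2, e3, e4]
  field_simp
  try ring

lemma cotCoef_M {μ : Fin 3 → ℂ} (hμ : μ ∈ openChamber σ) : cotCoef (μ (σ 1)) (μ (σ 2)) (μ (σ 0)) =
    ((coefM (ratioA σ μ) (ratioB σ μ) : ℝ) : ℂ) := by
  obtain ⟨hA, hB, d1, d2, d3, -⟩ := chamber_data hμ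
  have n0 := qexp_ne_zero (μ (σ 0))
  have n1 := qexp_ne_zero (μ (σ 1))
  have n2 := qexp_ne_zero (μ (σ 2))
  rw [cotCoef_eq, coefM]
  push_cast
  rw [hA, hB]
  generalize qexp (μ (σ 0)) = a at *
  generalize qexp (μ (σ 1)) = b at *
  generalize qexp (μ (σ 2)) = c at *
  have e1 : b / c - c / b = -(c ^ 2 - b ^ 2) / (b * c) := by field_simp; ring
  have e2 : b / a - a / b = (b ^ 2 - a ^ 2) / (a * b) := by field_simp
  have e3 : 1 - a ^ 2 / b ^ 2 = (b ^ 2 - a ^ 2) / b ^ 2 := by field_simp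
  have e4 : 1 - b ^ 2 / c ^ 2 = (c ^ 2 - b ^ 2) / c ^ 2 := by field_simp
  rw [e1, e2, e3, e4]
  field_simp
  try ring

lemma cotCoef_L {μ : Fin 3 → ℂ} (hμ : μ ∈ openChamber σ) : cotCoef (μ (σ 2)) (μ (σ 0)) (μ (σ 1)) =
    ((ratioB σ μ * coefL (ratioA σ μ) (ratioB σ μ) : ℝ) : ℂ) := by
  obtain ⟨hA, hB, d1, d2, d3, -⟩ := chamber_data hμ
  have n0 := qexp_ne_zero (μ (σ 0))
  have n1 := qexp_ne_zero (μ (σ 1))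
  have n2 := qexp_ne_zero (μ (σ 2))
  rw [cotCoef_eq, coefL]
  push_cast
  rw [hA, hB]
  generalize qexp (μ (σ 0)) = a at *
  generalize qexp (μ (σ 1)) = b at *
  generalize qexp (μ (σ 2)) = c at *
  have e1 : c / a - a / c = (c ^ 2 - a ^ 2) / (a * c) := by field_simp
  have e2 : c / b - b / c = (c ^ 2 - b ^ 2) / (b * c) := by field_simp
  have e3 : 1 - b ^ 2 / c ^ 2 = (c ^ 2 - b ^ 2) / c ^ 2 := by field_simp
  have e4 : 1 - a ^ 2 / b ^ 2 * (b ^ 2 / c ^ 2) = (c ^ 2 - a ^ 2) / c ^ 2 := by field_simp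
  rw [e1, e2, e3, e4]
  field_simp
  try ring

lemma sinPi_betaW_zero (s₁ s₂ m : ℂ) : sinPi (betaW 0 (s₁ - m) (s₂ + m)) = sinPi (s₁ + s₂) := by
  congr 1
  show s₁ - m + (s₂ + m) = s₁ + s₂
  ring

lemma betaW_one (p q : ℂ) : betaW 1 p q = q := rfl

lemma betaW_two (p q : ℂ) : betaW 2 p q = p := rfl

lemma perm_swap_zero_two : (σ * Equiv.swap 0 2 : Equiv.Perm (Fin 3)) 0 = σ 2 ∧ (σ * Equiv.swap 0 2 : Equiv.Perm (Fin 3)) 1 = σ 1 ∧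
    (σ * Equiv.swap 0 2 : Equiv.Perm (Fin 3)) 2 = σ 0 := by
  refine ⟨?_, ?_, ?_⟩ <;> rw [Equiv.Perm.mul_apply] <;> congr 1

lemma perm_swap_one_two : (σ * Equiv.swap 1 2 : Equiv.Perm (Fin 3)) 0 = σ 0 ∧ (σ * Equiv.swap 1 2 : Equiv.Perm (Fin 3)) 1 = σ 2 ∧
    (σ * Equiv.swap 1 2 : Equiv.Perm (Fin 3)) 2 = σ 1 := by
  refine ⟨?_, ?_, ?_⟩ <;> rw [Equiv.Perm.mul_apply] <;> congr 1

/-- A trigonometric monomial in terms of `qexp`. -/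
lemma trigMono_eq (a b c d : ℤ) (J : Fin 3) (μ : Fin 3 → ℂ) (s₁ s₂ : ℂ) :
    trigMono ![a, b, c, d] J σ μ s₁ s₂ =
      (qexp s₁ / qexp (μ (σ 0))) ^ a * (qexp s₁ / qexp (μ (σ 1))) ^ b *
      ((qexp s₂ * qexp (μ (σ 0))) ^ c * (qexp s₂ * qexp (μ (σ 1))) ^ d) *
      sinPi (betaW J (s₁ - μ (σ 2)) (s₂ + μ (σ 2))) := by
  rw [trigMono, qexp_sub, qexp_sub, qexp_add, qexp_add]
  rfl

lemma trigMono_eq_LMH (a b c d : ℤ) (J : Fin 3) (μ : Fin 3 → ℂ) (s₁ s₂ : ℂ) :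
    trigMono ![a, b, c, d] J (σ * Equiv.swap 0 2 : Equiv.Perm (Fin 3)) μ s₁ s₂ =
      (qexp s₁ / qexp (μ (σ 2))) ^ a * (qexp s₁ / qexp (μ (σ 1))) ^ b *
      ((qexp s₂ * qexp (μ (σ 2))) ^ c * (qexp s₂ * qexp (μ (σ 1))) ^ d) *
      sinPi (betaW J (s₁ - μ (σ 0)) (s₂ + μ (σ 0))) := by
  obtain ⟨h0, h1, h2⟩ := perm_swap_zero_two σ
  rw [trigMono_eq, h0, h1, h2]

lemma trigMono_eq_HLM (a b c d : ℤ) (J : Fin 3) (μ : Fin 3 → ℂ) (s₁ s₂ : ℂ) :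
    trigMono ![a, b, c, d] J (σ * Equiv.swap 1 2 : Equiv.Perm (Fin 3)) μ s₁ s₂ =
      (qexp s₁ / qexp (μ (σ 0))) ^ a * (qexp s₁ / qexp (μ (σ 2))) ^ b *
      ((qexp s₂ * qexp (μ (σ 0))) ^ c * (qexp s₂ * qexp (μ (σ 2))) ^ d) *
      sinPi (betaW J (s₁ - μ (σ 1)) (s₂ + μ (σ 1))) := by
  obtain ⟨h0, h1, h2⟩ := perm_swap_one_two σ
  rw [trigMono_eq, h0, h1, h2]

/-- The trigonometric factor of `S^{--}`. -/
def trigMM (a b c s₁ s₂ : ℂ) : ℂ := cotCoef a b c * (sinPi (s₁ - a) * sinPi (s₂ + a) * sinPi (s₁ + s₂))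

lemma trigSum_MM_H : TrigSum σ fun μ s₁ s₂ => trigMM (μ (σ 0)) (μ (σ 1)) (μ (σ 2)) s₁ s₂ := by
  refine ((((trigSum_mono σ 1 1 1 1 0 σ (((nice_const (-(1 / 4))).mul nice_left).mul nice_coefH)).add
    (trigSum_mono σ 1 1 (-1) (-1) 0 σ ((nice_const (1 / 4)).mul nice_coefH))).add
    (trigSum_mono σ (-1) (-1) 1 1 0 σ ((((nice_const (1 / 4)).mul nice_left).mul nice_left).mul nice_coefH))).add
    (trigSum_mono σ (-1) (-1) (-1) (-1) 0 σ (((nice_const (-(1 / 4))).mul nice_left).mul nice_coefH))).congr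
    fun μ hμ s₁ s₂ => ?_
  obtain ⟨hA, hB, -⟩ := chamber_data hμ
  have n0 := qexp_ne_zero (μ (σ 0))
  have n1 := qexp_ne_zero (μ (σ 1))
  have n2 := qexp_ne_zero (μ (σ 2))
  have m1 := qexp_ne_zero s₁
  have m2 := qexp_ne_zero s₂
  simp only [trigMM, cotCoef_H σ hμ, trigMono_eq σ, sinPi_betaW_zero, zpow_one, zpow_neg]
  push_cast
  rw [sinPi_mul_sinPi (s₁ - μ (σ 0)) (s₂ + μ (σ 0))]
  simp only [sqDiff, qexp_sub, qexp_add]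
  rw [hA]
  generalize sinPi (s₁ + s₂) = k
  field_simp
  ring

lemma trigSum_MM_L : TrigSum σ fun μ s₁ s₂ => trigMM (μ (σ 2)) (μ (σ 0)) (μ (σ 1)) s₁ s₂ := by
  refine ((((trigSum_mono σ 1 1 1 1 0 (σ * Equiv.swap 0 2) (((nice_const (-(1 / 4))).mul nice_right).mul nice_coefL)).add
    (trigSum_mono σ 1 1 (-1) (-1) 0 (σ * Equiv.swap 0 2) ((((nice_const (1 / 4)).mul nice_right).mul nice_right).mul nice_coefL))).add
    (trigSum_mono σ (-1) (-1) 1 1 0 (σ * Equiv.swap 0 2) ((nice_const (1 / 4)).mul nice_coefL))).add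
    (trigSum_mono σ (-1) (-1) (-1) (-1) 0 (σ * Equiv.swap 0 2) (((nice_const (-(1 / 4))).mul nice_right).mul nice_coefL))).congr
    fun μ hμ s₁ s₂ => ?_
  obtain ⟨hA, hB, -⟩ := chamber_data hμ
  have n0 := qexp_ne_zero (μ (σ 0))
  have n1 := qexp_ne_zero (μ (σ 1))
  have n2 := qexp_ne_zero (μ (σ 2))
  have m1 := qexp_ne_zero s₁
  have m2 := qexp_ne_zero s₂
  simp only [trigMM, cotCoef_L σ hμ, trigMono_eq_LMH, sinPi_betaW_zero, zpow_one, zpow_neg]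
  push_cast
  rw [sinPi_mul_sinPi (s₁ - μ (σ 2)) (s₂ + μ (σ 2))]
  simp only [sqDiff, qexp_sub, qexp_add]
  rw [hB]
  generalize sinPi (s₁ + s₂) = k
  field_simp
  ring

lemma trigSum_MM_M : TrigSum σ fun μ s₁ s₂ => trigMM (μ (σ 1)) (μ (σ 2)) (μ (σ 0)) s₁ s₂ := by
  refine ((((trigSum_mono σ 1 1 1 1 0 σ ((nice_const (-(1 / 4))).mul nice_coefM)).add
    (trigSum_mono σ (-1) (-1) (-1) (-1) 0 σ ((nice_const (-(1 / 4))).mul nice_coefM))).add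
    (trigSum_mono σ 1 1 (-1) (-1) 0 σ (((nice_const (1 / 4)).mul nice_left).mul nice_coefM))).add
    (trigSum_mono σ (-1) (-1) 1 1 0 (σ * Equiv.swap 0 2) (((nice_const (1 / 4)).mul nice_right).mul nice_coefM))).congr
    fun μ hμ s₁ s₂ => ?_
  obtain ⟨hA, hB, -⟩ := chamber_data hμ
  have n0 := qexp_ne_zero (μ (σ 0))
  have n1 := qexp_ne_zero (μ (σ 1))
  have n2 := qexp_ne_zero (μ (σ 2))
  have m1 := qexp_ne_zero s₁
  have m2 := qexp_ne_zero s₂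
  simp only [trigMM, cotCoef_M σ hμ, trigMono_eq σ, trigMono_eq_LMH, sinPi_betaW_zero, zpow_one, zpow_neg]
  push_cast
  rw [sinPi_mul_sinPi (s₁ - μ (σ 1)) (s₂ + μ (σ 1))]
  simp only [sqDiff, qexp_sub, qexp_add]
  rw [hA, hB]
  generalize sinPi (s₁ + s₂) = k
  field_simp
  ring

/-- The trigonometric factor of `S^{+-}`. -/
def trigPM (a b c s₁ s₂ : ℂ) : ℂ := cotCoef a b c * (sinPi (s₁ - a) * sinPi (s₂ + b) * sinPi (s₂ + c))

/-- The trigonometric factor of `S^{-+}`. -/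
def trigMP (a b c s₁ s₂ : ℂ) : ℂ := cotCoef a b c * (sinPi (s₂ + a) * sinPi (s₁ - b) * sinPi (s₁ - c))

lemma trigSum_PM_H : TrigSum σ fun μ s₁ s₂ => trigPM (μ (σ 0)) (μ (σ 1)) (μ (σ 2)) s₁ s₂ := by
  refine ((((trigSum_mono σ 1 1 1 1 1 σ ((nice_const (-(1 / 4))).mul nice_coefH)).add
    (trigSum_mono σ 1 1 (-1) (-1) 1 σ (((nice_const (1 / 4)).mul nice_left).mul nice_coefH))).add
    (trigSum_mono σ (-1) (-1) 1 1 1 σ (((nice_const (1 / 4)).mul nice_left).mul nice_coefH))).add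
    (trigSum_mono σ (-1) (-1) (-1) (-1) 1 σ ((((nice_const (-(1 / 4))).mul nice_left).mul nice_left).mul nice_coefH))).congr
    fun μ hμ s₁ s₂ => ?_
  obtain ⟨hA, hB, -⟩ := chamber_data hμ
  have n0 := qexp_ne_zero (μ (σ 0))
  have n1 := qexp_ne_zero (μ (σ 1))
  have n2 := qexp_ne_zero (μ (σ 2))
  have m1 := qexp_ne_zero s₁
  have m2 := qexp_ne_zero s₂
  simp only [trigPM, cotCoef_H σ hμ, trigMono_eq σ, betaW_one, zpow_one, zpow_neg]
  push_cast
  rw [sinPi_mul_sinPi (s₁ - μ (σ 0)) (s₂ + μ (σ 1))]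
  simp only [sqDiff, qexp_sub, qexp_add]
  rw [hA]
  generalize sinPi (s₂ + μ (σ 2)) = k
  field_simp
  ring

lemma trigSum_PM_L : TrigSum σ fun μ s₁ s₂ => trigPM (μ (σ 2)) (μ (σ 0)) (μ (σ 1)) s₁ s₂ := by
  refine ((((trigSum_mono σ 1 1 1 1 1 (σ * Equiv.swap 0 2) ((((nice_const (-(1 / 4))).mul nice_right).mul nice_right).mul nice_coefL)).add
    (trigSum_mono σ 1 1 (-1) (-1) 1 (σ * Equiv.swap 0 2) (((nice_const (1 / 4)).mul nice_right).mul nice_coefL))).add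
    (trigSum_mono σ (-1) (-1) 1 1 1 (σ * Equiv.swap 0 2) (((nice_const (1 / 4)).mul nice_right).mul nice_coefL))).add
    (trigSum_mono σ (-1) (-1) (-1) (-1) 1 (σ * Equiv.swap 0 2) ((nice_const (-(1 / 4))).mul nice_coefL))).congr
    fun μ hμ s₁ s₂ => ?_
  obtain ⟨hA, hB, -⟩ := chamber_data hμ
  have n0 := qexp_ne_zero (μ (σ 0))
  have n1 := qexp_ne_zero (μ (σ 1))
  have n2 := qexp_ne_zero (μ (σ 2))
  have m1 := qexp_ne_zero s₁
  have m2 := qexp_ne_zero s₂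
  simp only [trigPM, cotCoef_L σ hμ, trigMono_eq_LMH, betaW_one, zpow_one, zpow_neg]
  push_cast
  rw [mul_right_comm (sinPi (s₁ - μ (σ 2))), sinPi_mul_sinPi (s₁ - μ (σ 2)) (s₂ + μ (σ 1))]
  simp only [sqDiff, qexp_sub, qexp_add]
  rw [hB]
  generalize sinPi (s₂ + μ (σ 0)) = k
  field_simp
  ring

lemma trigSum_MP_H : TrigSum σ fun μ s₁ s₂ => trigMP (μ (σ 0)) (μ (σ 1)) (μ (σ 2)) s₁ s₂ := by
  refine ((((trigSum_mono σ 1 1 1 1 2 σ ((((nice_const (-(1 / 4))).mul nice_left).mul nice_left).mul nice_coefH)).add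
    (trigSum_mono σ 1 1 (-1) (-1) 2 σ (((nice_const (1 / 4)).mul nice_left).mul nice_coefH))).add
    (trigSum_mono σ (-1) (-1) 1 1 2 σ (((nice_const (1 / 4)).mul nice_left).mul nice_coefH))).add
    (trigSum_mono σ (-1) (-1) (-1) (-1) 2 σ ((nice_const (-(1 / 4))).mul nice_coefH))).congr
    fun μ hμ s₁ s₂ => ?_
  obtain ⟨hA, hB, -⟩ := chamber_data hμ
  have n0 := qexp_ne_zero (μ (σ 0))
  have n1 := qexp_ne_zero (μ (σ 1))
  have n2 := qexp_ne_zero (μ (σ 2))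
  have m1 := qexp_ne_zero s₁
  have m2 := qexp_ne_zero s₂
  simp only [trigMP, cotCoef_H σ hμ, trigMono_eq σ, betaW_two, zpow_one, zpow_neg]
  push_cast
  rw [sinPi_mul_sinPi (s₂ + μ (σ 0)) (s₁ - μ (σ 1))]
  simp only [sqDiff, qexp_sub, qexp_add]
  rw [hA]
  generalize sinPi (s₁ - μ (σ 2)) = k
  field_simp
  ring

lemma trigSum_MP_L : TrigSum σ fun μ s₁ s₂ => trigMP (μ (σ 2)) (μ (σ 0)) (μ (σ 1)) s₁ s₂ := by
  refine ((((trigSum_mono σ 1 1 1 1 2 (σ * Equiv.swap 0 2) ((nice_const (-(1 / 4))).mul nice_coefL)).add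
    (trigSum_mono σ 1 1 (-1) (-1) 2 (σ * Equiv.swap 0 2) (((nice_const (1 / 4)).mul nice_right).mul nice_coefL))).add
    (trigSum_mono σ (-1) (-1) 1 1 2 (σ * Equiv.swap 0 2) (((nice_const (1 / 4)).mul nice_right).mul nice_coefL))).add
    (trigSum_mono σ (-1) (-1) (-1) (-1) 2 (σ * Equiv.swap 0 2) ((((nice_const (-(1 / 4))).mul nice_right).mul nice_right).mul nice_coefL))).congr
    fun μ hμ s₁ s₂ => ?_
  obtain ⟨hA, hB, -⟩ := chamber_data hμ
  have n0 := qexp_ne_zero (μ (σ 0))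
  have n1 := qexp_ne_zero (μ (σ 1))
  have n2 := qexp_ne_zero (μ (σ 2))
  have m1 := qexp_ne_zero s₁
  have m2 := qexp_ne_zero s₂
  simp only [trigMP, cotCoef_L σ hμ, trigMono_eq_LMH, betaW_two, zpow_one, zpow_neg]
  push_cast
  rw [mul_right_comm (sinPi (s₂ + μ (σ 2))), sinPi_mul_sinPi (s₂ + μ (σ 2)) (s₁ - μ (σ 1))]
  simp only [sqDiff, qexp_sub, qexp_add]
  rw [hB]
  generalize sinPi (s₁ - μ (σ 0)) = k
  field_simp
  ring

lemma left_mul_coefR₂ {μ : Fin 3 → ℂ} (hμ : μ ∈ openChamber σ) :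
    (ratioA σ μ : ℂ) * coefR₂ (ratioA σ μ) (ratioB σ μ) =
      qexp (μ (σ 0)) ^ 2 * (qexp (μ (σ 2)) ^ 4 - qexp (μ (σ 1)) ^ 4) /
        (qexp (μ (σ 1)) ^ 2 * (qexp (μ (σ 2)) ^ 4 - qexp (μ (σ 0)) ^ 4)) := by
  obtain ⟨hA, hB, d1, d2, d3, d4⟩ := chamber_data hμ
  have n1 := qexp_ne_zero (μ (σ 1))
  have n2 := qexp_ne_zero (μ (σ 2))
  rw [coefR₂]
  push_cast
  rw [hA, hB]
  generalize qexp (μ (σ 0)) = a at *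
  generalize qexp (μ (σ 1)) = b at *
  generalize qexp (μ (σ 2)) = c at *
  have e : 1 - (a ^ 2 / b ^ 2) ^ 2 * (b ^ 2 / c ^ 2) ^ 2 = (c ^ 4 - a ^ 4) / c ^ 4 := by field_simp
  rw [e]
  field_simp

lemma right_mul_coefR₁ {μ : Fin 3 → ℂ} (hμ : μ ∈ openChamber σ) :
    (ratioB σ μ : ℂ) * coefR₁ (ratioA σ μ) (ratioB σ μ) =
      qexp (μ (σ 2)) ^ 2 * (qexp (μ (σ 1)) ^ 4 - qexp (μ (σ 0)) ^ 4) /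
        (qexp (μ (σ 1)) ^ 2 * (qexp (μ (σ 2)) ^ 4 - qexp (μ (σ 0)) ^ 4)) := by
  obtain ⟨hA, hB, d1, d2, d3, d4⟩ := chamber_data hμ
  have n1 := qexp_ne_zero (μ (σ 1))
  have n2 := qexp_ne_zero (μ (σ 2))
  rw [coefR₁]
  push_cast
  rw [hA, hB]
  generalize qexp (μ (σ 0)) = a at *
  generalize qexp (μ (σ 1)) = b at *
  generalize qexp (μ (σ 2)) = c at *
  have e : 1 - (a ^ 2 / b ^ 2) ^ 2 * (b ^ 2 / c ^ 2) ^ 2 = (c ^ 4 - a ^ 4) / c ^ 4 := by field_simp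
  rw [e]
  field_simp

lemma trigSum_PM_M : TrigSum σ fun μ s₁ s₂ => trigPM (μ (σ 1)) (μ (σ 2)) (μ (σ 0)) s₁ s₂ := by
  refine ((((((((((trigSum_mono σ 1 (-1) (-1) 1 2 (σ * Equiv.swap 1 2) ((nice_const (1 / 4)).mul nice_coefM)).add
    (trigSum_mono σ (-1) 1 1 (-1) 2 (σ * Equiv.swap 1 2) ((nice_const (1 / 4)).mul nice_coefM))).add
    (trigSum_mono σ (-1) (-1) 1 1 1 σ ((nice_const (1 / 4)).mul nice_coefM))).add
    (trigSum_mono σ (-1) 1 1 1 0 σ (((nice_const (-(1 / 4))).mul nice_right).mul nice_coefM))).add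
    (trigSum_mono σ 1 1 1 1 1 σ ((((nice_const (-(1 / 4))).mul nice_left).mul nice_coefR₂).mul nice_coefM))).add
    (trigSum_mono σ 1 1 1 1 1 (σ * Equiv.swap 0 2) ((((((nice_const (1 / 4)).mul nice_left).mul nice_coefR₂).mul nice_left).mul nice_right).mul nice_coefM))).add
    (trigSum_mono σ 1 1 (-1) (-1) 1 (σ * Equiv.swap 0 2) ((nice_const (1 / 4)).mul nice_coefM))).add
    (trigSum_mono σ 1 (-1) (-1) (-1) 0 (σ * Equiv.swap 0 2) (((nice_const (-(1 / 4))).mul nice_left).mul nice_coefM))).add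
    (trigSum_mono σ (-1) (-1) (-1) (-1) 1 (σ * Equiv.swap 0 2) ((((nice_const (-(1 / 4))).mul nice_right).mul nice_coefR₁).mul nice_coefM))).add
    (trigSum_mono σ (-1) (-1) (-1) (-1) 1 σ ((((((nice_const (1 / 4)).mul nice_right).mul nice_coefR₁).mul nice_left).mul nice_right).mul nice_coefM))).congr
    fun μ hμ s₁ s₂ => ?_
  obtain ⟨hA, hB, d1, d2, d3, d4⟩ := chamber_data hμ
  have n0 := qexp_ne_zero (μ (σ 0))
  have n1 := qexp_ne_zero (μ (σ 1))
  have n2 := qexp_ne_zero (μ (σ 2))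
  have m1 := qexp_ne_zero s₁
  have m2 := qexp_ne_zero s₂
  have r2 := left_mul_coefR₂ σ hμ
  have r1 := right_mul_coefR₁ σ hμ
  simp only [trigPM, cotCoef_M σ hμ, trigMono_eq σ, trigMono_eq_LMH, trigMono_eq_HLM, sinPi_betaW_zero,
    betaW_one, betaW_two, zpow_one, zpow_neg]
  push_cast
  simp only [mul_assoc (_ : ℂ) (ratioA σ μ : ℂ) (coefR₂ _ _ : ℂ), mul_assoc (_ : ℂ) (ratioB σ μ : ℂ) (coefR₁ _ _ : ℂ)]
  rw [r2, r1, sinPi_mul_sinPi]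
  simp only [sinPi_eq_sqDiff, sqDiff, qexp_sub, qexp_add]
  rw [hA, hB]
  generalize (2 * Complex.I)⁻¹ = k
  generalize (coefM (ratioA σ μ) (ratioB σ μ) : ℂ) = w
  generalize qexp (μ (σ 0)) = a at *
  generalize qexp (μ (σ 1)) = b at *
  generalize qexp (μ (σ 2)) = c at *
  generalize qexp s₁ = s at *
  generalize qexp s₂ = u at *
  field_simp
  ring

lemma trigSum_MP_M : TrigSum σ fun μ s₁ s₂ => trigMP (μ (σ 1)) (μ (σ 2)) (μ (σ 0)) s₁ s₂ := by
  refine ((((((((((trigSum_mono σ 1 (-1) (-1) 1 1 (σ * Equiv.swap 1 2) ((nice_const (1 / 4)).mul nice_coefM)).add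
    (trigSum_mono σ (-1) 1 1 (-1) 1 (σ * Equiv.swap 1 2) ((nice_const (1 / 4)).mul nice_coefM))).add
    (trigSum_mono σ 1 1 (-1) (-1) 2 (σ * Equiv.swap 0 2) ((nice_const (1 / 4)).mul nice_coefM))).add
    (trigSum_mono σ 1 1 (-1) 1 0 (σ * Equiv.swap 0 2) (((nice_const (-(1 / 4))).mul nice_left).mul nice_coefM))).add
    (trigSum_mono σ 1 1 1 1 2 (σ * Equiv.swap 0 2) ((((nice_const (-(1 / 4))).mul nice_right).mul nice_coefR₁).mul nice_coefM))).add
    (trigSum_mono σ 1 1 1 1 2 σ ((((((nice_const (1 / 4)).mul nice_right).mul nice_coefR₁).mul nice_left).mul nice_right).mul nice_coefM))).add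
    (trigSum_mono σ (-1) (-1) 1 1 2 σ ((nice_const (1 / 4)).mul nice_coefM))).add
    (trigSum_mono σ (-1) (-1) 1 (-1) 0 σ (((nice_const (-(1 / 4))).mul nice_right).mul nice_coefM))).add
    (trigSum_mono σ (-1) (-1) (-1) (-1) 2 σ ((((nice_const (-(1 / 4))).mul nice_left).mul nice_coefR₂).mul nice_coefM))).add
    (trigSum_mono σ (-1) (-1) (-1) (-1) 2 (σ * Equiv.swap 0 2) ((((((nice_const (1 / 4)).mul nice_left).mul nice_coefR₂).mul nice_left).mul nice_right).mul nice_coefM))).congr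
    fun μ hμ s₁ s₂ => ?_
  obtain ⟨hA, hB, d1, d2, d3, d4⟩ := chamber_data hμ
  have n0 := qexp_ne_zero (μ (σ 0))
  have n1 := qexp_ne_zero (μ (σ 1))
  have n2 := qexp_ne_zero (μ (σ 2))
  have m1 := qexp_ne_zero s₁
  have m2 := qexp_ne_zero s₂
  have r2 := left_mul_coefR₂ σ hμ
  have r1 := right_mul_coefR₁ σ hμ
  simp only [trigMP, cotCoef_M σ hμ, trigMono_eq σ, trigMono_eq_LMH, trigMono_eq_HLM, sinPi_betaW_zero,
    betaW_one, betaW_two, zpow_one, zpow_neg]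
  push_cast
  simp only [mul_assoc (_ : ℂ) (ratioA σ μ : ℂ) (coefR₂ _ _ : ℂ), mul_assoc (_ : ℂ) (ratioB σ μ : ℂ) (coefR₁ _ _ : ℂ)]
  rw [r2, r1, sinPi_mul_sinPi]
  simp only [sinPi_eq_sqDiff, sqDiff, qexp_sub, qexp_add]
  rw [hA, hB]
  generalize (2 * Complex.I)⁻¹ = k
  generalize (coefM (ratioA σ μ) (ratioB σ μ) : ℂ) = w
  generalize qexp (μ (σ 0)) = a at *
  generalize qexp (μ (σ 1)) = b at *
  generalize qexp (μ (σ 2)) = c at *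
  generalize qexp s₁ = s at *
  generalize qexp s₂ = u at *
  field_simp
  ring

/-- The trigonometric factor of `S^{++}`. -/
def trigPP (a b c s₁ s₂ : ℂ) : ℂ := cosHalf (a - b) * cosHalf (b - c) * cosHalf (c - a) * sinPi (s₁ + s₂)

lemma trigSum_PP : TrigSum σ fun μ s₁ s₂ => trigPP (μ (σ 0)) (μ (σ 1)) (μ (σ 2)) s₁ s₂ := by
  refine (trigSum_mono σ 1 (-1) (-1) 1 0 (σ * Equiv.swap 1 2) ((((nice_const (1 / 8)).mul
    ((nice_const 1).add nice_left)).mul ((nice_const 1).add nice_right)).mul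
    ((nice_const 1).add nice_left_mul_right))).congr fun μ hμ s₁ s₂ => ?_
  obtain ⟨hA, hB, -⟩ := chamber_data hμ
  have n0 := qexp_ne_zero (μ (σ 0))
  have n1 := qexp_ne_zero (μ (σ 1))
  have n2 := qexp_ne_zero (μ (σ 2))
  have m1 := qexp_ne_zero s₁
  have m2 := qexp_ne_zero s₂
  simp only [trigPP, cosHalf_eq, trigMono_eq_HLM, sinPi_betaW_zero, zpow_one, zpow_neg, qexp_sub]
  push_cast
  rw [hA, hB]
  generalize sinPi (s₁ + s₂) = k
  field_simp
  try ring

end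

/-! ### Decomposition of the long element kernel -/

/-- `sin(π(s₁ + s₂)) S`, without the factors `sin(π(s₁ + s₂))` in denominators. -/
def trigNum (y₁ y₂ : ℝ) (μ : Fin 3 → ℂ) (s₁ s₂ : ℂ) : ℂ :=
  if 0 < y₁ then
    (if 0 < y₂ then ((1 / (24 * Real.pi ^ 2) : ℝ) : ℂ) * trigPP (μ 0) (μ 1) (μ 2) s₁ s₂
    else ((1 / (32 * Real.pi ^ 2) : ℝ) : ℂ) * trigPM (μ 0) (μ 1) (μ 2) s₁ s₂)
  else
    (if 0 < y₂ then ((1 / (32 * Real.pi ^ 2) : ℝ) : ℂ) * trigMP (μ 2) (μ 0) (μ 1) s₁ s₂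
    else ((-(1 / (32 * Real.pi ^ 2)) : ℝ) : ℂ) * trigMM (μ 1) (μ 2) (μ 0) s₁ s₂)

lemma trigSum_of_symm (σ : Equiv.Perm (Fin 3)) {F : ℂ → ℂ → ℂ → ℂ → ℂ → ℂ}
    (hF : ∀ a b c s₁ s₂, F a b c s₁ s₂ = F a c b s₁ s₂)
    (h0 : TrigSum σ fun μ s₁ s₂ => F (μ (σ 0)) (μ (σ 1)) (μ (σ 2)) s₁ s₂)
    (h1 : TrigSum σ fun μ s₁ s₂ => F (μ (σ 1)) (μ (σ 2)) (μ (σ 0)) s₁ s₂)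
    (h2 : TrigSum σ fun μ s₁ s₂ => F (μ (σ 2)) (μ (σ 0)) (μ (σ 1)) s₁ s₂) {i j k : Fin 3}
    (hij : i ≠ j) (hik : i ≠ k) (hjk : j ≠ k) :
    TrigSum σ fun μ s₁ s₂ => F (μ i) (μ j) (μ k) s₁ s₂ := by
  obtain ⟨p, rfl⟩ := σ.surjective i
  obtain ⟨q, rfl⟩ := σ.surjective j
  obtain ⟨r, rfl⟩ := σ.surjective k
  fin_cases p <;> fin_cases q <;> first | exact absurd rfl hij | (fin_cases r <;>
    first | exact absurd rfl hik | exact absurd rfl hjk | exact h0 | exact h1 | exact h2 |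
      exact h0.congr fun μ _ s₁ s₂ => hF _ _ _ _ _ | exact h1.congr fun μ _ s₁ s₂ => hF _ _ _ _ _ |
      exact h2.congr fun μ _ s₁ s₂ => hF _ _ _ _ _)

lemma trigPP_rotate (a b c s₁ s₂ : ℂ) : trigPP a b c s₁ s₂ = trigPP b c a s₁ s₂ := by
  rw [trigPP, trigPP]; ring

lemma trigPP_comm (a b c s₁ s₂ : ℂ) : trigPP a b c s₁ s₂ = trigPP a c b s₁ s₂ := by
  rw [trigPP, trigPP, ← neg_sub b a, ← neg_sub c b, ← neg_sub a c, cosHalf_neg, cosHalf_neg, cosHalf_neg]; ring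

lemma trigSum_trigNum (σ : Equiv.Perm (Fin 3)) (y₁ y₂ : ℝ) : TrigSum σ (trigNum y₁ y₂) := by
  have n01 : (0 : Fin 3) ≠ 1 := by decide
  have n02 : (0 : Fin 3) ≠ 2 := by decide
  have n12 : (1 : Fin 3) ≠ 2 := by decide
  have pp := trigSum_of_symm σ trigPP_comm (trigSum_PP σ)
    ((trigSum_PP σ).congr fun μ _ s₁ s₂ => (trigPP_rotate _ _ _ _ _).symm)
    ((trigSum_PP σ).congr fun μ _ s₁ s₂ => trigPP_rotate _ _ _ _ _) n01 n02 n12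
  have pm := trigSum_of_symm σ (F := trigPM) (fun a b c s₁ s₂ => by rw [trigPM, trigPM, cotCoef_comm]; ring)
    (trigSum_PM_H σ) (trigSum_PM_M σ) (trigSum_PM_L σ) n01 n02 n12
  have mp := trigSum_of_symm σ (F := trigMP) (fun a b c s₁ s₂ => by rw [trigMP, trigMP, cotCoef_comm]; ring)
    (trigSum_MP_H σ) (trigSum_MP_M σ) (trigSum_MP_L σ) n02.symm n12.symm n01
  have mm := trigSum_of_symm σ (F := trigMM) (fun a b c s₁ s₂ => by rw [trigMM, trigMM, cotCoef_comm])
    (trigSum_MM_H σ) (trigSum_MM_M σ) (trigSum_MM_L σ) n12 n01.symm n02.symm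
  by_cases h1 : 0 < y₁ <;> by_cases h2 : 0 < y₂
  · exact (pp.const_mul (1 / (24 * Real.pi ^ 2))).congr fun μ _ s₁ s₂ => by rw [trigNum, if_pos h1, if_pos h2]
  · exact (pm.const_mul (1 / (32 * Real.pi ^ 2))).congr fun μ _ s₁ s₂ => by rw [trigNum, if_pos h1, if_neg h2]
  · exact (mp.const_mul (1 / (32 * Real.pi ^ 2))).congr fun μ _ s₁ s₂ => by rw [trigNum, if_neg h1, if_pos h2]
  · exact (mm.const_mul (-(1 / (32 * Real.pi ^ 2)))).congr fun μ _ s₁ s₂ => by rw [trigNum, if_neg h1, if_neg h2]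

lemma cosT_nu (μ : Fin 3 → ℂ) : cosT (nu μ 0) = cosHalf (μ 0 - μ 1) ∧ cosT (nu μ 1) = cosHalf (μ 1 - μ 2) ∧
    cosT (nu μ 2) = cosHalf (μ 2 - μ 0) := by
  refine ⟨?_, ?_, ?_⟩ <;>
  · rw [cosT, cosHalf]
    congr 1
    simp only [nu, Matrix.cons_val]
    ring

lemma sinT_nu (μ : Fin 3 → ℂ) : sinT (nu μ 0) = sinHalf (μ 0 - μ 1) ∧ sinT (nu μ 1) = sinHalf (μ 1 - μ 2) ∧
    sinT (nu μ 2) = sinHalf (μ 2 - μ 0) := by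
  refine ⟨?_, ?_, ?_⟩ <;>
  · rw [sinT, sinHalf]
    congr 1
    simp only [nu, Matrix.cons_val]
    ring

lemma S_eq_trigNum (y₁ y₂ : ℝ) {s₁ s₂ : ℂ} (hs : sinPi (s₁ + s₂) ≠ 0) (μ : Fin 3 → ℂ) :
    S y₁ y₂ s₁ s₂ μ = trigNum y₁ y₂ μ s₁ s₂ / sinPi (s₁ + s₂) := by
  obtain ⟨c0, c1, c2⟩ := cosT_nu μ
  obtain ⟨d0, d1, d2⟩ := sinT_nu μ
  have e : ∀ a b k : ℂ, a * b / (k * sinPi (s₁ + s₂)) * sinPi (s₁ + s₂) = a * (b / k) := fun a b k => by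
    rw [mul_comm k, ← div_div, div_right_comm, div_mul_cancel₀ _ hs, mul_div_assoc]
  rw [eq_div_iff hs]
  by_cases h1 : 0 < y₁ <;> by_cases h2 : 0 < y₂
  · rw [S, trigNum, if_pos h1, if_pos h2, if_pos h1, if_pos h2, Spp, trigPP, Fin.prod_univ_three, c0, c1, c2]
    push_cast
    ring
  · rw [S, trigNum, if_pos h1, if_neg h2, if_pos h1, if_neg h2, Spm, trigPM, cotCoef, c1, d0, d2,
      ← neg_sub (μ 2) (μ 0), sinHalf_neg (μ 2 - μ 0), e]
    push_cast
    ring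
  · rw [S, trigNum, if_neg h1, if_pos h2, if_neg h1, if_pos h2, Smp, trigMP, cotCoef, c0, d1, d2,
      ← neg_sub (μ 1) (μ 2), sinHalf_neg (μ 1 - μ 2), e]
    push_cast
    ring
  · rw [S, trigNum, if_neg h1, if_neg h2, if_neg h1, if_neg h2, Smm, trigMM, cotCoef, c2, d1, d0,
      ← neg_sub (μ 0) (μ 1), sinHalf_neg (μ 0 - μ 1)]
    push_cast
    ring

/-- The angles attached to a vector of signs. -/
def signAngle (e : Fin 4 → ℤ) (j : Fin 4) : ℝ := e j * (Real.pi / 2)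

lemma abs_signAngle_le {e : Fin 4 → ℤ} (he : ∀ j, |e j| ≤ 1) (j : Fin 4) : |signAngle e j| ≤ Real.pi / 2 := by
  have h : |(e j : ℝ)| ≤ 1 := by exact_mod_cast he j
  have := Real.pi_pos
  rw [signAngle, abs_mul, abs_of_pos (by positivity : 0 < Real.pi / 2)]
  nlinarith

lemma rGamma_signAngle (e : Fin 4 → ℤ) (j : Fin 4) (z : ℂ) :
    rGamma (signAngle e j) z = Complex.Gamma z * qexp z ^ e j := by
  rw [rGamma, signAngle, qexp_zpow]

lemma prod_perm (f : Fin 3 → ℂ) (ρ : Equiv.Perm (Fin 3)) : ∏ j, f j = f (ρ 0) * f (ρ 1) * f (ρ 2) := by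
  rw [← Equiv.prod_comp ρ, Fin.prod_univ_three]

lemma gamma_mul_trigMono (e : Fin 4 → ℤ) (J : Fin 3) (ρ : Equiv.Perm (Fin 3)) (μ : Fin 3 → ℂ) (s₁ s₂ : ℂ) :
    (∏ j, (Complex.Gamma (s₁ - μ j) * Complex.Gamma (s₂ + μ j))) * (Complex.Gamma (1 - (s₁ + s₂)) / Real.pi) *
      trigMono e J ρ μ s₁ s₂ = termFn (signAngle e) J ρ μ s₁ s₂ := by
  rw [prod_perm _ ρ, termFn, trigMono, betaJ, rGamma_signAngle, rGamma_signAngle, rGamma_signAngle,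
    rGamma_signAngle, show 1 - (s₁ - μ (ρ 2)) - (s₂ + μ (ρ 2)) = 1 - (s₁ + s₂) by ring]
  ring

lemma Gamma_mul_sinPi_inv {z : ℂ} (hz : z.re < 1) (hs : sinPi z ≠ 0) :
    1 / Complex.Gamma z / sinPi z = Complex.Gamma (1 - z) / Real.pi := by
  have hg : Complex.Gamma (1 - z) ≠ 0 := Complex.Gamma_ne_zero_of_re_pos (by simpa using hz)
  have h := Gamma_mul_sinPi hg hs
  have hpi : (Real.pi : ℂ) ≠ 0 := Complex.ofReal_ne_zero.2 Real.pi_ne_zero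
  have hz' : Complex.Gamma z ≠ 0 := by
    intro h0
    rw [h0, zero_mul, zero_div] at h
    exact one_div_ne_zero hg h.symm
  rw [div_div, div_eq_div_iff (mul_ne_zero hz' hs) hpi]
  rw [div_eq_div_iff hpi hg] at h
  linear_combination -h

lemma G_mul_S (y₁ y₂ : ℝ) {s₁ s₂ : ℂ} (hz : (s₁ + s₂).re < 1) (hs : sinPi (s₁ + s₂) ≠ 0) (μ : Fin 3 → ℂ) :
    G s₁ s₂ μ * S y₁ y₂ s₁ s₂ μ = (∏ j, (Complex.Gamma (s₁ - μ j) * Complex.Gamma (s₂ + μ j))) *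
      (Complex.Gamma (1 - (s₁ + s₂)) / Real.pi) * trigNum y₁ y₂ μ s₁ s₂ := by
  rw [S_eq_trigNum y₁ y₂ hs, ← Gamma_mul_sinPi_inv hz hs, G]
  ring

lemma sinPi_ne_zero_of_ne_zero {z : ℂ} (h0 : z ≠ 0) (h1 : |z.re| < 1) : sinPi z ≠ 0 := by
  intro h
  obtain ⟨k, hk⟩ := Complex.sin_eq_zero_iff.1 h
  have hpi : (Real.pi : ℂ) ≠ 0 := Complex.ofReal_ne_zero.2 Real.pi_ne_zero
  have hz : z = k := mul_left_cancel₀ hpi (by rw [hk]; ring)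
  rw [hz, Complex.intCast_re] at h1
  have : k = 0 := Int.abs_lt_one_iff.1 (by exact_mod_cast h1)
  exact h0 (by rw [hz, this, Int.cast_zero])

lemma list_sum_mul_left (l : List TrigTerm) (f : TrigTerm → ℂ) (c : ℂ) :
    c * (l.map f).sum = (l.map fun x => c * f x).sum := (List.sum_map_mul_left ..).symm

/-- The building block attached to a term. -/
def TrigTerm.integrand (x : TrigTerm) (Y₁ Y₂ : ℝ) (μ : Fin 3 → ℂ) (t : ℝ × ℝ) : ℂ :=
  termIntegrand (signAngle x.2.1) x.2.2.1 x.2.2.2 Y₁ Y₂ μ t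

/-- The integral of the building block attached to a term. -/
def TrigTerm.kernel (x : TrigTerm) (Y₁ Y₂ : ℝ) (μ : Fin 3 → ℂ) : ℂ :=
  termKernel (signAngle x.2.1) x.2.2.1 x.2.2.2 Y₁ Y₂ μ

lemma ofReal_cpow_neg {y : ℝ} (hy : 0 < y) (s : ℂ) : (y : ℂ) ^ (-s) = Complex.exp (-(s * Real.log y)) := by
  rw [Complex.cpow_def_of_ne_zero (Complex.ofReal_ne_zero.2 hy.ne'), ← Complex.ofReal_log hy.le]
  congr 1; ring

lemma abs_barnesPath_re_le (μ : Fin 3 → ℂ) (t : ℝ) : |(barnesPath μ t).re| ≤ 1 / 8 := by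
  rw [barnesPath_re, barnesRe, abs_le]
  refine ⟨(by norm_num : -(1 / 8 : ℝ) ≤ -(1 / 8)).trans (le_max_left _ _), max_le (by norm_num) (min_le_left _ _)⟩

lemma volume_add_eq_zero : (volume : Measure (ℝ × ℝ)) {t | t.1 + t.2 = 0} = 0 := by
  have hm : MeasurableSet {t : ℝ × ℝ | t.1 + t.2 = 0} :=
    measurableSet_eq_fun (measurable_fst.add measurable_snd) measurable_const
  rw [Measure.volume_eq_prod, Measure.measure_prod_null hm]
  refine Eventually.of_forall fun a => ?_
  have : Prod.mk a ⁻¹' {t : ℝ × ℝ | t.1 + t.2 = 0} = {-a} := by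
    ext b
    simp only [mem_preimage, mem_ofPred_eq, mem_singleton_iff]
    constructor <;> intro h <;> linarith
  simp only [this, Real.volume_singleton, Pi.zero_apply]

/-- The decomposition of the integrand. -/
lemma kernelW6Integrand_ae_eq {σ : Equiv.Perm (Fin 3)} {y₁ y₂ : ℝ} {l : List TrigTerm} {μ : Fin 3 → ℂ}
    (hl : ∀ s₁ s₂, trigNum y₁ y₂ μ s₁ s₂ = (l.map fun x => ((x.1 (ratioA σ μ) (ratioB σ μ) : ℝ) : ℂ) *
        trigMono x.2.1 x.2.2.1 x.2.2.2 μ s₁ s₂).sum) (h1 : y₁ ≠ 0) (h2 : y₂ ≠ 0) :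
    kernelW6Integrand y₁ y₂ μ =ᵐ[volume] fun t => (l.map fun x => ((x.1 (ratioA σ μ) (ratioB σ μ) : ℝ) : ℂ) *
      x.integrand (Real.log |4 * Real.pi ^ 2 * y₁|) (Real.log |4 * Real.pi ^ 2 * y₂|) μ t).sum := by
  have hae : ∀ᵐ t : ℝ × ℝ, ¬ (t.1 + t.2 = 0) := by
    rw [ae_iff]; simpa using volume_add_eq_zero
  have hp : ∀ y : ℝ, y ≠ 0 → 0 < |4 * Real.pi ^ 2 * y| := fun y hy => by
    have := Real.pi_pos
    positivity
  filter_upwards [hae] with t ht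
  have hre : |(barnesPath μ t.1 + barnesPath μ t.2).re| < 1 := by
    rw [Complex.add_re]
    have a1 := abs_barnesPath_re_le μ t.1
    have a2 := abs_barnesPath_re_le μ t.2
    have := abs_add_le (barnesPath μ t.1).re (barnesPath μ t.2).re
    linarith
  have hne : barnesPath μ t.1 + barnesPath μ t.2 ≠ 0 := by
    intro h
    apply ht
    have := congrArg Complex.im h
    simpa only [Complex.add_im, barnesPath_im, Complex.zero_im] using this
  rw [kernelW6Integrand, ofReal_cpow_neg (hp _ h1), ofReal_cpow_neg (hp _ h2),
    mul_assoc (_ * _ : ℂ) (G _ _ _), G_mul_S y₁ y₂ (abs_lt.1 hre).2 (sinPi_ne_zero_of_ne_zero hne hre), hl,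
    list_sum_mul_left, list_sum_mul_left, ← List.sum_map_mul_right, div_eq_mul_inv, ← List.sum_map_mul_right]
  congr 2
  funext x
  rw [TrigTerm.integrand, termIntegrand, ← gamma_mul_trigMono]
  ring

lemma integral_list_sum {ι α : Type*} [MeasurableSpace α] {m : Measure α} (l : List ι) {f : ι → α → ℂ}
    (hf : ∀ x ∈ l, Integrable (f x) m) : Integrable (fun t => (l.map fun x => f x t).sum) m ∧
      ∫ t, (l.map fun x => f x t).sum ∂m = (l.map fun x => ∫ t, f x t ∂m).sum := by
  induction l with
  | nil => simp
  | cons x l ih =>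
    obtain ⟨i1, i2⟩ := ih fun y hy => hf y (List.mem_cons_of_mem _ hy)
    have i3 := hf x List.mem_cons_self
    simp only [List.map_cons, List.sum_cons]
    exact ⟨i3.add i1, by rw [integral_add i3 i1, i2]⟩

lemma kernelW6_eq {σ : Equiv.Perm (Fin 3)} {y₁ y₂ : ℝ} {l : List TrigTerm} {μ : Fin 3 → ℂ} (hμ : μ ∈ iaStar)
    (he : ∀ x ∈ l, ∀ j, |x.2.1 j| ≤ 1)
    (hl : ∀ s₁ s₂, trigNum y₁ y₂ μ s₁ s₂ = (l.map fun x => ((x.1 (ratioA σ μ) (ratioB σ μ) : ℝ) : ℂ) *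
        trigMono x.2.1 x.2.2.1 x.2.2.2 μ s₁ s₂).sum) (h1 : y₁ ≠ 0) (h2 : y₂ ≠ 0) :
    Integrable (kernelW6Integrand y₁ y₂ μ) ∧
    kernelW6 y₁ y₂ μ = (l.map fun x => ((x.1 (ratioA σ μ) (ratioB σ μ) : ℝ) : ℂ) *
      x.kernel (Real.log |4 * Real.pi ^ 2 * y₁|) (Real.log |4 * Real.pi ^ 2 * y₂|) μ).sum := by
  have h := kernelW6Integrand_ae_eq hl h1 h2
  obtain ⟨i1, i2⟩ := integral_list_sum (m := volume) l (f := fun x t => ((x.1 (ratioA σ μ) (ratioB σ μ) : ℝ) : ℂ) *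
      x.integrand (Real.log |4 * Real.pi ^ 2 * y₁|) (Real.log |4 * Real.pi ^ 2 * y₂|) μ t)
    fun x hx => (integrable_termIntegrand (abs_signAngle_le (he x hx)) _ _ _ _ hμ).const_mul _
  refine ⟨i1.congr h.symm, ?_⟩
  rw [kernelW6, integral_congr_ae h, i2]
  congr 2
  funext x
  rw [integral_const_mul]
  rfl

lemma exists_mem_openChamber {μ : Fin 3 → ℂ} (hμ : μ ∈ iaStar)
    (hd : ∀ i j, i ≠ j → (μ i).im ≠ (μ j).im) : ∃ σ, μ ∈ openChamber σ := by
  have h01 := (hd 0 1 (by decide)).lt_or_gt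
  have h02 := (hd 0 2 (by decide)).lt_or_gt
  have h12 := (hd 1 2 (by decide)).lt_or_gt
  have key : ∀ a b c : Fin 3, a ≠ b → a ≠ c → b ≠ c → ∃ σ : Equiv.Perm (Fin 3), σ 0 = a ∧ σ 1 = b ∧ σ 2 = c := by
    decide
  have mk : ∀ a b c : Fin 3, (a ≠ b ∧ a ≠ c ∧ b ≠ c) → (μ b).im < (μ a).im → (μ c).im < (μ b).im →
      ∃ σ, μ ∈ openChamber σ := by
    rintro a b c ⟨n1, n2, n3⟩ g1 g2
    obtain ⟨σ, rfl, rfl, rfl⟩ := key a b c n1 n2 n3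
    exact ⟨σ, hμ, g1, g2⟩
  rcases h01 with h01 | h01 <;> rcases h02 with h02 | h02 <;> rcases h12 with h12 | h12
  · exact mk 2 1 0 (by decide) h12 h01
  · exact mk 1 2 0 (by decide) h12 h02
  · exact absurd (h01.trans h12) h02.not_gt
  · exact mk 1 0 2 (by decide) h01 h02
  · exact mk 2 0 1 (by decide) h02 h01
  · exact absurd (h02.trans h12) h01.not_gt
  · exact mk 0 2 1 (by decide) h02 h12
  · exact mk 0 1 2 (by decide) h01 h12

lemma im_ne_of_notMem_walls {μ : Fin 3 → ℂ} (hμ : μ ∈ iaStar \ walls) (i j : Fin 3) (hij : i ≠ j) :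
    (μ i).im ≠ (μ j).im := by
  intro h
  have hh : μ i = μ j := Complex.ext (by rw [hμ.1.1 i, hμ.1.1 j]) h
  refine hμ.2 ⟨Equiv.swap i j, by rw [Ne, Equiv.swap_eq_one_iff]; exact hij, ?_⟩
  funext k
  rw [Function.comp_apply]
  rcases eq_or_ne k i with rfl | hk
  · rw [Equiv.swap_apply_left, hh]
  rcases eq_or_ne k j with rfl | hk'
  · rw [Equiv.swap_apply_right, hh]
  · rw [Equiv.swap_apply_of_ne_of_ne hk hk']

lemma integrable_kernelW6Integrand {y₁ y₂ : ℝ} (h1 : y₁ ≠ 0) (h2 : y₂ ≠ 0) {μ : Fin 3 → ℂ}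
    (hμ : μ ∈ iaStar \ walls) : Integrable (kernelW6Integrand y₁ y₂ μ) := by
  obtain ⟨σ, hσ⟩ := exists_mem_openChamber hμ.1 (im_ne_of_notMem_walls hμ)
  obtain ⟨l, hl, hl'⟩ := trigSum_trigNum σ y₁ y₂
  exact (kernelW6_eq hμ.1 (fun x hx => (hl x hx).2) (hl' μ hσ) h1 h2).1

/-! ### The spectral measure on a chamber -/

/-- The limit of the product of the tangents is `1`; the product itself in terms of the ratios. -/
def tanCoef (α β : ℝ) : ℝ :=
  (1 - α) * (1 - β) * (1 - α * β) * ((1 + α)⁻¹ * (1 + β)⁻¹ * (1 + α * β)⁻¹)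

lemma nice_tanCoef : Nice tanCoef := by
  refine ((((nice_const 1).sub nice_left).mul ((nice_const 1).sub nice_right)).mul
    ((nice_const 1).sub nice_left_mul_right)).mul (((nice_left.inv_one_add fun α β h _ => h).mul
    (nice_right.inv_one_add fun α β _ h => h)).mul (nice_left_mul_right.inv_one_add fun α β h h' => mul_nonneg h h'))

/-- The product of the tangents of the half differences. -/
def tanProd (a b c : ℂ) : ℂ :=
  sinHalf (a - b) / cosHalf (a - b) * (sinHalf (b - c) / cosHalf (b - c)) * (sinHalf (c - a) / cosHalf (c - a))

lemma tanProd_rotate (a b c : ℂ) : tanProd a b c = tanProd b c a := by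
  rw [tanProd, tanProd]; ring

lemma tanProd_comm (a b c : ℂ) : tanProd a c b = -tanProd a b c := by
  rw [tanProd, tanProd, ← neg_sub c a, ← neg_sub b c, ← neg_sub a b]
  simp only [sinHalf_neg, cosHalf_neg]
  ring

lemma spec_eq (μ : Fin 3 → ℂ) : spec μ = (∏ j, (3 * nu μ j)) * tanProd (μ 0) (μ 1) (μ 2) := by
  have h : ∀ z w : ℂ, Complex.tan (3 * Real.pi / 2 * ((z - w) / 3)) = sinHalf (z - w) / cosHalf (z - w) := by
    intro z w
    rw [Complex.tan, sinHalf, cosHalf]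
    congr 2 <;> ring
  rw [spec, Finset.prod_mul_distrib, tanProd]
  congr 1
  rw [Fin.prod_univ_three, ← h, ← h, ← h]
  rfl

lemma tanProd_chamber {σ : Equiv.Perm (Fin 3)} {μ : Fin 3 → ℂ} (hμ : μ ∈ openChamber σ) :
    tanProd (μ (σ 0)) (μ (σ 1)) (μ (σ 2)) = Complex.I * (tanCoef (ratioA σ μ) (ratioB σ μ) : ℝ) := by
  obtain ⟨hA, hB, -⟩ := chamber_data hμ
  have n0 := qexp_ne_zero (μ (σ 0))
  have n1 := qexp_ne_zero (μ (σ 1))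
  have n2 := qexp_ne_zero (μ (σ 2))
  have a0 := ratioA_pos σ μ
  have b0 := ratioB_pos σ μ
  have p1 : (1 + ratioA σ μ : ℂ) ≠ 0 := by
    exact_mod_cast (by positivity : (1 + ratioA σ μ : ℝ) ≠ 0)
  have p2 : (1 + ratioB σ μ : ℂ) ≠ 0 := by
    exact_mod_cast (by positivity : (1 + ratioB σ μ : ℝ) ≠ 0)
  have p3 : (1 + ratioA σ μ * ratioB σ μ : ℂ) ≠ 0 := by
    exact_mod_cast (by positivity : (1 + ratioA σ μ * ratioB σ μ : ℝ) ≠ 0)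
  have key : ∀ z w : ℂ, ∀ r : ℂ, qexp z ^ 2 / qexp w ^ 2 = r → 1 + r ≠ 0 →
      sinHalf (z - w) / cosHalf (z - w) = (r - 1) * (1 + r)⁻¹ * Complex.I⁻¹ := by
    intro z w r hr h
    have nz := qexp_ne_zero z
    have nw := qexp_ne_zero w
    have hI := Complex.I_ne_zero
    have h2 : qexp w ^ 2 + qexp z ^ 2 ≠ 0 := by
      intro h0
      apply h
      rw [← hr]
      field_simp
      linear_combination h0
    rw [sinHalf_eq, cosHalf_eq, qexp_sub, ← hr]
    have h3 : qexp z / qexp w + (qexp z / qexp w)⁻¹ ≠ 0 := by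
      have : qexp z / qexp w + (qexp z / qexp w)⁻¹ = (qexp w ^ 2 + qexp z ^ 2) / (qexp z * qexp w) := by
        field_simp; ring
      rw [this]
      positivity
    have h4 : 1 + qexp z ^ 2 / qexp w ^ 2 = (qexp w ^ 2 + qexp z ^ 2) / qexp w ^ 2 := by field_simp
    have h5 : qexp z / qexp w + (qexp z / qexp w)⁻¹ = (qexp w ^ 2 + qexp z ^ 2) / (qexp z * qexp w) := by
      field_simp; ring
    rw [h4, h5]
    field_simp
  have hC : qexp (μ (σ 0)) ^ 2 / qexp (μ (σ 2)) ^ 2 = (ratioA σ μ * ratioB σ μ : ℂ) := by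
    rw [hA, hB]; field_simp
  have e3 : sinHalf (μ (σ 2) - μ (σ 0)) / cosHalf (μ (σ 2) - μ (σ 0)) =
      -(sinHalf (μ (σ 0) - μ (σ 2)) / cosHalf (μ (σ 0) - μ (σ 2))) := by
    rw [← neg_sub, sinHalf_neg, cosHalf_neg, neg_div]
  rw [tanProd, e3, key _ _ _ hA.symm p1, key _ _ _ hB.symm p2, key _ _ _ hC p3, tanCoef, Complex.inv_I]
  push_cast
  generalize (ratioA σ μ : ℂ) = a
  generalize (ratioB σ μ : ℂ) = b
  linear_combination (a - 1) * (1 + a)⁻¹ * ((b - 1) * (1 + b)⁻¹) * ((a * b - 1) * (1 + a * b)⁻¹) *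
    Complex.I * Complex.I_sq

lemma exists_spec_eq (σ : Equiv.Perm (Fin 3)) : ∃ c : ℂ, ‖c‖ = 1 ∧ ∀ μ ∈ openChamber σ,
    spec μ = c * (∏ j, (3 * nu μ j)) * (tanCoef (ratioA σ μ) (ratioB σ μ) : ℝ) := by
  have key : ∀ p q r : Fin 3, p ≠ q → p ≠ r → q ≠ r → ∃ s : ℂ, ‖s‖ = 1 ∧ ∀ μ : Fin 3 → ℂ,
      tanProd (μ 0) (μ 1) (μ 2) = s * tanProd (μ p) (μ q) (μ r) := by
    have hd : ∀ p q r : Fin 3, p ≠ q → p ≠ r → q ≠ r → (p, q, r) ∈ [((0 : Fin 3), (1 : Fin 3), (2 : Fin 3)),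
        (1, 2, 0), (2, 0, 1), (0, 2, 1), (1, 0, 2), (2, 1, 0)] := by decide
    intro p q r h1 h2 h3
    have := hd p q r h1 h2 h3
    simp only [List.mem_cons, Prod.mk.injEq, List.not_mem_nil, or_false] at this
    rcases this with ⟨rfl, rfl, rfl⟩ | ⟨rfl, rfl, rfl⟩ | ⟨rfl, rfl, rfl⟩ | ⟨rfl, rfl, rfl⟩ | ⟨rfl, rfl, rfl⟩ |
      ⟨rfl, rfl, rfl⟩
    · exact ⟨1, norm_one, fun μ => (one_mul _).symm⟩
    · exact ⟨1, norm_one, fun μ => by rw [one_mul, tanProd_rotate (μ 0)]⟩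
    · exact ⟨1, norm_one, fun μ => by rw [one_mul, tanProd_rotate (μ 2)]⟩
    · exact ⟨-1, by simp, fun μ => by rw [neg_one_mul, tanProd_comm (μ 0) (μ 1) (μ 2), neg_neg]⟩
    · exact ⟨-1, by simp, fun μ => by rw [neg_one_mul, tanProd_comm (μ 1) (μ 2), neg_neg, tanProd_rotate (μ 0)]⟩
    · exact ⟨-1, by simp, fun μ => by rw [neg_one_mul, tanProd_comm (μ 2) (μ 0), neg_neg, tanProd_rotate (μ 2)]⟩
  obtain ⟨s, hs, h⟩ := key (σ 0) (σ 1) (σ 2) (σ.injective.ne (by decide)) (σ.injective.ne (by decide))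
    (σ.injective.ne (by decide))
  refine ⟨s * Complex.I, by rw [norm_mul, hs, Complex.norm_I, one_mul], fun μ hμ => ?_⟩
  rw [spec_eq, h, tanProd_chamber hμ]
  ring

section

variable {h : ℝ → (Fin 3 → ℂ) → ℂ} {ε B c : ℝ}

/-! ### Replacing convergent coefficients by their limits -/

lemma pow_mul_exp_neg_le (n : ℕ) {a : ℝ} (ha : 0 < a) {T : ℝ} (hT : 0 < T) :
    T ^ n * Real.exp (-(a * T)) ≤ n.factorial / a ^ n := by
  have h := Real.pow_div_factorial_le_exp (a * T) (by positivity) n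
  rw [div_le_iff₀ (by positivity)] at h
  rw [Real.exp_neg, ← div_eq_mul_inv, div_le_div_iff₀ (Real.exp_pos _) (by positivity)]
  calc T ^ n * a ^ n = (a * T) ^ n := by rw [mul_pow, mul_comm]
    _ ≤ _ := by rw [mul_comm (n.factorial : ℝ)]; exact h

lemma measurable_ratioA (σ : Equiv.Perm (Fin 3)) : Measurable fun t => ratioA σ (imagParam t) := by
  have h0 := (continuous_imagParam_im (σ 0)).measurable
  have h1 := (continuous_imagParam_im (σ 1)).measurable
  exact Real.measurable_exp.comp ((h0.sub h1).const_mul _).neg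

lemma measurable_ratioB (σ : Equiv.Perm (Fin 3)) : Measurable fun t => ratioB σ (imagParam t) := by
  have h0 := (continuous_imagParam_im (σ 1)).measurable
  have h1 := (continuous_imagParam_im (σ 2)).measurable
  exact Real.measurable_exp.comp ((h0.sub h1).const_mul _).neg

lemma Nice.measurable_comp {κ : ℝ → ℝ → ℝ} (hκ : Nice κ) (σ : Equiv.Perm (Fin 3)) :
    Measurable fun t => ((κ (ratioA σ (imagParam t)) (ratioB σ (imagParam t)) : ℝ) : ℂ) :=
  Complex.measurable_ofReal.comp (hκ.1.comp ((measurable_ratioA σ).prodMk (measurable_ratioB σ)))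

lemma mem_chamber_of_amplitude_ne_zero {σ : Equiv.Perm (Fin 3)} {T : ℝ} {t : ℝ × ℝ}
    (ht : amplitude h σ T t ≠ 0) : t ∈ chamber σ :=
  (indicator_apply_ne_zero.1 ht).1

lemma TestData.ratio_le (H : TestData h ε B c) {σ : Equiv.Perm (Fin 3)} {T : ℝ} (hT : 1 < T) {t : ℝ × ℝ}
    (ht : amplitude h σ T t ≠ 0) : ratioA σ (imagParam t) ≤ Real.exp (-(Real.pi * c * T)) ∧
      ratioB σ (imagParam t) ≤ Real.exp (-(Real.pi * c * T)) := by
  obtain ⟨m1, m2⟩ := mem_chamber_of_amplitude_ne_zero ht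
  have h0 := ne_zero_of_amplitude_ne_zero ht
  have g1 := H.gap T hT t h0 (σ 0) (σ 1) (σ.injective.ne (by decide))
  have g2 := H.gap T hT t h0 (σ 1) (σ 2) (σ.injective.ne (by decide))
  rw [abs_of_pos (sub_pos.2 m1)] at g1
  rw [abs_of_pos (sub_pos.2 m2)] at g2
  have hp := Real.pi_pos
  refine ⟨Real.exp_le_exp.2 (neg_le_neg ?_), Real.exp_le_exp.2 (neg_le_neg ?_)⟩
  · rw [mul_assoc]; exact mul_le_mul_of_nonneg_left g1 hp.le
  · rw [mul_assoc]; exact mul_le_mul_of_nonneg_left g2 hp.le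

theorem TestData.integral_mul_nice (H : TestData h ε B c) (σ : Equiv.Perm (Fin 3)) {κ : ℝ → ℝ → ℝ}
    (hκ : Nice κ) {D : ℝ} (hD : 0 ≤ D) (n : ℕ) : ∃ C : ℝ, 0 ≤ C ∧ ∀ T : ℝ, 1 < T → ∀ k : ℝ × ℝ → ℂ,
      AEStronglyMeasurable k → (∀ t, h T (imagParam t) ≠ 0 → ‖k t‖ ≤ D * T ^ n) →
      Integrable (fun t => amplitude h σ T t * k t *
        ((κ (ratioA σ (imagParam t)) (ratioB σ (imagParam t)) : ℝ) : ℂ)) ∧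
      ‖∫ t, amplitude h σ T t * k t * ((κ (ratioA σ (imagParam t)) (ratioB σ (imagParam t)) : ℝ) : ℂ)‖ ≤
        C + |κ 0 0| * ‖∫ t, amplitude h σ T t * k t‖ := by
  have hc := H.c_pos
  have hp := Real.pi_pos
  set q : ℝ := Real.exp (-(Real.pi * c)) with hq
  have q1 : q < 1 := Real.exp_lt_one_iff.2 (neg_lt_zero.2 (by positivity))
  obtain ⟨E, hE, hEb⟩ := hκ.2 q (Real.exp_pos _).le q1
  obtain ⟨C, hC, hCb⟩ := H.amplitude_spec σ one_pos
  refine ⟨D * (E * 2) * C * ((n + 5).factorial / (Real.pi * c) ^ (n + 5)), by positivity,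
    fun T hT k hk hkb => ?_⟩
  have hT0 : 0 < T := by linarith
  obtain ⟨f1, f2, -⟩ := hCb T hT
  set f := amplitude h σ T with hf
  have b1 : ∀ t, ‖f t * k t‖ ≤ D * T ^ n * ‖f t‖ := by
    intro t
    by_cases h0 : f t = 0
    · rw [h0, zero_mul, norm_zero, mul_zero]
    · rw [norm_mul, mul_comm]
      exact mul_le_mul_of_nonneg_right (hkb t (ne_zero_of_amplitude_ne_zero h0)) (norm_nonneg _)
  have i1 : Integrable fun t => f t * k t :=
    (f1.norm.const_mul (D * T ^ n)).mono' (f1.aestronglyMeasurable.mul hk) (Eventually.of_forall b1)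
  set e := Real.exp (-(Real.pi * c * T)) with he
  set g : ℝ × ℝ → ℂ := fun t => ((κ (ratioA σ (imagParam t)) (ratioB σ (imagParam t)) : ℝ) : ℂ) - (κ 0 0 : ℝ) with hg
  have b2 : ∀ t, ‖f t * k t * g t‖ ≤ D * (E * 2) * (T ^ n * e) * ‖f t‖ := by
    intro t
    by_cases h0 : f t = 0
    · rw [h0, zero_mul, zero_mul, norm_zero, mul_zero]
    · obtain ⟨r1, r2⟩ := H.ratio_le hT h0
      have heq : e ≤ q := Real.exp_le_exp.2 (neg_le_neg (le_mul_of_one_le_right (by positivity) hT.le))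
      have hgb : ‖g t‖ ≤ E * 2 * e := by
        rw [hg]
        simp only
        rw [← Complex.ofReal_sub, Complex.norm_real, Real.norm_eq_abs]
        refine (hEb _ _ (ratioA_pos _ _).le (r1.trans heq) (ratioB_pos _ _).le (r2.trans heq)).trans ?_
        rw [mul_assoc]
        exact mul_le_mul_of_nonneg_left (by linarith) hE
      rw [norm_mul]
      calc _ ≤ D * T ^ n * ‖f t‖ * (E * 2 * e) := by
            have := b1 t
            gcongr
        _ = _ := by ring
  have hgm : Measurable g := (hκ.measurable_comp σ).sub_const _
  have i2 : Integrable fun t => f t * k t * g t :=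
    (f1.norm.const_mul _).mono' (i1.aestronglyMeasurable.mul hgm.aestronglyMeasurable) (Eventually.of_forall b2)
  have hsplit : ∀ t, f t * k t * ((κ (ratioA σ (imagParam t)) (ratioB σ (imagParam t)) : ℝ) : ℂ) =
      f t * k t * g t + ((κ 0 0 : ℝ) : ℂ) * (f t * k t) := fun t => by rw [hg]; ring
  simp only [hsplit]
  refine ⟨i2.add (i1.const_mul _), ?_⟩
  rw [integral_add i2 (i1.const_mul _), integral_const_mul]
  refine (norm_add_le _ _).trans ?_
  rw [norm_mul, Complex.norm_real, Real.norm_eq_abs]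
  gcongr
  calc ‖∫ t, f t * k t * g t‖ ≤ ∫ t, D * (E * 2) * (T ^ n * e) * ‖f t‖ :=
        norm_integral_le_of_norm_le (f1.norm.const_mul _) (Eventually.of_forall b2)
    _ = D * (E * 2) * (T ^ n * e) * ∫ t, ‖f t‖ := integral_const_mul _ _
    _ ≤ D * (E * 2) * (T ^ n * e) * (C * T ^ 5) := by
        have he0 : 0 < e := Real.exp_pos _
        gcongr
        refine f2.trans ?_
        gcongr
        rw [← Real.rpow_natCast]
        exact Real.rpow_le_rpow_of_exponent_le hT.le (by push_cast; linarith [H.eps_pos])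
    _ = D * (E * 2) * C * (T ^ (n + 5) * e) := by ring
    _ ≤ _ := by
        gcongr
        exact pow_mul_exp_neg_le (n + 5) (by positivity) hT0

/-! ### The sum over the chambers -/

lemma chamber_unique {σ τ : Equiv.Perm (Fin 3)} {t : ℝ × ℝ} (h1 : t ∈ chamber σ) (h2 : t ∈ chamber τ) :
    σ = τ := by
  set g : Fin 3 → ℝ := fun j => (imagParam t (σ j)).im with hg
  have hanti : StrictAnti g := by
    rw [Fin.strictAnti_iff_succ_lt]
    intro i
    fin_cases i
    · exact h1.1
    · exact h1.2
  set ρ := σ⁻¹ * τ with hρ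
  have hv : ∀ j, g (ρ j) = (imagParam t (τ j)).im := fun j => by
    show (imagParam t (σ (σ.symm (τ j)))).im = _
    rw [Equiv.apply_symm_apply]
  have l1 : ρ 0 < ρ 1 := hanti.lt_iff_gt.1 (by rw [hv, hv]; exact h2.1)
  have l2 : ρ 1 < ρ 2 := hanti.lt_iff_gt.1 (by rw [hv, hv]; exact h2.2)
  have : ρ = 1 := by
    have key : ∀ a b c : Fin 3, a < b → b < c → a = 0 ∧ b = 1 ∧ c = 2 := by decide
    obtain ⟨k0, k1, k2⟩ := key _ _ _ l1 l2
    ext j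
    fin_cases j
    · exact congrArg _ k0
    · exact congrArg _ k1
    · exact congrArg _ k2
  rw [hρ, inv_mul_eq_one] at this
  exact this

lemma TestData.mem_chamber (H : TestData h ε B c) {T : ℝ} (hT : 1 < T) {t : ℝ × ℝ}
    (ht : h T (imagParam t) ≠ 0) : ∃ σ, imagParam t ∈ openChamber σ ∧ t ∈ chamber σ := by
  have hc := H.c_pos
  obtain ⟨σ, hσ⟩ := exists_mem_openChamber (imagParam_mem_iaStar t) fun i j hij heq => by
    have := H.gap T hT t ht i j hij
    rw [heq, sub_self, abs_zero] at this
    have : 0 < c * T := by positivity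
    linarith
  exact ⟨σ, hσ, hσ.2⟩

/-- A function supported on the chambers as a sum over the chambers. -/
lemma TestData.eq_sum_chambers (H : TestData h ε B c) {T : ℝ} (hT : 1 < T) (k : ℝ × ℝ → ℂ)
    (u : Equiv.Perm (Fin 3) → ℝ × ℝ → ℂ)
    (hu : ∀ σ t, imagParam t ∈ openChamber σ →
      h T (imagParam t) * k t = (h T (imagParam t) * ∏ j, (3 * nu (imagParam t) j)) * u σ t) (t : ℝ × ℝ) :
    h T (imagParam t) * k t = ∑ σ, amplitude h σ T t * u σ t := by
  by_cases h0 : h T (imagParam t) = 0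
  · rw [h0, zero_mul]
    symm
    refine Finset.sum_eq_zero fun σ _ => ?_
    by_contra h1
    exact ne_zero_of_amplitude_ne_zero (left_ne_zero_of_mul h1) h0
  · obtain ⟨σ, hσ, hσ'⟩ := H.mem_chamber hT h0
    rw [Finset.sum_eq_single σ, hu σ t hσ, amplitude, indicator_of_mem hσ']
    · intro τ _ hτ
      rw [amplitude, indicator_of_notMem fun hm => hτ (chamber_unique hm hσ'), zero_mul]
    · exact fun hn => absurd (Finset.mem_univ _) hn

end

section

variable {h : ℝ → (Fin 3 → ℂ) → ℂ} {ε B c : ℝ}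

/-! ### The bound for the long element weight function -/

lemma TestData.norm_kernel_le (H : TestData h ε B c) {x : TrigTerm} (he : ∀ j, |x.2.1 j| ≤ 1) {T : ℝ} (hT : 1 < T)
    {Y₁ Y₂ : ℝ} (h1 : |Y₁| ≤ 4 + 100 * Real.log T) (h2 : |Y₂| ≤ 4 + 100 * Real.log T) {t : ℝ × ℝ}
    (ht : h T (imagParam t) ≠ 0) :
    ‖x.kernel Y₁ Y₂ (imagParam t)‖ ≤ (termConst * Real.exp 1 * (1 + B) ^ 6) * T ^ 31 := by
  have hT0 : 0 < T := by linarith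
  have hB := H.B_pos
  have hl : 0 ≤ Real.log T := Real.log_nonneg hT.le
  have htc := termConst_nonneg
  have hy : ∀ Y : ℝ, |Y| ≤ 4 + 100 * Real.log T → Real.exp (|Y| / 8) ≤ Real.exp (1 / 2) * Real.exp (25 / 2 * Real.log T) := by
    intro Y hY
    rw [← Real.exp_add]
    exact Real.exp_le_exp.2 (by linarith)
  have e1 : Real.exp (1 / 2) * Real.exp (25 / 2 * Real.log T) * (Real.exp (1 / 2) * Real.exp (25 / 2 * Real.log T)) =
      Real.exp 1 * T ^ 25 := by
    have : T ^ 25 = Real.exp (25 * Real.log T) := by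
      rw [show (25 : ℝ) * Real.log T = (25 : ℕ) * Real.log T by norm_num, Real.exp_nat_mul, Real.exp_log hT0]
    rw [this, ← Real.exp_add, ← Real.exp_add, ← Real.exp_add]
    congr 1; ring
  have hn : 1 + ‖imagParam t‖ ≤ (1 + B) * T := by
    have := H.norm_le T hT t ht
    linarith
  calc _ ≤ termConst * Real.exp (|Y₁| / 8) * Real.exp (|Y₂| / 8) * (1 + ‖imagParam t‖) ^ 6 :=
        norm_termKernel_le (abs_signAngle_le he) _ _ _ _ (imagParam_mem_iaStar t)
    _ ≤ termConst * (Real.exp (1 / 2) * Real.exp (25 / 2 * Real.log T)) *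
          (Real.exp (1 / 2) * Real.exp (25 / 2 * Real.log T)) * ((1 + B) * T) ^ 6 := by
        have a1 := hy Y₁ h1
        have a2 := hy Y₂ h2
        gcongr
    _ = termConst * (Real.exp 1 * T ^ 25) * ((1 + B) * T) ^ 6 := by rw [← e1]; ring
    _ = _ := by ring

lemma log_le_rpow {η T : ℝ} (hη : 0 < η) (hT : 1 < T) (a b : ℝ) (ha : 0 ≤ a) (hb : 0 ≤ b) :
    a + b * Real.log T ≤ (a + b / η) * T ^ η := by
  have h1 := Real.log_le_rpow_div (by linarith : (0 : ℝ) ≤ T) hη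
  have h2 : (1 : ℝ) ≤ T ^ η := Real.one_le_rpow hT.le hη.le
  calc a + b * Real.log T ≤ a * T ^ η + b * (T ^ η / η) := by
        gcongr
        exact le_mul_of_one_le_right ha h2
    _ = _ := by ring

lemma TestData.norm_integral_kernel_le (H : TestData h ε B c) (σ : Equiv.Perm (Fin 3)) {x : TrigTerm}
    (he : ∀ j, |x.2.1 j| ≤ 1) {δ : ℝ} (hδ : 0 < δ) : ∃ C : ℝ, 0 ≤ C ∧ ∀ T : ℝ, 1 < T → ∀ Y₁ Y₂ : ℝ,
      |Y₁| ≤ 4 + 100 * Real.log T → |Y₂| ≤ 4 + 100 * Real.log T →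
      ‖∫ t, amplitude h σ T t * x.kernel Y₁ Y₂ (imagParam t)‖ ≤ C * T ^ (3 + δ) := by
  have hB := H.B_pos
  have hε := H.eps_pos
  have hε' := H.eps_lt
  set η := δ / 3 with hη
  have hη0 : 0 < η := by positivity
  obtain ⟨C, hC, hCb⟩ := H.amplitude_spec σ hη0
  have htb := termBoundConst_nonneg
  set P : ℝ := 5 + 104 / η with hP
  have hP0 : 0 ≤ P := by positivity
  refine ⟨termBoundConst * (P * P * C + P * (1 + B) ^ 2 * C), by positivity, fun T hT Y₁ Y₂ h1 h2 => ?_⟩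
  have hT0 : 0 < T := by linarith
  obtain ⟨f1, f2, f3⟩ := hCb T hT
  have hl : 0 ≤ Real.log T := Real.log_nonneg hT.le
  have hTη : 0 < T ^ η := Real.rpow_pos_of_pos hT0 _
  have hlog := log_le_rpow hη0 hT 5 104 (by norm_num) (by norm_num)
  have hlog' : 5 + 100 * Real.log T ≤ P * T ^ η := by linarith
  have hf1 : 0 ≤ ∫ t, ‖amplitude h σ T t‖ := integral_nonneg fun t => norm_nonneg _
  refine (norm_integral_mul_termKernel_le (abs_signAngle_le he) _ _ f1 (R := T ^ (1 - ε)) (K := B * T)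
    (W := 4 * Real.log T) (Real.one_le_rpow hT.le (by linarith))
    (fun t ht => H.norm_le T hT t (ne_zero_of_amplitude_ne_zero ht)) (by positivity) f3 h1 h2 (by positivity) ?_).trans ?_
  · rw [Real.log_rpow hT0]
    nlinarith
  · rw [mul_assoc termBoundConst]
    refine mul_le_mul_of_nonneg_left ?_ htb
    rw [add_mul (P * P * C)]
    have hw : Real.exp (-(4 * Real.log T)) = (T ^ 4)⁻¹ := by
      rw [Real.exp_neg, show (4 : ℝ) * Real.log T = (4 : ℕ) * Real.log T by norm_num, Real.exp_nat_mul,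
        Real.exp_log hT0]
    have hR : (T ^ (1 - ε)) ^ 2 = T ^ (2 - 2 * ε) := by
      rw [← Real.rpow_natCast, ← Real.rpow_mul hT0.le]; congr 1; push_cast; ring
    refine add_le_add ?_ ?_
    · rw [hR]
      calc (1 + (4 + 100 * Real.log T) + 4 * Real.log T) * (1 + (4 + 100 * Real.log T)) *
            (C * T ^ (5 - 2 * ε + η)) / T ^ (2 - 2 * ε)
          ≤ (P * T ^ η) * (P * T ^ η) * (C * T ^ (5 - 2 * ε + η)) / T ^ (2 - 2 * ε) := by
            gcongr <;> linarith
        _ = P * P * C * (T ^ η * T ^ η * T ^ (5 - 2 * ε + η) / T ^ (2 - 2 * ε)) := by ring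
        _ = P * P * C * T ^ (3 + δ) := by
            rw [← Real.rpow_add hT0, ← Real.rpow_add hT0, ← Real.rpow_sub hT0]
            congr 2
            rw [hη]; ring
    · rw [hw]
      calc (1 + (4 + 100 * Real.log T) + 4 * Real.log T) * (1 + B * T) ^ 2 * (T ^ 4)⁻¹ * ∫ t, ‖amplitude h σ T t‖
          ≤ (P * T ^ η) * ((1 + B) * T) ^ 2 * (T ^ 4)⁻¹ * (C * T ^ (5 - 2 * ε)) := by
            gcongr <;> linarith
        _ = P * (1 + B) ^ 2 * C * (T ^ η * T ^ 2 * T ^ (5 - 2 * ε) / T ^ 4) := by ring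
        _ ≤ _ := by
            refine mul_le_mul_of_nonneg_left ?_ (by positivity)
            rw [← Real.rpow_natCast, ← Real.rpow_natCast, ← Real.rpow_add hT0, ← Real.rpow_add hT0,
              ← Real.rpow_sub hT0]
            refine Real.rpow_le_rpow_of_exponent_le hT.le ?_
            push_cast
            linarith

/-- The contribution of a term on a chamber. -/
lemma TestData.term_bound (H : TestData h ε B c) (σ : Equiv.Perm (Fin 3)) {x : TrigTerm}
    (hx : Nice x.1 ∧ ∀ j, |x.2.1 j| ≤ 1) {δ : ℝ} (hδ : 0 < δ) : ∃ C : ℝ, 0 ≤ C ∧ ∀ T : ℝ, 1 < T → ∀ Y₁ Y₂ : ℝ,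
      |Y₁| ≤ 4 + 100 * Real.log T → |Y₂| ≤ 4 + 100 * Real.log T →
      Integrable (fun t => amplitude h σ T t * x.kernel Y₁ Y₂ (imagParam t) *
        ((x.1 (ratioA σ (imagParam t)) (ratioB σ (imagParam t)) *
          tanCoef (ratioA σ (imagParam t)) (ratioB σ (imagParam t)) : ℝ) : ℂ)) ∧
      ‖∫ t, amplitude h σ T t * x.kernel Y₁ Y₂ (imagParam t) *
        ((x.1 (ratioA σ (imagParam t)) (ratioB σ (imagParam t)) *
          tanCoef (ratioA σ (imagParam t)) (ratioB σ (imagParam t)) : ℝ) : ℂ)‖ ≤ C * T ^ (3 + δ) := by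
  have hB := H.B_pos
  have htc := termConst_nonneg
  obtain ⟨C, hC, hCb⟩ := H.integral_mul_nice σ (hx.1.mul nice_tanCoef)
    (D := termConst * Real.exp 1 * (1 + B) ^ 6) (by positivity) 31
  obtain ⟨C', hC', hCb'⟩ := H.norm_integral_kernel_le σ hx.2 hδ
  refine ⟨C + |x.1 0 0 * tanCoef 0 0| * C', by positivity, fun T hT Y₁ Y₂ h1 h2 => ?_⟩
  obtain ⟨i1, i2⟩ := hCb T hT (fun t => x.kernel Y₁ Y₂ (imagParam t))
    (stronglyMeasurable_termKernel _ _ _ _ _).aestronglyMeasurable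
    fun t ht => H.norm_kernel_le hx.2 hT h1 h2 ht
  refine ⟨i1, i2.trans ?_⟩
  have hb := hCb' T hT Y₁ Y₂ h1 h2
  have hone : (1 : ℝ) ≤ T ^ (3 + δ) := Real.one_le_rpow hT.le (by linarith)
  calc _ ≤ C * T ^ (3 + δ) + |x.1 0 0 * tanCoef 0 0| * (C' * T ^ (3 + δ)) := by
        gcongr
        exact le_mul_of_one_le_right hC hone
    _ = _ := by ring

lemma abs_log_le {T y : ℝ} (hT : 1 < T) (hy : y ∈ Ioo (T ^ (-100 : ℝ)) (T ^ (100 : ℝ))) :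
    |Real.log y| ≤ 100 * Real.log T := by
  have hT0 : 0 < T := by linarith
  have hy0 : 0 < y := (Real.rpow_pos_of_pos hT0 _).trans hy.1
  rw [abs_le, ← neg_mul, ← Real.log_rpow hT0, ← Real.log_rpow hT0]
  exact ⟨Real.log_le_log (Real.rpow_pos_of_pos hT0 _) hy.1.le, Real.log_le_log hy0 hy.2.le⟩

lemma abs_of_mem_signs {α : ℝ} (hα : α ∈ ({1, -1} : Set ℝ)) : |α| = 1 := by
  rcases hα with rfl | h
  · exact abs_one
  · rw [mem_singleton_iff.1 h, abs_neg, abs_one]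

lemma abs_log_scale_le {T y α : ℝ} (hT : 1 < T) (hy : y ∈ Ioo (T ^ (-100 : ℝ)) (T ^ (100 : ℝ)))
    (hα : α ∈ ({1, -1} : Set ℝ)) : |Real.log (|4 * Real.pi ^ 2 * (α * y)|)| ≤ 4 + 100 * Real.log T := by
  have hT0 : 0 < T := by linarith
  have hy0 : 0 < y := (Real.rpow_pos_of_pos hT0 _).trans hy.1
  have hp : (0 : ℝ) < 4 * Real.pi ^ 2 := by have := Real.pi_pos; positivity
  rw [abs_mul, abs_mul α, abs_of_mem_signs hα, one_mul, abs_of_pos hp, abs_of_pos hy0, Real.log_mul hp.ne' hy0.ne']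
  refine (abs_add_le _ _).trans (add_le_add ?_ (abs_log_le hT hy))
  have h1 : (1 : ℝ) ≤ 4 * Real.pi ^ 2 := by nlinarith [Real.pi_gt_three]
  rw [abs_of_nonneg (Real.log_nonneg h1), Real.log_le_iff_le_exp hp]
  have h2 : Real.exp 4 = Real.exp 1 ^ 4 := by rw [← Real.exp_nat_mul]; norm_num
  have h3 : (2.7 : ℝ) ^ 4 ≤ Real.exp 1 ^ 4 := by
    have := Real.exp_one_gt_d9
    gcongr
    linarith
  have h4 : Real.pi ^ 2 ≤ 3.15 ^ 2 := by
    have := Real.pi_lt_d2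
    have := Real.pi_pos
    gcongr
  rw [h2]
  norm_num at h3 h4 ⊢
  linarith

lemma trigNum_signs {α₁ α₂ y₁ y₂ : ℝ} (h1 : 0 < y₁) (h2 : 0 < y₂) :
    trigNum (α₁ * y₁) (α₂ * y₂) = trigNum α₁ α₂ := by
  funext μ s₁ s₂
  simp only [trigNum, mul_pos_iff_of_pos_right h1, mul_pos_iff_of_pos_right h2]

theorem TestData.norm_phiW6_le (H : TestData h ε B c) {α₁ α₂ : ℝ} (hα₁ : α₁ ∈ ({1, -1} : Set ℝ))
    (hα₂ : α₂ ∈ ({1, -1} : Set ℝ)) {δ : ℝ} (hδ : 0 < δ) : ∃ C : ℝ, 0 ≤ C ∧ ∀ T : ℝ, 1 < T →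
      ∀ y₁ ∈ Ioo (T ^ (-100 : ℝ)) (T ^ (100 : ℝ)), ∀ y₂ ∈ Ioo (T ^ (-100 : ℝ)) (T ^ (100 : ℝ)),
        Integrable (phiW6Integrand (h T) (α₁ * y₁) (α₂ * y₂)) ∧
        ‖phiW6 (h T) (α₁ * y₁) (α₂ * y₂)‖ ≤ C * T ^ (3 + δ) := by
  choose l hl hl' using fun σ => trigSum_trigNum σ α₁ α₂
  choose d hd hd' using exists_spec_eq
  choose! C hC hCb using fun (σ : Equiv.Perm (Fin 3)) (x : TrigTerm)
    (hx : Nice x.1 ∧ ∀ j, |x.2.1 j| ≤ 1) => H.term_bound σ hx hδ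
  have hC0 : ∀ σ, 0 ≤ ((l σ).map (C σ)).sum := fun σ => List.sum_nonneg fun a ha => by
    obtain ⟨x, hx, rfl⟩ := List.mem_map.1 ha
    exact hC σ x (hl σ x hx)
  refine ⟨∑ σ, ((l σ).map (C σ)).sum, Finset.sum_nonneg fun σ _ => hC0 σ, fun T hT y₁ hy₁ y₂ hy₂ => ?_⟩
  have hT0 : 0 < T := by linarith
  have p1 : 0 < y₁ := (Real.rpow_pos_of_pos hT0 _).trans hy₁.1
  have p2 : 0 < y₂ := (Real.rpow_pos_of_pos hT0 _).trans hy₂.1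
  have hα : ∀ {α : ℝ}, α ∈ ({1, -1} : Set ℝ) → α ≠ 0 := fun {α} h0 h1 => by
    have := abs_of_mem_signs h0
    rw [h1, abs_zero] at this
    exact zero_ne_one this
  set Y₁ := Real.log |4 * Real.pi ^ 2 * (α₁ * y₁)| with hY₁
  set Y₂ := Real.log |4 * Real.pi ^ 2 * (α₂ * y₂)| with hY₂
  have b1 : |Y₁| ≤ 4 + 100 * Real.log T := abs_log_scale_le hT hy₁ hα₁
  have b2 : |Y₂| ≤ 4 + 100 * Real.log T := abs_log_scale_le hT hy₂ hα₂
  set v : Equiv.Perm (Fin 3) → TrigTerm → ℝ × ℝ → ℂ := fun σ x t =>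
    amplitude h σ T t * x.kernel Y₁ Y₂ (imagParam t) *
        ((x.1 (ratioA σ (imagParam t)) (ratioB σ (imagParam t)) *
          tanCoef (ratioA σ (imagParam t)) (ratioB σ (imagParam t)) : ℝ) : ℂ) with hv
  have hpt : ∀ t, phiW6Integrand (h T) (α₁ * y₁) (α₂ * y₂) t =
      ∑ σ, (Complex.I ^ 2 * d σ) * ((l σ).map fun x => v σ x t).sum := by
    intro t
    have := H.eq_sum_chambers hT (fun t => kernelW6 (α₁ * y₁) (α₂ * y₂) (imagParam t) * spec (imagParam t) * Complex.I ^ 2)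
      (fun σ t => Complex.I ^ 2 * d σ * ((l σ).map fun x => x.kernel Y₁ Y₂ (imagParam t) *
        ((x.1 (ratioA σ (imagParam t)) (ratioB σ (imagParam t)) *
          tanCoef (ratioA σ (imagParam t)) (ratioB σ (imagParam t)) : ℝ) : ℂ)).sum) ?_ t
    · rw [phiW6Integrand, mul_assoc, mul_assoc, ← mul_assoc (kernelW6 _ _ _), this]
      refine Finset.sum_congr rfl fun σ _ => ?_
      rw [mul_left_comm, list_sum_mul_left]
      congr 3
      funext x
      rw [hv]
      ring
    · intro σ t ht
      have hk := (kernelW6_eq (imagParam_mem_iaStar t) (fun x hx => (hl σ x hx).2)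
        (by rw [trigNum_signs p1 p2]; exact hl' σ _ ht) (mul_ne_zero (hα hα₁) p1.ne')
        (mul_ne_zero (hα hα₂) p2.ne')).2
      have hlist : ((l σ).map fun x => x.kernel Y₁ Y₂ (imagParam t) *
          ((x.1 (ratioA σ (imagParam t)) (ratioB σ (imagParam t)) *
          tanCoef (ratioA σ (imagParam t)) (ratioB σ (imagParam t)) : ℝ) : ℂ)).sum =
          (tanCoef (ratioA σ (imagParam t)) (ratioB σ (imagParam t)) : ℝ) *
            kernelW6 (α₁ * y₁) (α₂ * y₂) (imagParam t) := by
        rw [hk, list_sum_mul_left]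
        congr 2
        funext x
        push_cast
        ring
      rw [hlist, hd' σ _ ht]
      ring
  have hvi : ∀ σ, ∀ x ∈ l σ, Integrable (v σ x) ∧ ‖∫ t, v σ x t‖ ≤ C σ x * T ^ (3 + δ) :=
    fun σ x hx => hCb σ x (hl σ x hx) T hT Y₁ Y₂ b1 b2
  have hvs : ∀ σ, Integrable (fun t => (Complex.I ^ 2 * d σ) * ((l σ).map fun x => v σ x t).sum) := fun σ =>
    (integral_list_sum (l σ) fun x hx => (hvi σ x hx).1).1.const_mul _
  have hfun : phiW6Integrand (h T) (α₁ * y₁) (α₂ * y₂) =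
      fun t => ∑ σ, (Complex.I ^ 2 * d σ) * ((l σ).map fun x => v σ x t).sum := funext hpt
  rw [phiW6, hfun]
  refine ⟨integrable_finsetSum _ fun σ _ => hvs σ, ?_⟩
  rw [integral_finsetSum _ fun σ _ => hvs σ, Finset.sum_mul]
  refine (norm_sum_le _ _).trans (Finset.sum_le_sum fun σ _ => ?_)
  rw [integral_const_mul, (integral_list_sum (l σ) fun x hx => (hvi σ x hx).1).2, norm_mul, norm_mul, hd,
    norm_pow, Complex.norm_I, one_pow, one_mul, one_mul]
  have key : ∀ L : List TrigTerm, (∀ x ∈ L, ‖∫ t, v σ x t‖ ≤ C σ x * T ^ (3 + δ)) →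
      ‖(L.map fun x => ∫ t, v σ x t).sum‖ ≤ (L.map (C σ)).sum * T ^ (3 + δ) := by
    intro L
    induction L with
    | nil => simp
    | cons x L ih =>
      intro hL
      simp only [List.map_cons, List.sum_cons, add_mul]
      exact (norm_add_le _ _).trans (add_le_add (hL x List.mem_cons_self)
        (ih fun y hy => hL y (List.mem_cons_of_mem _ hy)))
  exact key _ fun x hx => (hvi σ x hx).2

end

/-! ### The building blocks of the kernel for `w₄` -/

/-- The line of integration. -/
def lineW4 (t : ℝ) : ℂ := ((1 / 12 : ℝ) : ℂ) + t * Complex.I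

/-- The integrand of a building block. -/
def tripleIntegrand (a : Fin 3 → ℝ) (Y : ℝ) (μ : Fin 3 → ℂ) (t : ℝ) : ℂ :=
  Complex.exp (-(lineW4 t * Y)) * ∏ j, rGamma (a j) (lineW4 t - μ j)

/-- A building block of the kernel for `w₄`. -/
def tripleKernel (a : Fin 3 → ℝ) (Y : ℝ) (μ : Fin 3 → ℂ) : ℂ := ∫ t, tripleIntegrand a Y μ t

@[simp] lemma lineW4_re (t : ℝ) : (lineW4 t).re = 1 / 12 := by simp [lineW4]

@[simp] lemma lineW4_im (t : ℝ) : (lineW4 t).im = t := by simp [lineW4]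

lemma measurable_lineW4 : Measurable lineW4 := by
  unfold lineW4; fun_prop

lemma norm_exp_lineW4 (t Y : ℝ) : ‖Complex.exp (-(lineW4 t * Y))‖ = Real.exp (-(Y / 12)) := by
  rw [Complex.norm_exp, Complex.neg_re, Complex.re_mul_ofReal, lineW4_re]
  congr 1; ring

lemma measurable_tripleIntegrand (a : Fin 3 → ℝ) (Y : ℝ) :
    Measurable fun p : (Fin 3 → ℂ) × ℝ => tripleIntegrand a Y p.1 p.2 := by
  have hl : Measurable fun p : (Fin 3 → ℂ) × ℝ => lineW4 p.2 := by
    unfold lineW4; fun_prop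
  have hr : ∀ j, Measurable fun p : (Fin 3 → ℂ) × ℝ => rGamma (a j) (lineW4 p.2 - p.1 j) := by
    intro j
    have e : Measurable fun p : (Fin 3 → ℂ) × ℝ => lineW4 p.2 - p.1 j := by fun_prop
    have h := (measurable_rGamma (a j)).comp e
    simpa only [Function.comp_def] using h
  unfold tripleIntegrand
  exact (by fun_prop : Measurable fun p : (Fin 3 → ℂ) × ℝ => Complex.exp (-(lineW4 p.2 * Y))).mul
    (Finset.measurable_prod _ fun j _ => hr j)

lemma measurable_tripleIntegrand_right (a : Fin 3 → ℝ) (Y : ℝ) (μ : Fin 3 → ℂ) :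
    Measurable (tripleIntegrand a Y μ) := by
  have e : Measurable fun t : ℝ => (μ, t) := by fun_prop
  have h := (measurable_tripleIntegrand a Y).comp e
  simpa only [Function.comp_def] using h

lemma stronglyMeasurable_tripleKernel (a : Fin 3 → ℝ) (Y : ℝ) :
    StronglyMeasurable fun t : ℝ × ℝ => tripleKernel a Y (imagParam t) := by
  have e : Measurable fun x : (ℝ × ℝ) × ℝ => (imagParam x.1, x.2) :=
    (continuous_imagParam.measurable.comp measurable_fst).prodMk measurable_snd
  have h : StronglyMeasurable (Function.uncurry fun (x : ℝ × ℝ) (y : ℝ) => tripleIntegrand a Y (imagParam x) y) :=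
    ((measurable_tripleIntegrand a Y).comp e).stronglyMeasurable
  exact h.integral_prod_right

lemma norm_rGamma_lineW4_le {a : ℝ} (ha : |a| ≤ Real.pi / 2) {μ : Fin 3 → ℂ} (hμ : μ ∈ iaStar) (j : Fin 3) (t : ℝ) :
    ‖rGamma a (lineW4 t - μ j)‖ ≤ stirlingConst * ((1 + ‖μ‖) * (1 + |t|) ^ (-(5 / 12) : ℝ)) := by
  have hC := one_le_stirlingConst
  have hre : (lineW4 t - μ j).re = 1 / 12 := by rw [Complex.sub_re, lineW4_re, hμ.1, sub_zero]
  have him : (lineW4 t - μ j).im = t - (μ j).im := by rw [Complex.sub_im, lineW4_im]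
  refine (norm_rGamma_le (by rw [hre]; norm_num) (by rw [hre]; norm_num) (Or.inl hre.ge)).trans ?_
  refine mul_le_mul_of_nonneg_left ?_ (by linarith)
  rw [hre, him]
  set m := (μ j).im
  have hm : |m| ≤ ‖μ‖ := abs_im_le_norm μ j
  have h1 : Real.exp (-((Real.pi / 2 - |a|) * |t - m|)) ≤ 1 := by
    rw [Real.exp_le_one_iff, neg_nonpos]
    exact mul_nonneg (sub_nonneg.2 ha) (abs_nonneg _)
  have h2 : (1 + |t|) / (1 + ‖μ‖) ≤ 1 + |t - m| := by
    rw [div_le_iff₀ (by positivity)]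
    have : |t| ≤ |t - m| + |m| := by
      have := abs_add_le (t - m) m
      rwa [sub_add_cancel] at this
    nlinarith [norm_nonneg μ, abs_nonneg (t - m)]
  calc (1 + |t - m|) ^ ((1 / 12 : ℝ) - 1 / 2) * Real.exp (-((Real.pi / 2 - |a|) * |t - m|))
      ≤ (1 + |t - m|) ^ ((1 / 12 : ℝ) - 1 / 2) := mul_le_of_le_one_right (by positivity) h1
    _ ≤ ((1 + |t|) / (1 + ‖μ‖)) ^ ((1 / 12 : ℝ) - 1 / 2) :=
        Real.rpow_le_rpow_of_nonpos (by positivity) h2 (by norm_num)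
    _ = (1 + ‖μ‖) ^ (5 / 12 : ℝ) * (1 + |t|) ^ (-(5 / 12) : ℝ) := by
        rw [Real.div_rpow (by positivity) (by positivity), show (1 / 12 : ℝ) - 1 / 2 = -(5 / 12) by norm_num,
          Real.rpow_neg (by positivity : 0 ≤ 1 + ‖μ‖), div_inv_eq_mul, mul_comm]
    _ ≤ (1 + ‖μ‖) * (1 + |t|) ^ (-(5 / 12) : ℝ) := by
        refine mul_le_mul_of_nonneg_right ?_ (by positivity)
        calc (1 + ‖μ‖) ^ (5 / 12 : ℝ) ≤ (1 + ‖μ‖) ^ (1 : ℝ) :=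
              Real.rpow_le_rpow_of_exponent_le (by linarith [norm_nonneg μ]) (by norm_num)
          _ = _ := Real.rpow_one _

lemma norm_tripleIntegrand_le {a : Fin 3 → ℝ} (ha : ∀ j, |a j| ≤ Real.pi / 2) (Y : ℝ) {μ : Fin 3 → ℂ}
    (hμ : μ ∈ iaStar) (t : ℝ) : ‖tripleIntegrand a Y μ t‖ ≤
      Real.exp (-(Y / 12)) * (stirlingConst ^ 3 * (1 + ‖μ‖) ^ 3) * (1 + |t|) ^ (-(5 / 4) : ℝ) := by
  rw [tripleIntegrand, norm_mul, norm_exp_lineW4, norm_prod]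
  have h3 : ((1 + |t|) ^ (-(5 / 12) : ℝ)) ^ 3 = (1 + |t|) ^ (-(5 / 4) : ℝ) := by
    rw [← Real.rpow_natCast, ← Real.rpow_mul (by positivity)]; norm_num
  calc _ ≤ Real.exp (-(Y / 12)) * ∏ _j : Fin 3, (stirlingConst * ((1 + ‖μ‖) * (1 + |t|) ^ (-(5 / 12) : ℝ))) := by
        gcongr with j
        exact norm_rGamma_lineW4_le (ha j) hμ j t
    _ = _ := by
        rw [Finset.prod_const, Finset.card_univ, Fintype.card_fin, mul_pow, mul_pow, h3]; ring

lemma integrable_tripleMajorant : Integrable fun t : ℝ => (1 + |t|) ^ (-(5 / 4) : ℝ) :=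
  integrable_one_add_abs_rpow (by norm_num)

lemma integrable_tripleIntegrand {a : Fin 3 → ℝ} (ha : ∀ j, |a j| ≤ Real.pi / 2) (Y : ℝ) {μ : Fin 3 → ℂ}
    (hμ : μ ∈ iaStar) : Integrable (tripleIntegrand a Y μ) :=
  (integrable_tripleMajorant.const_mul _).mono' (measurable_tripleIntegrand_right a Y μ).aestronglyMeasurable
    (Eventually.of_forall fun t => norm_tripleIntegrand_le ha Y hμ t)

/-- The constant in the trivial bound for `tripleKernel`. -/
def tripleConst : ℝ := stirlingConst ^ 3 * ∫ t : ℝ, (1 + |t|) ^ (-(5 / 4) : ℝ)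

lemma tripleConst_nonneg : 0 ≤ tripleConst := by
  have := one_le_stirlingConst
  exact mul_nonneg (by positivity) (integral_nonneg fun t => by positivity)

lemma norm_tripleKernel_le {a : Fin 3 → ℝ} (ha : ∀ j, |a j| ≤ Real.pi / 2) (Y : ℝ) {μ : Fin 3 → ℂ}
    (hμ : μ ∈ iaStar) : ‖tripleKernel a Y μ‖ ≤ tripleConst * Real.exp (-(Y / 12)) * (1 + ‖μ‖) ^ 3 := by
  refine (norm_integral_le_of_norm_le (integrable_tripleMajorant.const_mul _)
    (Eventually.of_forall fun t => norm_tripleIntegrand_le ha Y hμ t)).trans_eq ?_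
  rw [integral_const_mul, tripleConst]; ring

lemma tendsto_tripleKernel {ι : Type*} {l : Filter ι} [l.IsCountablyGenerated] {a : ι → Fin 3 → ℝ}
    {a₀ : Fin 3 → ℝ} (ha : ∀ j, Tendsto (fun i => a i j) l (𝓝 (a₀ j)))
    (ha' : ∀ i j, |a i j| ≤ Real.pi / 2) (Y : ℝ) {μ : Fin 3 → ℂ} (hμ : μ ∈ iaStar) :
    Tendsto (fun i => tripleKernel (a i) Y μ) l (𝓝 (tripleKernel a₀ Y μ)) := by
  refine tendsto_integral_filter_of_dominated_convergence _
    (Eventually.of_forall fun i => (measurable_tripleIntegrand_right (a i) Y μ).aestronglyMeasurable)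
    (Eventually.of_forall fun i => Eventually.of_forall fun t => norm_tripleIntegrand_le (ha' i) Y hμ t)
    (integrable_tripleMajorant.const_mul _) (Eventually.of_forall fun t => ?_)
  exact (tendsto_finsetProd _ fun j _ =>
    (continuous_rGamma_left (lineW4 t - μ j)).continuousAt.tendsto.comp (ha j)).const_mul _

lemma integrable_mul_tripleKernel {a : Fin 3 → ℝ} (ha : ∀ j, |a j| ≤ Real.pi / 2) (Y : ℝ)
    {f : ℝ × ℝ → ℂ} (hf : Integrable f) {K : ℝ} (hK : ∀ t, f t ≠ 0 → ‖imagParam t‖ ≤ K) :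
    Integrable (fun t => f t * tripleKernel a Y (imagParam t)) ∧
    ∀ t, ‖f t * tripleKernel a Y (imagParam t)‖ ≤
      tripleConst * Real.exp (-(Y / 12)) * (1 + K) ^ 3 * ‖f t‖ := by
  have hT := tripleConst_nonneg
  have hb : ∀ t, ‖f t * tripleKernel a Y (imagParam t)‖ ≤
      tripleConst * Real.exp (-(Y / 12)) * (1 + K) ^ 3 * ‖f t‖ := by
    intro t
    by_cases h0 : f t = 0
    · simp [h0]
    · rw [norm_mul, mul_comm]
      have h1 := norm_tripleKernel_le ha Y (imagParam_mem_iaStar t)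
      have h2 := hK t h0
      refine mul_le_mul_of_nonneg_right (h1.trans ?_) (norm_nonneg _)
      gcongr
  exact ⟨(hf.norm.const_mul _).mono' (hf.aestronglyMeasurable.mul
    (stronglyMeasurable_tripleKernel a Y).aestronglyMeasurable) (Eventually.of_forall hb), hb⟩

lemma tendsto_integral_mul_tripleKernel {ι : Type*} {l : Filter ι} [l.IsCountablyGenerated]
    {a : ι → Fin 3 → ℝ} {a₀ : Fin 3 → ℝ} (ha : ∀ j, Tendsto (fun i => a i j) l (𝓝 (a₀ j)))
    (ha' : ∀ i j, |a i j| ≤ Real.pi / 2) (Y : ℝ)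
    {f : ℝ × ℝ → ℂ} (hf : Integrable f) {K : ℝ} (hK : ∀ t, f t ≠ 0 → ‖imagParam t‖ ≤ K) :
    Tendsto (fun i => ∫ t, f t * tripleKernel (a i) Y (imagParam t)) l
      (𝓝 (∫ t, f t * tripleKernel a₀ Y (imagParam t))) := by
  refine tendsto_integral_filter_of_dominated_convergence _
    (Eventually.of_forall fun i => (integrable_mul_tripleKernel (ha' i) Y hf hK).1.aestronglyMeasurable)
    (Eventually.of_forall fun i => Eventually.of_forall fun t =>
      (integrable_mul_tripleKernel (ha' i) Y hf hK).2 t)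
    (hf.norm.const_mul _) (Eventually.of_forall fun t => ?_)
  exact (tendsto_tripleKernel ha ha' Y (imagParam_mem_iaStar t)).const_mul _

/-- The frequencies in the convolution formula. -/
def tripleVec (Y : ℝ) (p : ℝ × ℝ) : Fin 3 → ℝ := ![-p.1, -(p.1 - p.2), -(Y - 2 * p.1 + p.2)]

/-- The weight in the convolution formula. -/
def tripleRot (a : Fin 3 → ℝ) (Y : ℝ) (p : ℝ × ℝ) : ℂ :=
  rotExp (a 0) p.1 * (rotExp (a 1) (p.1 - p.2) * rotExp (a 2) (Y - 2 * p.1 + p.2))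

lemma continuous_tripleRot (a : Fin 3 → ℝ) (Y : ℝ) : Continuous (tripleRot a Y) := by
  have h0 := continuous_rotExp_right (a 0)
  have h1 := continuous_rotExp_right (a 1)
  have h2 := continuous_rotExp_right (a 2)
  unfold tripleRot
  fun_prop

lemma norm_tripleRot_le_one {a : Fin 3 → ℝ} (ha : ∀ j, |a j| ≤ Real.pi / 2) (Y : ℝ) (p : ℝ × ℝ) :
    ‖tripleRot a Y p‖ ≤ 1 := by
  rw [tripleRot, norm_mul, norm_mul]
  exact mul_le_one₀ (norm_rotExp_le_one (ha 0) _) (by positivity)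
    (mul_le_one₀ (norm_rotExp_le_one (ha 1) _) (norm_nonneg _) (norm_rotExp_le_one (ha 2) _))

lemma integrable_tripleRot {a : Fin 3 → ℝ} (ha : ∀ j, |a j| < Real.pi / 2) (Y : ℝ) :
    Integrable (tripleRot a Y) := by
  obtain ⟨C₀, hC₀, h0⟩ := exists_exp_mul_exp_neg_le (σ := 1) (cos_pos_of_abs_lt (ha 0))
  obtain ⟨C₁, hC₁, h1⟩ := exists_exp_mul_exp_neg_le (σ := 1) (cos_pos_of_abs_lt (ha 1))
  obtain ⟨C₂, hC₂, h2⟩ := exists_exp_mul_exp_neg_le (σ := 1) (cos_pos_of_abs_lt (ha 2))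
  have hi := (integrable_exp_neg_mul_abs (s := 1 / 2) (by norm_num))
  refine ((hi.mul_prod hi).const_mul (C₀ * C₁ * C₂ * Real.exp (-Y))).mono'
    (continuous_tripleRot a Y).aestronglyMeasurable (Eventually.of_forall fun p => ?_)
  obtain ⟨v, x⟩ := p
  simp only [tripleRot, norm_mul, norm_rotExp]
  have g0 := h0 _ v le_rfl
  have g1 := h1 _ (v - x) le_rfl
  have g2 := (h2 _ (Y - 2 * v + x) le_rfl).trans (mul_le_of_le_one_right hC₂ (by
    rw [Real.exp_le_one_iff, neg_nonpos]; positivity))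
  have e : Real.exp (1 * v) * Real.exp (1 * (v - x)) * Real.exp (1 * (Y - 2 * v + x)) * Real.exp (-Y) = 1 := by
    rw [← Real.exp_add, ← Real.exp_add, ← Real.exp_add, Real.exp_eq_one_iff]; ring
  have e2 : Real.exp (-(1 * |v|)) * Real.exp (-(1 * |v - x|)) ≤
      Real.exp (-(1 / 2 * |v|)) * Real.exp (-(1 / 2 * |x|)) := by
    rw [← Real.exp_add, ← Real.exp_add]
    apply Real.exp_le_exp.2
    have h := abs_sub_abs_le_abs_sub x v
    rw [abs_sub_comm] at h
    linarith [abs_nonneg (v - x)]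
  calc _ = (Real.exp (1 * v) * Real.exp (-(Real.cos (a 0) * Real.exp v))) *
      ((Real.exp (1 * (v - x)) * Real.exp (-(Real.cos (a 1) * Real.exp (v - x)))) *
      (Real.exp (1 * (Y - 2 * v + x)) * Real.exp (-(Real.cos (a 2) * Real.exp (Y - 2 * v + x))))) *
      Real.exp (-Y) := by
        linear_combination (-(Real.exp (-(Real.cos (a 0) * Real.exp v)) *
          Real.exp (-(Real.cos (a 1) * Real.exp (v - x))) *
          Real.exp (-(Real.cos (a 2) * Real.exp (Y - 2 * v + x))))) * e
    _ ≤ (C₀ * Real.exp (-(1 * |v|))) * ((C₁ * Real.exp (-(1 * |v - x|))) * C₂) * Real.exp (-Y) := by gcongr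
    _ = C₀ * C₁ * C₂ * Real.exp (-Y) * (Real.exp (-(1 * |v|)) * Real.exp (-(1 * |v - x|))) := by ring
    _ ≤ _ := by gcongr

/-- The regularized building block as a convolution. -/
theorem tripleKernel_eq_integral {a : Fin 3 → ℝ} (ha : ∀ j, |a j| < Real.pi / 2) (Y : ℝ) {μ : Fin 3 → ℂ}
    (hμ : μ ∈ iaStar) : tripleKernel a Y μ =
      2 * Real.pi * ∫ p, tripleRot a Y p * Complex.exp (∑ j, μ j * tripleVec Y p j) := by
  have hre : ∀ (t : ℝ) (j : Fin 3), (lineW4 t - μ j).re = 1 / 12 := fun t j => by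
    rw [Complex.sub_re, lineW4_re, hμ.1, sub_zero]
  set g : ℝ → ℂ := fun t => rGamma (a 1) (lineW4 t + -μ 1) * rGamma (a 2) (lineW4 t + -μ 2) with hg
  have hgi : Integrable g := by
    have i1 := integrable_rGamma_line (σ := 1 / 12) (ha 1) le_rfl (by norm_num) (β := -μ 1) (by simp [hμ.1])
    have hC := one_le_stirlingConst
    refine (i1.norm.mul_const stirlingConst).mono' (Measurable.aestronglyMeasurable ?_)
      (Eventually.of_forall fun t => ?_)
    · have := (measurable_rGamma (a 1)).comp (measurable_lineW4.add_const (-μ 1))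
      have := (measurable_rGamma (a 2)).comp (measurable_lineW4.add_const (-μ 2))
      simp only [Function.comp_def] at *
      fun_prop
    · rw [norm_mul]
      refine mul_le_mul_of_nonneg_left ((norm_rGamma_line_le (by rw [← sub_eq_add_neg, hre])
        (by rw [← sub_eq_add_neg, hre]; norm_num)).trans (mul_le_of_le_one_right (by linarith) ?_)) (norm_nonneg _)
      rw [Real.exp_le_one_iff, neg_nonpos]
      exact mul_nonneg (sub_nonneg.2 (ha 2).le) (abs_nonneg _)
  set F : ℝ → ℝ → ℂ := fun t v => Complex.exp (-(lineW4 t * Y)) *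
    (Complex.exp ((lineW4 t - μ 0) * v) * rotExp (a 0) v) * g t with hF
  have hstep : ∀ t, tripleIntegrand a Y μ t = ∫ v, F t v := by
    intro t
    simp only [hF]
    rw [integral_mul_const, integral_const_mul, integral_exp_mul_rotExp (ha 0) (by rw [hre]; norm_num),
      tripleIntegrand, Fin.prod_univ_three, hg]
    simp only [sub_eq_add_neg]
    ring
  have hFi : Integrable (Function.uncurry F) (volume.prod volume) := by
    have hi := (hgi.norm.mul_prod ((integrable_exp_mul_rotExp (ha 0) (z := ((1 / 12 : ℝ) : ℂ))
      (by rw [Complex.ofReal_re]; norm_num)).norm.const_mul (Real.exp (-(Y / 12)))))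
    refine hi.mono' ?_ (Eventually.of_forall fun p => ?_)
    · refine AEStronglyMeasurable.mul ?_ hgi.aestronglyMeasurable.comp_fst
      have h1 := continuous_rotExp_right (a 0)
      unfold lineW4
      exact Continuous.aestronglyMeasurable (by fun_prop)
    · simp only [Function.uncurry, hF]
      rw [norm_mul, norm_mul, norm_exp_lineW4, norm_exp_mul_rotExp, norm_exp_mul_rotExp, hre, Complex.ofReal_re]
      exact le_of_eq (by ring)
  rw [tripleKernel]
  simp_rw [hstep]
  rw [integral_integral_swap hFi]
  have hv : ∀ v : ℝ, ∫ t, F t v = 2 * Real.pi * ∫ x : ℝ, tripleRot a Y (v, x) *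
      Complex.exp (∑ j, μ j * tripleVec Y (v, x) j) := by
    intro v
    have hb := integral_rGamma_mul_rGamma (σ := 1 / 12) (ha 1) (ha 2) le_rfl (by norm_num)
      (α := -μ 1) (β := -μ 2) (by simp [hμ.1]) (by simp [hμ.1]) (Y - v)
    have e1 : ∫ t, F t v = rotExp (a 0) v * Complex.exp (-(μ 0 * v)) *
        ∫ t : ℝ, Complex.exp (-((((1 / 12 : ℝ) : ℂ) + t * Complex.I) * ((Y - v : ℝ) : ℂ))) *
          rGamma (a 1) (((1 / 12 : ℝ) : ℂ) + t * Complex.I + -μ 1) *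
          rGamma (a 2) (((1 / 12 : ℝ) : ℂ) + t * Complex.I + -μ 2) := by
      rw [← integral_const_mul]
      congr 1; ext t
      simp only [hF, hg]
      have ee : Complex.exp (-(lineW4 t * Y)) * Complex.exp ((lineW4 t - μ 0) * v) =
          Complex.exp (-(μ 0 * v)) * Complex.exp (-(lineW4 t * ((Y - v : ℝ) : ℂ))) := by
        rw [← Complex.exp_add, ← Complex.exp_add]; congr 1; push_cast; ring
      rw [← lineW4]
      linear_combination (rotExp (a 0) v * rGamma (a 1) (lineW4 t + -μ 1) * rGamma (a 2) (lineW4 t + -μ 2)) * ee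
    rw [e1, hb, besselB, ← integral_sub_left_eq_self _ volume v, mul_left_comm, ← integral_const_mul]
    congr 2; ext x
    have ee : Complex.exp (∑ j, μ j * tripleVec Y (v, x) j) = Complex.exp (-(μ 0 * v)) *
        Complex.exp (-μ 1 * ((v - x : ℝ) : ℂ) + -μ 2 * (((Y - v : ℝ) : ℂ) - ((v - x : ℝ) : ℂ))) := by
      rw [← Complex.exp_add, Fin.sum_univ_three]
      congr 1
      simp only [tripleVec, Matrix.cons_val]
      push_cast
      ring
    rw [ee, tripleRot, show Y - v - (v - x) = Y - 2 * v + x by ring]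
    ring
  simp_rw [hv]
  rw [integral_const_mul]
  congr 1
  refine (integral_prod (fun p : ℝ × ℝ => tripleRot a Y p * Complex.exp (∑ j, μ j * tripleVec Y p j)) ?_).symm
  refine (integrable_tripleRot ha Y).norm.mono' ?_ (Eventually.of_forall fun p => ?_)
  · refine (continuous_tripleRot a Y).aestronglyMeasurable.mul (Continuous.aestronglyMeasurable ?_)
    simp only [Fin.sum_univ_three, tripleVec, Matrix.cons_val]
    fun_prop
  · rw [norm_mul, Complex.norm_exp, Complex.re_sum]
    simp [hμ.1]

/-! ### The bound for the building blocks of the kernel for `w₄` -/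

/-- The majorant of the Fourier transform in the convolution formula. -/
def tripleMajorant (R Y : ℝ) (p : ℝ × ℝ) : ℝ :=
  ((1 + R / 2 * |0 + 2 * p.2|) ^ 4)⁻¹ * ((1 + R * |-(2 * Y + 3 * p.2) / 3 + 2 * p.1|) ^ 4)⁻¹

lemma integral_tripleMajorant {R : ℝ} (hR : 0 < R) (Y : ℝ) : Integrable (tripleMajorant R Y) ∧
    ∫ p, tripleMajorant R Y p = bumpConst ^ 2 / (2 * R ^ 2) := by
  obtain ⟨i1, e1⟩ := integral_bump (half_pos hR) 0
  have h2 := fun x : ℝ => integral_bump hR (-(2 * Y + 3 * x) / 3)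
  have hm : Measurable (tripleMajorant R Y) := by
    unfold tripleMajorant; fun_prop
  have hin : ∀ x : ℝ, ∫ v, tripleMajorant R Y (v, x) =
      ((1 + R / 2 * |0 + 2 * x|) ^ 4)⁻¹ * (bumpConst / (2 * R)) := by
    intro x
    simp only [tripleMajorant]
    rw [integral_const_mul, (h2 x).2]
  have hpos : ∀ p, 0 ≤ tripleMajorant R Y p := fun p => by unfold tripleMajorant; positivity
  have hi : Integrable (tripleMajorant R Y) (volume.prod volume) := by
    rw [integrable_prod_iff' hm.aestronglyMeasurable]
    refine ⟨Eventually.of_forall fun x => (h2 x).1.const_mul (((1 + R / 2 * |0 + 2 * x|) ^ 4)⁻¹), ?_⟩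
    simp only [Real.norm_of_nonneg (hpos _), hin]
    exact i1.mul_const _
  refine ⟨hi, ?_⟩
  rw [Measure.volume_eq_prod, integral_prod_symm _ hi]
  simp only [hin]
  rw [integral_mul_const, e1]
  field_simp

lemma FourierDecay.le_tripleMajorant {f : ℝ × ℝ → ℂ} {R M : ℝ} (hF : FourierDecay f R M) (hR : 0 < R) (Y : ℝ)
    (p : ℝ × ℝ) : ‖planeFourier f (tripleVec Y p)‖ ≤ M * tripleMajorant R Y p := by
  have hM := hF.nonneg
  refine (hF.le_mul hR.le (c := tripleVec Y p) (i := 0) (k := 1) (m := 2) (by decide) (by decide) (by decide)).trans ?_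
  rw [mul_assoc]
  refine mul_le_mul_of_nonneg_left ?_ hM
  have e0 : |tripleVec Y p 0 - tripleVec Y p 1| = |p.2| := by
    simp only [tripleVec, Matrix.cons_val]
    rw [show -p.1 - -(p.1 - p.2) = -p.2 by ring, abs_neg]
  have e1 : |tripleVec Y p 0 + tripleVec Y p 1 - 2 * tripleVec Y p 2| / 2 =
      3 / 2 * |-(2 * Y + 3 * p.2) / 3 + 2 * p.1| := by
    simp only [tripleVec, Matrix.cons_val]
    rw [show -p.1 + -(p.1 - p.2) - 2 * -(Y - 2 * p.1 + p.2) = -3 * (-(2 * Y + 3 * p.2) / 3 + 2 * p.1) by ring,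
      abs_mul, abs_neg, abs_of_pos (by norm_num : (0 : ℝ) < 3)]
    ring
  rw [tripleMajorant, e0, mul_div_assoc, e1, zero_add, abs_mul, abs_of_pos (by norm_num : (0 : ℝ) < 2),
    show R / 2 * (2 * |p.2|) = R * |p.2| by ring]
  gcongr
  linarith [abs_nonneg (-(2 * Y + 3 * p.2) / 3 + 2 * p.1)]

lemma norm_integral_mul_tripleKernel_le_of_lt {a : Fin 3 → ℝ} (ha : ∀ j, |a j| < Real.pi / 2) (Y : ℝ)
    {f : ℝ × ℝ → ℂ} {R M : ℝ} (hf : Integrable f) (hR : 0 < R) (hF : FourierDecay f R M) :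
    ‖∫ t, f t * tripleKernel a Y (imagParam t)‖ ≤ Real.pi * bumpConst ^ 2 * (M / R ^ 2) := by
  have hM := hF.nonneg
  have hre := fun t => (imagParam_mem_iaStar t).1
  set H : ℝ × ℝ → ℝ × ℝ → ℂ := fun t p => f t * (tripleRot a Y p *
    Complex.exp (∑ j, imagParam t j * tripleVec Y p j)) with hH
  have hHi : Integrable (Function.uncurry H) ((volume : Measure (ℝ × ℝ)).prod (volume : Measure (ℝ × ℝ))) := by
    refine (hf.norm.mul_prod (integrable_tripleRot ha Y).norm).mono' ?_ (Eventually.of_forall fun z => ?_)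
    · refine hf.aestronglyMeasurable.comp_fst.mul (Continuous.aestronglyMeasurable ?_)
      have h1 := continuous_tripleRot a Y
      have h2 : ∀ j, Continuous fun t => imagParam t j := fun j => (continuous_apply j).comp continuous_imagParam
      simp only [Fin.sum_univ_three, tripleVec, Matrix.cons_val]
      fun_prop
    · simp only [Function.uncurry, hH]
      rw [norm_mul, norm_mul, Complex.norm_exp, Complex.re_sum]
      simp [hre]
  have e1 : ∫ t, f t * tripleKernel a Y (imagParam t) = 2 * Real.pi * ∫ p, tripleRot a Y p *
      planeFourier f (tripleVec Y p) := by
    have : ∀ t, f t * tripleKernel a Y (imagParam t) = 2 * Real.pi * ∫ p, H t p := fun t => by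
      rw [tripleKernel_eq_integral ha Y (imagParam_mem_iaStar t)]
      simp only [hH]
      rw [integral_const_mul]
      ring
    simp_rw [this]
    rw [integral_const_mul, integral_integral_swap hHi]
    congr 2; ext p
    rw [planeFourier, ← integral_const_mul]
    congr 1; ext t
    simp only [hH]
    ring
  obtain ⟨i2, e2⟩ := integral_tripleMajorant hR Y
  have hb : ∀ p, ‖tripleRot a Y p * planeFourier f (tripleVec Y p)‖ ≤ M * tripleMajorant R Y p := fun p => by
    rw [norm_mul]
    calc _ ≤ 1 * ‖planeFourier f (tripleVec Y p)‖ := by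
          gcongr; exact norm_tripleRot_le_one (fun j => (ha j).le) Y p
      _ ≤ _ := by rw [one_mul]; exact hF.le_tripleMajorant hR Y p
  have h3 := norm_integral_le_of_norm_le (i2.const_mul M) (Eventually.of_forall hb)
  rw [integral_const_mul, e2] at h3
  rw [e1, norm_mul]
  have hn : ‖(2 * Real.pi : ℂ)‖ = 2 * Real.pi := by
    rw [norm_mul, Complex.norm_real, Real.norm_of_nonneg Real.pi_pos.le]; norm_num
  rw [hn]
  have hp := Real.pi_pos
  calc _ ≤ 2 * Real.pi * (M * (bumpConst ^ 2 / (2 * R ^ 2))) := by gcongr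
    _ = _ := by field_simp

theorem norm_integral_mul_tripleKernel_le {a : Fin 3 → ℝ} (ha : ∀ j, |a j| ≤ Real.pi / 2) (Y : ℝ)
    {f : ℝ × ℝ → ℂ} {R M K : ℝ} (hf : Integrable f) (hR : 0 < R) (hK : ∀ t, f t ≠ 0 → ‖imagParam t‖ ≤ K)
    (hF : FourierDecay f R M) :
    ‖∫ t, f t * tripleKernel a Y (imagParam t)‖ ≤ Real.pi * bumpConst ^ 2 * (M / R ^ 2) := by
  set b : ℕ → Fin 3 → ℝ := fun n j => (1 - 1 / ((n : ℝ) + 1)) * a j with hb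
  have hc : ∀ n : ℕ, 0 ≤ 1 - 1 / ((n : ℝ) + 1) ∧ 1 - 1 / ((n : ℝ) + 1) < 1 := by
    intro n
    have : 1 / ((n : ℝ) + 1) ≤ 1 := by
      rw [div_le_one (by positivity)]; linarith [(Nat.cast_nonneg n : (0 : ℝ) ≤ n)]
    have h2 : 0 < 1 / ((n : ℝ) + 1) := by positivity
    constructor <;> linarith
  have hblt : ∀ n j, |b n j| < Real.pi / 2 := by
    intro n j
    rw [hb, abs_mul, abs_of_nonneg (hc n).1]
    calc _ ≤ (1 - 1 / ((n : ℝ) + 1)) * (Real.pi / 2) := mul_le_mul_of_nonneg_left (ha j) (hc n).1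
      _ < 1 * (Real.pi / 2) := mul_lt_mul_of_pos_right (hc n).2 (by positivity)
      _ = _ := one_mul _
  have hlim : ∀ j, Tendsto (fun n => b n j) atTop (𝓝 (a j)) := by
    intro j
    have := (tendsto_one_div_add_atTop_nhds_zero_nat (𝕜 := ℝ)).const_sub 1
    simpa [hb] using this.mul_const (a j)
  exact le_of_tendsto (tendsto_integral_mul_tripleKernel hlim (fun n j => (hblt n j).le) Y hf hK).norm
    (Eventually.of_forall fun n => norm_integral_mul_tripleKernel_le_of_lt (hblt n) Y hf hR hF)

section

/-! ### Decomposition of the kernel for `w₄` -/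

lemma ne_neg_nat_of_re_pos {z : ℂ} (hz : 0 < z.re) (n : ℕ) : z ≠ -n := by
  intro h
  rw [h] at hz
  simp only [Complex.neg_re, Complex.natCast_re] at hz
  linarith [(Nat.cast_nonneg n : (0 : ℝ) ≤ n)]

/-- The factor in the reflection formulas. -/
def reflFactor (z : ℂ) : ℂ := (Real.pi : ℂ) ^ (z - 1 / 2) * Complex.Gammaℂ z

lemma Gamma_half_div_even {z : ℂ} (hz : 0 < z.re) :
    Complex.Gamma (1 / 2 * z) / Complex.Gamma (1 / 2 * (1 - z)) = reflFactor z * cosHalf z := by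
  have hpi : (Real.pi : ℂ) ≠ 0 := Complex.ofReal_ne_zero.2 Real.pi_ne_zero
  have h := Complex.Gammaℝ_div_Gammaℝ_one_sub (s := z) fun n => by
    have := ne_neg_nat_of_re_pos hz (2 * n + 1)
    push_cast at this
    exact this
  rw [Complex.Gammaℝ_def, Complex.Gammaℝ_def, mul_div_mul_comm, ← Complex.cpow_sub _ _ hpi,
    show -z / 2 - -(1 - z) / 2 = -(z - 1 / 2) by ring, Complex.cpow_neg] at h
  have hne : (Real.pi : ℂ) ^ (z - 1 / 2) ≠ 0 := by
    rw [Complex.cpow_def_of_ne_zero hpi]; exact Complex.exp_ne_zero _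
  rw [inv_mul_eq_iff_eq_mul₀ hne] at h
  rw [show 1 / 2 * z = z / 2 by ring, show 1 / 2 * (1 - z) = (1 - z) / 2 by ring, h, reflFactor, cosHalf,
    show (Real.pi : ℂ) / 2 * z = Real.pi * z / 2 by ring, mul_assoc]

lemma Gamma_half_div_odd {z : ℂ} (hz : 0 < z.re) :
    Complex.Gamma (1 / 2 * (1 + z)) / Complex.Gamma (1 / 2 * (2 - z)) = reflFactor z * sinHalf z := by
  have hpi : (Real.pi : ℂ) ≠ 0 := Complex.ofReal_ne_zero.2 Real.pi_ne_zero
  have h := Complex.inv_Gammaℝ_two_sub (s := z) (ne_neg_nat_of_re_pos hz)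
  have h1 : Complex.Gammaℝ (z + 1) ≠ 0 := Complex.Gammaℝ_ne_zero_of_re_pos (by
    rw [Complex.add_re, Complex.one_re]; linarith)
  have h2 : Complex.Gammaℝ (z + 1) / Complex.Gammaℝ (2 - z) = Complex.Gammaℂ z * Complex.sin (Real.pi * z / 2) := by
    rw [div_eq_mul_inv, h, mul_comm, mul_assoc, inv_mul_cancel₀ h1, mul_one]
  rw [Complex.Gammaℝ_def, Complex.Gammaℝ_def, mul_div_mul_comm, ← Complex.cpow_sub _ _ hpi,
    show -(z + 1) / 2 - -(2 - z) / 2 = -(z - 1 / 2) by ring, Complex.cpow_neg] at h2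
  have hne : (Real.pi : ℂ) ^ (z - 1 / 2) ≠ 0 := by
    rw [Complex.cpow_def_of_ne_zero hpi]; exact Complex.exp_ne_zero _
  rw [inv_mul_eq_iff_eq_mul₀ hne] at h2
  rw [show 1 / 2 * (1 + z) = (z + 1) / 2 by ring, show 1 / 2 * (2 - z) = (2 - z) / 2 by ring, h2, reflFactor,
    sinHalf, show (Real.pi : ℂ) / 2 * z = Real.pi * z / 2 by ring, mul_assoc]

/-- The vectors of signs. -/
def signVecs : Finset (Fin 3 → ℤ) := Fintype.piFinset fun _ => {1, -1}

lemma abs_signVecs {e : Fin 3 → ℤ} (he : e ∈ signVecs) (j : Fin 3) : |e j * (Real.pi / 2)| ≤ Real.pi / 2 := by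
  have h := Fintype.mem_piFinset.1 he j
  have hp := Real.pi_pos
  rw [Finset.mem_insert, Finset.mem_singleton] at h
  rcases h with h | h <;> rw [h] <;> simp [abs_of_pos, hp]

lemma cosHalf_eq_sum (z : ℂ) : cosHalf z = ∑ e ∈ ({1, -1} : Finset ℤ), 1 / 2 * qexp z ^ e := by
  rw [Finset.sum_pair (by decide), cosHalf_eq, zpow_one, zpow_neg_one]; ring

lemma sinHalf_eq_sum (z : ℂ) : sinHalf z = ∑ e ∈ ({1, -1} : Finset ℤ), e * (2 * Complex.I)⁻¹ * qexp z ^ e := by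
  rw [Finset.sum_pair (by decide), sinHalf_eq, zpow_one, zpow_neg_one]; push_cast; ring

/-- The coefficients of the building blocks. -/
def signCoef (α : ℝ) (e : Fin 3 → ℤ) : ℂ :=
  (∏ _j : Fin 3, (1 / 2 : ℂ)) + (α : ℂ) * Complex.I * ∏ j, ((e j : ℂ) * (2 * Complex.I)⁻¹)

lemma prod_trig_eq_sum (α : ℝ) (z : Fin 3 → ℂ) :
    (∏ j, cosHalf (z j)) + (α : ℂ) * Complex.I * ∏ j, sinHalf (z j) =
      ∑ e ∈ signVecs, signCoef α e * ∏ j, qexp (z j) ^ e j := by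
  simp_rw [cosHalf_eq_sum, sinHalf_eq_sum]
  rw [Finset.prod_univ_sum, Finset.prod_univ_sum, Finset.mul_sum, ← Finset.sum_add_distrib]
  refine Finset.sum_congr rfl fun e _ => ?_
  rw [Finset.prod_mul_distrib, Finset.prod_mul_distrib, signCoef]
  ring

lemma rGamma_sign (e : ℤ) (z : ℂ) : rGamma (e * (Real.pi / 2)) z = Complex.Gamma z * qexp z ^ e := by
  rw [rGamma, qexp_zpow]

/-- The constant factor of `Gtilde`. -/
def gtildeConst : ℂ :=
  8 * (Real.pi : ℂ) ^ (-(3 / 2) : ℂ) / (12288 * (Real.pi : ℂ) ^ (7 / 2 : ℂ))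

lemma prod_reflFactor {s : ℂ} {μ : Fin 3 → ℂ} (hμ : μ ∈ iaStar) :
    (Real.pi : ℂ) ^ (-(3 * s)) * ∏ j, reflFactor (s - μ j) = 8 * (Real.pi : ℂ) ^ (-(3 / 2) : ℂ) *
      Complex.exp (-(s * Real.log (8 * Real.pi ^ 3))) * ∏ j, Complex.Gamma (s - μ j) := by
  have hp := Real.pi_pos
  have hpi : (Real.pi : ℂ) ≠ 0 := Complex.ofReal_ne_zero.2 Real.pi_ne_zero
  have h2 : (2 : ℂ) * Real.pi ≠ 0 := mul_ne_zero two_ne_zero hpi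
  have hlog : Real.log (8 * Real.pi ^ 3) = 3 * Real.log (2 * Real.pi) := by
    rw [show 8 * Real.pi ^ 3 = (2 * Real.pi) ^ 3 by ring, Real.log_pow]; norm_num
  have hl1 : Complex.log (2 * Real.pi) = Real.log (2 * Real.pi) := by
    rw [Complex.ofReal_log (by positivity)]; push_cast; rfl
  have hl2 : Complex.log Real.pi = Real.log Real.pi := (Complex.ofReal_log hp.le).symm
  have hsum := hμ.2
  rw [Fin.sum_univ_three] at hsum
  simp only [reflFactor, Complex.Gammaℂ_def, Fin.prod_univ_three]
  simp only [Complex.cpow_def_of_ne_zero hpi, Complex.cpow_def_of_ne_zero h2, hl1, hl2, hlog]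
  have key : Complex.exp (Real.log Real.pi * -(3 * s)) *
      (Complex.exp (Real.log Real.pi * (s - μ 0 - 1 / 2)) * Complex.exp (Real.log (2 * Real.pi) * -(s - μ 0)) *
      (Complex.exp (Real.log Real.pi * (s - μ 1 - 1 / 2)) * Complex.exp (Real.log (2 * Real.pi) * -(s - μ 1))) *
      (Complex.exp (Real.log Real.pi * (s - μ 2 - 1 / 2)) * Complex.exp (Real.log (2 * Real.pi) * -(s - μ 2)))) =
      Complex.exp (Real.log Real.pi * -(3 / 2)) * Complex.exp (-(s * ((3 * Real.log (2 * Real.pi) : ℝ) : ℂ))) := by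
    simp only [← Complex.exp_add]
    congr 1
    push_cast
    linear_combination (-(Real.log Real.pi : ℂ) + Real.log (2 * Real.pi)) * hsum
  linear_combination 8 * (Complex.Gamma (s - μ 0) * Complex.Gamma (s - μ 1) * Complex.Gamma (s - μ 2)) * key

lemma Gtilde_eq_sum (α : ℝ) {s : ℂ} (hs : 0 < s.re) {μ : Fin 3 → ℂ} (hμ : μ ∈ iaStar) :
    Gtilde α s μ = ∑ e ∈ signVecs, gtildeConst * signCoef α e *
      (Complex.exp (-(s * Real.log (8 * Real.pi ^ 3))) * ∏ j, rGamma (e j * (Real.pi / 2)) (s - μ j)) := by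
  have hre : ∀ j, 0 < (s - μ j).re := fun j => by rw [Complex.sub_re, hμ.1, sub_zero]; exact hs
  have h1 : ∏ j, Complex.Gamma (1 / 2 * (s - μ j)) / Complex.Gamma (1 / 2 * (1 - s + μ j)) =
      (∏ j, reflFactor (s - μ j)) * ∏ j, cosHalf (s - μ j) := by
    rw [← Finset.prod_mul_distrib]
    refine Finset.prod_congr rfl fun j _ => ?_
    rw [← Gamma_half_div_even (hre j), show 1 - (s - μ j) = 1 - s + μ j by ring]
  have h2 : ∏ j, Complex.Gamma (1 / 2 * (1 + s - μ j)) / Complex.Gamma (1 / 2 * (2 - s + μ j)) =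
      (∏ j, reflFactor (s - μ j)) * ∏ j, sinHalf (s - μ j) := by
    rw [← Finset.prod_mul_distrib]
    refine Finset.prod_congr rfl fun j _ => ?_
    rw [← Gamma_half_div_odd (hre j), show 2 - (s - μ j) = 2 - s + μ j by ring,
      show 1 + (s - μ j) = 1 + s - μ j by ring]
  have h3 : ∀ e : Fin 3 → ℤ, ∏ j, rGamma (e j * (Real.pi / 2)) (s - μ j) =
      (∏ j, Complex.Gamma (s - μ j)) * ∏ j, qexp (s - μ j) ^ e j := fun e => by
    rw [← Finset.prod_mul_distrib]
    exact Finset.prod_congr rfl fun j _ => rGamma_sign _ _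
  have h4 := prod_trig_eq_sum α fun j => s - μ j
  have h5 := prod_reflFactor (s := s) hμ
  have h6 : Gtilde α s μ = ((Real.pi : ℂ) ^ (-(3 * s)) * ∏ j, reflFactor (s - μ j)) /
      (12288 * (Real.pi : ℂ) ^ (7 / 2 : ℂ)) * ((∏ j, cosHalf (s - μ j)) + (α : ℂ) * Complex.I * ∏ j, sinHalf (s - μ j)) := by
    rw [Gtilde, h1, h2]; ring
  rw [h6, h4, h5, Finset.mul_sum]
  refine Finset.sum_congr rfl fun e _ => ?_
  rw [h3, gtildeConst]
  ring

lemma kernelW4Integrand_eq {y : ℝ} (hy : y ≠ 0) {μ : Fin 3 → ℂ} (hμ : μ ∈ iaStar) (t : ℝ) :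
    kernelW4Integrand y μ t = ∑ e ∈ signVecs, gtildeConst * signCoef (Real.sign y) e / (2 * Real.pi) *
      tripleIntegrand (fun j => e j * (Real.pi / 2)) (Real.log |y| + Real.log (8 * Real.pi ^ 3)) μ t := by
  have hl : (1 / 12 + t * Complex.I : ℂ) = lineW4 t := by rw [lineW4]; push_cast; rfl
  rw [kernelW4Integrand, hl, ofReal_cpow_neg (abs_pos.2 hy), Gtilde_eq_sum _ (by rw [lineW4_re]; norm_num) hμ,
    Finset.mul_sum, Finset.sum_div]
  refine Finset.sum_congr rfl fun e _ => ?_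
  have ee : Complex.exp (-(lineW4 t * ((Real.log |y| + Real.log (8 * Real.pi ^ 3) : ℝ) : ℂ))) =
      Complex.exp (-(lineW4 t * Real.log |y|)) * Complex.exp (-(lineW4 t * Real.log (8 * Real.pi ^ 3))) := by
    rw [← Complex.exp_add]; congr 1; push_cast; ring
  rw [tripleIntegrand, ee]
  ring

lemma kernelW4_eq {y : ℝ} (hy : y ≠ 0) {μ : Fin 3 → ℂ} (hμ : μ ∈ iaStar) :
    Integrable (kernelW4Integrand y μ) ∧
    kernelW4 y μ = ∑ e ∈ signVecs, gtildeConst * signCoef (Real.sign y) e / (2 * Real.pi) *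
      tripleKernel (fun j => e j * (Real.pi / 2)) (Real.log |y| + Real.log (8 * Real.pi ^ 3)) μ := by
  have hfun : kernelW4Integrand y μ = fun t => ∑ e ∈ signVecs, gtildeConst * signCoef (Real.sign y) e / (2 * Real.pi) *
      tripleIntegrand (fun j => e j * (Real.pi / 2)) (Real.log |y| + Real.log (8 * Real.pi ^ 3)) μ t :=
    funext fun t => kernelW4Integrand_eq hy hμ t
  have hi : ∀ e ∈ signVecs, Integrable fun t => gtildeConst * signCoef (Real.sign y) e / (2 * Real.pi) *
      tripleIntegrand (fun j => e j * (Real.pi / 2)) (Real.log |y| + Real.log (8 * Real.pi ^ 3)) μ t :=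
    fun e he => (integrable_tripleIntegrand (abs_signVecs he) _ hμ).const_mul _
  rw [kernelW4, hfun]
  refine ⟨integrable_finsetSum _ hi, ?_⟩
  rw [integral_finsetSum _ hi]
  exact Finset.sum_congr rfl fun e _ => integral_const_mul _ _

variable {h : ℝ → (Fin 3 → ℂ) → ℂ} {ε B c : ℝ}

/-! ### The bound for the weight function for `w₄` -/

lemma log_eight_pi_cube : |Real.log (8 * Real.pi ^ 3)| ≤ 6 := by
  have hp := Real.pi_gt_three
  have h1 : (1 : ℝ) ≤ 8 * Real.pi ^ 3 := by
    have : (3 : ℝ) ^ 3 ≤ Real.pi ^ 3 := by gcongr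
    linarith
  rw [abs_of_nonneg (Real.log_nonneg h1), Real.log_le_iff_le_exp (by positivity),
    show (6 : ℝ) = (6 : ℕ) * 1 by norm_num, Real.exp_nat_mul]
  have h3 : (2.7 : ℝ) ^ 6 ≤ Real.exp 1 ^ 6 := by
    have := Real.exp_one_gt_d9
    gcongr
    linarith
  have h4 : Real.pi ^ 3 ≤ 3.15 ^ 3 := by
    have := Real.pi_lt_d2
    gcongr
  norm_num at h3 h4 ⊢
  linarith

lemma TestData.triple_bound (H : TestData h ε B c) (σ : Equiv.Perm (Fin 3)) {a : Fin 3 → ℝ}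
    (ha : ∀ j, |a j| ≤ Real.pi / 2) {δ : ℝ} (hδ : 0 < δ) : ∃ C : ℝ, 0 ≤ C ∧ ∀ T : ℝ, 1 < T → ∀ Y : ℝ,
      |Y| ≤ 6 + 100 * Real.log T →
      Integrable (fun t => amplitude h σ T t * tripleKernel a Y (imagParam t) *
        ((tanCoef (ratioA σ (imagParam t)) (ratioB σ (imagParam t)) : ℝ) : ℂ)) ∧
      ‖∫ t, amplitude h σ T t * tripleKernel a Y (imagParam t) *
        ((tanCoef (ratioA σ (imagParam t)) (ratioB σ (imagParam t)) : ℝ) : ℂ)‖ ≤ C * T ^ (3 + δ) := by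
  have hB := H.B_pos
  have hε := H.eps_pos
  have htc := tripleConst_nonneg
  have hbc := bumpConst_nonneg
  have hp := Real.pi_pos
  obtain ⟨C, hC, hCb⟩ := H.integral_mul_nice σ nice_tanCoef
    (D := tripleConst * Real.exp 1 * (1 + B) ^ 3) (by positivity) 12
  obtain ⟨C', hC', hCb'⟩ := H.amplitude_spec σ hδ
  refine ⟨C + |tanCoef 0 0| * (Real.pi * bumpConst ^ 2 * C'), by positivity, fun T hT Y hY => ?_⟩
  have hT0 : 0 < T := by linarith
  have hl : 0 ≤ Real.log T := Real.log_nonneg hT.le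
  obtain ⟨i1, i2⟩ := hCb T hT (fun t => tripleKernel a Y (imagParam t))
    (stronglyMeasurable_tripleKernel _ _).aestronglyMeasurable fun t ht => by
      have hn : 1 + ‖imagParam t‖ ≤ (1 + B) * T := by
        have := H.norm_le T hT t ht
        linarith
      have he : Real.exp (-(Y / 12)) ≤ Real.exp 1 * T ^ 9 := by
        have : T ^ 9 = Real.exp (9 * Real.log T) := by
          rw [show (9 : ℝ) * Real.log T = (9 : ℕ) * Real.log T by norm_num, Real.exp_nat_mul, Real.exp_log hT0]
        rw [this, ← Real.exp_add]
        apply Real.exp_le_exp.2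
        have := neg_abs_le Y
        linarith
      calc _ ≤ tripleConst * Real.exp (-(Y / 12)) * (1 + ‖imagParam t‖) ^ 3 :=
            norm_tripleKernel_le ha Y (imagParam_mem_iaStar t)
        _ ≤ tripleConst * (Real.exp 1 * T ^ 9) * ((1 + B) * T) ^ 3 := by gcongr
        _ = _ := by ring
  refine ⟨i1, i2.trans ?_⟩
  obtain ⟨f1, -, f3⟩ := hCb' T hT
  have hb := norm_integral_mul_tripleKernel_le ha Y f1 (Real.rpow_pos_of_pos hT0 (1 - ε))
    (fun t ht => H.norm_le T hT t (ne_zero_of_amplitude_ne_zero ht)) f3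
  have hR : C' * T ^ (5 - 2 * ε + δ) / (T ^ (1 - ε)) ^ 2 = C' * T ^ (3 + δ) := by
    rw [← Real.rpow_natCast, ← Real.rpow_mul hT0.le, mul_div_assoc, ← Real.rpow_sub hT0]
    congr 2
    push_cast
    ring
  rw [hR] at hb
  have hone : (1 : ℝ) ≤ T ^ (3 + δ) := Real.one_le_rpow hT.le (by linarith)
  calc _ ≤ C * T ^ (3 + δ) + |tanCoef 0 0| * (Real.pi * bumpConst ^ 2 * (C' * T ^ (3 + δ))) := by
        gcongr
        exact le_mul_of_one_le_right hC hone
    _ = _ := by ring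

theorem TestData.norm_phiW4_le (H : TestData h ε B c) {α : ℝ} (hα : α ∈ ({1, -1} : Set ℝ)) {δ : ℝ} (hδ : 0 < δ) :
    ∃ C : ℝ, 0 ≤ C ∧ ∀ T : ℝ, 1 < T → ∀ y ∈ Ioo (T ^ (-100 : ℝ)) (T ^ (100 : ℝ)),
      Integrable (phiW4Integrand (h T) (α * y)) ∧ ‖phiW4 (h T) (α * y)‖ ≤ C * T ^ (3 + δ) := by
  choose d hd hd' using exists_spec_eq
  choose! C hC hCb using fun (σ : Equiv.Perm (Fin 3)) (e : Fin 3 → ℤ) (he : e ∈ signVecs) =>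
    H.triple_bound σ (abs_signVecs he) hδ
  set w : (Fin 3 → ℤ) → ℂ := fun e => gtildeConst * signCoef (Real.sign α) e / (2 * Real.pi) with hw
  refine ⟨∑ σ, ∑ e ∈ signVecs, ‖w e‖ * C σ e, Finset.sum_nonneg fun σ _ => Finset.sum_nonneg fun e he =>
    mul_nonneg (norm_nonneg _) (hC σ e he), fun T hT y hy => ?_⟩
  have hT0 : 0 < T := by linarith
  have hy0 : 0 < y := (Real.rpow_pos_of_pos hT0 _).trans hy.1
  have hα0 : α ≠ 0 := fun h1 => by
    have := abs_of_mem_signs hα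
    rw [h1, abs_zero] at this
    exact zero_ne_one this
  have hsign : Real.sign (α * y) = Real.sign α := by
    rcases hα with rfl | h1
    · rw [one_mul, Real.sign_of_pos hy0, Real.sign_one]
    · rw [mem_singleton_iff.1 h1, Real.sign_of_neg (by linarith), Real.sign_of_neg (by norm_num)]
  set Y := Real.log |α * y| + Real.log (8 * Real.pi ^ 3) with hYdef
  have hY : |Y| ≤ 6 + 100 * Real.log T := by
    rw [hYdef, abs_mul, abs_of_mem_signs hα, one_mul, abs_of_pos hy0]
    have h1 := abs_log_le hT hy
    have h2 := log_eight_pi_cube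
    exact (abs_add_le _ _).trans (by linarith)
  set v : Equiv.Perm (Fin 3) → (Fin 3 → ℤ) → ℝ × ℝ → ℂ := fun σ e t =>
    amplitude h σ T t * tripleKernel (fun j => e j * (Real.pi / 2)) Y (imagParam t) *
        ((tanCoef (ratioA σ (imagParam t)) (ratioB σ (imagParam t)) : ℝ) : ℂ) with hv
  have hfun : phiW4Integrand (h T) (α * y) =
      fun t => ∑ σ, ∑ e ∈ signVecs, (Complex.I ^ 2 * d σ * w e) * v σ e t := by
    funext t
    have := H.eq_sum_chambers hT (fun t => kernelW4 (α * y) (imagParam t) * spec (imagParam t) * Complex.I ^ 2)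
      (fun σ t => Complex.I ^ 2 * d σ * ((∑ e ∈ signVecs, w e *
        tripleKernel (fun j => e j * (Real.pi / 2)) Y (imagParam t)) *
        ((tanCoef (ratioA σ (imagParam t)) (ratioB σ (imagParam t)) : ℝ) : ℂ))) ?_ t
    · rw [phiW4Integrand, mul_assoc, mul_assoc, ← mul_assoc (kernelW4 _ _), this]
      refine Finset.sum_congr rfl fun σ _ => ?_
      rw [Finset.sum_mul, Finset.mul_sum, Finset.mul_sum]
      refine Finset.sum_congr rfl fun e _ => ?_
      rw [hv]
      ring
    · intro σ t ht
      have hk := (kernelW4_eq (mul_ne_zero hα0 hy0.ne') (imagParam_mem_iaStar t)).2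
      rw [hsign] at hk
      rw [← hk, hd' σ _ ht]
      ring
  have hvi : ∀ σ, ∀ e ∈ signVecs, Integrable (v σ e) ∧ ‖∫ t, v σ e t‖ ≤ C σ e * T ^ (3 + δ) :=
    fun σ e he => hCb σ e he T hT Y hY
  have hvs : ∀ σ, ∀ e ∈ signVecs, Integrable fun t => (Complex.I ^ 2 * d σ * w e) * v σ e t :=
    fun σ e he => (hvi σ e he).1.const_mul _
  rw [phiW4, hfun]
  refine ⟨integrable_finsetSum _ fun σ _ => integrable_finsetSum _ (hvs σ), ?_⟩
  rw [integral_finsetSum _ fun σ _ => integrable_finsetSum _ (hvs σ), Finset.sum_mul]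
  refine (norm_sum_le _ _).trans (Finset.sum_le_sum fun σ _ => ?_)
  rw [integral_finsetSum _ (hvs σ), Finset.sum_mul]
  refine (norm_sum_le _ _).trans (Finset.sum_le_sum fun e he => ?_)
  rw [integral_const_mul, norm_mul, norm_mul, norm_mul, hd, norm_pow, Complex.norm_I, one_pow, one_mul, one_mul,
    mul_assoc]
  exact mul_le_mul_of_nonneg_left (hvi σ e he).2 (norm_nonneg _)

end

/-! ### The main theorem -/

lemma exists_const_of_signs {P : ℝ → ℝ → Prop}
    (hP : ∀ α ∈ ({1, -1} : Set ℝ), ∃ C : ℝ, ∀ C' : ℝ, C ≤ C' → P α C') :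
    ∃ C : ℝ, ∀ α ∈ ({1, -1} : Set ℝ), P α C := by
  obtain ⟨C₁, h₁⟩ := hP 1 (by simp)
  obtain ⟨C₂, h₂⟩ := hP (-1) (by simp)
  refine ⟨max C₁ C₂, ?_⟩
  rintro α (rfl | rfl)
  exacts [h₁ _ (le_max_left _ _), h₂ _ (le_max_right _ _)]

lemma one_le_rpow_add_rpow_neg {y : ℝ} (hy : 0 < y) :
    1 ≤ y ^ (1 / 6 : ℝ) + y ^ (-(1 / 6) : ℝ) := by
  have h1 : 0 < y ^ (1 / 6 : ℝ) := Real.rpow_pos_of_pos hy _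
  have h2 : 0 < y ^ (-(1 / 6) : ℝ) := Real.rpow_pos_of_pos hy _
  rcases le_total 1 y with h | h
  · linarith [Real.one_le_rpow h (by norm_num : (0 : ℝ) ≤ 1 / 6)]
  · linarith [Real.one_le_rpow_of_pos_of_le_one_of_nonpos hy h (by norm_num : (-(1 / 6) : ℝ) ≤ 0)]

end GL3Kuznetsov

end

open GL3Kuznetsov in
theorem mainTheorem8
    (Ω Ω' : Set (Fin 3 → ℂ))
    (hΩ : IsCompact Ω) (hΩ_sub : Ω ⊆ iaStar) (hΩ_walls : Disjoint Ω walls)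
    (hΩ_weyl : ∀ μ ∈ Ω, ∀ w : Equiv.Perm (Fin 3), μ ∘ w ∈ Ω)
    (hΩ' : IsCompact Ω') (hΩ'_sub : Ω' ⊆ iaStar) (hΩ'_walls : Disjoint Ω' walls)
    (hΩΩ' : Ω ⊆ Ω')
    (μ₀ : Fin 3 → ℂ) (hμ₀ : μ₀ ∈ Ω)
    (A : ℕ) (ε : ℝ) (hε₀ : 0 < ε) (hε : ε < 1 / 2)
    (h : ℝ → (Fin 3 → ℂ) → ℂ) (hh : IsTestFamily Ω' A ε μ₀ h) :
    (∀ y₁ y₂ : ℝ, y₁ ≠ 0 → y₂ ≠ 0 → ∀ μ ∈ iaStar \ walls,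
      MeasureTheory.Integrable (kernelW6Integrand y₁ y₂ μ)) ∧
    (∀ y : ℝ, y ≠ 0 → ∀ μ ∈ iaStar, MeasureTheory.Integrable (kernelW4Integrand y μ)) ∧
    (∀ δ : ℝ, 0 < δ → ∃ C : ℝ, ∀ T : ℝ, 1 < T →
      ∀ y₁ ∈ Set.Ioo (T ^ (-100 : ℝ)) (T ^ (100 : ℝ)),
      ∀ y₂ ∈ Set.Ioo (T ^ (-100 : ℝ)) (T ^ (100 : ℝ)),
      ∀ α₁ ∈ ({1, -1} : Set ℝ), ∀ α₂ ∈ ({1, -1} : Set ℝ),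
        MeasureTheory.Integrable (phiW6Integrand (h T) (α₁ * y₁) (α₂ * y₂)) ∧
        ‖phiW6 (h T) (α₁ * y₁) (α₂ * y₂)‖ ≤ C * T ^ (3 + δ)) ∧
    (∀ δ : ℝ, 0 < δ → ∃ C : ℝ, ∀ T : ℝ, 1 < T →
      ∀ y ∈ Set.Ioo (T ^ (-100 : ℝ)) (T ^ (100 : ℝ)), ∀ α ∈ ({1, -1} : Set ℝ),
        MeasureTheory.Integrable (phiW4Integrand (h T) (α * y)) ∧
        ‖phiW4 (h T) (α * y)‖ ≤ C * T ^ (3 + δ) * (y ^ (1 / 6 : ℝ) + y ^ (-(1 / 6) : ℝ))) := by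
  have hμ₀' := hΩΩ' hμ₀
  obtain ⟨B, c, H⟩ := exists_testData hΩ' hΩ'_sub hΩ'_walls hμ₀' hε₀ hε hh
  refine ⟨fun y₁ y₂ h1 h2 μ hμ => integrable_kernelW6Integrand h1 h2 hμ,
    fun y hy μ hμ => (kernelW4_eq hy hμ).1, fun δ hδ => ?_, fun δ hδ => ?_⟩
  · have key : ∀ α₁ ∈ ({1, -1} : Set ℝ), ∃ C : ℝ, ∀ α₂ ∈ ({1, -1} : Set ℝ), ∀ T : ℝ, 1 < T →
        ∀ y₁ ∈ Set.Ioo (T ^ (-100 : ℝ)) (T ^ (100 : ℝ)),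
        ∀ y₂ ∈ Set.Ioo (T ^ (-100 : ℝ)) (T ^ (100 : ℝ)),
          MeasureTheory.Integrable (phiW6Integrand (h T) (α₁ * y₁) (α₂ * y₂)) ∧
          ‖phiW6 (h T) (α₁ * y₁) (α₂ * y₂)‖ ≤ C * T ^ (3 + δ) := by
      intro α₁ hα₁
      refine exists_const_of_signs fun α₂ hα₂ => ?_
      obtain ⟨C, -, hC⟩ := H.norm_phiW6_le hα₁ hα₂ hδ
      refine ⟨C, fun C' hC' T hT y₁ hy₁ y₂ hy₂ => ⟨(hC T hT y₁ hy₁ y₂ hy₂).1,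
        (hC T hT y₁ hy₁ y₂ hy₂).2.trans ?_⟩⟩
      gcongr
    obtain ⟨C, hC⟩ := exists_const_of_signs (P := fun α₁ C => ∀ α₂ ∈ ({1, -1} : Set ℝ),
        ∀ T : ℝ, 1 < T → ∀ y₁ ∈ Set.Ioo (T ^ (-100 : ℝ)) (T ^ (100 : ℝ)),
        ∀ y₂ ∈ Set.Ioo (T ^ (-100 : ℝ)) (T ^ (100 : ℝ)),
          MeasureTheory.Integrable (phiW6Integrand (h T) (α₁ * y₁) (α₂ * y₂)) ∧
          ‖phiW6 (h T) (α₁ * y₁) (α₂ * y₂)‖ ≤ C * T ^ (3 + δ)) fun α₁ hα₁ => by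
      obtain ⟨C, hC⟩ := key α₁ hα₁
      refine ⟨C, fun C' hC' α₂ hα₂ T hT y₁ hy₁ y₂ hy₂ => ⟨(hC α₂ hα₂ T hT y₁ hy₁ y₂ hy₂).1,
        (hC α₂ hα₂ T hT y₁ hy₁ y₂ hy₂).2.trans ?_⟩⟩
      gcongr
    exact ⟨C, fun T hT y₁ hy₁ y₂ hy₂ α₁ hα₁ α₂ hα₂ => hC α₁ hα₁ α₂ hα₂ T hT y₁ hy₁ y₂ hy₂⟩
  · obtain ⟨C, hC⟩ := exists_const_of_signs (P := fun α C =>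
        ∀ T : ℝ, 1 < T → ∀ y ∈ Set.Ioo (T ^ (-100 : ℝ)) (T ^ (100 : ℝ)),
          MeasureTheory.Integrable (phiW4Integrand (h T) (α * y)) ∧
          ‖phiW4 (h T) (α * y)‖ ≤ C * T ^ (3 + δ) * (y ^ (1 / 6 : ℝ) + y ^ (-(1 / 6) : ℝ)))
        fun α hα => by
      obtain ⟨C, hC0, hC⟩ := H.norm_phiW4_le hα hδ
      refine ⟨C, fun C' hC' T hT y hy => ⟨(hC T hT y hy).1, (hC T hT y hy).2.trans ?_⟩⟩
      have hT0 : 0 < T := by linarith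
      have hy0 : 0 < y := (Real.rpow_pos_of_pos hT0 _).trans hy.1
      have hCT : 0 ≤ C' * T ^ (3 + δ) := mul_nonneg (hC0.trans hC') (Real.rpow_nonneg hT0.le _)
      calc C * T ^ (3 + δ) ≤ C' * T ^ (3 + δ) * 1 := by rw [mul_one]; gcongr
        _ ≤ _ := mul_le_mul_of_nonneg_left (one_le_rpow_add_rpow_neg hy0) hCT
    exact ⟨C, fun T hT y hy α hα => hC α hα T hT y hy⟩
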